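/- Work over $\mathbb C$; "graded" means $\mathbb Z/2$-graded, comodules are graded right comodules with even coaction, and isomorphisms are even. Let $p,q\ge 0$. Let $A(p,q)$ be the super bialgebra generated, as a supercommutative algebra, by the entries of a supermatrix $c=\begin{pmatrix}A&B\\ C&D\end{pmatrix}$ of size $(p+q)\times(p+q)$ ($A$, $D$ even, $B$, $C$ odd), localized at the monoid generated by $\det A$ and $\det D$, with $\Delta(c^i_j)=\sum_k c^i_k\otimes c^k_j$ and $\varepsilon(c^i_j)=\delta^i_j$. Let $A_0(p,q)$ be its purely even quotient by $B=C=0$, with projection $\pi$ and generators $A_0,D_0$; let $A_+(p,q)$ and $A_-(p,q)$ be the quotients by $C=0$ and by $B=0$, with projections $\pi_\pm$. Put $$\tilde A^{-1}=A-BD^{-1}C,\quad \tilde D^{-1}=D-CA^{-1}B,\quad \xi=A^{-1}B,\quad \eta=D^{-1}C,\quad \zeta_+=(1-\eta\xi)^{-1}\eta,\quad \zeta_-=(1-\xi\eta)^{-1}\xi .$$ In a comodule $\gamma:W\to W\otimes A(p,q)$ an element $x$ is called primitive if $(\mathrm{id}\otimes\pi_+)\gamma(x)$ lies in $W\otimes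 A_0(p,q)\subset W\otimes A_+(p,q)$ (is independent of $B$), and antiprimitive if $(\mathrm{id}\otimes\pi_-)\gamma(x)$ lies in $W\otimes A_0(p,q)\subset W\otimes A_-(p,q)$ (is independent of $C$). Let $\beta:V\to V\otimes A_0(p,q)$ be an $A_0(p,q)$-comodule (not necessarily finite dimensional), and write $\beta(e_j)=\sum_i e_i\otimes\mathcal D(A_0,D_0)^i_j$ in a basis $(e_i)$ of $V$. Let $$\mathrm{ind}(V)=\{x\in V\otimes A(p,q)\mid(\beta\otimes\mathrm{id})(x)=(\mathrm{id}\otimes(\pi\otimes\mathrm{id})\Delta)(x)\}$$ with coaction the restriction of $\mathrm{id}\otimes\Delta$. Then $\mathrm{ind}(V)$ is an $A(p,q)$-comodule, $\dim\mathrm{ind}(V)=2^{2pq}\dim V$, and: 1. (Filtration.) For $j\ge0$ let $W_j(V)$ be the space of all $\sum_{i,k}e_i\otimes\mathcal D(A,\tilde D^{-1})^i_k\,x^k$, where the $x^k$ are polynomials in the entries of $\xi$ and $\zeta_+$, of degree at most $j$ in the entries of $\zeta_+$. The $W_j(V)$ are subcomodules, $0\subseteq W_0(V)\subseteq W_1(V)\subseteq\dots\subseteq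 W_{pq}(V)=\mathrm{ind}(V)$, and $W_0(V)$ consists of the elements with all $x^k$ polynomials in $\xi$ alone. The span $V_j\subset A(p,q)$ of the monomials of order $j$ in the entries of $\zeta_+$ is an $A_0(p,q)$-comodule under $(\mathrm{id}\otimes\pi)\Delta$, and for $1\le j\le pq$ $$W_j(V)/W_{j-1}(V)\;\cong\;W_0(V\otimes V_j)\qquad\text{as } A(p,q)\text{-comodules.}$$ 2. (Primitive elements.) The primitive elements of $\mathrm{ind}(V)$ are exactly the elements $\sum_{i,k}e_i\otimes\mathcal D(A,\tilde D^{-1})^i_k\,F^k(\zeta_+)$ with polynomials $F^k$ in the entries of $\zeta_+$. The primitive elements of $W_0(V)$ are exactly those with all $x^k$ constant. 3. (Kac modules.) Let $U\subset W_0(V)$ be the subspace of the elements for which all $x^k$ are multiples of the product of all entries of $\xi$. Then $W_0(V)$ is the Kac module generated by $U$: $U$ is a graded subspace with $(\mathrm{id}\otimes\pi_-)\gamma(U)\subset U\otimes A_0(p,q)$ (in particular it consists of antiprimitive elements), and $W_0(V)$ is free over $U$ under the exterior algebra of the odd operators $\partial_{ij}=(\mathrm{id}\otimes\partial/\partial B^i_j|_{c=1})\gamma$,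 i.e. every element of $W_0(V)$ is uniquely $\sum_S\partial_S u_S$ with $u_S\in U$, where $S$ runs over the subsets of $\{1,\dots,p\}\times\{1,\dots,q\}$ and $\partial_S$ is the product of the $\partial_{ij}$, $(i,j)\in S$, in a fixed order. 4. (Mirror image.) All of 1.–3. also holds with $A\leftrightarrow D$, $B\leftrightarrow C$ interchanged: for coefficients $\mathcal D(\tilde A^{-1},D)$ in place of $\mathcal D(A,\tilde D^{-1})$, $\eta$ in place of $\xi$, $\zeta_-$ in place of $\zeta_+$, $\pi_\mp$ in place of $\pi_\pm$, antiprimitive in place of primitive (and vice versa) and $\partial/\partial C^j_i$ in place of $\partial/\partial B^i_j$. In particular the antiprimitive elements of $\mathrm{ind}(V)$ are exactly the elements $\sum_{i,k}e_i\otimes\mathcal D(\tilde A^{-1},D)^i_k\,F^k(\zeta_-)$. -/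

import Mathlib

open scoped TensorProduct
noncomputable section
namespace GLSuper

/-! ### The even and odd generators -/

/-- Indices of the even generators: the entries of the blocks `A` (size `p`) and `D` (size `q`). -/
abbrev EvenGen (p q : ℕ) : Type := (Fin p × Fin p) ⊕ (Fin q × Fin q)
/-- Indices of the odd generators: the entries of the blocks `B` (size `p × q`) and `C` (size `q × p`). -/
abbrev OddGen (p q : ℕ) : Type := (Fin p × Fin q) ⊕ (Fin q × Fin p)
/-- The polynomial algebra in the entries of `A` and `D`. -/
abbrev EvenPoly (p q : ℕ) : Type := MvPolynomial (EvenGen p q) ℂ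

/-- The generic block `A`, with polynomial entries. -/
def polyA (p q : ℕ) : Matrix (Fin p) (Fin p) (EvenPoly p q) :=
  Matrix.of fun i j => MvPolynomial.X (Sum.inl (i, j))
/-- The generic block `D`, with polynomial entries. -/
def polyD (p q : ℕ) : Matrix (Fin q) (Fin q) (EvenPoly p q) :=
  Matrix.of fun i j => MvPolynomial.X (Sum.inr (i, j))

/-- The monoid generated by `det A` and `det D`. -/
def dets (p q : ℕ) : Submonoid (EvenPoly p q) :=
  Submonoid.closure {(polyA p q).det, (polyD p q).det}

/-- The purely even coalgebra `A₀(p,q) = A(p,0) ⊗ A(0,q)`: the coordinate ring of `GL_p × GL_q`, that is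
the polynomials in the entries of `A₀`, `D₀`, localized at the monoid generated by the determinants. -/
def FunGL0 (p q : ℕ) : Type := Localization (dets p q)

instance (p q : ℕ) : CommRing (FunGL0 p q) := inferInstanceAs (CommRing (Localization (dets p q)))
instance (p q : ℕ) : Algebra ℂ (FunGL0 p q) := inferInstanceAs (Algebra ℂ (Localization (dets p q)))
instance (p q : ℕ) : Algebra (EvenPoly p q) (FunGL0 p q) :=
  inferInstanceAs (Algebra (EvenPoly p q) (Localization (dets p q)))
instance (p q : ℕ) : IsScalarTower ℂ (EvenPoly p q) (FunGL0 p q) :=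
  inferInstanceAs (IsScalarTower ℂ (EvenPoly p q) (Localization (dets p q)))
instance (p q : ℕ) : IsLocalization (dets p q) (FunGL0 p q) :=
  inferInstanceAs (IsLocalization (dets p q) (Localization (dets p q)))

/-- The matrix `A₀` over `A₀(p,q)`. -/
def matA0 (p q : ℕ) : Matrix (Fin p) (Fin p) (FunGL0 p q) :=
  (polyA p q).map (algebraMap (EvenPoly p q) (FunGL0 p q))
/-- The matrix `D₀` over `A₀(p,q)`. -/
def matD0 (p q : ℕ) : Matrix (Fin q) (Fin q) (FunGL0 p q) :=
  (polyD p q).map (algebraMap (EvenPoly p q) (FunGL0 p q))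

lemma isUnit_det_matA0 (p q : ℕ) : IsUnit (matA0 p q).det := by
  have h := IsLocalization.map_units (FunGL0 p q)
    (⟨(polyA p q).det, Submonoid.subset_closure (by simp)⟩ : dets p q)
  rwa [RingHom.map_det] at h

lemma isUnit_det_matD0 (p q : ℕ) : IsUnit (matD0 p q).det := by
  have h := IsLocalization.map_units (FunGL0 p q)
    (⟨(polyD p q).det, Submonoid.subset_closure (by simp)⟩ : dets p q)
  rwa [RingHom.map_det] at h

/-- The algebra homomorphism `FunGL0 p q → Z` with `A₀ ↦ X`, `D₀ ↦ Y`, for invertible matrices `X`, `Y`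
over a commutative algebra `Z`. -/
def evalComm {p q : ℕ} {Z : Type*} [CommRing Z] [Algebra ℂ Z]
    (X : Matrix (Fin p) (Fin p) Z) (Y : Matrix (Fin q) (Fin q) Z)
    (hX : IsUnit X.det) (hY : IsUnit Y.det) : FunGL0 p q →ₐ[ℂ] Z :=
  IsLocalization.liftAlgHom (M := dets p q)
    (f := MvPolynomial.aeval (Sum.elim (fun k => X k.1 k.2) (fun k => Y k.1 k.2))) (by
      set f : EvenPoly p q →ₐ[ℂ] Z :=
        MvPolynomial.aeval (Sum.elim (fun k => X k.1 k.2) (fun k => Y k.1 k.2)) with hf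
      intro y
      have hle : dets p q ≤ (IsUnit.submonoid Z).comap (f : EvenPoly p q →* Z) := by
        refine (Submonoid.closure_le).2 ?_
        rintro _ (rfl | rfl)
        · have : f (polyA p q).det = X.det := by
            rw [AlgHom.map_det]; congr 1; ext i j; simp [hf, polyA]
          simpa [Submonoid.mem_comap, IsUnit.mem_submonoid_iff, this] using hX
        · have : f (polyD p q).det = Y.det := by
            rw [AlgHom.map_det]; congr 1; ext i j; simp [hf, polyD]
          simpa [Submonoid.mem_comap, IsUnit.mem_submonoid_iff, this] using hY
      exact hle y.2)

lemma isUnit_det_map {n R S : Type*} [Fintype n] [DecidableEq n] [CommRing R] [CommRing S]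
    [Algebra ℂ R] [Algebra ℂ S] (f : R →ₐ[ℂ] S) {M : Matrix n n R} (h : IsUnit M.det) :
    IsUnit (M.map f).det := by
  have := h.map f
  rwa [AlgHom.map_det] at this

/-- The comultiplication of `A₀(p,q)`: `A₀ ↦ A₀₁ A₀₂`, `D₀ ↦ D₀₁ D₀₂` (matrix products). -/
def comul0 (p q : ℕ) : FunGL0 p q →ₐ[ℂ] FunGL0 p q ⊗[ℂ] FunGL0 p q :=
  evalComm
    ((matA0 p q).map (Algebra.TensorProduct.includeLeft (R := ℂ) (S := ℂ)) *
      (matA0 p q).map Algebra.TensorProduct.includeRight)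
    ((matD0 p q).map (Algebra.TensorProduct.includeLeft (R := ℂ) (S := ℂ)) *
      (matD0 p q).map Algebra.TensorProduct.includeRight)
    (by
      rw [Matrix.det_mul]
      exact (isUnit_det_map _ (isUnit_det_matA0 p q)).mul
        (isUnit_det_map _ (isUnit_det_matA0 p q)))
    (by
      rw [Matrix.det_mul]
      exact (isUnit_det_map _ (isUnit_det_matD0 p q)).mul
        (isUnit_det_map _ (isUnit_det_matD0 p q)))

/-- The counit of `A₀(p,q)`: `A₀ ↦ 1`, `D₀ ↦ 1`. -/
def counit0 (p q : ℕ) : FunGL0 p q →ₐ[ℂ] ℂ := evalComm 1 1 (by simp) (by simp)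

/-- The `ℤ/2`-grading of `A₀(p,q)`, which is purely even. -/
def gr0 (p q : ℕ) (i : ZMod 2) : Submodule ℂ (FunGL0 p q) := if i = 0 then ⊤ else ⊥

/-- The Grassmann algebra in the odd generators. -/
abbrev Grass (p q : ℕ) : Type := ExteriorAlgebra ℂ (OddGen p q → ℂ)
/-- The super bialgebra `A(p,q)`, as a super algebra: the free supercommutative algebra on the entries of
the `(p+q) × (p+q)` supermatrix, localized at the monoid generated by `det A` and `det D`. -/
def FunGL (p q : ℕ) : Type := FunGL0 p q ⊗[ℂ] Grass p q

instance (p q : ℕ) : Ring (FunGL p q) := inferInstanceAs (Ring (FunGL0 p q ⊗[ℂ] Grass p q))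
instance (p q : ℕ) : Algebra ℂ (FunGL p q) := inferInstanceAs (Algebra ℂ (FunGL0 p q ⊗[ℂ] Grass p q))

/-- The identification of `A(p,q)` with its defining tensor product. -/
def toA (p q : ℕ) : FunGL0 p q ⊗[ℂ] Grass p q ≃ₐ[ℂ] FunGL p q := AlgEquiv.refl

/-- The `ℤ/2`-grading of `A(p,q)`: the `B`- and `C`-entries are odd, the `A`- and `D`-entries even. -/
def gr (p q : ℕ) (i : ZMod 2) : Submodule ℂ (FunGL p q) :=
  (((CliffordAlgebra.evenOdd (0 : QuadraticForm ℂ (OddGen p q → ℂ)) i).baseChange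
    (FunGL0 p q)).restrictScalars ℂ).comap (toA p q).symm.toLinearMap

instance (p q : ℕ) : GradedAlgebra (gr p q) :=
  let G : GradedAlgebra fun i => (CliffordAlgebra.evenOdd
      (0 : QuadraticForm ℂ (OddGen p q → ℂ)) i).baseChange (FunGL0 p q) := inferInstance
  { one_mem := G.one_mem
    mul_mem := G.mul_mem
    decompose' := G.decompose'
    left_inv := G.left_inv
    right_inv := G.right_inv }

lemma FunGL_induction {p q : ℕ} {P : FunGL p q → Prop} (x : FunGL p q)
    (tmul : ∀ r w, P (toA p q (r ⊗ₜ w))) (add : ∀ x y, P x → P y → P (x + y)) : P x :=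
  TensorProduct.induction_on (motive := fun t => P (toA p q t)) x
    (by simpa using tmul 0 0) tmul (fun x y hx hy => add _ _ hx hy)

/-! ### Odd elements, their products and central elements -/

section odd
variable {T : Type*} [Ring T] [Algebra ℂ T]

/-- Elements that are odd and supercommute with everything, with respect to a parity map `σ`. -/
def superOdd (σ : T →ₗ[ℂ] T) : Submodule ℂ T where
  carrier := {θ | (∀ x, θ * x = σ x * θ) ∧ σ θ = -θ}
  add_mem' := by
    rintro a b ⟨ha, ha'⟩ ⟨hb, hb'⟩
    refine ⟨fun x => by rw [add_mul, mul_add, ha, hb], by rw [map_add, ha', hb', neg_add]⟩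
  zero_mem' := ⟨fun x => by simp, by simp⟩
  smul_mem' := by
    rintro c a ⟨ha, ha'⟩
    refine ⟨fun x => by rw [smul_mul_assoc, mul_smul_comm, ha], by rw [map_smul, ha', smul_neg]⟩

lemma superOdd_anticomm {σ : T →ₗ[ℂ] T} {a b : T} (ha : a ∈ superOdd σ) (hb : b ∈ superOdd σ) :
    a * b = -(b * a) := by
  rw [ha.1 b, hb.2, neg_mul]

lemma superOdd_sq {σ : T →ₗ[ℂ] T} {a : T} (ha : a ∈ superOdd σ) : a * a = 0 := by
  have h := superOdd_anticomm ha ha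
  have h2 : (2 : ℂ) • (a * a) = 0 := by
    rw [two_smul]; nth_rewrite 1 [h]; exact neg_add_cancel _
  exact (smul_eq_zero.1 h2).resolve_left two_ne_zero

lemma superOdd_mul_mem_center {σ : T →ₗ[ℂ] T} (hσ : ∀ x, σ (σ x) = x) {a b : T}
    (ha : a ∈ superOdd σ) (hb : b ∈ superOdd σ) : a * b ∈ Subalgebra.center ℂ T := by
  rw [Subalgebra.mem_center_iff]
  intro x
  rw [mul_assoc a b x, hb.1 x, ← mul_assoc a, ha.1 (σ x), hσ, mul_assoc]

lemma superOdd_mul_nilpotent {σ : T →ₗ[ℂ] T} (hσ : ∀ x, σ (σ x) = x) {a b : T}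
    (ha : a ∈ superOdd σ) (hb : b ∈ superOdd σ) :
    IsNilpotent (⟨a * b, superOdd_mul_mem_center hσ ha hb⟩ : Subalgebra.center ℂ T) := by
  refine ⟨2, Subtype.ext ?_⟩
  change (a * b) ^ 2 = 0
  rw [pow_two, mul_assoc, ← mul_assoc b a b, superOdd_anticomm hb ha, neg_mul, mul_assoc a b b,
    superOdd_sq hb]
  simp

end odd

lemma isUnit_det_add {n Z : Type*} [Fintype n] [DecidableEq n] [CommRing Z] {X N : Matrix n n Z}
    (hX : IsUnit X.det) (hN : ∀ i j, IsNilpotent (N i j)) : IsUnit (X + N).det := by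
  have h : (X + N).det - X.det ∈ nilradical Z := by
    rw [← Ideal.Quotient.eq, RingHom.map_det, RingHom.map_det]
    congr 1
    ext i j
    have : Ideal.Quotient.mk (nilradical Z) (N i j) = 0 :=
      Ideal.Quotient.eq_zero_iff_mem.2 (mem_nilradical.2 (hN i j))
    simp [this]
  have := IsNilpotent.isUnit_add_left_of_commute (mem_nilradical.1 h) hX (Commute.all _ _)
  simpa using this

/-- The parity involution. -/
def parity (p q : ℕ) : FunGL p q →ₗ[ℂ] FunGL p q :=
  (toA p q).toLinearMap ∘ₗ
    (CliffordAlgebra.involute (Q := (0 : QuadraticForm ℂ (OddGen p q → ℂ)))).toLinearMap.lTensor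
      (FunGL0 p q) ∘ₗ (toA p q).symm.toLinearMap

lemma parity_toA {p q : ℕ} (r : FunGL0 p q) (w : Grass p q) :
    parity p q (toA p q (r ⊗ₜ w)) = toA p q
      (r ⊗ₜ CliffordAlgebra.involute (Q := (0 : QuadraticForm ℂ (OddGen p q → ℂ))) w) := rfl

lemma parity_parity {p q : ℕ} (x : FunGL p q) : parity p q (parity p q x) = x := by
  induction x using FunGL_induction with
  | add x y hx hy => rw [map_add, map_add, hx, hy]
  | tmul r w => simp [parity_toA]

lemma gr_induction {p q : ℕ} {i : ZMod 2} {P : FunGL p q → Prop} (x : FunGL p q) (hx : x ∈ gr p q i)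
    (tmul : ∀ r, ∀ w ∈ CliffordAlgebra.evenOdd (0 : QuadraticForm ℂ (OddGen p q → ℂ)) i,
      P (toA p q (r ⊗ₜ w))) (add : ∀ x y, P x → P y → P (x + y)) : P x := by
  obtain ⟨t, ht⟩ : ∃ t, (CliffordAlgebra.evenOdd
      (0 : QuadraticForm ℂ (OddGen p q → ℂ)) i).subtype.lTensor (FunGL0 p q) t = (toA p q).symm x := hx
  have : x = toA p q ((CliffordAlgebra.evenOdd
      (0 : QuadraticForm ℂ (OddGen p q → ℂ)) i).subtype.lTensor (FunGL0 p q) t) := by rw [ht]; simp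
  rw [this]
  clear this ht
  induction t using TensorProduct.induction_on with
  | zero => simpa using tmul 0 0 (zero_mem _)
  | add a b ha hb => rw [map_add, map_add]; exact add _ _ ha hb
  | tmul r w => exact tmul r w w.2

lemma parity_of_mem_zero {p q : ℕ} {x : FunGL p q} (hx : x ∈ gr p q 0) : parity p q x = x := by
  refine gr_induction x hx (P := fun x => parity p q x = x) (fun r w hw => ?_) (fun x y hx hy => by rw [map_add, hx, hy])
  rw [parity_toA, CliffordAlgebra.involute_eq_of_mem_even hw]

lemma parity_of_mem_one {p q : ℕ} {x : FunGL p q} (hx : x ∈ gr p q 1) : parity p q x = -x := by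
  refine gr_induction x hx (P := fun x => parity p q x = -x) (fun r w hw => ?_) (fun x y hx hy => by rw [map_add, hx, hy, neg_add])
  rw [parity_toA, CliffordAlgebra.involute_eq_of_mem_odd hw, TensorProduct.tmul_neg, map_neg]

/-- The odd generators of `A(p,q)`. -/
def oddEl {p q : ℕ} (k : OddGen p q) : FunGL p q :=
  toA p q (1 ⊗ₜ ExteriorAlgebra.ι ℂ (Pi.single k 1))

lemma ι_mul_eq {M : Type*} [AddCommGroup M] [Module ℂ M] (m : M) (w : ExteriorAlgebra ℂ M) :
    ExteriorAlgebra.ι ℂ m * w =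
      CliffordAlgebra.involute (Q := (0 : QuadraticForm ℂ M)) w * ExteriorAlgebra.ι ℂ m := by
  induction w using ExteriorAlgebra.induction with
  | algebraMap r => 
    rw [AlgHom.commutes, Algebra.commutes]
  | ι x =>
    rw [CliffordAlgebra.involute_ι, neg_mul]
    exact eq_neg_of_add_eq_zero_left (ExteriorAlgebra.ι_add_mul_swap m x)
  | mul a b ha hb => rw [map_mul, ← mul_assoc, ha, mul_assoc, hb, mul_assoc]
  | add a b ha hb => rw [map_add, mul_add, ha, hb, add_mul]

lemma oddEl_mem {p q : ℕ} (k : OddGen p q) : oddEl k ∈ superOdd (parity p q) := by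
  refine ⟨fun x => ?_, ?_⟩
  · induction x using FunGL_induction with
    | add x y hx hy => rw [mul_add, hx, hy, map_add, add_mul]
    | tmul r w =>
      rw [parity_toA, oddEl, ← map_mul, ← map_mul]
      simp [ι_mul_eq]
  · rw [oddEl, parity_toA, ← map_neg, ← TensorProduct.tmul_neg]
    exact congrArg (fun w => toA p q (1 ⊗ₜ w)) (CliffordAlgebra.involute_ι _)

lemma oddEl_mem_gr {p q : ℕ} (k : OddGen p q) : oddEl k ∈ gr p q 1 :=
  Submodule.tmul_mem_baseChange_of_mem _ (CliffordAlgebra.ι_mem_evenOdd_one _ _)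

/-- The inclusion of the even generators, `A₀ ↦ A`, `D₀ ↦ D`. -/
def evenHom (p q : ℕ) : FunGL0 p q →ₐ[ℂ] FunGL p q :=
  (toA p q).toAlgHom.comp Algebra.TensorProduct.includeLeft

lemma evenHom_mem_gr {p q : ℕ} (r : FunGL0 p q) : evenHom p q r ∈ gr p q 0 :=
  Submodule.tmul_mem_baseChange_of_mem _ (SetLike.GradedOne.one_mem)

lemma evenHom_mem_center {p q : ℕ} (r : FunGL0 p q) :
    evenHom p q r ∈ Subalgebra.center ℂ (FunGL p q) := by
  rw [Subalgebra.mem_center_iff]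
  intro x
  induction x using FunGL_induction with
  | add x y hx hy => rw [add_mul, hx, hy, mul_add]
  | tmul s w =>
    change toA p q (s ⊗ₜ w) * toA p q (r ⊗ₜ 1) = toA p q (r ⊗ₜ 1) * toA p q (s ⊗ₜ w)
    rw [← map_mul, ← map_mul]
    simp [mul_comm]

/-- The super tensor square of `A(p,q)`: `(a ⊗ b)(c ⊗ d) = (-1)^{|b||c|} ac ⊗ bd`. -/
abbrev AA (p q : ℕ) : Type := gr p q ᵍ⊗[ℂ] gr p q

open GradedTensorProduct in
/-- The total parity involution of the super tensor square. -/
def parity2 (p q : ℕ) : AA p q →ₗ[ℂ] AA p q :=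
  (of ℂ (gr p q) (gr p q)).toLinearMap ∘ₗ TensorProduct.map (parity p q) (parity p q) ∘ₗ
    (of ℂ (gr p q) (gr p q)).symm.toLinearMap

lemma parity2_tmul {p q : ℕ} (x y : FunGL p q) :
    parity2 p q (x ᵍ⊗ₜ[ℂ] y) = parity p q x ᵍ⊗ₜ[ℂ] parity p q y := rfl

lemma zmod_two : ∀ i : ZMod 2, i = 0 ∨ i = 1 := by decide

lemma tmul_zero_left {p q : ℕ} (y : FunGL p q) : (0 ᵍ⊗ₜ[ℂ] y : AA p q) = 0 :=
  (congrArg (GradedTensorProduct.of ℂ (gr p q) (gr p q)) (TensorProduct.zero_tmul _ y)).trans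
    (map_zero _)

lemma tmul_zero_right {p q : ℕ} (x : FunGL p q) : (x ᵍ⊗ₜ[ℂ] 0 : AA p q) = 0 :=
  (congrArg (GradedTensorProduct.of ℂ (gr p q) (gr p q)) (TensorProduct.tmul_zero _ x)).trans
    (map_zero _)

lemma tmul_neg_left {p q : ℕ} (x y : FunGL p q) :
    ((-x) ᵍ⊗ₜ[ℂ] y : AA p q) = -(x ᵍ⊗ₜ[ℂ] y) :=
  (congrArg (GradedTensorProduct.of ℂ (gr p q) (gr p q)) (TensorProduct.neg_tmul x y)).trans
    (map_neg _ _)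

lemma tmul_neg_right {p q : ℕ} (x y : FunGL p q) :
    (x ᵍ⊗ₜ[ℂ] (-y) : AA p q) = -(x ᵍ⊗ₜ[ℂ] y) :=
  (congrArg (GradedTensorProduct.of ℂ (gr p q) (gr p q)) (TensorProduct.tmul_neg x y)).trans
    (map_neg _ _)

lemma AA_induction {p q : ℕ} {P : AA p q → Prop} (add : ∀ x y, P x → P y → P (x + y))
    (hom : ∀ i j, ∀ x ∈ gr p q i, ∀ y ∈ gr p q j, P (x ᵍ⊗ₜ[ℂ] y)) (t : AA p q) : P t := by
  have h0 : P 0 := by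
    have := hom 0 0 0 (zero_mem _) 0 (zero_mem _)
    rwa [tmul_zero_left] at this
  refine TensorProduct.induction_on (motive := P) t h0 (fun x y => ?_) add
  change P (x ᵍ⊗ₜ[ℂ] y)
  induction x using DirectSum.Decomposition.inductionOn (gr p q) with
  | zero => rwa [tmul_zero_left]
  | add a b ha hb =>
    have := add _ _ ha hb
    rwa [← map_add, ← TensorProduct.add_tmul] at this
  | homogeneous a =>
    induction y using DirectSum.Decomposition.inductionOn (gr p q) with
    | zero => rwa [tmul_zero_right]
    | add b c hb hc =>
      have := add _ _ hb hc
      rwa [← map_add, ← TensorProduct.tmul_add] at this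
    | homogeneous b => exact hom _ _ _ a.2 _ b.2

lemma parity2_parity2 {p q : ℕ} (t : AA p q) : parity2 p q (parity2 p q t) = t := by
  induction t using AA_induction with
  | add x y hx hy => rw [map_add, map_add, hx, hy]
  | hom i j x hx y hy => rw [parity2_tmul, parity2_tmul, parity_parity, parity_parity]

lemma AA_mul {p q : ℕ} {i j : ZMod 2} (a : FunGL p q) {b : FunGL p q} (hb : b ∈ gr p q j) {c : FunGL p q}
    (hc : c ∈ gr p q i) (d : FunGL p q) :
    a ᵍ⊗ₜ[ℂ] b * c ᵍ⊗ₜ[ℂ] d = ((-1 : ℤˣ) ^ (j * i) • (a * c) ᵍ⊗ₜ[ℂ] (b * d) : AA p q) :=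
  GradedTensorProduct.tmul_coe_mul_coe_tmul (gr p q) (gr p q) a ⟨b, hb⟩ ⟨c, hc⟩ d

lemma superOdd_left {p q : ℕ} {θ z : FunGL p q} (hθ : θ ∈ superOdd (parity p q)) (hθ1 : θ ∈ gr p q 1)
    (hz : z ∈ gr p q 0) (hzc : z ∈ Subalgebra.center ℂ (FunGL p q)) :
    θ ᵍ⊗ₜ[ℂ] z ∈ superOdd (parity2 p q) := by
  rw [Subalgebra.mem_center_iff] at hzc
  refine ⟨fun t => ?_, ?_⟩
  · induction t using AA_induction with
    | add x y hx hy => rw [mul_add, hx, hy, map_add, add_mul]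
    | hom i j x hx y hy =>
      rw [AA_mul _ hz hx, parity2_tmul, hθ.1 x, ← hzc y]
      obtain rfl | rfl : j = 0 ∨ j = 1 := zmod_two j
      · rw [parity_of_mem_zero hy, AA_mul _ hy hθ1]
        simp
      · rw [parity_of_mem_one hy, AA_mul _ (neg_mem hy) hθ1]
        rw [neg_mul, tmul_neg_right, mul_one, uzpow_one, zero_mul,
          uzpow_zero, one_smul, Units.neg_smul, one_smul, neg_neg]
  · rw [parity2_tmul, hθ.2, parity_of_mem_zero hz, tmul_neg_left]

lemma superOdd_right {p q : ℕ} {θ z : FunGL p q} (hθ : θ ∈ superOdd (parity p q)) (hθ1 : θ ∈ gr p q 1)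
    (hz : z ∈ gr p q 0) (hzc : z ∈ Subalgebra.center ℂ (FunGL p q)) :
    z ᵍ⊗ₜ[ℂ] θ ∈ superOdd (parity2 p q) := by
  rw [Subalgebra.mem_center_iff] at hzc
  refine ⟨fun t => ?_, ?_⟩
  · induction t using AA_induction with
    | add x y hx hy => rw [mul_add, hx, hy, map_add, add_mul]
    | hom i j x hx y hy =>
      have hy' : parity p q y ∈ gr p q j := by
        obtain rfl | rfl : j = 0 ∨ j = 1 := zmod_two j
        · rwa [parity_of_mem_zero hy]
        · rw [parity_of_mem_one hy]; exact neg_mem hy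
      rw [AA_mul _ hθ1 hx, parity2_tmul, AA_mul _ hy' hz, hθ.1 y, ← hzc x]
      obtain rfl | rfl : i = 0 ∨ i = 1 := zmod_two i
      · rw [parity_of_mem_zero hx]
        simp
      · rw [parity_of_mem_one hx]
        rw [neg_mul, tmul_neg_left, mul_one, uzpow_one, mul_zero, uzpow_zero,
          one_smul, Units.neg_smul, one_smul]
  · rw [parity2_tmul, hθ.2, parity_of_mem_zero hz, tmul_neg_right]

lemma even_left_mem_center {p q : ℕ} {z : FunGL p q} 
    (hz : z ∈ gr p q 0) (hzc : z ∈ Subalgebra.center ℂ (FunGL p q)) :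
    z ᵍ⊗ₜ[ℂ] 1 ∈ Subalgebra.center ℂ (AA p q) := by
  rw [Subalgebra.mem_center_iff] at hzc ⊢
  intro t
  induction t using AA_induction with
  | add x y hx hy => rw [add_mul, hx, hy, mul_add]
  | hom i j x hx y hy =>
    rw [AA_mul _ hy hz, AA_mul _ SetLike.GradedOne.one_mem hx, hzc]
    simp

lemma even_right_mem_center {p q : ℕ} {z : FunGL p q} 
    (hz : z ∈ gr p q 0) (hzc : z ∈ Subalgebra.center ℂ (FunGL p q)) :
    1 ᵍ⊗ₜ[ℂ] z ∈ Subalgebra.center ℂ (AA p q) := by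
  rw [Subalgebra.mem_center_iff] at hzc ⊢
  intro t
  induction t using AA_induction with
  | add x y hx hy => rw [add_mul, hx, hy, mul_add]
  | hom i j x hx y hy =>
    rw [AA_mul _ hy SetLike.GradedOne.one_mem, AA_mul _ hz hx, hzc]
    simp

/-! ### The matrix of generators and the comultiplication of `A(p,q)` -/

/-- The block `A`. -/
def matA (p q : ℕ) : Matrix (Fin p) (Fin p) (FunGL p q) := (matA0 p q).map (evenHom p q)
/-- The block `B`. -/
def matB (p q : ℕ) : Matrix (Fin p) (Fin q) (FunGL p q) := Matrix.of fun i j => oddEl (Sum.inl (i, j))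
/-- The block `C`. -/
def matC (p q : ℕ) : Matrix (Fin q) (Fin p) (FunGL p q) := Matrix.of fun i j => oddEl (Sum.inr (i, j))
/-- The block `D`. -/
def matD (p q : ℕ) : Matrix (Fin q) (Fin q) (FunGL p q) := (matD0 p q).map (evenHom p q)
/-- The matrix `A⁻¹`. -/
def matAinv (p q : ℕ) : Matrix (Fin p) (Fin p) (FunGL p q) := (matA0 p q)⁻¹.map (evenHom p q)
/-- The matrix `D⁻¹`. -/
def matDinv (p q : ℕ) : Matrix (Fin q) (Fin q) (FunGL p q) := (matD0 p q)⁻¹.map (evenHom p q)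

/-- The full supermatrix of generators `((c^i_j))`. -/
def supermatrix (p q : ℕ) : Matrix (Fin p ⊕ Fin q) (Fin p ⊕ Fin q) (FunGL p q) :=
  Matrix.fromBlocks (matA p q) (matB p q) (matC p q) (matD p q)

/-- `r ↦ r ⊗ 1`, into the centre of the super tensor square. -/
def central1 (p q : ℕ) : FunGL0 p q →ₐ[ℂ] Subalgebra.center ℂ (AA p q) :=
  ((GradedTensorProduct.includeLeft (gr p q) (gr p q)).comp (evenHom p q)).codRestrict _
    fun r => even_left_mem_center (evenHom_mem_gr r) (evenHom_mem_center r)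

/-- `r ↦ 1 ⊗ r`, into the centre of the super tensor square. -/
def central2 (p q : ℕ) : FunGL0 p q →ₐ[ℂ] Subalgebra.center ℂ (AA p q) :=
  ((GradedTensorProduct.includeRight (gr p q) (gr p q)).comp (evenHom p q)).codRestrict _
    fun r => even_right_mem_center (evenHom_mem_gr r) (evenHom_mem_center r)

lemma one_mem_gr_zero {p q : ℕ} : (1 : FunGL p q) ∈ gr p q 0 := SetLike.GradedOne.one_mem

lemma odd1_mem {p q : ℕ} (k : OddGen p q) :
    oddEl k ᵍ⊗ₜ[ℂ] (1 : FunGL p q) ∈ superOdd (parity2 p q) :=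
  superOdd_left (oddEl_mem k) (oddEl_mem_gr k) one_mem_gr_zero (one_mem _)

lemma odd2_mem {p q : ℕ} (k : OddGen p q) :
    (1 : FunGL p q) ᵍ⊗ₜ[ℂ] oddEl k ∈ superOdd (parity2 p q) :=
  superOdd_right (oddEl_mem k) (oddEl_mem_gr k) one_mem_gr_zero (one_mem _)

lemma odd1_mul_odd2 {p q : ℕ} (k l : OddGen p q) :
    (oddEl k ᵍ⊗ₜ[ℂ] (1 : FunGL p q) * (1 : FunGL p q) ᵍ⊗ₜ[ℂ] oddEl l : AA p q) =
      oddEl k ᵍ⊗ₜ[ℂ] oddEl l := GradedTensorProduct.tmul_one_mul_one_tmul _ _ _ _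

lemma odd_tmul_odd_mem_center {p q : ℕ} (k l : OddGen p q) :
    oddEl k ᵍ⊗ₜ[ℂ] oddEl l ∈ Subalgebra.center ℂ (AA p q) := by
  rw [← odd1_mul_odd2]
  exact superOdd_mul_mem_center parity2_parity2 (odd1_mem k) (odd2_mem l)

/-- The central element `θ_k ⊗ θ_l`. -/
def oddodd {p q : ℕ} (k l : OddGen p q) : Subalgebra.center ℂ (AA p q) :=
  ⟨oddEl k ᵍ⊗ₜ[ℂ] oddEl l, odd_tmul_odd_mem_center k l⟩

lemma oddodd_nilpotent {p q : ℕ} (k l : OddGen p q) : IsNilpotent (oddodd k l) := by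
  have h := superOdd_mul_nilpotent parity2_parity2 (odd1_mem k) (odd2_mem l)
  have e : oddodd k l = ⟨_, superOdd_mul_mem_center parity2_parity2 (odd1_mem k) (odd2_mem l)⟩ :=
    Subtype.ext (odd1_mul_odd2 k l).symm
  rwa [e]

/-- `A₁ A₂ + B₁ C₂`. -/
def comulA (p q : ℕ) : Matrix (Fin p) (Fin p) (Subalgebra.center ℂ (AA p q)) :=
  (matA0 p q).map (central1 p q) * (matA0 p q).map (central2 p q) +
    Matrix.of fun i j => ∑ k, oddodd (Sum.inl (i, k)) (Sum.inr (k, j))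

/-- `C₁ B₂ + D₁ D₂`. -/
def comulD (p q : ℕ) : Matrix (Fin q) (Fin q) (Subalgebra.center ℂ (AA p q)) :=
  (matD0 p q).map (central1 p q) * (matD0 p q).map (central2 p q) +
    Matrix.of fun i j => ∑ k, oddodd (Sum.inr (i, k)) (Sum.inl (k, j))

lemma isUnit_det_comulA (p q : ℕ) : IsUnit (comulA p q).det := by
  refine isUnit_det_add ?_ fun i j => ?_
  · rw [Matrix.det_mul]
    exact (isUnit_det_map _ (isUnit_det_matA0 p q)).mul (isUnit_det_map _ (isUnit_det_matA0 p q))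
  · rw [Matrix.of_apply]
    exact isNilpotent_sum fun k _ => oddodd_nilpotent _ _

lemma isUnit_det_comulD (p q : ℕ) : IsUnit (comulD p q).det := by
  refine isUnit_det_add ?_ fun i j => ?_
  · rw [Matrix.det_mul]
    exact (isUnit_det_map _ (isUnit_det_matD0 p q)).mul (isUnit_det_map _ (isUnit_det_matD0 p q))
  · rw [Matrix.of_apply]
    exact isNilpotent_sum fun k _ => oddodd_nilpotent _ _

/-- The comultiplication on the odd generators: `B ↦ A₁ B₂ + B₁ D₂`, `C ↦ C₁ A₂ + D₁ C₂`. -/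
def comulOddGen {p q : ℕ} : OddGen p q → AA p q
  | Sum.inl (i, j) => ∑ k, matA p q i k ᵍ⊗ₜ[ℂ] matB p q k j + ∑ k, matB p q i k ᵍ⊗ₜ[ℂ] matD p q k j
  | Sum.inr (i, j) => ∑ k, matC p q i k ᵍ⊗ₜ[ℂ] matA p q k j + ∑ k, matD p q i k ᵍ⊗ₜ[ℂ] matC p q k j

lemma comulOddGen_mem {p q : ℕ} (k : OddGen p q) : comulOddGen k ∈ superOdd (parity2 p q) := by
  rcases k with ⟨i, j⟩ | ⟨i, j⟩
  · exact add_mem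
      (sum_mem fun k _ => superOdd_right (oddEl_mem _) (oddEl_mem_gr _) (evenHom_mem_gr _)
        (evenHom_mem_center _))
      (sum_mem fun k _ => superOdd_left (oddEl_mem _) (oddEl_mem_gr _) (evenHom_mem_gr _)
        (evenHom_mem_center _))
  · exact add_mem
      (sum_mem fun k _ => superOdd_left (oddEl_mem _) (oddEl_mem_gr _) (evenHom_mem_gr _)
        (evenHom_mem_center _))
      (sum_mem fun k _ => superOdd_right (oddEl_mem _) (oddEl_mem_gr _) (evenHom_mem_gr _)
        (evenHom_mem_center _))

/-- The comultiplication on the even generators: `A ↦ A₁ A₂ + B₁ C₂`, `D ↦ C₁ B₂ + D₁ D₂`. -/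
def comulEven (p q : ℕ) : FunGL0 p q →ₐ[ℂ] AA p q :=
  (Subalgebra.center ℂ (AA p q)).val.comp
    (evalComm (comulA p q) (comulD p q) (isUnit_det_comulA p q) (isUnit_det_comulD p q))

/-- The comultiplication on the Grassmann algebra. -/
def comulOdd (p q : ℕ) : Grass p q →ₐ[ℂ] AA p q :=
  ExteriorAlgebra.lift ℂ ⟨Fintype.linearCombination ℂ comulOddGen, fun m =>
    superOdd_sq (σ := parity2 p q) (by
      rw [Fintype.linearCombination_apply]
      exact sum_mem fun k _ => Submodule.smul_mem _ _ (comulOddGen_mem k))⟩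

lemma comulEven_commute (p q : ℕ) (r : FunGL0 p q) (w : Grass p q) :
    Commute (comulEven p q r) (comulOdd p q w) :=
  ((Subalgebra.mem_center_iff.1 (evalComm (comulA p q) (comulD p q) (isUnit_det_comulA p q)
    (isUnit_det_comulD p q) r).2) _).symm

/-- The comultiplication of `A(p,q)`, as a homomorphism to the super tensor square; it is the one with
`Δ(c^i_j) = ∑ₖ c^i_k ⊗ c^k_j`, see `comulHom_supermatrix`. -/
def comulHom (p q : ℕ) : FunGL p q →ₐ[ℂ] AA p q :=
  (Algebra.TensorProduct.lift (comulEven p q) (comulOdd p q) (comulEven_commute p q)).comp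
    (toA p q).symm.toAlgHom

lemma evalComm_matA0 {p q : ℕ} {Z : Type*} [CommRing Z] [Algebra ℂ Z]
    (X : Matrix (Fin p) (Fin p) Z) (Y : Matrix (Fin q) (Fin q) Z)
    (hX : IsUnit X.det) (hY : IsUnit Y.det) (i j) :
    evalComm X Y hX hY (matA0 p q i j) = X i j := by
  simp [evalComm, matA0, polyA, IsLocalization.liftAlgHom]

lemma evalComm_matD0 {p q : ℕ} {Z : Type*} [CommRing Z] [Algebra ℂ Z]
    (X : Matrix (Fin p) (Fin p) Z) (Y : Matrix (Fin q) (Fin q) Z)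
    (hX : IsUnit X.det) (hY : IsUnit Y.det) (i j) :
    evalComm X Y hX hY (matD0 p q i j) = Y i j := by
  simp [evalComm, matD0, polyD, IsLocalization.liftAlgHom]

lemma comulHom_even {p q : ℕ} (r : FunGL0 p q) : comulHom p q (evenHom p q r) = comulEven p q r := by
  change Algebra.TensorProduct.lift _ _ (comulEven_commute p q) (r ⊗ₜ 1) = _
  rw [Algebra.TensorProduct.lift_tmul, map_one, mul_one]

lemma comulHom_odd {p q : ℕ} (k : OddGen p q) : comulHom p q (oddEl k) = comulOddGen k := by
  change Algebra.TensorProduct.lift _ _ (comulEven_commute p q) (1 ⊗ₜ _) = _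
  rw [Algebra.TensorProduct.lift_tmul, map_one, one_mul, comulOdd, ExteriorAlgebra.lift_ι_apply]
  simp [Fintype.linearCombination_apply_single]

/-- `Δ(c^i_j) = ∑ₖ c^i_k ⊗ c^k_j`. -/
lemma comulHom_supermatrix (p q : ℕ) (i j : Fin p ⊕ Fin q) :
    comulHom p q (supermatrix p q i j) =
      ∑ k, supermatrix p q i k ᵍ⊗ₜ[ℂ] supermatrix p q k j := by
  rw [Fintype.sum_sum_type]
  rcases i with i | i <;> rcases j with j | j
  · change comulHom p q (evenHom p q (matA0 p q i j)) = _
    rw [comulHom_even]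
    change ((evalComm _ _ (isUnit_det_comulA p q) (isUnit_det_comulD p q) (matA0 p q i j) : Subalgebra.center ℂ (AA p q)) : AA p q) = _
    rw [evalComm_matA0, comulA, Matrix.add_apply, Matrix.mul_apply]
    push_cast
    congr 1
    · refine Finset.sum_congr rfl fun k _ => ?_
      exact GradedTensorProduct.tmul_one_mul_one_tmul _ _ _ _
    · simp [oddodd, supermatrix, matB, matC]
  · exact comulHom_odd _
  · exact comulHom_odd _
  · change comulHom p q (evenHom p q (matD0 p q i j)) = _
    rw [comulHom_even]
    change ((evalComm _ _ (isUnit_det_comulA p q) (isUnit_det_comulD p q) (matD0 p q i j) : Subalgebra.center ℂ (AA p q)) : AA p q) = _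
    rw [evalComm_matD0, comulD, Matrix.add_apply, Matrix.mul_apply, add_comm]
    push_cast
    congr 1
    · simp [oddodd, supermatrix, matB, matC]
    · refine Finset.sum_congr rfl fun k _ => ?_
      exact GradedTensorProduct.tmul_one_mul_one_tmul _ _ _ _

/-! ### The two Schur complements -/

/-- `Ã⁻¹ = A - B D⁻¹ C`, the inverse of the upper left block of the inverse supermatrix. -/
def tildeAinv (p q : ℕ) : Matrix (Fin p) (Fin p) (FunGL p q) :=
  matA p q - matB p q * matDinv p q * matC p q

/-- `D̃⁻¹ = D - C A⁻¹ B`, the inverse of the lower right block of the inverse supermatrix. -/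
def tildeDinv (p q : ℕ) : Matrix (Fin q) (Fin q) (FunGL p q) :=
  matD p q - matC p q * matAinv p q * matB p q

/-- `r ↦ r`, into the centre of `A(p,q)`. -/
def central (p q : ℕ) : FunGL0 p q →ₐ[ℂ] Subalgebra.center ℂ (FunGL p q) :=
  (evenHom p q).codRestrict _ evenHom_mem_center

/-- The product of two odd generators, as an element of the centre. -/
def oddProd {p q : ℕ} (k l : OddGen p q) : Subalgebra.center ℂ (FunGL p q) :=
  ⟨oddEl k * oddEl l, superOdd_mul_mem_center parity_parity (oddEl_mem k) (oddEl_mem l)⟩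

lemma oddProd_nilpotent {p q : ℕ} (k l : OddGen p q) : IsNilpotent (oddProd k l) :=
  superOdd_mul_nilpotent parity_parity (oddEl_mem k) (oddEl_mem l)

lemma oddProd_eq {p q : ℕ} (k l : OddGen p q) (r : FunGL0 p q) :
    oddEl k * evenHom p q r * oddEl l = ((central p q r * oddProd k l :
      Subalgebra.center ℂ (FunGL p q)) : FunGL p q) := by
  change _ = evenHom p q r * (oddEl k * oddEl l)
  rw [← mul_assoc, Subalgebra.mem_center_iff.1 (evenHom_mem_center r) (oddEl k)]

/-- `Ã⁻¹` as a matrix over the centre. -/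
def schurA (p q : ℕ) : Matrix (Fin p) (Fin p) (Subalgebra.center ℂ (FunGL p q)) :=
  (matA0 p q).map (central p q) + Matrix.of fun i j =>
    -∑ l, ∑ k, central p q ((matD0 p q)⁻¹ k l) * oddProd (Sum.inl (i, k)) (Sum.inr (l, j))

/-- `D̃⁻¹` as a matrix over the centre. -/
def schurD (p q : ℕ) : Matrix (Fin q) (Fin q) (Subalgebra.center ℂ (FunGL p q)) :=
  (matD0 p q).map (central p q) + Matrix.of fun i j =>
    -∑ l, ∑ k, central p q ((matA0 p q)⁻¹ k l) * oddProd (Sum.inr (i, k)) (Sum.inl (l, j))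

lemma schurA_coe (p q : ℕ) (i j) : (schurA p q i j : FunGL p q) = tildeAinv p q i j := by
  rw [schurA, tildeAinv, Matrix.add_apply, Matrix.sub_apply, sub_eq_add_neg, Matrix.mul_apply]
  push_cast
  congr 1
  rw [Matrix.of_apply]
  push_cast
  refine congrArg _ (Finset.sum_congr rfl fun l _ => ?_)
  rw [Matrix.mul_apply, Finset.sum_mul]
  refine Finset.sum_congr rfl fun k _ => ?_
  exact (oddProd_eq _ _ _).symm

lemma schurD_coe (p q : ℕ) (i j) : (schurD p q i j : FunGL p q) = tildeDinv p q i j := by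
  rw [schurD, tildeDinv, Matrix.add_apply, Matrix.sub_apply, sub_eq_add_neg, Matrix.mul_apply]
  push_cast
  congr 1
  rw [Matrix.of_apply]
  push_cast
  refine congrArg _ (Finset.sum_congr rfl fun l _ => ?_)
  rw [Matrix.mul_apply, Finset.sum_mul]
  refine Finset.sum_congr rfl fun k _ => ?_
  exact (oddProd_eq _ _ _).symm

lemma isUnit_det_schurA (p q : ℕ) : IsUnit (schurA p q).det := by
  refine isUnit_det_add (isUnit_det_map _ (isUnit_det_matA0 p q)) fun i j => ?_
  rw [Matrix.of_apply]
  exact (isNilpotent_sum fun l _ => isNilpotent_sum fun k _ =>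
    (Commute.all _ _).isNilpotent_mul_left (oddProd_nilpotent _ _)).neg

lemma isUnit_det_schurD (p q : ℕ) : IsUnit (schurD p q).det := by
  refine isUnit_det_add (isUnit_det_map _ (isUnit_det_matD0 p q)) fun i j => ?_
  rw [Matrix.of_apply]
  exact (isNilpotent_sum fun l _ => isNilpotent_sum fun k _ =>
    (Commute.all _ _).isNilpotent_mul_left (oddProd_nilpotent _ _)).neg

/-- The two mirror-image cases (interchanging `A` with `D` and `B` with `C`):

* `plus`: coefficients `𝒟(A, D̃⁻¹)`, variables `ξ = A⁻¹B` and `(1 - ηξ)⁻¹η`, parabolic quotient `A₊`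
  (`C = 0`), primitive elements;
* `minus`: coefficients `𝒟(Ã⁻¹, D)`, variables `η = D⁻¹C` and `(1 - ξη)⁻¹ξ`, parabolic quotient `A₋`
  (`B = 0`), antiprimitive elements. -/
inductive Side
  | plus
  | minus

/-- The other side. -/
def Side.opp : Side → Side
  | .plus => .minus
  | .minus => .plus

/-- The substitution of arguments in the coefficients: `(A₀, D₀) ↦ (A, D̃⁻¹)` for `plus`,
`(A₀, D₀) ↦ (Ã⁻¹, D)` for `minus`. -/
def subst (p q : ℕ) : Side → (FunGL0 p q →ₐ[ℂ] FunGL p q)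
  | .plus => (Subalgebra.center ℂ (FunGL p q)).val.comp
      (evalComm ((matA0 p q).map (central p q)) (schurD p q)
        (isUnit_det_map _ (isUnit_det_matA0 p q)) (isUnit_det_schurD p q))
  | .minus => (Subalgebra.center ℂ (FunGL p q)).val.comp
      (evalComm (schurA p q) ((matD0 p q).map (central p q))
        (isUnit_det_schurA p q) (isUnit_det_map _ (isUnit_det_matD0 p q)))

lemma subst_plus_matA0 (p q : ℕ) (i j) : subst p q .plus (matA0 p q i j) = matA p q i j := by
  change ((evalComm ((matA0 p q).map (central p q)) (schurD p q)
    (isUnit_det_map _ (isUnit_det_matA0 p q)) (isUnit_det_schurD p q) (matA0 p q i j) :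
      Subalgebra.center ℂ (FunGL p q)) : FunGL p q) = _
  rw [evalComm_matA0]; rfl

lemma subst_plus_matD0 (p q : ℕ) (i j) : subst p q .plus (matD0 p q i j) = tildeDinv p q i j := by
  change ((evalComm ((matA0 p q).map (central p q)) (schurD p q)
    (isUnit_det_map _ (isUnit_det_matA0 p q)) (isUnit_det_schurD p q) (matD0 p q i j) :
      Subalgebra.center ℂ (FunGL p q)) : FunGL p q) = _
  rw [evalComm_matD0, schurD_coe]

lemma subst_minus_matA0 (p q : ℕ) (i j) : subst p q .minus (matA0 p q i j) = tildeAinv p q i j := by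
  change ((evalComm (schurA p q) ((matD0 p q).map (central p q))
        (isUnit_det_schurA p q) (isUnit_det_map _ (isUnit_det_matD0 p q)) (matA0 p q i j) :
      Subalgebra.center ℂ (FunGL p q)) : FunGL p q) = _
  rw [evalComm_matA0, schurA_coe]

lemma subst_minus_matD0 (p q : ℕ) (i j) : subst p q .minus (matD0 p q i j) = matD p q i j := by
  change ((evalComm (schurA p q) ((matD0 p q).map (central p q))
        (isUnit_det_schurA p q) (isUnit_det_map _ (isUnit_det_matD0 p q)) (matD0 p q i j) :
      Subalgebra.center ℂ (FunGL p q)) : FunGL p q) = _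
  rw [evalComm_matD0]; rfl

/-- `ξ = A⁻¹ B`. -/
def xi (p q : ℕ) : Matrix (Fin p) (Fin q) (FunGL p q) := matAinv p q * matB p q
/-- `η = D⁻¹ C`. -/
def eta (p q : ℕ) : Matrix (Fin q) (Fin p) (FunGL p q) := matDinv p q * matC p q

lemma matDinv_mul (p q : ℕ) : matDinv p q * matD p q = 1 := by
  rw [matDinv, matD, ← Matrix.map_mul, Matrix.nonsing_inv_mul _ (isUnit_det_matD0 p q)]
  exact Matrix.map_one _ (map_zero _) (map_one _)

lemma matD_mul (p q : ℕ) : matD p q * matDinv p q = 1 := by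
  rw [matDinv, matD, ← Matrix.map_mul, Matrix.mul_nonsing_inv _ (isUnit_det_matD0 p q)]
  exact Matrix.map_one _ (map_zero _) (map_one _)

lemma matAinv_mul (p q : ℕ) : matAinv p q * matA p q = 1 := by
  rw [matAinv, matA, ← Matrix.map_mul, Matrix.nonsing_inv_mul _ (isUnit_det_matA0 p q)]
  exact Matrix.map_one _ (map_zero _) (map_one _)

lemma matA_mul (p q : ℕ) : matA p q * matAinv p q = 1 := by
  rw [matAinv, matA, ← Matrix.map_mul, Matrix.mul_nonsing_inv _ (isUnit_det_matA0 p q)]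
  exact Matrix.map_one _ (map_zero _) (map_one _)

/-- `1 - η ξ` is invertible. -/
lemma isUnit_one_sub_eta_xi (p q : ℕ) : IsUnit (1 - eta p q * xi p q) := by
  have h1 : 1 - eta p q * xi p q = matDinv p q * tildeDinv p q := by
    rw [tildeDinv, mul_sub, matDinv_mul, eta, xi]
    simp only [Matrix.mul_assoc]
  have h2 : IsUnit (tildeDinv p q) := by
    have := ((Matrix.isUnit_iff_isUnit_det _).2 (isUnit_det_schurD p q)).map
      (Subalgebra.center ℂ (FunGL p q)).val.toRingHom.mapMatrix
    convert this
    ext i j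
    exact (schurD_coe p q i j).symm
  rw [h1]
  exact IsUnit.mul ⟨⟨_, _, matDinv_mul p q, matD_mul p q⟩, rfl⟩ h2

/-- `1 - ξ η` is invertible. -/
lemma isUnit_one_sub_xi_eta (p q : ℕ) : IsUnit (1 - xi p q * eta p q) := by
  have h1 : 1 - xi p q * eta p q = matAinv p q * tildeAinv p q := by
    rw [tildeAinv, mul_sub, matAinv_mul, eta, xi]
    simp only [Matrix.mul_assoc]
  have h2 : IsUnit (tildeAinv p q) := by
    have := ((Matrix.isUnit_iff_isUnit_det _).2 (isUnit_det_schurA p q)).map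
      (Subalgebra.center ℂ (FunGL p q)).val.toRingHom.mapMatrix
    convert this
    ext i j
    exact (schurA_coe p q i j).symm
  rw [h1]
  exact IsUnit.mul ⟨⟨_, _, matAinv_mul p q, matA_mul p q⟩, rfl⟩ h2

/-- The composite variables: `(1 - η ξ)⁻¹ η`. -/
def zetaPlus (p q : ℕ) : Matrix (Fin q) (Fin p) (FunGL p q) :=
  Ring.inverse (1 - eta p q * xi p q) * eta p q
/-- The composite variables: `(1 - ξ η)⁻¹ ξ`. -/
def zetaMinus (p q : ℕ) : Matrix (Fin p) (Fin q) (FunGL p q) :=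
  Ring.inverse (1 - xi p q * eta p q) * xi p q

/-- The entries of `ξ` for `plus`, of `η` for `minus`. -/
def baseVars (p q : ℕ) : Side → Set (FunGL p q)
  | .plus => {x | ∃ i j, x = xi p q i j}
  | .minus => {x | ∃ i j, x = eta p q i j}

/-- The entries of `(1 - ηξ)⁻¹η` for `plus`, of `(1 - ξη)⁻¹ξ` for `minus`. -/
def compVars (p q : ℕ) : Side → Set (FunGL p q)
  | .plus => {x | ∃ i j, x = zetaPlus p q i j}
  | .minus => {x | ∃ i j, x = zetaMinus p q i j}

/-! ### Super comodules -/

section comodules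
variable {C : Type*} [AddCommGroup C] [Module ℂ C] {V : Type*} [AddCommGroup V] [Module ℂ V]

/-- The total grading of a tensor product. -/
def tensorGr (gV : ZMod 2 → Submodule ℂ V) (gC : ZMod 2 → Submodule ℂ C) (i : ZMod 2) :
    Submodule ℂ (V ⊗[ℂ] C) :=
  ⨆ j, LinearMap.range (TensorProduct.map (gV j).subtype (gC (i - j)).subtype)

/-- `β` makes the `ℤ/2`-graded space `V` a (graded, right) comodule over the coalgebra `(C, Δ, ε)`. -/
structure IsSuperComodule (Δ : C →ₗ[ℂ] C ⊗[ℂ] C) (ε : C →ₗ[ℂ] ℂ) (gC : ZMod 2 → Submodule ℂ C)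
    (gV : ZMod 2 → Submodule ℂ V) (β : V →ₗ[ℂ] V ⊗[ℂ] C) : Prop where
  isInternal : DirectSum.IsInternal gV
  even : ∀ i, ∀ v ∈ gV i, β v ∈ tensorGr gV gC i
  coassoc : ∀ v, TensorProduct.assoc ℂ V C C (β.rTensor C (β v)) = Δ.lTensor V (β v)
  counit : ∀ v, TensorProduct.rid ℂ V (ε.lTensor V (β v)) = v

/-- `U` is a (graded) subcomodule. -/
structure IsSubcomodule (gV : ZMod 2 → Submodule ℂ V) (γ : V →ₗ[ℂ] V ⊗[ℂ] C)
    (U : Submodule ℂ V) : Prop where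
  homogeneous : U ≤ ⨆ i, U ⊓ gV i
  stable : ∀ u ∈ U, γ u ∈ LinearMap.range (U.subtype.rTensor C)

lemma subtype_rTensor_injective (U : Submodule ℂ V) :
    Function.Injective (U.subtype.rTensor C) :=
  Module.Flat.rTensor_preserves_injective_linearMap _ U.injective_subtype

/-- The induced grading on a subspace. -/
def restrictGr (gV : ZMod 2 → Submodule ℂ V) (U : Submodule ℂ V) (i : ZMod 2) : Submodule ℂ U :=
  (gV i).comap U.subtype

variable {gV : ZMod 2 → Submodule ℂ V} {γ : V →ₗ[ℂ] V ⊗[ℂ] C} {U U' : Submodule ℂ V}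

/-- The coaction of a subcomodule, characterised by `coaction_spec`. -/
def IsSubcomodule.coaction (h : IsSubcomodule gV γ U) : U →ₗ[ℂ] U ⊗[ℂ] C :=
  (LinearEquiv.ofInjective (U.subtype.rTensor C) (subtype_rTensor_injective U)).symm.toLinearMap ∘ₗ
    (γ ∘ₗ U.subtype).codRestrict _ fun u => h.stable u u.2

lemma IsSubcomodule.coaction_spec (h : IsSubcomodule gV γ U) (u : U) :
    U.subtype.rTensor C (h.coaction u) = γ u := by
  have := LinearEquiv.apply_symm_apply
    (LinearEquiv.ofInjective (U.subtype.rTensor C) (subtype_rTensor_injective U))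
    ⟨γ u, h.stable u u.2⟩
  exact congrArg Subtype.val this

/-- The coaction induced on the quotient of two nested subcomodules. -/
def IsSubcomodule.quotCoaction (h : IsSubcomodule gV γ U) (h' : IsSubcomodule gV γ U')
    (hle : U' ≤ U) :
    (U ⧸ U'.submoduleOf U) →ₗ[ℂ] (U ⧸ U'.submoduleOf U) ⊗[ℂ] C :=
  (U'.submoduleOf U).liftQ ((U'.submoduleOf U).mkQ.rTensor C ∘ₗ h.coaction) (by
    intro u hu
    have hu' : (u : V) ∈ U' := hu
    obtain ⟨t, ht⟩ := h'.stable u hu'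
    have e : h.coaction u = (Submodule.inclusion hle).rTensor C t := by
      apply subtype_rTensor_injective U
      rw [h.coaction_spec, ← ht, ← LinearMap.comp_apply, ← LinearMap.rTensor_comp,
        Submodule.subtype_comp_inclusion]
    have z : (U'.submoduleOf U).mkQ ∘ₗ Submodule.inclusion hle = 0 := by
      ext x
      exact (Submodule.Quotient.mk_eq_zero _).2 x.2
    rw [LinearMap.mem_ker, LinearMap.comp_apply, e, ← LinearMap.comp_apply,
      ← LinearMap.rTensor_comp, z, LinearMap.rTensor_zero, LinearMap.zero_apply])

/-- The induced grading on the quotient of two nested subspaces. -/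
def quotGr (gV : ZMod 2 → Submodule ℂ V) (U U' : Submodule ℂ V) (i : ZMod 2) :
    Submodule ℂ (U ⧸ U'.submoduleOf U) :=
  (restrictGr gV U i).map (U'.submoduleOf U).mkQ

/-- Isomorphism of graded comodules (even, bijective, compatible with the coactions). -/
def ComoduleIso {V' : Type*} [AddCommGroup V'] [Module ℂ V']
    (gV : ZMod 2 → Submodule ℂ V) (γ : V →ₗ[ℂ] V ⊗[ℂ] C)
    (gV' : ZMod 2 → Submodule ℂ V') (γ' : V' →ₗ[ℂ] V' ⊗[ℂ] C) : Prop :=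
  ∃ e : V ≃ₗ[ℂ] V', (∀ i, (gV i).map e.toLinearMap = gV' i) ∧
    ∀ v, γ' (e v) = e.toLinearMap.rTensor C (γ v)

/-- The coaction `id ⊗ Δ` on `V ⊗ C`. -/
def cofree (V : Type*) [AddCommGroup V] [Module ℂ V] (Δ : C →ₗ[ℂ] C ⊗[ℂ] C) :
    V ⊗[ℂ] C →ₗ[ℂ] (V ⊗[ℂ] C) ⊗[ℂ] C :=
  (TensorProduct.assoc ℂ V C C).symm.toLinearMap ∘ₗ Δ.lTensor V

/-- The induced comodule `{x ∈ V ⊗ C | (β ⊗ id) x = (id ⊗ (π ⊗ id)Δ) x}`; its coaction is the restriction of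
`id ⊗ Δ`. -/
def ind {D : Type*} [AddCommGroup D] [Module ℂ D] (Δ : C →ₗ[ℂ] C ⊗[ℂ] C) (π : C →ₗ[ℂ] D)
    (β : V →ₗ[ℂ] V ⊗[ℂ] D) : Submodule ℂ (V ⊗[ℂ] C) :=
  LinearMap.eqLocus ((TensorProduct.assoc ℂ V D C).toLinearMap ∘ₗ β.rTensor C)
    ((π.rTensor C ∘ₗ Δ).lTensor V)

/-- The tensor product of two comodules over a purely even bialgebra:
`v ⊗ w ↦ ∑ v₀ ⊗ w₀ ⊗ v₁ w₁` (no signs, since the coefficients are even). -/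
def tensorCoaction {D : Type*} [CommRing D] [Algebra ℂ D] {V' : Type*} [AddCommGroup V']
    [Module ℂ V'] (β : V →ₗ[ℂ] V ⊗[ℂ] D) (β' : V' →ₗ[ℂ] V' ⊗[ℂ] D) :
    V ⊗[ℂ] V' →ₗ[ℂ] (V ⊗[ℂ] V') ⊗[ℂ] D :=
  (LinearMap.mul' ℂ D).lTensor (V ⊗[ℂ] V') ∘ₗ
    (TensorProduct.tensorTensorTensorComm ℂ V D V' D).toLinearMap ∘ₗ TensorProduct.map β β'

end comodules

/-- The comultiplication of `A(p,q)`, as a linear map to the tensor square. -/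
def comul (p q : ℕ) : FunGL p q →ₗ[ℂ] FunGL p q ⊗[ℂ] FunGL p q :=
  (GradedTensorProduct.of ℂ (gr p q) (gr p q)).symm.toLinearMap ∘ₗ (comulHom p q).toLinearMap

/-- The projection `π : A(p,q) → A₀(p,q)`: `A ↦ A₀`, `D ↦ D₀`, `B ↦ 0`, `C ↦ 0`. -/
def proj0 (p q : ℕ) : FunGL p q →ₐ[ℂ] FunGL0 p q :=
  ((Algebra.TensorProduct.rid ℂ ℂ (FunGL0 p q)).toAlgHom.comp
    (Algebra.TensorProduct.map (AlgHom.id ℂ (FunGL0 p q)) ExteriorAlgebra.algebraMapInv)).comp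
      (toA p q).symm.toAlgHom

/-- The counit of `A(p,q)`: `ε(c^i_j) = δ^i_j`. -/
def counit (p q : ℕ) : FunGL p q →ₗ[ℂ] ℂ := (counit0 p q).toLinearMap ∘ₗ (proj0 p q).toLinearMap

section main
variable {p q : ℕ} {V : Type*} [AddCommGroup V] [Module ℂ V]

/-- The parameterisation `∑ⱼ eⱼ ⊗ F^j ↦ ∑ᵢⱼ eᵢ ⊗ 𝒟(X,Y)^i_j F^j`, where `β(eⱼ) = ∑ᵢ eᵢ ⊗ 𝒟(A₀,D₀)^i_j` and
`(X,Y) = (A, D̃⁻¹)` for `plus`, `(X,Y) = (Ã⁻¹, D)` for `minus`. -/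
def param (s : Side) (β : V →ₗ[ℂ] V ⊗[ℂ] FunGL0 p q) : V ⊗[ℂ] FunGL p q →ₗ[ℂ] V ⊗[ℂ] FunGL p q :=
  (LinearMap.mul' ℂ (FunGL p q)).lTensor V ∘ₗ
    (TensorProduct.assoc ℂ V (FunGL p q) (FunGL p q)).toLinearMap ∘ₗ
      ((subst p q s).toLinearMap.lTensor V ∘ₗ β).rTensor (FunGL p q)

/-- All elements `∑ᵢⱼ eᵢ ⊗ 𝒟(X,Y)^i_j F^j` with the `F^j` in the given space `P` of functions. -/
def elems (s : Side) (β : V →ₗ[ℂ] V ⊗[ℂ] FunGL0 p q) (P : Submodule ℂ (FunGL p q)) :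
    Submodule ℂ (V ⊗[ℂ] FunGL p q) :=
  (LinearMap.range (P.subtype.lTensor V)).map (param s β)

/-- The Kac filtration: `W_j(V)` consists of the elements `∑ᵢₖ eᵢ ⊗ 𝒟(X,Y)^i_k F^k` with `F^k` a polynomial in
the base variables and the composite variables, of degree at most `j` in the composite variables. -/
def kacFil (s : Side) (β : V →ₗ[ℂ] V ⊗[ℂ] FunGL0 p q) (j : ℕ) : Submodule ℂ (V ⊗[ℂ] FunGL p q) :=
  elems s β (Subalgebra.toSubmodule (Algebra.adjoin ℂ (baseVars p q s)) *
    (1 ⊔ Submodule.span ℂ (compVars p q s)) ^ j)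

end main

/-- `V_j`: the span of the monomials of order `j` in the composite variables. -/
def compMonomials (p q : ℕ) (s : Side) (j : ℕ) : Submodule ℂ (FunGL p q) :=
  Submodule.span ℂ (compVars p q s) ^ j

/-- The right `A₀(p,q)`-coaction `(id ⊗ π)Δ` on `A(p,q)`. -/
def rightCoaction0 (p q : ℕ) : FunGL p q →ₗ[ℂ] FunGL p q ⊗[ℂ] FunGL0 p q :=
  (proj0 p q).toLinearMap.lTensor (FunGL p q) ∘ₗ comul p q

/-- The parabolic quotients `A₊(p,q)` (`A`, `D` and `B` survive) and `A₋(p,q)` (`A`, `D` and `C` survive). The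
odd generators of both are indexed by pairs `(i,j)`: `B i j` for `A₊`, and `C j i` for `A₋`. -/
def Par (p q : ℕ) : Type := FunGL0 p q ⊗[ℂ] ExteriorAlgebra ℂ (Fin p × Fin q → ℂ)
instance (p q : ℕ) : Ring (Par p q) :=
  inferInstanceAs (Ring (FunGL0 p q ⊗[ℂ] ExteriorAlgebra ℂ (Fin p × Fin q → ℂ)))
instance (p q : ℕ) : Algebra ℂ (Par p q) :=
  inferInstanceAs (Algebra ℂ (FunGL0 p q ⊗[ℂ] ExteriorAlgebra ℂ (Fin p × Fin q → ℂ)))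

/-- The identification with the defining tensor product. -/
def toPar (p q : ℕ) : FunGL0 p q ⊗[ℂ] ExteriorAlgebra ℂ (Fin p × Fin q → ℂ) ≃ₐ[ℂ] Par p q :=
  AlgEquiv.refl

/-- The odd generators that survive in the parabolic quotient. -/
def sideGen {p q : ℕ} : Side → Fin p × Fin q → OddGen p q
  | .plus, k => Sum.inl k
  | .minus, k => Sum.inr (k.2, k.1)

/-- The projections `π₊` (with `C ↦ 0`) and `π₋` (with `B ↦ 0`). -/
def parProj (p q : ℕ) (s : Side) : FunGL p q →ₐ[ℂ] Par p q :=
  ((toPar p q).toAlgHom.comp (Algebra.TensorProduct.map (AlgHom.id ℂ (FunGL0 p q))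
    (ExteriorAlgebra.map (LinearMap.funLeft ℂ ℂ (sideGen s))))).comp (toA p q).symm.toAlgHom

/-- The inclusion of the elements of `A₊` or `A₋` that do not depend on the odd generators. -/
def parEven (p q : ℕ) : FunGL0 p q →ₐ[ℂ] Par p q :=
  (toPar p q).toAlgHom.comp Algebra.TensorProduct.includeLeft

section prim
variable {p q : ℕ} {W : Type*} [AddCommGroup W] [Module ℂ W]

/-- The primitive elements (`plus`: `(id ⊗ π₊)γ(x)` is independent of `B₊`) and the antiprimitive elements
(`minus`: `(id ⊗ π₋)γ(x)` is independent of `C₋`) of a comodule `γ`. -/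
def primitive (s : Side) (γ : W →ₗ[ℂ] W ⊗[ℂ] FunGL p q) : Submodule ℂ W :=
  (LinearMap.range ((parEven p q).toLinearMap.lTensor W)).comap
    ((parProj p q s).toLinearMap.lTensor W ∘ₗ γ)

/-- The tangent functional at the unit in the direction of an odd generator: `∂/∂B i j` for `plus`,
`∂/∂C j i` for `minus`. -/
def oddFunctional (s : Side) (k : Fin p × Fin q) : FunGL p q →ₗ[ℂ] ℂ :=
  LinearMap.mul' ℂ ℂ ∘ₗ TensorProduct.map (counit0 p q).toLinearMap
    (LinearMap.proj (sideGen s k) ∘ₗ ExteriorAlgebra.ιInv) ∘ₗ (toA p q).symm.toLinearMap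

/-- The action `(id ⊗ ∂)γ` of an odd root vector on a comodule `γ`. -/
def oddOp (s : Side) (γ : W →ₗ[ℂ] W ⊗[ℂ] FunGL p q) (k : Fin p × Fin q) : Module.End ℂ W :=
  (TensorProduct.rid ℂ W).toLinearMap ∘ₗ (oddFunctional s k).lTensor W ∘ₗ γ

/-- The product, in a fixed order, of the odd root vectors of one side with indices in `S`. -/
def oddWord (s : Side) (γ : W →ₗ[ℂ] W ⊗[ℂ] FunGL p q) (S : Finset (Fin (p * q))) : Module.End ℂ W :=
  ((S.sort (· ≤ ·)).map fun m => oddOp s γ (finProdFinEquiv.symm m)).prod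

/-- `W` is the Kac module generated by `U`: the subspace `U` is stable under the even part and annihilated by the
odd part of the opposite side (so it is a module of the parabolic `𝔤₀ ⊕ 𝔤₋` on which `𝔤₋` acts by zero, where
`𝔤₊`, `𝔤₋` are the odd parts of the given and of the opposite side), and `W` is freely generated from `U` by
the exterior algebra of `𝔤₊`, that is `W = U(𝔤) ⊗_{U(𝔤₀ ⊕ 𝔤₋)} U`. -/
structure IsKacComodule (s : Side) (gW : ZMod 2 → Submodule ℂ W) (γ : W →ₗ[ℂ] W ⊗[ℂ] FunGL p q)
    (U : Submodule ℂ W) : Prop where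
  homogeneous : U ≤ ⨆ i, U ⊓ gW i
  stable : ∀ u ∈ U, (parProj p q s.opp).toLinearMap.lTensor W (γ u) ∈
    LinearMap.range (TensorProduct.map U.subtype (parEven p q).toLinearMap)
  free : Function.Bijective fun f : Finset (Fin (p * q)) → U => ∑ S, oddWord s γ S (f S)

end prim

end GLSuper
end
open GLSuper

open scoped TensorProduct
noncomputable section
namespace GLSuper
set_option linter.unusedSectionVars false

/-! ### Gradings by `ZMod 2` as eigenspaces of involutions -/

/-! Everything becomes transparent in adapted coordinates. For the side `plus`, put T = D - Cξ, the
Schur complement D̃⁻¹. Since T = D(1 - ηξ), the composite variables are ζ = T⁻¹C. The division-free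
relations Aξ = B, T = D - Cξ, Tζ = C show that A ↦ A, D ↦ T, B ↦ ξ, C ↦ ζ defines an automorphism
`bigPsi` of A(p,q); its inverse `bigPhi` sends A to A, D to D(1 + CB), B to AB and C to DC.

Under the left coaction of the even part, A and T are multiplied by A₀ and D₀, whereas ξ and ζ are
invariant. So A(p,q), as a left A₀(p,q)-comodule, is A₀(p,q) tensored with a trivial Grassmann
algebra in ξ and ζ, and ind(V) is the image of an injective map `omega` on V ⊗ `Grass`
(`omega_injective`, `ind_eq_range`). Every subspace in the theorem is the image of V tensored with a
span of monomials, so that dimensions, inclusions and intersections are questions about sets of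
generators.

For the coaction, let the indices 1 and 2 denote the two factors of the super tensor square, and put
α = A₂ + ξ₁C₂, δ = D₂ - C₂Δ(ξ). Then Δ(A) = A₁α, Δ(T) = T₁δ, αΔ(ξ) = B₂ + ξ₁D₂ and δΔ(ζ) = ζ₁α + C₂.
Neither α nor δ contains ζ₁, so the degree in ζ never grows (`comul_filPoly`), and the W_j are
subcomodules. The coefficients 𝒟(A,T) become 𝒟(A₁,T₁)𝒟(α,δ). Modulo lower degree, ζ becomes δ⁻¹ζ₁α,
which is the right coaction of the even part on ζ with (A₀,D₀) replaced by (α,δ). On a quotient of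
the filtration the monomials in ζ therefore behave like additional basis vectors of the inducing
comodule (`comoduleIso_kacFil`).

If C₂ = 0, then α = A₂, δ = D₂ and Δ(ζ) = D₂⁻¹ζ₁A₂ is free of B₂; so polynomials in ζ give primitive
elements. Conversely, the odd operators for B annihilate A, T and ζ and send ξ to matrix units,
hence act on V ⊗ `Grass` as contractions (`oddOp_omega`). A primitive element is annihilated by all
of them and so contains no ξ (`primitive_ind`).

Applied to the product of all entries of ξ, products of contractions give each monomial in ξ exactly
once, up to a nonzero scalar: this is the freeness in the Kac module. If B₂ = 0, then αΔ(ξ) = ξ₁D₂.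
The top monomial is annihilated by every entry of ξ₁, so that α and δ act on it like A₂ and D₂, and
its coproduct is itself times an even element of the second factor (`killC2_kappa_comul_top`).

The mirror image needs no second proof: the blocks are named relative to a `Side`, and only
elementary lemmas distinguish the two cases. Below, A, B, C, D, T, ξ, ζ stand for the blocks `sA`,
`sB`, `sC`, `sD`, `sT`, `sXi`, `sZeta` of the chosen side. Gradings are treated as eigenspaces of
involutions, which turns evenness of a map into a commutation relation. -/

/-- The sign `(-1)^i`. -/
def sg (i : ZMod 2) : ℂ := if i = 0 then 1 else -1

@[simp] lemma sg_zero : sg 0 = 1 := rfl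

@[simp] lemma sg_one : sg 1 = -1 := by simp [sg]

lemma sg_mul_self (i : ZMod 2) : sg i * sg i = 1 := by
  obtain rfl | rfl := zmod_two i <;> simp

lemma sg_sub (i j : ZMod 2) : sg (i - j) = sg i * sg j := by
  obtain rfl | rfl := zmod_two i <;> obtain rfl | rfl := zmod_two j <;>
    simp [show (-1 : ZMod 2) = 1 from rfl]

section involutions
variable {C : Type*} [AddCommGroup C] [Module ℂ C] {V : Type*} [AddCommGroup V] [Module ℂ V]
variable {V' : Type*} [AddCommGroup V'] [Module ℂ V']

/-- The grading `gV` is given by the eigenspaces of the involution `σ`. -/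
structure IsInv (gV : ZMod 2 → Submodule ℂ V) (σ : V →ₗ[ℂ] V) : Prop where
  invol : ∀ v, σ (σ v) = v
  mem : ∀ i v, v ∈ gV i ↔ σ v = sg i • v

/-- The projection to the `i`-th eigenspace of an involution. -/
def eigenProj (σ : V →ₗ[ℂ] V) (i : ZMod 2) : V →ₗ[ℂ] V :=
  (2⁻¹ : ℂ) • (LinearMap.id + sg i • σ)

lemma eigenProj_apply (σ : V →ₗ[ℂ] V) (i : ZMod 2) (v : V) :
    eigenProj σ i v = (2⁻¹ : ℂ) • (v + sg i • σ v) := rfl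

lemma eigenProj_add (σ : V →ₗ[ℂ] V) (v : V) : eigenProj σ 0 v + eigenProj σ 1 v = v := by
  simp only [eigenProj_apply, sg_zero, sg_one]
  module

namespace IsInv
variable {gV : ZMod 2 → Submodule ℂ V} {σ : V →ₗ[ℂ] V} {gC : ZMod 2 → Submodule ℂ C}
  {τ : C →ₗ[ℂ] C} {gV' : ZMod 2 → Submodule ℂ V'} {σ' : V' →ₗ[ℂ] V'}

lemma eigenProj_mem (h : IsInv gV σ) (i : ZMod 2) (v : V) : eigenProj σ i v ∈ gV i := by
  rw [h.mem, eigenProj_apply, map_smul, map_add, map_smul, h.invol, smul_comm (sg i) (2⁻¹ : ℂ),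
    smul_add (sg i), smul_smul (sg i), sg_mul_self, one_smul, add_comm (sg i • v)]

lemma isInternal (h : IsInv gV σ) : DirectSum.IsInternal gV := by
  have h0 : ∀ v, v ∈ gV 0 ↔ σ v = v := fun v => by rw [h.mem]; simp
  have h1 : ∀ v, v ∈ gV 1 ↔ σ v = -v := fun v => by rw [h.mem]; simp
  rw [DirectSum.isInternal_submodule_iff_isCompl gV (i := 0) (j := 1) (by decide)
    (by ext i; obtain rfl | rfl := zmod_two i <;> simp)]
  refine ⟨?_, ?_⟩
  · rw [Submodule.disjoint_def]
    intro v hv hv'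
    have e : v = -v := ((h0 v).1 hv).symm.trans ((h1 v).1 hv')
    have : (2 : ℂ) • v = 0 := by
      rw [two_smul]; nth_rewrite 1 [e]; exact neg_add_cancel v
    exact (smul_eq_zero.1 this).resolve_left two_ne_zero
  · rw [codisjoint_iff_le_sup]
    intro v _
    rw [← eigenProj_add σ v]
    exact Submodule.add_mem_sup (h.eigenProj_mem 0 v) (h.eigenProj_mem 1 v)

lemma homogeneous (h : IsInv gV σ) {U : Submodule ℂ V} (hU : ∀ u ∈ U, σ u ∈ U) :
    U ≤ ⨆ i, U ⊓ gV i := by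
  intro u hu
  have key : ∀ i, eigenProj σ i u ∈ ⨆ i, U ⊓ gV i := fun i =>
    Submodule.mem_iSup_of_mem i ⟨by
      rw [eigenProj_apply]
      exact U.smul_mem _ (U.add_mem hu (U.smul_mem _ (hU u hu))), h.eigenProj_mem i u⟩
  rw [← eigenProj_add σ u]
  exact add_mem (key 0) (key 1)

/-- On each homogeneous piece the involution is a scalar. -/
lemma stable (h : IsInv gV σ) {U : Submodule ℂ V} (hU : U ≤ ⨆ i, U ⊓ gV i) :
    ∀ u ∈ U, σ u ∈ U := by
  have : U ≤ U.comap σ := hU.trans (iSup_le fun i => fun u hu => by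
    rw [Submodule.mem_comap, (h.mem i u).1 hu.2]
    exact U.smul_mem _ hu.1)
  exact this

lemma restrict (h : IsInv gV σ) {U : Submodule ℂ V} (hU : ∀ u ∈ U, σ u ∈ U) :
    IsInv (restrictGr gV U) (σ.restrict hU) where
  invol v := Subtype.ext (h.invol v)
  mem i v := by
    rw [Subtype.ext_iff]
    exact h.mem i v

lemma map_eq (h : IsInv gV σ) (h' : IsInv gV' σ') (e : V ≃ₗ[ℂ] V')
    (he : ∀ v, σ' (e v) = e (σ v)) (i : ZMod 2) : (gV i).map e.toLinearMap = gV' i := by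
  ext w
  rw [Submodule.mem_map, h'.mem]
  constructor
  · rintro ⟨v, hv, rfl⟩
    rw [LinearEquiv.coe_coe, he, (h.mem i v).1 hv, map_smul]
  · intro hw
    refine ⟨e.symm w, ?_, e.apply_symm_apply w⟩
    rw [h.mem]
    apply e.injective
    rw [← he, map_smul, e.apply_symm_apply, hw]

lemma map_mem (h : IsInv gV σ) (h' : IsInv gV' σ') (f : V →ₗ[ℂ] V')
    (hf : ∀ v, σ' (f v) = f (σ v)) {i : ZMod 2} {v : V} (hv : v ∈ gV i) : f v ∈ gV' i := by
  rw [h'.mem, hf, (h.mem i v).1 hv, map_smul]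

lemma comm_of_map_mem (h : IsInv gV σ) (h' : IsInv gV' σ') (f : V →ₗ[ℂ] V')
    (hf : ∀ i, ∀ v ∈ gV i, f v ∈ gV' i) (v : V) : σ' (f v) = f (σ v) := by
  rw [← eigenProj_add σ v, map_add, map_add, map_add, map_add]
  congr 1 <;>
  rw [(h'.mem _ _).1 (hf _ _ (h.eigenProj_mem _ v)), (h.mem _ _).1 (h.eigenProj_mem _ v), map_smul]

/-- The total degree of a product of eigenvectors is the sum of their degrees, and signs are
multiplicative. This replaces the supremum in `tensorGr` by a single eigenvalue equation. -/
lemma tensor (h : IsInv gV σ) (hC : IsInv gC τ) :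
    IsInv (tensorGr gV gC) (TensorProduct.map σ τ) where
  invol t := by
    rw [← LinearMap.comp_apply, ← TensorProduct.map_comp,
      show σ ∘ₗ σ = LinearMap.id from LinearMap.ext h.invol,
      show τ ∘ₗ τ = LinearMap.id from LinearMap.ext hC.invol, TensorProduct.map_id,
      LinearMap.id_apply]
  mem i t := by
    constructor
    · intro ht
      have : tensorGr gV gC i ≤ LinearMap.eqLocus (TensorProduct.map σ τ)
          (sg i • LinearMap.id) := by
        refine iSup_le fun j => ?_
        rintro _ ⟨x, rfl⟩
        induction x using TensorProduct.induction_on with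
        | zero => simp
        | add x y hx hy => rw [map_add]; exact add_mem hx hy
        | tmul v c =>
          rw [TensorProduct.map_tmul, LinearMap.mem_eqLocus, TensorProduct.map_tmul,
            Submodule.subtype_apply, Submodule.subtype_apply, (h.mem _ _).1 v.2,
            (hC.mem _ _).1 c.2, TensorProduct.smul_tmul_smul, sg_sub, mul_comm (sg j), mul_assoc,
            sg_mul_self, mul_one]
          rfl
      exact this ht
    · intro ht
      -- On a product of eigenvectors of degrees a and b the projection is the identity if a + b = i
      -- and zero otherwise; every tensor is a sum of such products. An eigenvector `t` is its own
      -- projection, which is the claim.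
      have key : ∀ t, eigenProj (TensorProduct.map σ τ) i t ∈ tensorGr gV gC i := by
        intro t
        induction t using TensorProduct.induction_on with
        | zero => rw [map_zero]; exact zero_mem _
        | add x y hx hy => rw [map_add]; exact add_mem hx hy
        | tmul v c =>
          have hom : ∀ a b, eigenProj (TensorProduct.map σ τ) i
              (eigenProj σ a v ⊗ₜ eigenProj τ b c) ∈ tensorGr gV gC i := by
            intro a b
            have e : eigenProj (TensorProduct.map σ τ) i (eigenProj σ a v ⊗ₜ eigenProj τ b c) =
                (2⁻¹ * (1 + sg i * (sg a * sg b))) • (eigenProj σ a v ⊗ₜ eigenProj τ b c) := by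
              rw [eigenProj_apply (TensorProduct.map σ τ), TensorProduct.map_tmul,
                (h.mem _ _).1 (h.eigenProj_mem a v), (hC.mem _ _).1 (hC.eigenProj_mem b c),
                TensorProduct.smul_tmul_smul]
              module
            rw [e]
            by_cases hb : b = i - a
            · refine Submodule.smul_mem _ _ (Submodule.mem_iSup_of_mem a ?_)
              exact ⟨(⟨_, h.eigenProj_mem a v⟩ : gV a) ⊗ₜ
                (⟨_, hb ▸ hC.eigenProj_mem b c⟩ : gC (i - a)), rfl⟩
            · have : sg i * (sg a * sg b) = -1 := by
                obtain rfl | rfl := zmod_two i <;> obtain rfl | rfl := zmod_two a <;>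
                  obtain rfl | rfl := zmod_two b <;>
                  simp_all [show (-1 : ZMod 2) = 1 from rfl]
              rw [this]
              simp
          rw [← eigenProj_add σ v, ← eigenProj_add τ c]
          simp only [TensorProduct.add_tmul, TensorProduct.tmul_add, map_add]
          exact add_mem (add_mem (hom _ _) (hom _ _)) (add_mem (hom _ _) (hom _ _))
      have := key t
      rw [eigenProj_apply, ht, smul_smul, sg_mul_self, one_smul, ← two_smul ℂ t, smul_smul] at this
      simpa using this

lemma quot (h : IsInv gV σ) {U U' : Submodule ℂ V} (hU : ∀ u ∈ U, σ u ∈ U)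
    {ρ : (U ⧸ U'.submoduleOf U) →ₗ[ℂ] (U ⧸ U'.submoduleOf U)}
    (hρ : ∀ u, ρ ((U'.submoduleOf U).mkQ u) = (U'.submoduleOf U).mkQ (σ.restrict hU u)) :
    IsInv (quotGr gV U U') ρ where
  invol v := by
    obtain ⟨v, rfl⟩ := Submodule.mkQ_surjective _ v
    rw [hρ, hρ, (h.restrict hU).invol]
  mem i v := by
    constructor
    · rintro ⟨u, hu, rfl⟩
      rw [hρ, ((h.restrict hU).mem i u).1 hu, map_smul]
    · intro hv
      obtain ⟨v, rfl⟩ := Submodule.mkQ_surjective _ v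
      -- A class of degree i need not have its given representative of degree i; projecting the
      -- representative does not change the class.
      refine ⟨eigenProj (σ.restrict hU) i v, (h.restrict hU).eigenProj_mem i v, ?_⟩
      rw [hρ] at hv
      rw [eigenProj_apply, map_smul, map_add, map_smul, hv, smul_smul, sg_mul_self, one_smul,
        ← two_smul ℂ, smul_smul]
      simp

end IsInv

/-- The involution is 2P - 1, where P is the projection onto the even part along the odd part. -/
lemma exists_isInv {gV : ZMod 2 → Submodule ℂ V} (h : DirectSum.IsInternal gV) :
    ∃ σ, IsInv gV σ := by
  have hc := (DirectSum.isInternal_submodule_iff_isCompl gV (i := 0) (j := 1) (by decide)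
    (by ext i; obtain rfl | rfl := zmod_two i <;> simp)).1 h
  set P : V →ₗ[ℂ] V := (gV 0).subtype ∘ₗ Submodule.projectionOnto _ _ hc with hP
  have P0 : ∀ v ∈ gV 0, P v = v := fun v hv => by
    rw [hP, LinearMap.comp_apply, Submodule.projectionOnto_apply_left hc ⟨v, hv⟩]; rfl
  have P1 : ∀ v ∈ gV 1, P v = 0 := fun v hv => by
    rw [hP, LinearMap.comp_apply, (Submodule.projectionOnto_apply_eq_zero_iff hc).2 hv]; simp
  have hmem : ∀ v, P v ∈ gV 0 := fun v => Subtype.mem _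
  have hmem' : ∀ v, v - P v ∈ gV 1 := fun v => by
    obtain ⟨a, ha, b, hb, rfl⟩ := Submodule.mem_sup.1
      (hc.sup_eq_top ▸ Submodule.mem_top : v ∈ gV 0 ⊔ gV 1)
    rw [map_add, P0 a ha, P1 b hb]
    simpa using hb
  refine ⟨(2 : ℂ) • P - LinearMap.id, ⟨fun v => ?_, fun i v => ?_⟩⟩
  · have : P (P v) = P v := P0 _ (hmem v)
    simp only [LinearMap.sub_apply, LinearMap.smul_apply, LinearMap.id_apply, map_sub, map_smul,
      this]
    module
  · simp only [LinearMap.sub_apply, LinearMap.smul_apply, LinearMap.id_apply]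
    obtain rfl | rfl := zmod_two i
    · refine ⟨fun hv => by rw [P0 v hv]; simp [two_smul], fun hv => ?_⟩
      have : P v = v := by
        have h2 : (2 : ℂ) • P v = (2 : ℂ) • v := by
          rw [sub_eq_iff_eq_add] at hv; rw [hv, two_smul, sg_zero, one_smul]
        exact smul_right_injective V (two_ne_zero (α := ℂ)) h2
      exact this ▸ hmem v
    · refine ⟨fun hv => by rw [P1 v hv]; simp, fun hv => ?_⟩
      have : P v = 0 := by
        have h2 : (2 : ℂ) • P v = 0 := by
          rw [sub_eq_iff_eq_add] at hv; rw [hv, sg_one]; simp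
        exact (smul_eq_zero.1 h2).resolve_left two_ne_zero
      simpa [this] using hmem' v

end involutions

/-! ### Subcomodules -/

section comodules
variable {C : Type*} [AddCommGroup C] [Module ℂ C] {V : Type*} [AddCommGroup V] [Module ℂ V]
variable {gV : ZMod 2 → Submodule ℂ V} {gC : ZMod 2 → Submodule ℂ C} {γ : V →ₗ[ℂ] V ⊗[ℂ] C}
  {Δ : C →ₗ[ℂ] C ⊗[ℂ] C} {ε : C →ₗ[ℂ] ℂ} {U U' : Submodule ℂ V} {τ : C →ₗ[ℂ] C}

lemma IsSuperComodule.parity_comm {σ : V →ₗ[ℂ] V} (h : IsSuperComodule Δ ε gC gV γ)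
    (hσ : IsInv gV σ) (hτ : IsInv gC τ) (v : V) : TensorProduct.map σ τ (γ v) = γ (σ v) :=
  hσ.comm_of_map_mem (hσ.tensor hτ) γ h.even v

/-- Over a field U ⊗ X → V ⊗ X is injective for every X, so each axiom may be checked after
embedding in V, where it holds. -/
theorem IsSuperComodule.restrict (h : IsSuperComodule Δ ε gC gV γ) (hτ : IsInv gC τ)
    (hU : IsSubcomodule gV γ U) : IsSuperComodule Δ ε gC (restrictGr gV U) hU.coaction := by
  obtain ⟨σ, hσ⟩ := exists_isInv h.isInternal
  have hs := hσ.stable hU.homogeneous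
  refine ⟨(hσ.restrict hs).isInternal, ?_, ?_, ?_⟩
  · intro i v hv
    refine (hσ.restrict hs).map_mem ((hσ.restrict hs).tensor hτ) _ (fun v => ?_) hv
    apply subtype_rTensor_injective U
    rw [hU.coaction_spec]
    have e : U.subtype.rTensor C ∘ₗ TensorProduct.map (σ.restrict hs) τ =
        TensorProduct.map σ τ ∘ₗ U.subtype.rTensor C := by
      ext u c; rfl
    rw [← LinearMap.comp_apply, e, LinearMap.comp_apply, hU.coaction_spec,
      h.parity_comm hσ hτ]
    rfl
  · intro v
    apply subtype_rTensor_injective (C := C ⊗[ℂ] C) U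
    have e1 : U.subtype.rTensor (C ⊗[ℂ] C) ∘ₗ (TensorProduct.assoc ℂ U C C).toLinearMap =
        (TensorProduct.assoc ℂ V C C).toLinearMap ∘ₗ (U.subtype.rTensor C).rTensor C := by
      ext u c d; rfl
    have e2 : U.subtype.rTensor (C ⊗[ℂ] C) ∘ₗ Δ.lTensor U = Δ.lTensor V ∘ₗ U.subtype.rTensor C := by
      ext u c; rfl
    have e3 : U.subtype.rTensor C ∘ₗ hU.coaction = γ ∘ₗ U.subtype :=
      LinearMap.ext hU.coaction_spec
    have l := LinearMap.congr_fun e1 (hU.coaction.rTensor C (hU.coaction v))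
    have r := LinearMap.congr_fun e2 (hU.coaction v)
    simp only [LinearMap.comp_apply, LinearEquiv.coe_coe] at l r
    rw [l, r, ← LinearMap.comp_apply ((U.subtype.rTensor C).rTensor C), ← LinearMap.rTensor_comp,
      e3, LinearMap.rTensor_comp, LinearMap.comp_apply, hU.coaction_spec]
    exact h.coassoc v
  · intro v
    apply Subtype.ext
    have e1 : U.subtype ∘ₗ (TensorProduct.rid ℂ U).toLinearMap ∘ₗ ε.lTensor U =
        (TensorProduct.rid ℂ V).toLinearMap ∘ₗ ε.lTensor V ∘ₗ U.subtype.rTensor C := by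
      ext u c; simp
    have := LinearMap.congr_fun e1 (hU.coaction v)
    simp only [LinearMap.comp_apply, LinearEquiv.coe_coe, hU.coaction_spec] at this
    exact this.trans (h.counit v)

lemma isSubcomodule_of_inv {σ : V →ₗ[ℂ] V} (hσ : IsInv gV σ) (hU : ∀ u ∈ U, σ u ∈ U)
    (hs : ∀ u ∈ U, γ u ∈ LinearMap.range (U.subtype.rTensor C)) : IsSubcomodule gV γ U :=
  ⟨hσ.homogeneous hU, hs⟩

end comodules

/-! ### Monomials in the exterior algebra -/

section monomials
variable {I : Type*} [Fintype I] [DecidableEq I]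

/-- The generators of the exterior algebra. -/
def theta (k : I) : ExteriorAlgebra ℂ (I → ℂ) := ExteriorAlgebra.ι ℂ (Pi.single k 1)

/-- A basis of the exterior algebra that consists of the products of generators, up to scalars. -/
structure IsMonomialBasis (e : Module.Basis (Finset I) ℂ (ExteriorAlgebra ℂ (I → ℂ))) : Prop where
  empty : e ∅ = 1
  singleton : ∀ k, e {k} = theta k
  mul_disjoint : ∀ S T, Disjoint S T → ∃ c : ℂ, c ≠ 0 ∧ e S * e T = c • e (S ∪ T)
  mul_not_disjoint : ∀ S T, ¬Disjoint S T → e S * e T = 0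

variable (I) in
lemma exists_isMonomialBasis :
    ∃ e : Module.Basis (Finset I) ℂ (ExteriorAlgebra ℂ (I → ℂ)), IsMonomialBasis e := by
  -- Any order serves: another one changes the monomials by signs only, and `IsMonomialBasis`
  -- specifies products only up to nonzero scalars.
  let o : LinearOrder I := LinearOrder.lift' (Fintype.equivFin I) (Fintype.equivFin I).injective
  have hd : ‹DecidableEq I› = o.toDecidableEq := Subsingleton.elim _ _
  subst hd
  refine ⟨(Pi.basisFun ℂ I).ExteriorAlgebra, ?_, fun k => ?_, fun S T h => ?_, fun S T h => ?_⟩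
  · rw [ExteriorAlgebra.basis_apply_ofCard (n := 0) _ Finset.card_empty]
    simp
  · rw [ExteriorAlgebra.basis_apply_ofCard (n := 1) _ (Finset.card_singleton k)]
    have hk : Set.powersetCard.ofFinEmbEquiv.symm
        (Set.powersetCard.ofCard (Finset.card_singleton k)) 0 = k := by
      have := (Set.powersetCard.mem_range_ofFinEmbEquiv_symm_iff_mem
        (Set.powersetCard.ofCard (Finset.card_singleton k))
        (Set.powersetCard.ofFinEmbEquiv.symm
          (Set.powersetCard.ofCard (Finset.card_singleton k)) 0)).1 ⟨0, rfl⟩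
      exact Finset.mem_singleton.1 this
    rw [ExteriorAlgebra.ιMulti_family, ExteriorAlgebra.ιMulti_apply]
    simp [hk, theta]
  · have := ExteriorAlgebra.basis_mul_of_disjoint (Pi.basisFun ℂ I)
      (Set.powersetCard.ofCard (rfl : S.card = S.card))
      (Set.powersetCard.ofCard (rfl : T.card = T.card)) h
    obtain hs | hs := Int.units_eq_one_or (Set.powersetCard.permOfDisjoint
      (s := Set.powersetCard.ofCard (rfl : S.card = S.card))
      (t := Set.powersetCard.ofCard (rfl : T.card = T.card)) h).sign
    · refine ⟨1, one_ne_zero, ?_⟩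
      rw [hs, one_smul] at this
      rw [one_smul]
      refine this.trans ?_
      congr 1
      ext x
      simp [Set.powersetCard.disjUnion, Set.powersetCard.ofCard]
    · refine ⟨-1, by simp, ?_⟩
      rw [hs, Units.neg_smul, one_smul] at this
      rw [neg_smul, one_smul]
      refine this.trans ?_
      congr 2
      ext x
      simp [Set.powersetCard.disjUnion, Set.powersetCard.ofCard]
  · exact ExteriorAlgebra.basis_mul_of_not_disjoint (Pi.basisFun ℂ I)
      (Set.powersetCard.ofCard (rfl : S.card = S.card))
      (Set.powersetCard.ofCard (rfl : T.card = T.card)) h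

/-- The span of the basis elements with indices in `F`. -/
def spanOf (e : Module.Basis (Finset I) ℂ (ExteriorAlgebra ℂ (I → ℂ))) (F : Set (Finset I)) :
    Submodule ℂ (ExteriorAlgebra ℂ (I → ℂ)) := Submodule.span ℂ (e '' F)

namespace IsMonomialBasis
variable {e : Module.Basis (Finset I) ℂ (ExteriorAlgebra ℂ (I → ℂ))}

lemma mem_spanOf {F : Set (Finset I)} {S : Finset I} (h : S ∈ F) : e S ∈ spanOf e F :=
  Submodule.subset_span ⟨S, h, rfl⟩

lemma spanOf_mono {F F' : Set (Finset I)} (h : F ⊆ F') : spanOf e F ≤ spanOf e F' :=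
  Submodule.span_mono (Set.image_mono h)

/-- Products of monomials are zero or nonzero multiples of monomials. The first hypothesis gives one
inclusion; the second, together with the invertibility of the scalars, gives the other. -/
lemma spanOf_mul (he : IsMonomialBasis e) {F F' F'' : Set (Finset I)}
    (h1 : ∀ S ∈ F, ∀ T ∈ F', Disjoint S T → S ∪ T ∈ F'')
    (h2 : ∀ U ∈ F'', ∃ S ∈ F, ∃ T ∈ F', Disjoint S T ∧ S ∪ T = U) :
    spanOf e F * spanOf e F' = spanOf e F'' := by
  rw [spanOf, spanOf, Submodule.span_mul_span]
  apply le_antisymm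
  · rw [Submodule.span_le]
    rintro _ ⟨_, ⟨S, hS, rfl⟩, _, ⟨T, hT, rfl⟩, rfl⟩
    change e S * e T ∈ spanOf e F''
    by_cases h : Disjoint S T
    · obtain ⟨c, -, hc⟩ := he.mul_disjoint S T h
      rw [hc]
      exact Submodule.smul_mem _ _ (mem_spanOf (h1 S hS T hT h))
    · rw [he.mul_not_disjoint S T h]
      exact zero_mem _
  · rw [spanOf, Submodule.span_le]
    rintro _ ⟨U, hU, rfl⟩
    obtain ⟨S, hS, T, hT, h, rfl⟩ := h2 U hU
    obtain ⟨c, hc0, hc⟩ := he.mul_disjoint S T h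
    have : e (S ∪ T) = c⁻¹ • (e S * e T) := by rw [hc, smul_smul, inv_mul_cancel₀ hc0, one_smul]
    rw [SetLike.mem_coe, this]
    exact Submodule.smul_mem _ _ (Submodule.subset_span ⟨_, ⟨S, hS, rfl⟩, _, ⟨T, hT, rfl⟩, rfl⟩)

lemma spanOf_one (he : IsMonomialBasis e) : spanOf e {∅} = 1 := by
  rw [spanOf, Set.image_singleton, he.empty, Submodule.one_eq_span]

lemma span_theta (he : IsMonomialBasis e) (Y : Set I) :
    Submodule.span ℂ (theta '' Y) = spanOf e {S | ∃ k ∈ Y, S = {k}} := by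
  rw [spanOf]
  congr 1
  ext x
  constructor
  · rintro ⟨k, hk, rfl⟩
    exact ⟨{k}, ⟨k, hk, rfl⟩, he.singleton k⟩
  · rintro ⟨_, ⟨k, hk, rfl⟩, rfl⟩
    exact ⟨k, hk, (he.singleton k).symm⟩

lemma span_theta_pow (he : IsMonomialBasis e) (Y : Set I) (j : ℕ) :
    Submodule.span ℂ (theta '' Y) ^ j = spanOf e {S | ↑S ⊆ Y ∧ S.card = j} := by
  induction j with
  | zero =>
    rw [pow_zero, ← he.spanOf_one]
    congr 1
    ext S
    simp only [Set.mem_singleton_iff, Set.mem_ofPred_eq, Finset.card_eq_zero]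
    exact ⟨fun h => ⟨by simp [h], h⟩, fun h => h.2⟩
  | succ j ih =>
    rw [pow_succ, ih, he.span_theta]
    refine he.spanOf_mul ?_ ?_
    · rintro S ⟨hS, rfl⟩ _ ⟨k, hk, rfl⟩ hd
      refine ⟨?_, by rw [Finset.card_union_of_disjoint hd, Finset.card_singleton]⟩
      rw [Finset.coe_union, Finset.coe_singleton]
      exact Set.union_subset hS (Set.singleton_subset_iff.2 hk)
    · rintro U ⟨hU, hc⟩
      obtain ⟨k, hk⟩ : U.Nonempty := Finset.card_pos.1 (by omega)
      refine ⟨U.erase k, ⟨fun x hx => hU (Finset.mem_of_mem_erase hx), ?_⟩, {k}, ⟨k, hU hk, rfl⟩,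
        ?_, ?_⟩
      · rw [Finset.card_erase_of_mem hk, hc, Nat.add_sub_cancel]
      · simp
      · ext x
        simp only [Finset.mem_union, Finset.mem_erase, Finset.mem_singleton]
        by_cases hx : x = k
        · simp [hx, hk]
        · simp [hx]

lemma one_sup_span_theta_pow (he : IsMonomialBasis e) (Y : Set I) (j : ℕ) :
    (1 ⊔ Submodule.span ℂ (theta '' Y)) ^ j = spanOf e {S | ↑S ⊆ Y ∧ S.card ≤ j} := by
  have h1 : 1 ⊔ Submodule.span ℂ (theta '' Y) = spanOf e {S | ↑S ⊆ Y ∧ S.card ≤ 1} := by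
    rw [← he.spanOf_one, he.span_theta, spanOf, spanOf, ← Submodule.span_union, ← Set.image_union,
      spanOf]
    congr 2
    ext S
    simp only [Set.mem_union, Set.mem_singleton_iff, Set.mem_ofPred_eq]
    constructor
    · rintro (rfl | ⟨k, hk, rfl⟩)
      · simp
      · simpa using hk
    · rintro ⟨h, hc⟩
      obtain hc | hc := Nat.le_one_iff_eq_zero_or_eq_one.1 hc
      · exact Or.inl (Finset.card_eq_zero.1 hc)
      · obtain ⟨k, rfl⟩ := Finset.card_eq_one.1 hc
        exact Or.inr ⟨k, by simpa using h, rfl⟩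
  induction j with
  | zero =>
    rw [pow_zero, ← he.spanOf_one]
    congr 1
    ext S
    simp only [Set.mem_singleton_iff, Set.mem_ofPred_eq, Nat.le_zero, Finset.card_eq_zero]
    exact ⟨fun h => ⟨by simp [h], h⟩, fun h => h.2⟩
  | succ j ih =>
    rw [pow_succ, ih, h1]
    refine he.spanOf_mul ?_ ?_
    · rintro S ⟨hS, hSc⟩ T ⟨hT, hTc⟩ hd
      refine ⟨?_, by rw [Finset.card_union_of_disjoint hd]; omega⟩
      rw [Finset.coe_union]
      exact Set.union_subset hS hT
    · rintro U ⟨hU, hc⟩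
      obtain hc' | hc' := Nat.lt_or_ge U.card (j + 1)
      · exact ⟨U, ⟨hU, by omega⟩, ∅, by simp, by simp, by simp⟩
      · obtain ⟨k, hk⟩ : U.Nonempty := Finset.card_pos.1 (by omega)
        refine ⟨U.erase k, ⟨fun x hx => hU (Finset.mem_of_mem_erase hx), ?_⟩, {k},
          ⟨by simpa using hU hk, by simp⟩, by simp, ?_⟩
        · rw [Finset.card_erase_of_mem hk]; omega
        · ext x
          simp only [Finset.mem_union, Finset.mem_erase, Finset.mem_singleton]
          by_cases hx : x = k
          · simp [hx, hk]
          · simp [hx]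

lemma insert_eq (he : IsMonomialBasis e) {S : Finset I} {k : I} (hk : k ∉ S) :
    ∃ c : ℂ, c ≠ 0 ∧ e (insert k S) = c • (e S * theta k) := by
  obtain ⟨c, hc0, hc⟩ := he.mul_disjoint S {k} (by simpa using hk)
  refine ⟨c⁻¹, inv_ne_zero hc0, ?_⟩
  rw [← he.singleton, hc, smul_smul, inv_mul_cancel₀ hc0, one_smul]
  congr 1
  ext x
  simp

lemma adjoin_theta (he : IsMonomialBasis e) (X : Set I) :
    Subalgebra.toSubmodule (Algebra.adjoin ℂ (theta '' X)) = spanOf e {S | ↑S ⊆ X} := by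
  apply le_antisymm
  · intro x hx
    rw [Subalgebra.mem_toSubmodule] at hx
    have hm : spanOf e {S | ↑S ⊆ X} * spanOf e {S | ↑S ⊆ X} = spanOf e {S | ↑S ⊆ X} :=
      he.spanOf_mul (fun S hS T hT _ => by
        simp only [Set.mem_ofPred_eq, Finset.coe_union] at *
        exact Set.union_subset hS hT) (fun U hU => ⟨U, hU, ∅, by simp, by simp, by simp⟩)
    induction hx using Algebra.adjoin_induction with
    | mem x hx =>
      obtain ⟨k, hk, rfl⟩ := hx
      rw [← he.singleton]
      exact mem_spanOf (by simpa using hk)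
    | algebraMap r =>
      rw [Algebra.algebraMap_eq_smul_one, ← he.empty]
      exact Submodule.smul_mem _ _ (mem_spanOf (by simp))
    | add x y _ _ hx hy => exact add_mem hx hy
    | mul x y _ _ hx hy => rw [← hm]; exact Submodule.mul_mem_mul hx hy
  · rw [spanOf, Submodule.span_le]
    rintro _ ⟨S, hS, rfl⟩
    rw [SetLike.mem_coe, Subalgebra.mem_toSubmodule]
    induction S using Finset.induction_on with
    | empty => rw [he.empty]; exact one_mem _
    | insert k S hk ih =>
      obtain ⟨c, -, hc⟩ := he.insert_eq hk
      rw [hc]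
      simp only [Set.mem_ofPred_eq, Finset.coe_insert, Set.insert_subset_iff] at hS
      exact Subalgebra.smul_mem _ (mul_mem (ih hS.2) (Algebra.subset_adjoin ⟨k, hS.1, rfl⟩)) _

-- With X and Y complementary, a monomial splits into its part in X, which is unrestricted, and its
-- part in Y, whose size is the degree in the Y-variables.
open Classical in
lemma adjoin_mul_pow (he : IsMonomialBasis e) {X Y : Set I} (hXY : IsCompl X Y) (j : ℕ) :
    Subalgebra.toSubmodule (Algebra.adjoin ℂ (theta '' X)) *
      (1 ⊔ Submodule.span ℂ (theta '' Y)) ^ j = spanOf e {S | (S.filter (· ∈ Y)).card ≤ j} := by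
  rw [he.adjoin_theta, he.one_sup_span_theta_pow]
  have hd := Set.disjoint_left.1 hXY.disjoint
  refine he.spanOf_mul ?_ ?_
  · rintro S hS T ⟨hT, hTc⟩ -
    refine (Finset.card_le_card ?_).trans hTc
    intro x hx
    simp only [Finset.mem_filter, Finset.mem_union] at hx
    exact hx.1.resolve_left fun h => hd (hS h) hx.2
  · intro U hU
    refine ⟨U.filter (· ∉ Y), fun x hx => ?_, U.filter (· ∈ Y), ⟨fun x hx => ?_, hU⟩, ?_, ?_⟩
    · have hx' := (Finset.mem_filter.1 hx).2
      exact (hXY.codisjoint.top_le (Set.mem_univ x)).resolve_right hx'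
    · exact (Finset.mem_filter.1 hx).2
    · exact (Finset.disjoint_filter_filter_not U U _).symm
    · rw [Finset.union_comm]; exact Finset.filter_union_filter_not_eq _ U

/-! Contractions. -/

/-- The contraction with the `k`-th coordinate form. -/
def _root_.GLSuper.contr (k : I) : Module.End ℂ (ExteriorAlgebra ℂ (I → ℂ)) :=
  (CliffordAlgebra.contractRight (Q := (0 : QuadraticForm ℂ (I → ℂ)))).flip (LinearMap.proj k)

/-- The contraction acts from the right, since this is the sign rule obeyed by the odd operators on
functions in `oddDer_mul`. -/
lemma _root_.GLSuper.contr_mul_theta (k l : I) (x : ExteriorAlgebra ℂ (I → ℂ)) :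
    contr k (x * theta l) = (Pi.single l 1 : I → ℂ) k • x - contr k x * theta l := by
  have := CliffordAlgebra.contractRight_mul_ι (Q := (0 : QuadraticForm ℂ (I → ℂ)))
    (LinearMap.proj k) (Pi.single l 1) x
  exact this

lemma _root_.GLSuper.contr_one (k : I) : contr k (1 : ExteriorAlgebra ℂ (I → ℂ)) = 0 :=
  CliffordAlgebra.contractRight_one (Q := (0 : QuadraticForm ℂ (I → ℂ))) (LinearMap.proj k)

lemma contr_of_notMem (he : IsMonomialBasis e) {S : Finset I} {k : I} (hk : k ∉ S) :
    contr k (e S) = 0 := by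
  induction S using Finset.induction_on with
  | empty => rw [he.empty, contr_one]
  | insert l S hl ih =>
    obtain ⟨c, -, hc⟩ := he.insert_eq hl
    rw [Finset.mem_insert, not_or] at hk
    rw [hc, map_smul, contr_mul_theta, ih hk.2, Pi.single_eq_of_ne hk.1]
    simp

lemma contr_of_mem (he : IsMonomialBasis e) {S : Finset I} {k : I} (hk : k ∈ S) :
    ∃ c : ℂ, c ≠ 0 ∧ contr k (e S) = c • e (S.erase k) := by
  obtain ⟨c, hc0, hc⟩ := he.insert_eq (Finset.notMem_erase k S)
  refine ⟨c, hc0, ?_⟩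
  rw [Finset.insert_erase hk] at hc
  rw [hc, map_smul, contr_mul_theta, he.contr_of_notMem (Finset.notMem_erase k S)]
  simp

/-- Each contraction removes one generator at the cost of a nonzero scalar. With X the set of all
base generators this yields the freeness of the Kac module. -/
lemma contr_word (he : IsMonomialBasis e) (X : Finset I) (l : List I) (hl : l.Nodup)
    (hX : ∀ k ∈ l, k ∈ X) :
    ∃ c : ℂ, c ≠ 0 ∧ (l.map contr).prod (e X) = c • e (X \ l.toFinset) := by
  induction l with
  | nil => exact ⟨1, one_ne_zero, by simp⟩
  | cons k l ih =>
    obtain ⟨hk, hl⟩ := List.nodup_cons.1 hl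
    obtain ⟨c, hc0, hc⟩ := ih hl fun x hx => hX x (List.mem_cons_of_mem _ hx)
    obtain ⟨d, hd0, hd⟩ := he.contr_of_mem (S := X \ l.toFinset) (k := k)
      (by simpa [hk] using hX k List.mem_cons_self)
    refine ⟨c * d, mul_ne_zero hc0 hd0, ?_⟩
    rw [List.map_cons, List.prod_cons, Module.End.mul_apply, hc, map_smul, hd, smul_smul]
    congr 2
    ext x
    simp only [Finset.mem_erase, Finset.mem_sdiff, List.mem_toFinset, List.mem_cons]
    tauto

/-- The dual form of `contr_of_mem`: a contraction loses no coefficient of a monomial containing k,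
since distinct sets containing k remain distinct when k is erased. -/
lemma coord_contr (he : IsMonomialBasis e) {S : Finset I} {k : I} (hk : k ∈ S) :
    ∃ c : ℂ, c ≠ 0 ∧ e.coord (S.erase k) ∘ₗ contr k = c • e.coord S := by
  obtain ⟨c, hc0, hc⟩ := he.contr_of_mem hk
  refine ⟨c, hc0, e.ext fun T => ?_⟩
  rw [LinearMap.comp_apply, LinearMap.smul_apply]
  by_cases hT : k ∈ T
  · by_cases hST : T = S
    · subst hST
      rw [hc]; simp
    · obtain ⟨d, -, hd⟩ := he.contr_of_mem hT
      have : T.erase k ≠ S.erase k := fun h => hST (by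
        rw [← Finset.insert_erase hT, h, Finset.insert_erase hk])
      rw [hd]
      simp [hST, this]
  · have hST : T ≠ S := fun h => hT (h ▸ hk)
    rw [he.contr_of_notMem hT]
    simp [hST]

/-- Splitting a monomial into the parts with indices in `Y` and in its complement `X`. -/
lemma exists_split (he : IsMonomialBasis e) {X Y : Set I} (hXY : Disjoint X Y) :
    ∃ n : ExteriorAlgebra ℂ (I → ℂ) →ₗ[ℂ] ExteriorAlgebra ℂ (I → ℂ) ⊗[ℂ] ExteriorAlgebra ℂ (I → ℂ),
      ∀ s ∈ spanOf e {S | ↑S ⊆ Y}, ∀ t ∈ spanOf e {S | ↑S ⊆ X}, n (s * t) = s ⊗ₜ t := by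
  classical
  have hd := Set.disjoint_left.1 hXY
  choose c hc0 hc using fun S T h => he.mul_disjoint S T h
  -- The scalar undoes the one in `mul_disjoint`. The value `0` is only a default: the two filtered
  -- sets are always disjoint because X and Y are.
  let n := e.constr ℂ fun U => (if h : Disjoint (U.filter (· ∈ Y)) (U.filter (· ∈ X)) then
    (c _ _ h)⁻¹ else 0) • (e (U.filter (· ∈ Y)) ⊗ₜ[ℂ] e (U.filter (· ∈ X)))
  refine ⟨n, fun s hs t ht => ?_⟩
  induction hs using Submodule.span_induction with
  | zero => simp
  | add x y _ _ hx hy => rw [add_mul, map_add, hx, hy, TensorProduct.add_tmul]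
  | smul a x _ hx => rw [smul_mul_assoc, map_smul, hx, TensorProduct.smul_tmul']
  | mem x hx =>
    obtain ⟨S, hS, rfl⟩ := hx
    induction ht using Submodule.span_induction with
    | zero => simp
    | add x y _ _ hx hy => rw [mul_add, map_add, hx, hy, TensorProduct.tmul_add]
    | smul a x _ hx => rw [mul_smul_comm, map_smul, hx, TensorProduct.tmul_smul]
    | mem x hx =>
      obtain ⟨T, hT, rfl⟩ := hx
      have hST : Disjoint S T := Finset.disjoint_left.2 fun x hx hx' => hd (hT hx') (hS hx)
      have f1 : (S ∪ T).filter (· ∈ Y) = S := by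
        ext x
        simp only [Finset.mem_filter, Finset.mem_union]
        exact ⟨fun h => h.1.resolve_right fun h' => hd (hT h') h.2, fun h => ⟨Or.inl h, hS h⟩⟩
      have f2 : (S ∪ T).filter (· ∈ X) = T := by
        ext x
        simp only [Finset.mem_filter, Finset.mem_union]
        exact ⟨fun h => h.1.resolve_left fun h' => hd h.2 (hS h'), fun h => ⟨Or.inr h, hT h⟩⟩
      have key : ∀ A B, A = S → B = T → (if h : Disjoint A B then (c _ _ h)⁻¹ else 0) •
          (e A ⊗ₜ[ℂ] e B) = (c _ _ hST)⁻¹ • (e S ⊗ₜ[ℂ] e T) := by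
        rintro _ _ rfl rfl
        rw [dif_pos hST]
      rw [hc S T hST, map_smul, Module.Basis.constr_basis, key _ _ f1 f2, smul_smul,
        mul_inv_cancel₀ (hc0 _ _ hST), one_smul]

end IsMonomialBasis

/-! Coordinates of tensors. -/

section coordinates
variable {V : Type*} [AddCommGroup V] [Module ℂ V]
  (e : Module.Basis (Finset I) ℂ (ExteriorAlgebra ℂ (I → ℂ)))

/-- The coefficient of `e S` in a tensor. -/
def tcoord (S : Finset I) : V ⊗[ℂ] ExteriorAlgebra ℂ (I → ℂ) →ₗ[ℂ] V :=
  (TensorProduct.rid ℂ V).toLinearMap ∘ₗ (e.coord S).lTensor V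

lemma tcoord_tmul (S : Finset I) (v : V) (x) : tcoord e S (v ⊗ₜ x) = e.coord S x • v := by
  simp [tcoord]

lemma sum_tcoord (t : V ⊗[ℂ] ExteriorAlgebra ℂ (I → ℂ)) :
    ∑ S, tcoord e S t ⊗ₜ[ℂ] e S = t := by
  induction t using TensorProduct.induction_on with
  | zero => simp
  | add x y hx hy =>
    conv_rhs => rw [← hx, ← hy, ← Finset.sum_add_distrib]
    exact Finset.sum_congr rfl fun S _ => by rw [map_add, TensorProduct.add_tmul]
  | tmul v x =>
    simp only [tcoord_tmul, TensorProduct.smul_tmul, ← TensorProduct.tmul_sum]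
    congr 1
    exact e.sum_repr x

lemma tcoord_ext {t t' : V ⊗[ℂ] ExteriorAlgebra ℂ (I → ℂ)}
    (h : ∀ S, tcoord e S t = tcoord e S t') : t = t' := by
  rw [← sum_tcoord e t, ← sum_tcoord e t']
  exact Finset.sum_congr rfl fun S _ => by rw [h S]

lemma mem_range_spanOf (F : Set (Finset I)) (t : V ⊗[ℂ] ExteriorAlgebra ℂ (I → ℂ)) :
    t ∈ LinearMap.range ((spanOf e F).subtype.lTensor V) ↔ ∀ S ∉ F, tcoord e S t = 0 := by
  constructor
  · rintro ⟨y, rfl⟩ S hS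
    induction y using TensorProduct.induction_on with
    | zero => simp
    | add x y hx hy => rw [map_add, map_add, hx, hy, add_zero]
    | tmul v x =>
      rw [LinearMap.lTensor_tmul, tcoord_tmul]
      have : spanOf e F ≤ LinearMap.ker (e.coord S) := by
        rw [spanOf, Submodule.span_le]
        rintro _ ⟨T, hT, rfl⟩
        have : T ≠ S := fun h => hS (h ▸ hT)
        simp [this]
      have h0 : e.coord S x = 0 := this x.2
      rw [Submodule.subtype_apply, h0, zero_smul]
  · intro h
    rw [← sum_tcoord e t]
    refine sum_mem fun S _ => ?_
    by_cases hS : S ∈ F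
    · exact ⟨tcoord e S t ⊗ₜ ⟨e S, IsMonomialBasis.mem_spanOf hS⟩, rfl⟩
    · rw [h S hS, TensorProduct.zero_tmul]
      exact zero_mem _

/-- This is how annihilation by an odd operator is turned into the absence of a variable. -/
lemma tcoord_eq_zero_of_contr {e} (he : IsMonomialBasis e) {t : V ⊗[ℂ] ExteriorAlgebra ℂ (I → ℂ)}
    {k : I} (h : (contr k).lTensor V t = 0) {S : Finset I} (hk : k ∈ S) : tcoord e S t = 0 := by
  obtain ⟨c, hc0, hc⟩ := he.coord_contr hk
  have : c • tcoord e S t = 0 := by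
    have e1 : tcoord e (S.erase k) ∘ₗ (contr k).lTensor V = c • tcoord (V := V) e S := by
      rw [tcoord, LinearMap.comp_assoc, ← LinearMap.lTensor_comp, hc, LinearMap.lTensor_smul,
        LinearMap.comp_smul]
      rfl
    rw [← LinearMap.smul_apply, ← e1, LinearMap.comp_apply, h, map_zero]
  exact (smul_eq_zero.1 this).resolve_left hc0

end coordinates
end monomials

/-! ### Homomorphisms out of `A₀(p,q)` and `A(p,q)` -/

/-- The case `inv` absorbs all denominators: an element of the localization is a polynomial times
the inverse of a polynomial. No determinant has to be mentioned again. -/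
theorem FunGL0_induction {p q : ℕ} {P : FunGL0 p q → Prop}
    (algebraMap : ∀ c : ℂ, P (algebraMap ℂ _ c)) (matA0 : ∀ i j, P (matA0 p q i j))
    (matD0 : ∀ i j, P (matD0 p q i j)) (add : ∀ x y, P x → P y → P (x + y))
    (mul : ∀ x y, P x → P y → P (x * y)) (inv : ∀ x y, x * y = 1 → P x → P y)
    (r : FunGL0 p q) : P r := by
  have poly : ∀ f : EvenPoly p q, P (Algebra.algebraMap (EvenPoly p q) (FunGL0 p q) f) := by
    intro f
    induction f using MvPolynomial.induction_on with
    | C c =>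
      have := algebraMap c
      rwa [IsScalarTower.algebraMap_apply ℂ (EvenPoly p q) (FunGL0 p q)] at this
    | add f g hf hg => rw [map_add]; exact add _ _ hf hg
    | mul_X f k hf =>
      rw [map_mul]
      refine mul _ _ hf ?_
      rcases k with k | k
      · exact matA0 k.1 k.2
      · exact matD0 k.1 k.2
  obtain ⟨⟨f, s⟩, hf⟩ := IsLocalization.surj (dets p q) r
  obtain ⟨u, hu⟩ := IsLocalization.map_units (FunGL0 p q) s
  have h1 : P (↑u⁻¹ : FunGL0 p q) := inv (u : FunGL0 p q) _ u.mul_inv (hu ▸ poly _)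
  have h2 : r = Algebra.algebraMap (EvenPoly p q) (FunGL0 p q) f * (↑u⁻¹ : FunGL0 p q) := by
    rw [← hf, ← hu, mul_assoc, u.mul_inv, mul_one]
  rw [h2]
  exact mul _ _ (poly f) h1

/-- Inverses are unique, so agreement on the generators suffices. The target may be noncommutative,
so the case of an inverse is the explicit computation f(y) = f(y)g(x)g(y) = f(y)f(x)g(y) = g(y). -/
theorem FunGL0_hom_ext {p q : ℕ} {T : Type*} [Ring T] [Algebra ℂ T] {f g : FunGL0 p q →ₐ[ℂ] T}
    (hA : ∀ i j, f (matA0 p q i j) = g (matA0 p q i j))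
    (hD : ∀ i j, f (matD0 p q i j) = g (matD0 p q i j)) : f = g := by
  ext r
  induction r using FunGL0_induction with
  | algebraMap c => rw [AlgHom.commutes, AlgHom.commutes]
  | matA0 i j => exact hA i j
  | matD0 i j => exact hD i j
  | add x y hx hy => rw [map_add, map_add, hx, hy]
  | mul x y hx hy => rw [map_mul, map_mul, hx, hy]
  | inv x y hxy hx =>
    calc f y = f y * g (x * y) := by rw [hxy, map_one, mul_one]
      _ = f (y * x) * g y := by rw [map_mul, map_mul, hx, mul_assoc]
      _ = g y := by rw [mul_comm, hxy, map_one, one_mul]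

section lift
variable {I : Type*} [Fintype I] [DecidableEq I] {T : Type*} [Ring T] [Algebra ℂ T]

/-- The homomorphism from the exterior algebra with given anticommuting images of the generators. -/
def liftOdd (g : I → T) (h : ∀ k l, g k * g l = -(g l * g k)) :
    ExteriorAlgebra ℂ (I → ℂ) →ₐ[ℂ] T :=
  ExteriorAlgebra.lift ℂ ⟨Fintype.linearCombination ℂ g, fun m => by
    -- Exchanging the two summation indices changes the sign of every term, by anticommutativity; a
    -- square equal to its own negative vanishes in characteristic zero.
    have key : Fintype.linearCombination ℂ g m * Fintype.linearCombination ℂ g m =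
        -(Fintype.linearCombination ℂ g m * Fintype.linearCombination ℂ g m) := by
      rw [Fintype.linearCombination_apply, Finset.sum_mul_sum]
      nth_rewrite 2 [Finset.sum_comm]
      simp only [← Finset.sum_neg_distrib]
      refine Finset.sum_congr rfl fun k _ => Finset.sum_congr rfl fun l _ => ?_
      rw [smul_mul_smul_comm, smul_mul_smul_comm, h k l, smul_neg, mul_comm]
    have h2 : (2 : ℂ) • (Fintype.linearCombination ℂ g m * Fintype.linearCombination ℂ g m) = 0 := by
      rw [two_smul]; nth_rewrite 1 [key]; exact neg_add_cancel _
    exact (smul_eq_zero.1 h2).resolve_left two_ne_zero⟩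

lemma liftOdd_theta (g : I → T) (h : ∀ k l, g k * g l = -(g l * g k)) (k : I) :
    liftOdd g h (theta k) = g k := by
  rw [liftOdd, theta, ExteriorAlgebra.lift_ι_apply]
  simp [Fintype.linearCombination_apply_single]

lemma exterior_hom_ext {f g : ExteriorAlgebra ℂ (I → ℂ) →ₐ[ℂ] T}
    (h : ∀ k, f (theta k) = g (theta k)) : f = g := by
  apply ExteriorAlgebra.hom_ext
  apply LinearMap.pi_ext'
  intro k
  ext
  exact h k

lemma exterior_induction {P : ExteriorAlgebra ℂ (I → ℂ) → Prop} (one : P 1)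
    (add : ∀ x y, P x → P y → P (x + y)) (smul : ∀ (c : ℂ) x, P x → P (c • x))
    (mul_theta : ∀ x k, P x → P (x * theta k)) (x) : P x := by
  refine CliffordAlgebra.right_induction (0 : QuadraticForm ℂ (I → ℂ)) (P := P) ?_ add ?_ x
  · intro c
    rw [Algebra.algebraMap_eq_smul_one]
    exact smul c 1 one
  · intro m x hx
    have : CliffordAlgebra.ι (0 : QuadraticForm ℂ (I → ℂ)) m = ∑ k, m k • theta k := by
      conv_lhs => rw [pi_eq_sum_univ' m]
      rw [map_sum]
      refine Finset.sum_congr rfl fun k _ => ?_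
      rw [map_smul]
      rfl
    have h0 : P 0 := by simpa using smul 0 1 one
    rw [this, Finset.mul_sum]
    refine Finset.sum_induction _ P add h0 fun k _ => ?_
    rw [mul_smul_comm]
    exact smul _ _ (mul_theta x k hx)

end lift

section
variable {p q : ℕ} {T : Type*} [Ring T] [Algebra ℂ T]

/-- The inclusion of the Grassmann algebra. -/
def oddHom (p q : ℕ) : Grass p q →ₐ[ℂ] FunGL p q :=
  (toA p q).toAlgHom.comp Algebra.TensorProduct.includeRight

lemma toA_tmul (r : FunGL0 p q) (x : Grass p q) :
    toA p q (r ⊗ₜ x) = evenHom p q r * oddHom p q x := by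
  change toA p q (r ⊗ₜ x) = toA p q (r ⊗ₜ 1) * toA p q (1 ⊗ₜ x)
  rw [← map_mul, Algebra.TensorProduct.tmul_mul_tmul, mul_one, one_mul]

/-- The homomorphism with given restrictions to the even and the odd generators. -/
def liftFun (f : FunGL0 p q →ₐ[ℂ] T) (g : Grass p q →ₐ[ℂ] T) (h : ∀ r x, Commute (f r) (g x)) :
    FunGL p q →ₐ[ℂ] T :=
  (Algebra.TensorProduct.lift f g h).comp (toA p q).symm.toAlgHom

lemma liftFun_even (f : FunGL0 p q →ₐ[ℂ] T) (g : Grass p q →ₐ[ℂ] T) (h) (r) :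
    liftFun f g h (evenHom p q r) = f r := by
  change Algebra.TensorProduct.lift f g h (r ⊗ₜ 1) = _
  rw [Algebra.TensorProduct.lift_tmul, map_one, mul_one]

lemma liftFun_odd (f : FunGL0 p q →ₐ[ℂ] T) (g : Grass p q →ₐ[ℂ] T) (h) (x) :
    liftFun f g h (oddHom p q x) = g x := by
  change Algebra.TensorProduct.lift f g h (1 ⊗ₜ x) = _
  rw [Algebra.TensorProduct.lift_tmul, map_one, one_mul]

lemma FunGL_hom_ext {f g : FunGL p q →ₐ[ℂ] T}
    (h0 : ∀ r, f (evenHom p q r) = g (evenHom p q r))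
    (h1 : ∀ k, f (oddEl k) = g (oddEl k)) : f = g := by
  have h2 : f.comp (oddHom p q) = g.comp (oddHom p q) := exterior_hom_ext h1
  ext x
  induction x using FunGL_induction with
  | add x y hx hy => rw [map_add, map_add, hx, hy]
  | tmul r w =>
    have h3 : f (oddHom p q w) = g (oddHom p q w) := DFunLike.congr_fun h2 w
    rw [toA_tmul, map_mul, map_mul, h0, h3]

/-- Because of this, coassociativity, counit and parity identities reduce to identities for matrix
products. -/
lemma FunGL_hom_ext' {f g : FunGL p q →ₐ[ℂ] T}
    (h : ∀ i j, f (supermatrix p q i j) = g (supermatrix p q i j)) : f = g := by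
  refine FunGL_hom_ext ?_ ?_
  · have : f.comp (evenHom p q) = g.comp (evenHom p q) :=
      FunGL0_hom_ext (fun i j => h (Sum.inl i) (Sum.inl j)) (fun i j => h (Sum.inr i) (Sum.inr j))
    exact fun r => DFunLike.congr_fun this r
  · rintro (⟨i, j⟩ | ⟨i, j⟩)
    · exact h (Sum.inl i) (Sum.inr j)
    · exact h (Sum.inr i) (Sum.inl j)

/-! ### Parity -/

/-- The parity involution as a homomorphism. -/
def parityHom (p q : ℕ) : FunGL p q →ₐ[ℂ] FunGL p q :=
  (toA p q).toAlgHom.comp ((Algebra.TensorProduct.map (AlgHom.id ℂ (FunGL0 p q))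
    (CliffordAlgebra.involute (Q := (0 : QuadraticForm ℂ (OddGen p q → ℂ))))).comp
      (toA p q).symm.toAlgHom)

lemma parityHom_apply (x : FunGL p q) : parityHom p q x = parity p q x := rfl

lemma parity_one : parity p q 1 = 1 := map_one (parityHom p q)

lemma parity_mul (x y : FunGL p q) : parity p q (x * y) = parity p q x * parity p q y :=
  map_mul (parityHom p q) x y

lemma parity_evenHom (r : FunGL0 p q) : parity p q (evenHom p q r) = evenHom p q r :=
  parity_of_mem_zero (evenHom_mem_gr r)

lemma parity_oddEl (k : OddGen p q) : parity p q (oddEl k) = -oddEl k :=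
  (oddEl_mem k).2

lemma parity_of_mem {i : ZMod 2} {x : FunGL p q} (hx : x ∈ gr p q i) :
    parity p q x = sg i • x := by
  obtain rfl | rfl := zmod_two i
  · rw [parity_of_mem_zero hx, sg_zero, one_smul]
  · rw [parity_of_mem_one hx, sg_one, neg_smul, one_smul]

lemma isInv_of_internal {V : Type*} [AddCommGroup V] [Module ℂ V] {gV : ZMod 2 → Submodule ℂ V}
    (h : DirectSum.IsInternal gV) {σ : V →ₗ[ℂ] V} (hσ : ∀ i, ∀ v ∈ gV i, σ v = sg i • v) :
    IsInv gV σ := by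
  obtain ⟨τ, hτ⟩ := exists_isInv h
  have : σ = τ := by
    ext v
    rw [← eigenProj_add τ v, map_add, map_add]
    congr 1 <;> rw [hσ _ _ (hτ.eigenProj_mem _ v), (hτ.mem _ _).1 (hτ.eigenProj_mem _ v)]
  exact this ▸ hτ

lemma isInv_gr (p q : ℕ) : IsInv (gr p q) (parity p q) :=
  isInv_of_internal (DirectSum.Decomposition.isInternal (gr p q)) fun _ _ hx => parity_of_mem hx

lemma isInv_gr0 (p q : ℕ) : IsInv (gr0 p q) (LinearMap.id : FunGL0 p q →ₗ[ℂ] FunGL0 p q) where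
  invol _ := rfl
  mem i v := by
    obtain rfl | rfl := zmod_two i
    · simp [gr0]
    · simp only [gr0, one_ne_zero, if_false, Submodule.mem_bot, LinearMap.id_apply, sg_one,
        neg_smul, one_smul]
      refine ⟨fun h => by simp [h], fun h => ?_⟩
      have : (2 : ℂ) • v = 0 := by
        rw [two_smul]; nth_rewrite 1 [h]; exact neg_add_cancel v
      exact (smul_eq_zero.1 this).resolve_left two_ne_zero

/-! ### Homomorphisms out of the super tensor square -/

/-- `a ↦ a ⊗ 1`. -/
abbrev inL (p q : ℕ) : FunGL p q →ₐ[ℂ] AA p q := GradedTensorProduct.includeLeft (gr p q) (gr p q)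
/-- `a ↦ 1 ⊗ a`. -/
abbrev inR (p q : ℕ) : FunGL p q →ₐ[ℂ] AA p q := GradedTensorProduct.includeRight (gr p q) (gr p q)

lemma inL_mul_inR (x y : FunGL p q) : inL p q x * inR p q y = x ᵍ⊗ₜ[ℂ] y :=
  GradedTensorProduct.tmul_one_mul_one_tmul _ _ _ _

/-- Two homomorphisms whose values supercommute. -/
def SuperComm (f g : FunGL p q →ₐ[ℂ] T) : Prop :=
  ∀ ⦃i j⦄ (a : gr p q i) (b : gr p q j), f a * g b = (-1 : ℤˣ) ^ (j * i) • (g b * f a)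

/-- The homomorphism `a ⊗ b ↦ f(a) g(b)`. -/
def liftAA (f g : FunGL p q →ₐ[ℂ] T) (h : SuperComm f g) : AA p q →ₐ[ℂ] T :=
  GradedTensorProduct.lift (gr p q) (gr p q) f g h

lemma liftAA_tmul (f g : FunGL p q →ₐ[ℂ] T) (h : SuperComm f g) (x y : FunGL p q) :
    liftAA f g h (x ᵍ⊗ₜ[ℂ] y) = f x * g y := GradedTensorProduct.lift_tmul _ _ _ _ _ _ _

lemma liftAA_inL (f g : FunGL p q →ₐ[ℂ] T) (h : SuperComm f g) (x : FunGL p q) :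
    liftAA f g h (inL p q x) = f x := by
  refine (liftAA_tmul f g h x 1).trans ?_
  rw [map_one, mul_one]

lemma liftAA_inR (f g : FunGL p q →ₐ[ℂ] T) (h : SuperComm f g) (x : FunGL p q) :
    liftAA f g h (inR p q x) = g x := by
  refine (liftAA_tmul f g h 1 x).trans ?_
  rw [map_one, one_mul]

/-- A homomorphism preserves parity. -/
def IsEvenHom (f : FunGL p q →ₐ[ℂ] FunGL p q) : Prop := ∀ x, parity p q (f x) = f (parity p q x)

lemma IsEvenHom.map_mem {f : FunGL p q →ₐ[ℂ] FunGL p q} (hf : IsEvenHom f) {i : ZMod 2}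
    {x : FunGL p q} (hx : x ∈ gr p q i) : f x ∈ gr p q i :=
  (isInv_gr p q).map_mem (isInv_gr p q) f.toLinearMap hf hx

lemma isEvenHom_id : IsEvenHom (AlgHom.id ℂ (FunGL p q)) := fun _ => rfl

lemma isEvenHom_parityHom : IsEvenHom (parityHom p q) := fun _ => rfl

lemma inR_mul_inL {i j : ZMod 2} {a b : FunGL p q} (ha : a ∈ gr p q i) (hb : b ∈ gr p q j) :
    inL p q a * inR p q b = (-1 : ℤˣ) ^ (j * i) • (inR p q b * inL p q a) := by
  have h2 : inR p q b * inL p q a = (-1 : ℤˣ) ^ (j * i) • (a ᵍ⊗ₜ[ℂ] b : AA p q) := by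
    have := AA_mul (1 : FunGL p q) hb ha (1 : FunGL p q)
    rwa [one_mul, mul_one] at this
  rw [inL_mul_inR, h2, smul_smul, Int.units_mul_self, one_smul]

lemma superComm_even {f g : FunGL p q →ₐ[ℂ] FunGL p q} (hf : IsEvenHom f) (hg : IsEvenHom g) :
    SuperComm ((inL p q).comp f) ((inR p q).comp g) := fun _ _ a b =>
  inR_mul_inL (hf.map_mem a.2) (hg.map_mem b.2)

/-- The homomorphism `f ⊗ g` of the super tensor square. -/
def mapAA (f g : FunGL p q →ₐ[ℂ] FunGL p q) (hf : IsEvenHom f) (hg : IsEvenHom g) :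
    AA p q →ₐ[ℂ] AA p q :=
  liftAA _ _ (superComm_even hf hg)

lemma mapAA_tmul (f g : FunGL p q →ₐ[ℂ] FunGL p q) (hf : IsEvenHom f) (hg : IsEvenHom g) (x y) :
    mapAA f g hf hg (x ᵍ⊗ₜ[ℂ] y) = f x ᵍ⊗ₜ[ℂ] g y := by
  rw [mapAA, liftAA_tmul]
  exact inL_mul_inR _ _

lemma AA_hom_ext {M : Type*} [AddCommMonoid M] [Module ℂ M] {f g : AA p q →ₗ[ℂ] M}
    (h : ∀ x y, f (x ᵍ⊗ₜ[ℂ] y) = g (x ᵍ⊗ₜ[ℂ] y)) : f = g :=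
  GradedTensorProduct.hom_ext _ _ (TensorProduct.ext' h)

/-- The total parity was defined as a linear map; being of the form f ⊗ g for even homomorphisms
makes it multiplicative for the signed product. -/
lemma parity2_eq (t : AA p q) :
    parity2 p q t = mapAA (parityHom p q) (parityHom p q) isEvenHom_parityHom isEvenHom_parityHom t :=
  LinearMap.congr_fun (g := (mapAA (parityHom p q) (parityHom p q) isEvenHom_parityHom
    isEvenHom_parityHom).toLinearMap) (AA_hom_ext fun x y => (mapAA_tmul (parityHom p q)
    (parityHom p q) isEvenHom_parityHom isEvenHom_parityHom x y).symm) t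

lemma parity2_mul (s t : AA p q) : parity2 p q (s * t) = parity2 p q s * parity2 p q t := by
  simp only [parity2_eq, map_mul]

lemma parity2_one : parity2 p q 1 = 1 := by
  simp only [parity2_eq, map_one]

end

/-! ### The comultiplication is even, coassociative and counital -/

section
variable {p q : ℕ}

/-- The sign of an index of the supermatrix. -/
def idxSign : Fin p ⊕ Fin q → ℂ
  | Sum.inl _ => 1
  | Sum.inr _ => -1

lemma idxSign_mul_self (i : Fin p ⊕ Fin q) : idxSign i * idxSign i = 1 := by
  rcases i with i | i <;> simp [idxSign]

lemma parity_supermatrix (i j : Fin p ⊕ Fin q) :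
    parity p q (supermatrix p q i j) = (idxSign i * idxSign j) • supermatrix p q i j := by
  rcases i with i | i <;> rcases j with j | j <;> simp only [idxSign, mul_one, one_mul, neg_mul_neg,
    one_smul, neg_smul]
  · exact parity_evenHom _
  · exact parity_oddEl _
  · exact parity_oddEl _
  · exact parity_evenHom _

lemma comulHom_supermatrix' (i j : Fin p ⊕ Fin q) : comulHom p q (supermatrix p q i j) =
    ∑ k, inL p q (supermatrix p q i k) * inR p q (supermatrix p q k j) := by
  rw [comulHom_supermatrix]
  exact Finset.sum_congr rfl fun k _ => (inL_mul_inR _ _).symm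

lemma smul_tmul_smul_AA (a b : ℂ) (x y : FunGL p q) :
    ((a • x) ᵍ⊗ₜ[ℂ] (b • y) : AA p q) = (a * b) • (x ᵍ⊗ₜ[ℂ] y) := by
  change GradedTensorProduct.of ℂ (gr p q) (gr p q) ((a • x) ⊗ₜ (b • y)) = _
  rw [TensorProduct.smul_tmul_smul, map_smul]

lemma comulHom_parity (x : FunGL p q) :
    comulHom p q (parity p q x) = parity2 p q (comulHom p q x) := by
  have : (comulHom p q).comp (parityHom p q) =
      (mapAA (parityHom p q) (parityHom p q) isEvenHom_parityHom isEvenHom_parityHom).comp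
        (comulHom p q) := by
    refine FunGL_hom_ext' fun i j => ?_
    rw [AlgHom.comp_apply, AlgHom.comp_apply, parityHom_apply, parity_supermatrix, map_smul,
      comulHom_supermatrix, map_sum, Finset.smul_sum]
    refine Finset.sum_congr rfl fun k _ => ?_
    rw [mapAA_tmul, parityHom_apply, parityHom_apply, parity_supermatrix, parity_supermatrix,
      smul_tmul_smul_AA]
    congr 1
    -- The sign of the middle index k occurs twice and cancels.
    linear_combination (-(idxSign i * idxSign j)) * idxSign_mul_self k
  rw [parity2_eq]
  exact DFunLike.congr_fun this x

/-- The total grading of the super tensor square. -/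
def gr2 (p q : ℕ) (i : ZMod 2) : Submodule ℂ (AA p q) :=
  LinearMap.eqLocus (parity2 p q) (sg i • LinearMap.id)

lemma mem_gr2 {i : ZMod 2} {t : AA p q} : t ∈ gr2 p q i ↔ parity2 p q t = sg i • t := Iff.rfl

lemma isInv_gr2 (p q : ℕ) : IsInv (gr2 p q) (parity2 p q) := ⟨parity2_parity2, fun _ _ => mem_gr2⟩

lemma sg_add (i j : ZMod 2) : sg (i + j) = sg i * sg j := by
  have := sg_sub (i + j) j
  rw [add_sub_cancel_right] at this
  rw [this, mul_assoc, sg_mul_self, mul_one]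

instance : SetLike.GradedMonoid (gr2 p q) where
  one_mem := by rw [mem_gr2, parity2_one, sg_zero, one_smul]
  mul_mem i j x y hx hy := by
    rw [mem_gr2] at *
    rw [parity2_mul, hx, hy, smul_mul_smul_comm, sg_add]

/-- The total grading is needed to form the super tensor cube, with bracketing A ⊗ (A ⊗ A). -/
instance : GradedAlgebra (gr2 p q) :=
  { (inferInstance : SetLike.GradedMonoid (gr2 p q)) with
    toDecomposition := (isInv_gr2 p q).isInternal.chooseDecomposition }

lemma comulHom_mem {i : ZMod 2} {x : FunGL p q} (hx : x ∈ gr p q i) :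
    comulHom p q x ∈ gr2 p q i := by
  rw [mem_gr2, ← comulHom_parity, parity_of_mem hx, map_smul]

lemma inL_mem {i : ZMod 2} {x : FunGL p q} (hx : x ∈ gr p q i) : inL p q x ∈ gr2 p q i := by
  rw [mem_gr2]
  refine (parity2_tmul x 1).trans ?_
  rw [parity_one, parity_of_mem hx, ← one_smul ℂ (1 : FunGL p q), smul_tmul_smul_AA, mul_one]
  rfl

lemma inR_mem {i : ZMod 2} {x : FunGL p q} (hx : x ∈ gr p q i) : inR p q x ∈ gr2 p q i := by
  rw [mem_gr2]
  refine (parity2_tmul 1 x).trans ?_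
  rw [parity_one, parity_of_mem hx]
  nth_rewrite 1 [← one_smul ℂ (1 : FunGL p q)]
  rw [smul_tmul_smul_AA, one_mul]
  rfl

/-- The super tensor cube of `A(p,q)`. -/
abbrev AAA (p q : ℕ) : Type := gr p q ᵍ⊗[ℂ] gr2 p q

/-- `a ↦ a ⊗ 1`, to the super tensor cube. -/
abbrev cubeL (p q : ℕ) : FunGL p q →ₐ[ℂ] AAA p q :=
  GradedTensorProduct.includeLeft (gr p q) (gr2 p q)
/-- `t ↦ 1 ⊗ t`, to the super tensor cube. -/
abbrev cubeR (p q : ℕ) : AA p q →ₐ[ℂ] AAA p q :=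
  GradedTensorProduct.includeRight (gr p q) (gr2 p q)

lemma cubeL_mul_cubeR (x : FunGL p q) (t : AA p q) :
    cubeL p q x * cubeR p q t = GradedTensorProduct.tmul ℂ x t :=
  GradedTensorProduct.tmul_one_mul_one_tmul _ _ _ _

lemma cubeL_cubeR_comm {i j : ZMod 2} {a : FunGL p q} {t : AA p q} (ha : a ∈ gr p q i)
    (ht : t ∈ gr2 p q j) :
    cubeL p q a * cubeR p q t = (-1 : ℤˣ) ^ (j * i) • (cubeR p q t * cubeL p q a) := by
  have h2 : cubeR p q t * cubeL p q a = (-1 : ℤˣ) ^ (j * i) • (cubeL p q a * cubeR p q t) := by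
    have := GradedTensorProduct.tmul_coe_mul_coe_tmul (R := ℂ) (gr p q) (gr2 p q) 1 ⟨t, ht⟩ ⟨a, ha⟩ 1
    rw [one_mul, mul_one] at this
    rw [cubeL_mul_cubeR]
    exact this
  rw [h2, smul_smul, Int.units_mul_self, one_smul]

lemma superComm_cube {f : FunGL p q →ₐ[ℂ] AA p q} (hf : ∀ i, ∀ x ∈ gr p q i, f x ∈ gr2 p q i) :
    SuperComm (cubeL p q) ((cubeR p q).comp f) := fun _ _ a b =>
  cubeL_cubeR_comm a.2 (hf _ b b.2)

/-- `a ⊗ b ↦ a ⊗ b ⊗ 1`. -/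
def cube12 (p q : ℕ) : AA p q →ₐ[ℂ] AAA p q :=
  liftAA (cubeL p q) ((cubeR p q).comp (inL p q)) (superComm_cube fun _ _ hx => inL_mem hx)

lemma units_smul_eq {M : Type*} [AddCommGroup M] [Module ℂ M] (i j : ZMod 2) (x : M) :
    (-1 : ℤˣ) ^ (j * i) • x = (if j = 1 ∧ i = 1 then (-1 : ℂ) else 1) • x := by
  obtain rfl | rfl := zmod_two i <;> obtain rfl | rfl := zmod_two j <;> simp [Units.neg_smul]

/-- Moving an element of the third factor past the first two yields the product of two signs, that
is, the total parity of the first two. This is the supercommutation needed to define Δ ⊗ id as a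
homomorphism to the cube. -/
lemma cube12_comm {j : ZMod 2} {b : FunGL p q} (hb : b ∈ gr p q j) (t : AA p q) :
    cube12 p q t * cubeR p q (inR p q b) =
      cubeR p q (inR p q b) * cube12 p q (if j = 0 then t else parity2 p q t) := by
  induction t using AA_induction with
  | add x y hx hy =>
    rw [map_add, add_mul, hx, hy, ← mul_add, ← map_add]
    split_ifs <;> simp
  | hom i k x hx y hy =>
    have h1 : inL p q y * inR p q b = (-1 : ℤˣ) ^ (j * k) • (inR p q b * inL p q y) :=
      inR_mul_inL hy hb
    have h2 := cubeL_cubeR_comm hx (inR_mem hb)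
    have h3 : cube12 p q (x ᵍ⊗ₜ[ℂ] y) * cubeR p q (inR p q b) = (-1 : ℤˣ) ^ (j * k) •
        (-1 : ℤˣ) ^ (j * i) • (cubeR p q (inR p q b) * cube12 p q (x ᵍ⊗ₜ[ℂ] y)) := by
      rw [cube12, liftAA_tmul, AlgHom.comp_apply, mul_assoc, ← map_mul, h1, units_smul_eq, map_smul,
        map_mul, mul_smul_comm, ← mul_assoc, h2, units_smul_eq i j, smul_mul_assoc, mul_assoc,
        units_smul_eq, units_smul_eq]
    rw [h3]
    have h4 : parity2 p q (x ᵍ⊗ₜ[ℂ] y) = (sg i * sg k) • (x ᵍ⊗ₜ[ℂ] y) := by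
      rw [parity2_tmul, parity_of_mem hx, parity_of_mem hy, smul_tmul_smul_AA]
    obtain rfl | rfl := zmod_two j
    · simp
    · rw [if_neg one_ne_zero, h4, map_smul, mul_smul_comm, one_mul, one_mul]
      obtain rfl | rfl := zmod_two i <;> obtain rfl | rfl := zmod_two k <;> simp [Units.neg_smul]

lemma superComm_cube12 :
    SuperComm ((cube12 p q).comp (comulHom p q)) ((cubeR p q).comp (inR p q)) := by
  intro i j a b
  rw [AlgHom.comp_apply, AlgHom.comp_apply, cube12_comm b.2]
  have := (mem_gr2 (p := p) (q := q)).1 (comulHom_mem a.2)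
  obtain rfl | rfl := zmod_two j
  · simp
  · rw [if_neg one_ne_zero, this, map_smul, mul_smul_comm, one_mul]
    obtain rfl | rfl := zmod_two i <;> simp [Units.neg_smul]

lemma comul_apply (x : FunGL p q) : comul p q x = (GradedTensorProduct.of ℂ (gr p q) (gr p q)).symm
    (comulHom p q x) := rfl

/-- Both iterated coproducts are algebra homomorphisms to the super tensor cube, where `f1` is id ⊗
Δ and `f2` is Δ ⊗ id rebracketed. On the entries of the supermatrix they agree by associativity of
the matrix product. The rest identifies the underlying spaces of the graded and the ordinary tensor
products. -/
theorem comul_coassoc (x : FunGL p q) :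
    TensorProduct.assoc ℂ (FunGL p q) (FunGL p q) (FunGL p q)
      ((comul p q).rTensor (FunGL p q) (comul p q x)) =
        (comul p q).lTensor (FunGL p q) (comul p q x) := by
  set f1 := liftAA (cubeL p q) ((cubeR p q).comp (comulHom p q))
    (superComm_cube fun _ _ hx => comulHom_mem hx) with hf1
  set f2 := liftAA ((cube12 p q).comp (comulHom p q)) ((cubeR p q).comp (inR p q))
    superComm_cube12 with hf2
  have hom : f1.comp (comulHom p q) = f2.comp (comulHom p q) := by
    refine FunGL_hom_ext' fun i j => ?_
    rw [AlgHom.comp_apply, AlgHom.comp_apply, comulHom_supermatrix, map_sum, map_sum]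
    simp only [hf1, hf2, liftAA_tmul, AlgHom.comp_apply, comulHom_supermatrix', map_sum, map_mul,
      Finset.mul_sum, Finset.sum_mul, cube12, liftAA_inL, liftAA_inR]
    rw [Finset.sum_comm]
    simp only [mul_assoc]
  have e1 : ∀ t : FunGL p q ⊗[ℂ] FunGL p q, f1 (GradedTensorProduct.of ℂ (gr p q) (gr p q) t) =
      GradedTensorProduct.of ℂ (gr p q) (gr2 p q)
        ((comulHom p q).toLinearMap.lTensor (FunGL p q) t) := by
    intro t
    induction t using TensorProduct.induction_on with
    | zero => simp
    | add x y hx hy => simp only [map_add, hx, hy]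
    | tmul a b =>
      rw [hf1]
      refine (liftAA_tmul _ _ _ a b).trans ?_
      rw [AlgHom.comp_apply, cubeL_mul_cubeR]
      rfl
  have e12 : ∀ (t : FunGL p q ⊗[ℂ] FunGL p q) (b : FunGL p q),
      cube12 p q (GradedTensorProduct.of ℂ (gr p q) (gr p q) t) * cubeR p q (inR p q b) =
      GradedTensorProduct.of ℂ (gr p q) (gr2 p q)
        ((GradedTensorProduct.of ℂ (gr p q) (gr p q)).toLinearMap.lTensor (FunGL p q)
          (TensorProduct.assoc ℂ (FunGL p q) (FunGL p q) (FunGL p q) (t ⊗ₜ b))) := by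
    intro t b
    induction t using TensorProduct.induction_on with
    | zero => simp
    | add x y hx hy => simp only [map_add, add_mul, hx, hy, TensorProduct.add_tmul]
    | tmul a c =>
      have : cube12 p q (a ᵍ⊗ₜ[ℂ] c) = cubeL p q a * cubeR p q (inL p q c) := liftAA_tmul _ _ _ a c
      refine (congrArg (· * cubeR p q (inR p q b)) this).trans ?_
      rw [mul_assoc, ← map_mul, inL_mul_inR, cubeL_mul_cubeR]
      rfl
  have e2 : ∀ t : FunGL p q ⊗[ℂ] FunGL p q, f2 (GradedTensorProduct.of ℂ (gr p q) (gr p q) t) =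
      GradedTensorProduct.of ℂ (gr p q) (gr2 p q)
        ((GradedTensorProduct.of ℂ (gr p q) (gr p q)).toLinearMap.lTensor (FunGL p q)
          (TensorProduct.assoc ℂ (FunGL p q) (FunGL p q) (FunGL p q)
            ((comul p q).rTensor (FunGL p q) t))) := by
    intro t
    induction t using TensorProduct.induction_on with
    | zero => simp
    | add x y hx hy => simp only [map_add, hx, hy]
    | tmul a b =>
      rw [hf2]
      refine (liftAA_tmul _ _ _ a b).trans ?_
      exact e12 (comul p q a) b
  have h := DFunLike.congr_fun hom x
  rw [AlgHom.comp_apply, AlgHom.comp_apply] at h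
  have h1 := e1 (comul p q x)
  have h2 := e2 (comul p q x)
  have h3 := (GradedTensorProduct.of ℂ (gr p q) (gr2 p q)).injective (h2.symm.trans (h.symm.trans h1))
  have h4 := congrArg ((GradedTensorProduct.of ℂ (gr p q) (gr p q)).symm.toLinearMap.lTensor
    (FunGL p q)) h3
  rw [← LinearMap.lTensor_comp_apply, ← LinearMap.lTensor_comp_apply, LinearEquiv.symm_comp,
    LinearMap.lTensor_id] at h4
  exact h4

/-- The counit as a homomorphism. -/
def counitHom (p q : ℕ) : FunGL p q →ₐ[ℂ] ℂ := (counit0 p q).comp (proj0 p q)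

lemma proj0_even (r : FunGL0 p q) : proj0 p q (evenHom p q r) = r := by
  change TensorProduct.rid ℂ (FunGL0 p q) (r ⊗ₜ ExteriorAlgebra.algebraMapInv 1) = r
  simp

lemma proj0_odd (k : OddGen p q) : proj0 p q (oddEl k) = 0 := by
  change TensorProduct.rid ℂ (FunGL0 p q) (1 ⊗ₜ ExteriorAlgebra.algebraMapInv
    (ExteriorAlgebra.ι ℂ (Pi.single k 1))) = 0
  simp [ExteriorAlgebra.algebraMapInv]

/-- The supermatrix of generators of `A₀(p,q)`. -/
def supermatrix0 (p q : ℕ) : Matrix (Fin p ⊕ Fin q) (Fin p ⊕ Fin q) (FunGL0 p q) :=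
  Matrix.fromBlocks (matA0 p q) 0 0 (matD0 p q)

lemma proj0_supermatrix (i j) : proj0 p q (supermatrix p q i j) = supermatrix0 p q i j := by
  rcases i with i | i <;> rcases j with j | j
  · exact proj0_even _
  · exact proj0_odd _
  · exact proj0_odd _
  · exact proj0_even _

lemma comul0_matA0 (i j) : comul0 p q (matA0 p q i j) =
    ∑ k, matA0 p q i k ⊗ₜ matA0 p q k j := by
  rw [comul0, evalComm_matA0, Matrix.mul_apply]
  simp

lemma comul0_matD0 (i j) : comul0 p q (matD0 p q i j) =
    ∑ k, matD0 p q i k ⊗ₜ matD0 p q k j := by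
  rw [comul0, evalComm_matD0, Matrix.mul_apply]
  simp

lemma comul0_supermatrix0 (i j) : comul0 p q (supermatrix0 p q i j) =
    ∑ k, supermatrix0 p q i k ⊗ₜ supermatrix0 p q k j := by
  rw [Fintype.sum_sum_type]
  rcases i with i | i <;> rcases j with j | j <;>
    simp [supermatrix0, comul0_matA0, comul0_matD0]

lemma counit0_supermatrix0 (i j) : counit0 p q (supermatrix0 p q i j) = (1 : Matrix _ _ ℂ) i j := by
  rcases i with i | i <;> rcases j with j | j <;>
    simp [supermatrix0, counit0, evalComm_matA0, evalComm_matD0, Matrix.one_apply]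

lemma counitHom_supermatrix (i j) :
    counitHom p q (supermatrix p q i j) = (1 : Matrix _ _ ℂ) i j := by
  rw [counitHom, AlgHom.comp_apply, proj0_supermatrix, counit0_supermatrix0]

/-- A sign appears only between two odd elements, so it is harmless if one of the homomorphisms
annihilates them. This applies to the counit and to π. -/
lemma superComm_of_odd {T : Type*} [Ring T] [Algebra ℂ T] {f g : FunGL p q →ₐ[ℂ] T}
    (hc : ∀ a b, Commute (f a) (g b)) (h : (∀ b ∈ gr p q 1, g b = 0) ∨ ∀ a ∈ gr p q 1, f a = 0) :
    SuperComm f g := by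
  intro i j a b
  obtain rfl | rfl := zmod_two j
  · simpa using (hc a b).eq
  · rcases h with h | h
    · rw [h b b.2]; simp
    · obtain rfl | rfl := zmod_two i
      · simpa using (hc a b).eq
      · rw [h a a.2]; simp

/-- π is unchanged by composition with the parity, since both kill the odd generators in the same
way; on an odd element this gives π(x) = -π(x). -/
lemma proj0_of_mem_one {x : FunGL p q} (hx : x ∈ gr p q 1) : proj0 p q x = 0 := by
  have h : (proj0 p q).comp (parityHom p q) = proj0 p q := FunGL_hom_ext (fun r => by
    rw [AlgHom.comp_apply, parityHom_apply, parity_evenHom]) fun k => by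
    rw [AlgHom.comp_apply, parityHom_apply, parity_oddEl, map_neg, proj0_odd, neg_zero]
  have h2 : proj0 p q x = -proj0 p q x := by
    rw [← map_neg, ← parity_of_mem_one hx]
    exact (DFunLike.congr_fun h x).symm
  have : (2 : ℂ) • proj0 p q x = 0 := by
    rw [two_smul]; nth_rewrite 1 [h2]; exact neg_add_cancel _
  exact (smul_eq_zero.1 this).resolve_left two_ne_zero

theorem comul_counit (x : FunGL p q) :
    TensorProduct.rid ℂ (FunGL p q) ((counit p q).lTensor (FunGL p q) (comul p q x)) = x := by
  let f : AA p q →ₐ[ℂ] FunGL p q := liftAA (AlgHom.id ℂ _)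
    ((Algebra.ofId ℂ (FunGL p q)).comp (counitHom p q)) (superComm_of_odd
      (fun a b => (Algebra.commutes (R := ℂ) (counitHom p q b) a).symm) (Or.inl fun b hb => by
        change algebraMap ℂ _ (counit0 p q (proj0 p q b)) = 0
        rw [proj0_of_mem_one hb, map_zero, map_zero]))
  have hf : f.comp (comulHom p q) = AlgHom.id ℂ _ := by
    refine FunGL_hom_ext' fun i j => ?_
    rw [AlgHom.comp_apply, comulHom_supermatrix, map_sum]
    simp only [f, liftAA_tmul, AlgHom.comp_apply, counitHom_supermatrix, AlgHom.id_apply]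
    rw [Finset.sum_eq_single j]
    · simp
    · intro k _ hk
      simp [Matrix.one_apply_ne hk]
    · simp
  have e : ∀ t : FunGL p q ⊗[ℂ] FunGL p q, f (GradedTensorProduct.of ℂ (gr p q) (gr p q) t) =
      TensorProduct.rid ℂ (FunGL p q) ((counit p q).lTensor (FunGL p q) t) := by
    intro t
    induction t using TensorProduct.induction_on with
    | zero => simp
    | add x y hx hy => simp only [map_add, hx, hy]
    | tmul a b =>
      refine (liftAA_tmul _ _ _ a b).trans ?_
      change a * algebraMap ℂ _ (counit0 p q (proj0 p q b)) = counit0 p q (proj0 p q b) • a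
      rw [← Algebra.commutes, Algebra.smul_def]
  rw [← e]
  exact DFunLike.congr_fun hf x

lemma comul_parity (x : FunGL p q) :
    TensorProduct.map (parity p q) (parity p q) (comul p q x) = comul p q (parity p q x) := by
  rw [comul_apply, comul_apply, comulHom_parity]
  rfl

/-- The coaction `(id ⊗ π)Δ` as a homomorphism. -/
def rightHom (p q : ℕ) : FunGL p q →ₐ[ℂ] FunGL p q ⊗[ℂ] FunGL0 p q :=
  (liftAA Algebra.TensorProduct.includeLeft
    ((Algebra.TensorProduct.includeRight (R := ℂ)).comp (proj0 p q)) (superComm_of_odd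
      (fun a b => by
        change Commute (a ⊗ₜ[ℂ] (1 : FunGL0 p q)) ((1 : FunGL p q) ⊗ₜ proj0 p q b)
        simp [Commute, SemiconjBy])
      (Or.inl fun b hb => by
        rw [AlgHom.comp_apply, proj0_of_mem_one hb, map_zero]))).comp (comulHom p q)

lemma rightHom_apply (x : FunGL p q) : rightHom p q x = rightCoaction0 p q x := by
  rw [rightHom, AlgHom.comp_apply, rightCoaction0, LinearMap.comp_apply, comul_apply]
  generalize comulHom p q x = t
  induction t using AA_induction with
  | add x y hx hy => simp only [map_add, hx, hy]
  | hom i j x hx y hy =>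
    rw [liftAA_tmul]
    simp

lemma rightHom_supermatrix (i j) : rightHom p q (supermatrix p q i j) =
    ∑ k, supermatrix p q i k ⊗ₜ supermatrix0 p q k j := by
  rw [rightHom, AlgHom.comp_apply, comulHom_supermatrix, map_sum]
  refine Finset.sum_congr rfl fun k _ => ?_
  rw [liftAA_tmul, AlgHom.comp_apply, proj0_supermatrix]
  simp

/-- The homomorphism `(π ⊗ id)Δ`. -/
def leftHom (p q : ℕ) : FunGL p q →ₐ[ℂ] FunGL0 p q ⊗[ℂ] FunGL p q :=
  (liftAA ((Algebra.TensorProduct.includeLeft (S := ℂ)).comp (proj0 p q))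
    Algebra.TensorProduct.includeRight (superComm_of_odd
      (fun a b => by
        change Commute (proj0 p q a ⊗ₜ[ℂ] (1 : FunGL p q)) ((1 : FunGL0 p q) ⊗ₜ b)
        simp [Commute, SemiconjBy])
      (Or.inr fun b hb => by
        rw [AlgHom.comp_apply, proj0_of_mem_one hb, map_zero]))).comp (comulHom p q)

lemma leftHom_apply (x : FunGL p q) :
    leftHom p q x = (proj0 p q).toLinearMap.rTensor (FunGL p q) (comul p q x) := by
  rw [leftHom, AlgHom.comp_apply, comul_apply]
  generalize comulHom p q x = t
  induction t using AA_induction with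
  | add x y hx hy => simp only [map_add, hx, hy]
  | hom i j x hx y hy =>
    rw [liftAA_tmul]
    simp

lemma leftHom_supermatrix (i j) : leftHom p q (supermatrix p q i j) =
    ∑ k, supermatrix0 p q i k ⊗ₜ supermatrix p q k j := by
  rw [leftHom, AlgHom.comp_apply, comulHom_supermatrix, map_sum]
  refine Finset.sum_congr rfl fun k _ => ?_
  rw [liftAA_tmul, AlgHom.comp_apply, proj0_supermatrix]
  simp

theorem isSuperComodule_rightCoaction0 (p q : ℕ) :
    IsSuperComodule (comul0 p q).toLinearMap (counit0 p q).toLinearMap (gr0 p q) (gr p q)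
      (rightCoaction0 p q) := by
  have hr : ∀ x, rightCoaction0 p q x = (rightHom p q).toLinearMap x := fun x =>
    (rightHom_apply x).symm
  have hr' : rightCoaction0 p q = (rightHom p q).toLinearMap := LinearMap.ext hr
  refine ⟨(isInv_gr p q).isInternal, ?_, ?_, ?_⟩
  · intro i v hv
    refine (isInv_gr p q).map_mem ((isInv_gr p q).tensor (isInv_gr0 p q)) _ (fun v => ?_) hv
    have : (Algebra.TensorProduct.map (parityHom p q) (AlgHom.id ℂ (FunGL0 p q))).comp
        (rightHom p q) = (rightHom p q).comp (parityHom p q) := by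
      refine FunGL_hom_ext' fun i j => ?_
      rw [AlgHom.comp_apply, AlgHom.comp_apply, parityHom_apply, parity_supermatrix, map_smul,
        rightHom_supermatrix, map_sum, Finset.smul_sum]
      refine Finset.sum_congr rfl fun k _ => ?_
      rw [Algebra.TensorProduct.map_tmul, parityHom_apply, parity_supermatrix, AlgHom.id_apply]
      -- The off-diagonal blocks of `supermatrix0` vanish, so only indices k and j of equal sign
      -- contribute.
      rcases j with j | j <;> rcases k with k | k <;>
        simp [idxSign, supermatrix0, TensorProduct.smul_tmul', TensorProduct.neg_tmul]
    rw [hr']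
    exact DFunLike.congr_fun this v
  · intro x
    have : ((Algebra.TensorProduct.assoc ℂ ℂ ℂ (FunGL p q) (FunGL0 p q) (FunGL0 p q)).toAlgHom.comp
        (Algebra.TensorProduct.map (rightHom p q) (AlgHom.id ℂ (FunGL0 p q)))).comp (rightHom p q) =
        (Algebra.TensorProduct.map (AlgHom.id ℂ (FunGL p q)) (comul0 p q)).comp (rightHom p q) := by
      refine FunGL_hom_ext' fun i j => ?_
      simp only [AlgHom.comp_apply, rightHom_supermatrix, map_sum, Algebra.TensorProduct.map_tmul,
        comul0_supermatrix0, AlgHom.id_apply, TensorProduct.sum_tmul, TensorProduct.tmul_sum]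
      rw [Finset.sum_comm]
      rfl
    rw [hr']
    exact DFunLike.congr_fun this x
  · intro x
    have : ((Algebra.TensorProduct.rid ℂ ℂ (FunGL p q)).toAlgHom.comp
        (Algebra.TensorProduct.map (AlgHom.id ℂ (FunGL p q)) (counit0 p q))).comp (rightHom p q) =
        AlgHom.id ℂ _ := by
      refine FunGL_hom_ext' fun i j => ?_
      simp only [AlgHom.comp_apply, rightHom_supermatrix, map_sum, Algebra.TensorProduct.map_tmul,
        counit0_supermatrix0, AlgHom.id_apply]
      rw [Finset.sum_eq_single j]
      · simp
      · intro k _ hk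
        simp [Matrix.one_apply_ne hk]
      · simp
    rw [hr']
    exact DFunLike.congr_fun this x

theorem isSuperComodule_cofree {V : Type*} [AddCommGroup V] [Module ℂ V]
    {gV : ZMod 2 → Submodule ℂ V} {σ : V →ₗ[ℂ] V} (hσ : IsInv gV σ) :
    IsSuperComodule (comul p q) (counit p q) (gr p q) (tensorGr gV (gr p q))
      (cofree V (comul p q)) := by
  have hi := hσ.tensor (isInv_gr p q)
  refine ⟨hi.isInternal, ?_, ?_, ?_⟩
  · intro i v hv
    refine hi.map_mem (hi.tensor (isInv_gr p q)) _ (fun v => ?_) hv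
    have e1 : TensorProduct.map (TensorProduct.map σ (parity p q)) (parity p q) ∘ₗ
        (TensorProduct.assoc ℂ V (FunGL p q) (FunGL p q)).symm.toLinearMap =
        (TensorProduct.assoc ℂ V (FunGL p q) (FunGL p q)).symm.toLinearMap ∘ₗ
          TensorProduct.map σ (TensorProduct.map (parity p q) (parity p q)) := by
      apply TensorProduct.ext'
      intro v t
      induction t using TensorProduct.induction_on with
      | zero => simp
      | add x y hx hy => rw [TensorProduct.tmul_add, map_add, map_add, hx, hy]
      | tmul a b => rfl
    rw [cofree, LinearMap.comp_apply, ← LinearMap.comp_apply (TensorProduct.map _ _), e1,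
      LinearMap.comp_apply, LinearMap.comp_apply]
    congr 1
    induction v using TensorProduct.induction_on with
    | zero => simp
    | add x y hx hy => simp only [map_add, hx, hy]
    | tmul v x => simp [comul_parity]
  · intro v
    induction v using TensorProduct.induction_on with
    | zero => simp
    | add x y hx hy => simp only [map_add, hx, hy]
    | tmul v x =>
      have h := comul_coassoc x
      have e1 : ∀ t : FunGL p q ⊗[ℂ] FunGL p q,
          TensorProduct.assoc ℂ (V ⊗[ℂ] FunGL p q) (FunGL p q) (FunGL p q)
            ((cofree V (comul p q)).rTensor (FunGL p q)
              ((TensorProduct.assoc ℂ V (FunGL p q) (FunGL p q)).symm (v ⊗ₜ t))) =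
          (TensorProduct.assoc ℂ V (FunGL p q) (FunGL p q ⊗[ℂ] FunGL p q)).symm
            (v ⊗ₜ TensorProduct.assoc ℂ (FunGL p q) (FunGL p q) (FunGL p q)
              ((comul p q).rTensor (FunGL p q) t)) := by
        intro t
        induction t using TensorProduct.induction_on with
        | zero => simp
        | add x y hx hy => simp only [TensorProduct.tmul_add, map_add, hx, hy]
        | tmul a b =>
          simp only [TensorProduct.assoc_symm_tmul, LinearMap.rTensor_tmul]
          rw [cofree, LinearMap.comp_apply, LinearMap.lTensor_tmul, LinearEquiv.coe_coe]
          generalize comul p q a = s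
          induction s using TensorProduct.induction_on with
          | zero => simp
          | add x y hx hy => simp only [TensorProduct.tmul_add, TensorProduct.add_tmul, map_add, hx, hy]
          | tmul c d => rfl
      have e2 : ∀ t : FunGL p q ⊗[ℂ] FunGL p q,
          (comul p q).lTensor (V ⊗[ℂ] FunGL p q)
              ((TensorProduct.assoc ℂ V (FunGL p q) (FunGL p q)).symm (v ⊗ₜ t)) =
          (TensorProduct.assoc ℂ V (FunGL p q) (FunGL p q ⊗[ℂ] FunGL p q)).symm
            (v ⊗ₜ ((comul p q).lTensor (FunGL p q) t)) := by
        intro t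
        induction t using TensorProduct.induction_on with
        | zero => simp
        | add x y hx hy => simp only [TensorProduct.tmul_add, map_add, hx, hy]
        | tmul a b => rfl
      have e3 : cofree V (comul p q) (v ⊗ₜ x) =
        (TensorProduct.assoc ℂ V (FunGL p q) (FunGL p q)).symm (v ⊗ₜ comul p q x) := rfl
      rw [e3, e1, e2, h]
  · intro v
    induction v using TensorProduct.induction_on with
    | zero => simp
    | add x y hx hy => simp only [map_add, hx, hy]
    | tmul v x =>
      have h := comul_counit x
      have e1 : ∀ t : FunGL p q ⊗[ℂ] FunGL p q,
          TensorProduct.rid ℂ (V ⊗[ℂ] FunGL p q) ((counit p q).lTensor (V ⊗[ℂ] FunGL p q)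
              ((TensorProduct.assoc ℂ V (FunGL p q) (FunGL p q)).symm (v ⊗ₜ t))) =
          v ⊗ₜ TensorProduct.rid ℂ (FunGL p q) ((counit p q).lTensor (FunGL p q) t) := by
        intro t
        induction t using TensorProduct.induction_on with
        | zero => simp
        | add x y hx hy => simp only [TensorProduct.tmul_add, map_add, hx, hy]
        | tmul a b => simp
      exact (e1 _).trans (by rw [h])

end

/-! ### The blocks of the supermatrix, as seen from one of the two sides -/

/-- The size of the block `A` for `plus`, of `D` for `minus`. -/
def rowSize (p q : ℕ) : Side → ℕ
  | .plus => p
  | .minus => q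

/-- The size of the block `D` for `plus`, of `A` for `minus`. -/
def colSize (p q : ℕ) : Side → ℕ
  | .plus => q
  | .minus => p

/-- The block `A₀` for `plus`, `D₀` for `minus`. -/
def sA0 (p q : ℕ) : ∀ s, Matrix (Fin (rowSize p q s)) (Fin (rowSize p q s)) (FunGL0 p q)
  | .plus => matA0 p q
  | .minus => matD0 p q

/-- The block `D₀` for `plus`, `A₀` for `minus`. -/
def sD0 (p q : ℕ) : ∀ s, Matrix (Fin (colSize p q s)) (Fin (colSize p q s)) (FunGL0 p q)
  | .plus => matD0 p q
  | .minus => matA0 p q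

section sides
variable {p q : ℕ} {s : Side}

/-- The odd generators in the block `B` for `plus`, in `C` for `minus`. -/
def gB : ∀ s, Fin (rowSize p q s) → Fin (colSize p q s) → OddGen p q
  | .plus, i, j => Sum.inl (i, j)
  | .minus, i, j => Sum.inr (i, j)

/-- The odd generators in the block `C` for `plus`, in `B` for `minus`. -/
def gC : ∀ s, Fin (colSize p q s) → Fin (rowSize p q s) → OddGen p q
  | .plus, i, j => Sum.inr (i, j)
  | .minus, i, j => Sum.inl (i, j)

lemma oddGen_cases (s : Side) (k : OddGen p q) :
    (∃ i j, k = gB s i j) ∨ ∃ i j, k = gC s i j := by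
  cases s <;> rcases k with ⟨i, j⟩ | ⟨i, j⟩
  · exact Or.inl ⟨i, j, rfl⟩
  · exact Or.inr ⟨i, j, rfl⟩
  · exact Or.inr ⟨i, j, rfl⟩
  · exact Or.inl ⟨i, j, rfl⟩

/-- The pair of indices of an entry of the block `B`, in the order of `sideGen`. -/
def pairB : ∀ s, Fin (rowSize p q s) → Fin (colSize p q s) → Fin p × Fin q
  | .plus, i, j => (i, j)
  | .minus, i, j => (j, i)

lemma pairB_surjective (s : Side) (k : Fin p × Fin q) : ∃ i j, k = pairB s i j := by
  cases s
  · exact ⟨k.1, k.2, rfl⟩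
  · exact ⟨k.2, k.1, rfl⟩

lemma gB_eq (i j) : gB s i j = sideGen s (pairB (p := p) (q := q) s i j) := by
  cases s <;> rfl

lemma gC_eq (i j) : gC s j i = sideGen s.opp (pairB (p := p) (q := q) s i j) := by
  cases s <;> rfl

/-- The function on the odd generators with given values on the two blocks. -/
def oddFun {T : Type*} : ∀ s, Matrix (Fin (rowSize p q s)) (Fin (colSize p q s)) T →
    Matrix (Fin (colSize p q s)) (Fin (rowSize p q s)) T → OddGen p q → T
  | .plus, X, Y => Sum.elim (fun k => X k.1 k.2) (fun k => Y k.1 k.2)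
  | .minus, X, Y => Sum.elim (fun k => Y k.1 k.2) (fun k => X k.1 k.2)

lemma oddFun_gB {T : Type*} (X : Matrix (Fin (rowSize p q s)) (Fin (colSize p q s)) T) (Y) (i j) :
    oddFun s X Y (gB s i j) = X i j := by
  cases s <;> rfl

lemma oddFun_gC {T : Type*} (X : Matrix (Fin (rowSize p q s)) (Fin (colSize p q s)) T) (Y) (i j) :
    oddFun s X Y (gC s i j) = Y i j := by
  cases s <;> rfl

lemma isUnit_det_sA0 : IsUnit (sA0 p q s).det := by
  cases s
  · exact isUnit_det_matA0 p q
  · exact isUnit_det_matD0 p q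

lemma isUnit_det_sD0 : IsUnit (sD0 p q s).det := by
  cases s
  · exact isUnit_det_matD0 p q
  · exact isUnit_det_matA0 p q

/-- The homomorphism on `A₀(p,q)` with given values of the two blocks. -/
def evalSide {Z : Type*} [CommRing Z] [Algebra ℂ Z] :
    ∀ (s : Side) (X : Matrix (Fin (rowSize p q s)) (Fin (rowSize p q s)) Z)
      (Y : Matrix (Fin (colSize p q s)) (Fin (colSize p q s)) Z),
      IsUnit X.det → IsUnit Y.det → (FunGL0 p q →ₐ[ℂ] Z)
  | .plus, X, Y, hX, hY => evalComm X Y hX hY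
  | .minus, X, Y, hX, hY => evalComm Y X hY hX

section
variable {Z : Type*} [CommRing Z] [Algebra ℂ Z]
  {X : Matrix (Fin (rowSize p q s)) (Fin (rowSize p q s)) Z}
  {Y : Matrix (Fin (colSize p q s)) (Fin (colSize p q s)) Z}
  (hX : IsUnit X.det) (hY : IsUnit Y.det)

lemma evalSide_sA0 (i j) : evalSide s X Y hX hY (sA0 p q s i j) = X i j := by
  cases s
  · exact evalComm_matA0 X Y hX hY i j
  · exact evalComm_matD0 Y X hY hX i j

lemma evalSide_sD0 (i j) : evalSide s X Y hX hY (sD0 p q s i j) = Y i j := by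
  cases s
  · exact evalComm_matD0 X Y hX hY i j
  · exact evalComm_matA0 Y X hY hX i j

end

lemma FunGL0_side_induction (s : Side) {P : FunGL0 p q → Prop}
    (algebraMap : ∀ c : ℂ, P (algebraMap ℂ _ c)) (sA0 : ∀ i j, P (sA0 p q s i j))
    (sD0 : ∀ i j, P (sD0 p q s i j)) (add : ∀ x y, P x → P y → P (x + y))
    (mul : ∀ x y, P x → P y → P (x * y)) (inv : ∀ x y, x * y = 1 → P x → P y)
    (r : FunGL0 p q) : P r := by
  cases s
  · exact FunGL0_induction algebraMap sA0 sD0 add mul inv r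
  · exact FunGL0_induction algebraMap sD0 sA0 add mul inv r

lemma FunGL0_side_hom_ext (s : Side) {T : Type*} [Ring T] [Algebra ℂ T] {f g : FunGL0 p q →ₐ[ℂ] T}
    (hA : ∀ i j, f (sA0 p q s i j) = g (sA0 p q s i j))
    (hD : ∀ i j, f (sD0 p q s i j) = g (sD0 p q s i j)) : f = g := by
  cases s
  · exact FunGL0_hom_ext hA hD
  · exact FunGL0_hom_ext hD hA

variable (p q s) in
/-- The block `A` for `plus`, `D` for `minus`. -/
def sA : Matrix (Fin (rowSize p q s)) (Fin (rowSize p q s)) (FunGL p q) :=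
  (sA0 p q s).map (evenHom p q)

variable (p q s) in
/-- The block `D` for `plus`, `A` for `minus`. -/
def sD : Matrix (Fin (colSize p q s)) (Fin (colSize p q s)) (FunGL p q) :=
  (sD0 p q s).map (evenHom p q)

variable (p q s) in
/-- The block `B` for `plus`, `C` for `minus`. -/
def sB : Matrix (Fin (rowSize p q s)) (Fin (colSize p q s)) (FunGL p q) :=
  Matrix.of fun i j => oddEl (gB s i j)

variable (p q s) in
/-- The block `C` for `plus`, `B` for `minus`. -/
def sC : Matrix (Fin (colSize p q s)) (Fin (rowSize p q s)) (FunGL p q) :=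
  Matrix.of fun i j => oddEl (gC s i j)

variable (p q s) in
/-- The matrix `ξ` for `plus`, `η` for `minus`. -/
def sXi : Matrix (Fin (rowSize p q s)) (Fin (colSize p q s)) (FunGL p q) :=
  (sA0 p q s)⁻¹.map (evenHom p q) * sB p q s

variable (p q s) in
/-- The matrix `η` for `plus`, `ξ` for `minus`. -/
def sEta : Matrix (Fin (colSize p q s)) (Fin (rowSize p q s)) (FunGL p q) :=
  (sD0 p q s)⁻¹.map (evenHom p q) * sC p q s

variable (p q s) in
/-- The Schur complement `D̃⁻¹` for `plus`, `Ã⁻¹` for `minus`. -/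
def sT : Matrix (Fin (colSize p q s)) (Fin (colSize p q s)) (FunGL p q) :=
  sD p q s - sC p q s * sXi p q s

variable (p q s) in
/-- The composite variables. -/
def sZeta : Matrix (Fin (colSize p q s)) (Fin (rowSize p q s)) (FunGL p q) :=
  Ring.inverse (1 - sEta p q s * sXi p q s) * sEta p q s

lemma baseVars_eq : baseVars p q s = {x | ∃ i j, x = sXi p q s i j} := by
  cases s <;> rfl

lemma compVars_eq : compVars p q s = {x | ∃ i j, x = sZeta p q s i j} := by
  cases s <;> rfl

lemma subst_sA0 (i j) : subst p q s (sA0 p q s i j) = sA p q s i j := by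
  cases s
  · exact subst_plus_matA0 p q i j
  · exact subst_minus_matD0 p q i j

lemma subst_sD0 (i j) : subst p q s (sD0 p q s i j) = sT p q s i j := by
  cases s
  · refine (subst_plus_matD0 p q i j).trans ?_
    rw [tildeDinv, Matrix.mul_assoc]
    rfl
  · refine (subst_minus_matA0 p q i j).trans ?_
    rw [tildeAinv, Matrix.mul_assoc]
    rfl

section cancel
variable {T : Type*} [Ring T] [Algebra ℂ T] {Z : Type*} [CommRing Z] [Algebra ℂ Z] {n : ℕ}
  {M : Matrix (Fin n) (Fin n) Z} (f : Z →ₐ[ℂ] T)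

lemma map_inv_mul_map (h : IsUnit M.det) : M⁻¹.map f * M.map f = 1 := by
  rw [← Matrix.map_mul, Matrix.nonsing_inv_mul _ h]
  exact Matrix.map_one _ (map_zero _) (map_one _)

lemma map_mul_map_inv (h : IsUnit M.det) : M.map f * M⁻¹.map f = 1 := by
  rw [← Matrix.map_mul, Matrix.mul_nonsing_inv _ h]
  exact Matrix.map_one _ (map_zero _) (map_one _)

/-- The entries of X and Y lie in a noncommutative ring. The inverse is therefore formed over the
commutative ring Z and then mapped. -/
lemma map_mul_cancel (h : IsUnit M.det) {m : ℕ} {X Y : Matrix (Fin n) (Fin m) T}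
    (e : M.map f * X = M.map f * Y) : X = Y := by
  have := congrArg (M⁻¹.map f * ·) e
  simp only [← Matrix.mul_assoc, map_inv_mul_map f h, Matrix.one_mul] at this
  exact this

lemma eq_inv_mul (h : IsUnit M.det) {m : ℕ} {X Y : Matrix (Fin n) (Fin m) T}
    (e : M.map f * X = Y) : X = M⁻¹.map f * Y := by
  rw [← e, ← Matrix.mul_assoc, map_inv_mul_map f h, Matrix.one_mul]

end cancel

lemma sA_mul_sXi : sA p q s * sXi p q s = sB p q s := by
  rw [sXi, ← Matrix.mul_assoc, sA, map_mul_map_inv _ isUnit_det_sA0, Matrix.one_mul]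

lemma sD_mul_sEta : sD p q s * sEta p q s = sC p q s := by
  rw [sEta, ← Matrix.mul_assoc, sD, map_mul_map_inv _ isUnit_det_sD0, Matrix.one_mul]

lemma isUnit_one_sub : IsUnit (1 - sEta p q s * sXi p q s) := by
  cases s
  · exact isUnit_one_sub_eta_xi p q
  · exact isUnit_one_sub_xi_eta p q

/-- From T = D(1 - ηξ) and Dη = C. Together with Aξ = B and T = D - Cξ this is the division-free
description of the new variables; being preserved by every homomorphism, it is the starting point of
all computations below. -/
lemma sT_mul_sZeta : sT p q s * sZeta p q s = sC p q s := by
  have h1 : sT p q s = sD p q s * (1 - sEta p q s * sXi p q s) := by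
    rw [Matrix.mul_sub, ← Matrix.mul_assoc, sD_mul_sEta, Matrix.mul_one, sT]
  rw [h1, sZeta, Matrix.mul_assoc, ← Matrix.mul_assoc _ (Ring.inverse _),
    Ring.mul_inverse_cancel _ isUnit_one_sub, Matrix.one_mul, sD_mul_sEta]

/-- T is thus the image of an invertible matrix over a commutative ring, and may be cancelled after
any homomorphism. -/
lemma sT_eq : sT p q s = (sD0 p q s).map (subst p q s) := by
  ext i j; exact (subst_sD0 i j).symm

section relations
variable {T : Type*} [Ring T] [Algebra ℂ T] (f : FunGL p q →ₐ[ℂ] T)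

lemma map_sXi : (sA p q s).map f * (sXi p q s).map f = (sB p q s).map f := by
  rw [← Matrix.map_mul, sA_mul_sXi]

lemma map_sT : (sT p q s).map f = (sD p q s).map f - (sC p q s).map f * (sXi p q s).map f := by
  rw [← Matrix.map_mul, sT, Matrix.map_sub _ (map_sub f)]

lemma map_sZeta : (sT p q s).map f * (sZeta p q s).map f = (sC p q s).map f := by
  rw [← Matrix.map_mul, sT_mul_sZeta]

lemma sA_cancel {m : ℕ} {X Y : Matrix (Fin (rowSize p q s)) (Fin m) T}
    (e : (sA p q s).map f * X = (sA p q s).map f * Y) : X = Y :=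
  map_mul_cancel (f.comp (evenHom p q)) (isUnit_det_sA0 (s := s)) e

lemma sD_cancel {m : ℕ} {X Y : Matrix (Fin (colSize p q s)) (Fin m) T}
    (e : (sD p q s).map f * X = (sD p q s).map f * Y) : X = Y :=
  map_mul_cancel (f.comp (evenHom p q)) (isUnit_det_sD0 (s := s)) e

lemma sT_cancel {m : ℕ} {X Y : Matrix (Fin (colSize p q s)) (Fin m) T}
    (e : (sT p q s).map f * X = (sT p q s).map f * Y) : X = Y := by
  rw [sT_eq] at e
  exact map_mul_cancel (f.comp (subst p q s)) (isUnit_det_sD0 (s := s)) e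

/-- The blocks of a product of points. -/
lemma block_mul {f g h : FunGL p q →ₐ[ℂ] T} (H : ∀ i j, f (supermatrix p q i j) =
      ∑ k, g (supermatrix p q i k) * h (supermatrix p q k j)) (s : Side) :
    (sA p q s).map f = (sA p q s).map g * (sA p q s).map h + (sB p q s).map g * (sC p q s).map h ∧
    (sB p q s).map f = (sA p q s).map g * (sB p q s).map h + (sB p q s).map g * (sD p q s).map h ∧
    (sC p q s).map f = (sC p q s).map g * (sA p q s).map h + (sD p q s).map g * (sC p q s).map h ∧
    (sD p q s).map f = (sC p q s).map g * (sB p q s).map h + (sD p q s).map g * (sD p q s).map h := by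
  simp only [Fintype.sum_sum_type] at H
  cases s
  · refine ⟨?_, ?_, ?_, ?_⟩ <;> ext i j
    · exact H (Sum.inl i) (Sum.inl j)
    · exact H (Sum.inl i) (Sum.inr j)
    · exact H (Sum.inr i) (Sum.inl j)
    · exact H (Sum.inr i) (Sum.inr j)
  -- For `minus` the roles of the two index ranges are exchanged, so the two partial sums appear in
  -- the opposite order.
  · refine ⟨?_, ?_, ?_, ?_⟩ <;> ext i j <;> rw [Matrix.add_apply, add_comm]
    · exact H (Sum.inr i) (Sum.inr j)
    · exact H (Sum.inr i) (Sum.inl j)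
    · exact H (Sum.inl i) (Sum.inr j)
    · exact H (Sum.inl i) (Sum.inl j)

end relations

/-! ### Parities of the variables -/

lemma superOdd_center_mul {T : Type*} [Ring T] [Algebra ℂ T] {σ : T →ₗ[ℂ] T}
    (hσ : ∀ x y, σ (x * y) = σ x * σ y) {z θ : T} (hz : z ∈ Subalgebra.center ℂ T)
    (hz' : σ z = z) (hθ : θ ∈ superOdd σ) : z * θ ∈ superOdd σ := by
  rw [Subalgebra.mem_center_iff] at hz
  refine ⟨fun x => ?_, by rw [hσ, hz', hθ.2, mul_neg]⟩
  rw [mul_assoc, hθ.1, ← mul_assoc, ← mul_assoc, hz]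

lemma superOdd_mul_center {T : Type*} [Ring T] [Algebra ℂ T] {σ : T →ₗ[ℂ] T}
    (hσ : ∀ x y, σ (x * y) = σ x * σ y) {z θ : T} (hz : z ∈ Subalgebra.center ℂ T)
    (hz' : σ z = z) (hθ : θ ∈ superOdd σ) : θ * z ∈ superOdd σ := by
  have := superOdd_center_mul hσ hz hz' hθ
  rwa [← Subalgebra.mem_center_iff.1 hz θ] at this

lemma sXi_mem (i j) : sXi p q s i j ∈ superOdd (parity p q) := by
  rw [sXi, Matrix.mul_apply]
  exact sum_mem fun k _ => superOdd_center_mul parity_mul (evenHom_mem_center _)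
    (parity_evenHom _) (oddEl_mem _)

lemma subst_mem_center (r : FunGL0 p q) : subst p q s r ∈ Subalgebra.center ℂ (FunGL p q) := by
  cases s <;> exact Subtype.mem _

lemma parity_subst (r : FunGL0 p q) : parity p q (subst p q s r) = subst p q s r := by
  have : (parityHom p q).comp (subst p q s) = subst p q s := by
    refine FunGL0_side_hom_ext s (fun i j => ?_) fun i j => ?_
    · rw [AlgHom.comp_apply, subst_sA0]
      exact parity_evenHom _
    · rw [AlgHom.comp_apply, subst_sD0, sT, Matrix.sub_apply, Matrix.mul_apply, map_sub, map_sum]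
      refine congrArg₂ _ (parity_evenHom _) (Finset.sum_congr rfl fun k _ => ?_)
      rw [parityHom_apply, parity_mul, (sXi_mem k j).2, sC, Matrix.of_apply, parity_oddEl,
        neg_mul_neg]
  exact DFunLike.congr_fun this r

/-- The entries of ζ are combinations of the entries of C with even central coefficients; this shows
that they are odd. -/
lemma sZeta_eq : sZeta p q s = (sD0 p q s)⁻¹.map (subst p q s) * sC p q s := by
  apply eq_inv_mul _ isUnit_det_sD0
  rw [← sT_eq, sT_mul_sZeta]

lemma sZeta_mem (i j) : sZeta p q s i j ∈ superOdd (parity p q) := by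
  rw [sZeta_eq, Matrix.mul_apply]
  exact sum_mem fun k _ => superOdd_center_mul parity_mul (subst_mem_center _)
    (parity_subst _) (oddEl_mem _)

lemma oddFun_mem {T : Type*} [Ring T] [Algebra ℂ T] {σ : T →ₗ[ℂ] T}
    {X : Matrix (Fin (rowSize p q s)) (Fin (colSize p q s)) T} {Y}
    (hX : ∀ i j, X i j ∈ superOdd σ) (hY : ∀ i j, Y i j ∈ superOdd σ) (k : OddGen p q) :
    oddFun s X Y k ∈ superOdd σ := by
  obtain ⟨i, j, rfl⟩ | ⟨i, j, rfl⟩ := oddGen_cases s k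
  · rw [oddFun_gB]; exact hX i j
  · rw [oddFun_gC]; exact hY i j

/-! ### The new coordinates -/

variable (p q s) in
/-- The homomorphism from the Grassmann algebra that sends the generators to the base and the
composite variables. -/
def psi : Grass p q →ₐ[ℂ] FunGL p q :=
  liftOdd (oddFun s (sXi p q s) (sZeta p q s)) fun k l =>
    superOdd_anticomm (oddFun_mem sXi_mem sZeta_mem k) (oddFun_mem sXi_mem sZeta_mem l)

lemma psi_theta (k : OddGen p q) :
    psi p q s (theta k) = oddFun s (sXi p q s) (sZeta p q s) k := liftOdd_theta _ _ _

lemma psi_gB (i j) : psi p q s (theta (gB s i j)) = sXi p q s i j := by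
  rw [psi_theta, oddFun_gB]

lemma psi_gC (i j) : psi p q s (theta (gC s i j)) = sZeta p q s i j := by
  rw [psi_theta, oddFun_gC]

lemma psi_theta_mem (k : OddGen p q) : psi p q s (theta k) ∈ superOdd (parity p q) := by
  rw [psi_theta]
  exact oddFun_mem sXi_mem sZeta_mem k

lemma parity_psi (x : Grass p q) : parity p q (psi p q s x) =
    psi p q s (CliffordAlgebra.involute (Q := (0 : QuadraticForm ℂ (OddGen p q → ℂ))) x) := by
  have : (parityHom p q).comp (psi p q s) = (psi p q s).comp
      (CliffordAlgebra.involute (Q := (0 : QuadraticForm ℂ (OddGen p q → ℂ)))) := by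
    refine exterior_hom_ext fun k => ?_
    have h : CliffordAlgebra.involute (Q := (0 : QuadraticForm ℂ (OddGen p q → ℂ))) (theta k) =
      -theta k := CliffordAlgebra.involute_ι _
    rw [AlgHom.comp_apply, AlgHom.comp_apply, h, map_neg]
    exact (psi_theta_mem k).2
  exact DFunLike.congr_fun this x

variable (p q s) in
/-- The change of coordinates. -/
def bigPsi : FunGL p q →ₐ[ℂ] FunGL p q :=
  liftFun (subst p q s) (psi p q s) fun r _ =>
    (Subalgebra.mem_center_iff.1 (subst_mem_center r) _).symm

lemma bigPsi_even (r : FunGL0 p q) : bigPsi p q s (evenHom p q r) = subst p q s r :=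
  liftFun_even _ _ _ _

lemma bigPsi_odd (x : Grass p q) : bigPsi p q s (oddHom p q x) = psi p q s x :=
  liftFun_odd _ _ _ _

/-- The matrix `D (1 + c b)` over the centre, for the generic odd matrices `b`, `c`. -/
def unschur (p q : ℕ) (s : Side) : Matrix (Fin (colSize p q s)) (Fin (colSize p q s))
    (Subalgebra.center ℂ (FunGL p q)) :=
  (sD0 p q s).map (central p q) + Matrix.of fun i j =>
    ∑ l, ∑ k, central p q (sD0 p q s i k) * oddProd (gC s k l) (gB s l j)

lemma isUnit_det_unschur : IsUnit (unschur p q s).det := by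
  refine isUnit_det_add (isUnit_det_map _ isUnit_det_sD0) fun i j => ?_
  rw [Matrix.of_apply]
  exact isNilpotent_sum fun l _ => isNilpotent_sum fun k _ =>
    (Commute.all _ _).isNilpotent_mul_left (oddProd_nilpotent _ _)

lemma unschur_coe (i j) : (unschur p q s i j : FunGL p q) =
    (sD p q s + sD p q s * sC p q s * sB p q s) i j := by
  rw [unschur, Matrix.add_apply, Matrix.add_apply, Matrix.mul_apply]
  push_cast
  congr 1
  rw [Matrix.of_apply]
  push_cast
  refine Finset.sum_congr rfl fun l _ => ?_
  rw [Matrix.mul_apply, Finset.sum_mul]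
  exact Finset.sum_congr rfl fun k _ => (mul_assoc _ _ _).symm

variable (p q s) in
/-- The inverse change of coordinates on the even generators. -/
def phiEven : FunGL0 p q →ₐ[ℂ] FunGL p q :=
  (Subalgebra.center ℂ (FunGL p q)).val.comp
    (evalSide s ((sA0 p q s).map (central p q)) (unschur p q s)
      (isUnit_det_map _ isUnit_det_sA0) isUnit_det_unschur)

lemma phiEven_sA0 (i j) : phiEven p q s (sA0 p q s i j) = sA p q s i j := by
  rw [phiEven, AlgHom.comp_apply, evalSide_sA0]
  rfl

lemma phiEven_sD0 (i j) : phiEven p q s (sD0 p q s i j) =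
    (sD p q s + sD p q s * sC p q s * sB p q s) i j := by
  rw [phiEven, AlgHom.comp_apply, evalSide_sD0]
  exact unschur_coe i j

lemma sA_mul_sB_mem (i j) : (sA p q s * sB p q s) i j ∈ superOdd (parity p q) := by
  rw [Matrix.mul_apply]
  exact sum_mem fun k _ => superOdd_center_mul parity_mul (evenHom_mem_center _)
    (parity_evenHom _) (oddEl_mem _)

lemma sD_mul_sC_mem (i j) : (sD p q s * sC p q s) i j ∈ superOdd (parity p q) := by
  rw [Matrix.mul_apply]
  exact sum_mem fun k _ => superOdd_center_mul parity_mul (evenHom_mem_center _)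
    (parity_evenHom _) (oddEl_mem _)

variable (p q s) in
/-- The inverse change of coordinates on the odd generators. -/
def phiOdd : Grass p q →ₐ[ℂ] FunGL p q :=
  liftOdd (oddFun s (sA p q s * sB p q s) (sD p q s * sC p q s)) fun k l =>
    superOdd_anticomm (oddFun_mem sA_mul_sB_mem sD_mul_sC_mem k)
      (oddFun_mem sA_mul_sB_mem sD_mul_sC_mem l)

lemma phi_commute (r : FunGL0 p q) (x : Grass p q) :
    Commute (phiEven p q s r) (phiOdd p q s x) :=
  (Subalgebra.mem_center_iff.1 (Subtype.mem (evalSide s ((sA0 p q s).map (central p q))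
    (unschur p q s) (isUnit_det_map _ isUnit_det_sA0) isUnit_det_unschur r)) _).symm

variable (p q s) in
/-- The inverse change of coordinates. -/
def bigPhi : FunGL p q →ₐ[ℂ] FunGL p q := liftFun (phiEven p q s) (phiOdd p q s) phi_commute

lemma bigPhi_sA : (sA p q s).map (bigPhi p q s) = sA p q s := by
  ext i j
  exact (liftFun_even _ _ phi_commute _).trans (phiEven_sA0 i j)

lemma bigPhi_sD : (sD p q s).map (bigPhi p q s) =
    sD p q s + sD p q s * sC p q s * sB p q s := by
  ext i j
  exact (liftFun_even _ _ phi_commute _).trans (phiEven_sD0 i j)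

lemma bigPhi_sB : (sB p q s).map (bigPhi p q s) = sA p q s * sB p q s := by
  ext i j
  refine (liftFun_odd _ _ phi_commute (theta (gB s i j))).trans ?_
  rw [phiOdd, liftOdd_theta, oddFun_gB]

lemma bigPhi_sC : (sC p q s).map (bigPhi p q s) = sD p q s * sC p q s := by
  ext i j
  refine (liftFun_odd _ _ phi_commute (theta (gC s i j))).trans ?_
  rw [phiOdd, liftOdd_theta, oddFun_gC]

lemma matrix_map_id {m n : Type*} {T : Type*} [Ring T] [Algebra ℂ T] (M : Matrix m n T) :
    M.map (AlgHom.id ℂ T) = M := rfl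

/-- Apply `bigPhi` to Aξ = B: the right side becomes AB, and A cancels. -/
lemma bigPhi_sXi : (sXi p q s).map (bigPhi p q s) = sB p q s := by
  have h := map_sXi (s := s) (bigPhi p q s)
  rw [bigPhi_sA, bigPhi_sB] at h
  exact sA_cancel (AlgHom.id ℂ _) h

/-- D - Cξ goes to D + DCB - DC·B = D. The image of D under `bigPhi` was chosen for this. -/
lemma bigPhi_sT : (sT p q s).map (bigPhi p q s) = sD p q s := by
  rw [map_sT, bigPhi_sD, bigPhi_sC, bigPhi_sXi, add_sub_cancel_right]

lemma bigPhi_sZeta : (sZeta p q s).map (bigPhi p q s) = sC p q s := by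
  have h := map_sZeta (s := s) (bigPhi p q s)
  rw [bigPhi_sT, bigPhi_sC] at h
  exact sD_cancel (AlgHom.id ℂ _) h

lemma bigPsi_sA : (sA p q s).map (bigPsi p q s) = sA p q s := by
  ext i j; exact (bigPsi_even _).trans (subst_sA0 i j)

lemma bigPsi_sD : (sD p q s).map (bigPsi p q s) = sT p q s := by
  ext i j; exact (bigPsi_even _).trans (subst_sD0 i j)

lemma bigPsi_sB : (sB p q s).map (bigPsi p q s) = sXi p q s := by
  ext i j; exact (bigPsi_odd _).trans (psi_gB i j)

lemma bigPsi_sC : (sC p q s).map (bigPsi p q s) = sZeta p q s := by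
  ext i j; exact (bigPsi_odd _).trans (psi_gC i j)

/-- Two homomorphisms that agree on the four blocks are equal. -/
lemma FunGL_side_hom_ext (s : Side) {T : Type*} [Ring T] [Algebra ℂ T] {f g : FunGL p q →ₐ[ℂ] T}
    (hA : (sA p q s).map f = (sA p q s).map g) (hB : (sB p q s).map f = (sB p q s).map g)
    (hC : (sC p q s).map f = (sC p q s).map g) (hD : (sD p q s).map f = (sD p q s).map g) :
    f = g := by
  refine FunGL_hom_ext (DFunLike.congr_fun (f := f.comp (evenHom p q)) (g := g.comp (evenHom p q))
    (FunGL0_side_hom_ext s (fun i j => congrFun₂ hA i j) fun i j => congrFun₂ hD i j)) fun k => ?_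
  obtain ⟨i, j, rfl⟩ | ⟨i, j, rfl⟩ := oddGen_cases s k
  · exact congrFun₂ hB i j
  · exact congrFun₂ hC i j

lemma map_comp {m n : Type*} {T T' : Type*} [Ring T] [Algebra ℂ T] [Ring T'] [Algebra ℂ T']
    (M : Matrix m n (FunGL p q)) (f : FunGL p q →ₐ[ℂ] T) (g : T →ₐ[ℂ] T') :
    M.map (g.comp f) = (M.map f).map g := rfl

/-- With the converse composition, this says that A, T, ξ, ζ are again free supercommuting
coordinates with A and T invertible. -/
lemma bigPhi_bigPsi (x : FunGL p q) : bigPhi p q s (bigPsi p q s x) = x := by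
  have : (bigPhi p q s).comp (bigPsi p q s) = AlgHom.id ℂ _ := by
    refine FunGL_side_hom_ext s ?_ ?_ ?_ ?_ <;> rw [map_comp, matrix_map_id]
    · rw [bigPsi_sA, bigPhi_sA]
    · rw [bigPsi_sB, bigPhi_sXi]
    · rw [bigPsi_sC, bigPhi_sZeta]
    · rw [bigPsi_sD, bigPhi_sT]
  exact DFunLike.congr_fun this x

lemma bigPsi_bigPhi (x : FunGL p q) : bigPsi p q s (bigPhi p q s x) = x := by
  have : (bigPsi p q s).comp (bigPhi p q s) = AlgHom.id ℂ _ := by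
    refine FunGL_side_hom_ext s ?_ ?_ ?_ ?_ <;> rw [map_comp, matrix_map_id]
    · rw [bigPhi_sA, bigPsi_sA]
    · rw [bigPhi_sB, Matrix.map_mul, bigPsi_sA, bigPsi_sB, sA_mul_sXi]
    · rw [bigPhi_sC, Matrix.map_mul, bigPsi_sD, bigPsi_sC, sT_mul_sZeta]
    · rw [bigPhi_sD, Matrix.map_add _ (map_add _), Matrix.map_mul, Matrix.map_mul, bigPsi_sD,
        bigPsi_sC, bigPsi_sB, sT_mul_sZeta, sT, sub_add_cancel]
  exact DFunLike.congr_fun this x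

end sides

/-! ### The left coaction of the even part on the new coordinates -/

section left
variable {p q : ℕ} {s : Side}

variable (p q) in
/-- The inclusion `r ↦ r ⊗ 1`. -/
abbrev tL : FunGL0 p q →ₐ[ℂ] FunGL0 p q ⊗[ℂ] FunGL p q :=
  Algebra.TensorProduct.includeLeft (S := ℂ)

variable (p q) in
/-- The inclusion `x ↦ 1 ⊗ x`. -/
abbrev tR : FunGL p q →ₐ[ℂ] FunGL0 p q ⊗[ℂ] FunGL p q :=
  Algebra.TensorProduct.includeRight

lemma proj0_block (s : Side) : (sA p q s).map (proj0 p q) = sA0 p q s ∧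
    (sB p q s).map (proj0 p q) = 0 ∧ (sC p q s).map (proj0 p q) = 0 ∧
    (sD p q s).map (proj0 p q) = sD0 p q s := by
  refine ⟨?_, ?_, ?_, ?_⟩ <;> ext i j
  · exact proj0_even _
  · exact proj0_odd _
  · exact proj0_odd _
  · exact proj0_even _

lemma leftHom_blocks (s : Side) :
    (sA p q s).map (leftHom p q) = (sA0 p q s).map (tL p q) * (sA p q s).map (tR p q) ∧
    (sB p q s).map (leftHom p q) = (sA0 p q s).map (tL p q) * (sB p q s).map (tR p q) ∧
    (sC p q s).map (leftHom p q) = (sD0 p q s).map (tL p q) * (sC p q s).map (tR p q) ∧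
    (sD p q s).map (leftHom p q) = (sD0 p q s).map (tL p q) * (sD p q s).map (tR p q) := by
  have h := block_mul (f := leftHom p q)
    (g := (tL p q).comp (proj0 p q)) (h := tR p q) (fun i j => by
      rw [leftHom_supermatrix]
      refine Finset.sum_congr rfl fun k _ => ?_
      rw [AlgHom.comp_apply, proj0_supermatrix]
      simp) s
  obtain ⟨h1, h2, h3, h4⟩ := proj0_block (p := p) (q := q) s
  simp only [map_comp, h1, h2, h3, h4] at h
  have z : ∀ {m n : ℕ}, (0 : Matrix (Fin m) (Fin n) (FunGL0 p q)).map (tL p q) = 0 :=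
    Matrix.map_zero _ (map_zero _)
  simpa only [z, Matrix.zero_mul, add_zero, zero_add] using h

/-- Left translation multiplies both A and B by A₀, which drops out of Aξ = B. In the same way D₀
drops out of Tζ = C below. -/
lemma leftHom_sXi : (sXi p q s).map (leftHom p q) =
    (sXi p q s).map (tR p q) := by
  obtain ⟨h1, h2, -, -⟩ := leftHom_blocks (p := p) (q := q) s
  have h := map_sXi (s := s) (leftHom p q)
  rw [h1, h2, Matrix.mul_assoc] at h
  have h' := map_mul_cancel _ isUnit_det_sA0 h
  rw [← map_sXi] at h'
  exact sA_cancel _ h'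

lemma leftHom_sT : (sT p q s).map (leftHom p q) =
    (sD0 p q s).map (tL p q) * (sT p q s).map (tR p q) := by
  obtain ⟨-, -, h3, h4⟩ := leftHom_blocks (p := p) (q := q) s
  rw [map_sT, map_sT, h3, h4, leftHom_sXi, Matrix.mul_sub, Matrix.mul_assoc]

lemma leftHom_sZeta : (sZeta p q s).map (leftHom p q) =
    (sZeta p q s).map (tR p q) := by
  obtain ⟨-, -, h3, -⟩ := leftHom_blocks (p := p) (q := q) s
  have h := map_sZeta (s := s) (leftHom p q)
  rw [h3, leftHom_sT, Matrix.mul_assoc] at h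
  have h' := map_mul_cancel _ isUnit_det_sD0 h
  rw [← map_sZeta] at h'
  exact sT_cancel _ h'

/-- A and T are translated exactly as A₀ and D₀ are under `comul0`; so the substituted coefficients
transform like the original ones. -/
lemma leftHom_subst (r : FunGL0 p q) : leftHom p q (subst p q s r) =
    Algebra.TensorProduct.map (AlgHom.id ℂ _) (subst p q s) (comul0 p q r) := by
  have : (leftHom p q).comp (subst p q s) =
      (Algebra.TensorProduct.map (AlgHom.id ℂ _) (subst p q s)).comp (comul0 p q) := by
    have hA : ∀ i j, comul0 p q (sA0 p q s i j) = ∑ k, sA0 p q s i k ⊗ₜ sA0 p q s k j := by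
      cases s
      · exact comul0_matA0
      · exact comul0_matD0
    have hD : ∀ i j, comul0 p q (sD0 p q s i j) = ∑ k, sD0 p q s i k ⊗ₜ sD0 p q s k j := by
      cases s
      · exact comul0_matD0
      · exact comul0_matA0
    refine FunGL0_side_hom_ext s (fun i j => ?_) fun i j => ?_
    · rw [AlgHom.comp_apply, AlgHom.comp_apply, subst_sA0, hA, map_sum]
      refine (congrFun₂ (leftHom_blocks s).1 i j).trans ?_
      rw [Matrix.mul_apply]
      refine Finset.sum_congr rfl fun k _ => ?_
      simp [subst_sA0]
    · rw [AlgHom.comp_apply, AlgHom.comp_apply, subst_sD0, hD, map_sum]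
      refine (congrFun₂ leftHom_sT i j).trans ?_
      rw [Matrix.mul_apply]
      refine Finset.sum_congr rfl fun k _ => ?_
      simp [subst_sD0]
  exact DFunLike.congr_fun this r

lemma leftHom_psi (x : Grass p q) : leftHom p q (psi p q s x) = 1 ⊗ₜ psi p q s x := by
  have : (leftHom p q).comp (psi p q s) =
      (tR p q).comp (psi p q s) := by
    refine exterior_hom_ext fun k => ?_
    rw [AlgHom.comp_apply, AlgHom.comp_apply]
    obtain ⟨i, j, rfl⟩ | ⟨i, j, rfl⟩ := oddGen_cases s k
    · rw [psi_gB]; exact congrFun₂ leftHom_sXi i j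
    · rw [psi_gC]; exact congrFun₂ leftHom_sZeta i j
  exact DFunLike.congr_fun this x

end left

/-! ### The induced comodule in the new coordinates -/

lemma range_lTensor_map {V M N : Type*} [AddCommGroup V] [Module ℂ V] [AddCommGroup M] [Module ℂ M]
    [AddCommGroup N] [Module ℂ N] (f : M →ₗ[ℂ] N) (P : Submodule ℂ M) :
    LinearMap.range ((P.map f).subtype.lTensor V) =
      (LinearMap.range (P.subtype.lTensor V)).map (f.lTensor V) := by
  have hs : Function.Surjective (f.submoduleMap P) := f.submoduleMap_surjective P
  rw [← LinearMap.range_comp, ← LinearMap.lTensor_comp]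
  have e : f ∘ₗ P.subtype = (P.map f).subtype ∘ₗ f.submoduleMap P := rfl
  rw [e, LinearMap.lTensor_comp, LinearMap.range_comp_of_range_eq_top]
  exact LinearMap.range_eq_top.2 (LinearMap.lTensor_surjective V hs)

section omega
variable {p q : ℕ} {V : Type*} [AddCommGroup V] [Module ℂ V]

lemma param_tmul (s : Side) (β : V →ₗ[ℂ] V ⊗[ℂ] FunGL0 p q) (v : V) (F : FunGL p q) :
    param s β (v ⊗ₜ F) =
      (LinearMap.mulRight ℂ F ∘ₗ (subst p q s).toLinearMap).lTensor V (β v) := by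
  change (LinearMap.mul' ℂ (FunGL p q)).lTensor V (TensorProduct.assoc ℂ V _ _
    ((subst p q s).toLinearMap.lTensor V (β v) ⊗ₜ F)) = _
  induction β v using TensorProduct.induction_on with
  | zero => simp
  | add a b ha hb => rw [map_add, TensorProduct.add_tmul, map_add, map_add, ha, hb, map_add]
  | tmul v r => simp

/-- The parameterisation of the induced comodule by the Grassmann algebra in the base and the
composite variables. -/
def omega (s : Side) (β : V →ₗ[ℂ] V ⊗[ℂ] FunGL0 p q) : V ⊗[ℂ] Grass p q →ₗ[ℂ] V ⊗[ℂ] FunGL p q :=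
  param s β ∘ₗ (psi p q s).toLinearMap.lTensor V

variable {s : Side} {β : V →ₗ[ℂ] V ⊗[ℂ] FunGL0 p q}

lemma omega_tmul (v : V) (x : Grass p q) : omega s β (v ⊗ₜ x) =
    (LinearMap.mulRight ℂ (psi p q s x) ∘ₗ (subst p q s).toLinearMap).lTensor V (β v) :=
  param_tmul s β v _

lemma bigPsi_toA (r : FunGL0 p q) (x : Grass p q) :
    bigPsi p q s (toA p q (r ⊗ₜ x)) = subst p q s r * psi p q s x := by
  rw [toA_tmul, map_mul, bigPsi_even, bigPsi_odd]

/-- In the new coordinates the parameterisation is the coaction β with the Grassmann factor carried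
along. Injectivity and image can be read off from this form. -/
lemma omega_eq (t : V ⊗[ℂ] Grass p q) : omega s β t = (bigPsi p q s).toLinearMap.lTensor V
    ((toA p q).toLinearMap.lTensor V (TensorProduct.assoc ℂ V _ _ (β.rTensor (Grass p q) t))) := by
  induction t using TensorProduct.induction_on with
  | zero => simp
  | add a b ha hb => simp only [map_add, ha, hb]
  | tmul v x =>
    rw [omega_tmul, LinearMap.rTensor_tmul]
    induction β v using TensorProduct.induction_on with
    | zero => simp
    | add a b ha hb => rw [map_add, ha, hb, TensorProduct.add_tmul]; simp only [map_add]
    | tmul v r =>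
      simp only [LinearMap.lTensor_tmul, TensorProduct.assoc_tmul]
      exact congrArg (v ⊗ₜ[ℂ] ·) (bigPsi_toA r x).symm

lemma elems_map (P : Submodule ℂ (Grass p q)) : elems s β (P.map (psi p q s).toLinearMap) =
    (LinearMap.range (P.subtype.lTensor V)).map (omega s β) := by
  rw [elems, range_lTensor_map, omega, Submodule.map_comp]

/-- β has the counit as a left inverse, `bigPsi` is invertible, and tensoring over a field preserves
injectivity. -/
lemma omega_injective {gV : ZMod 2 → Submodule ℂ V}
    (hβ : IsSuperComodule (comul0 p q).toLinearMap (counit0 p q).toLinearMap (gr0 p q) gV β) :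
    Function.Injective (omega s β) := by
  have h1 : Function.Injective β := Function.LeftInverse.injective
    (g := fun t => TensorProduct.rid ℂ V ((counit0 p q).toLinearMap.lTensor V t)) hβ.counit
  have h2 : Function.Injective (bigPsi p q s).toLinearMap :=
    Function.LeftInverse.injective (g := bigPhi p q s) bigPhi_bigPsi
  have e : omega s β = (bigPsi p q s).toLinearMap.lTensor V ∘ₗ
      ((toA p q).toLinearMap.lTensor V ∘ₗ ((TensorProduct.assoc ℂ V _ _).toLinearMap ∘ₗ
        β.rTensor (Grass p q))) := LinearMap.ext omega_eq
  rw [e]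
  refine (Module.Flat.lTensor_preserves_injective_linearMap (M := V) _ h2).comp
    ((Module.Flat.lTensor_preserves_injective_linearMap (M := V) _ (toA p q).injective).comp
      ((TensorProduct.assoc ℂ V (FunGL0 p q) (Grass p q)).injective.comp (Module.Flat.rTensor_preserves_injective_linearMap _ h1)))

lemma comul0_counit (r : FunGL0 p q) :
    TensorProduct.rid ℂ _ ((counit0 p q).toLinearMap.lTensor _ (comul0 p q r)) = r := by
  have : ((Algebra.TensorProduct.rid ℂ ℂ (FunGL0 p q)).toAlgHom.comp
      (Algebra.TensorProduct.map (AlgHom.id ℂ _) (counit0 p q))).comp (comul0 p q) =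
        AlgHom.id ℂ _ := by
    refine FunGL0_hom_ext (fun i j => ?_) fun i j => ?_
    · have h := fun k => counit0_supermatrix0 (p := p) (q := q) (Sum.inl k) (Sum.inl j)
      simp only [supermatrix0, Matrix.fromBlocks_apply₁₁] at h
      simp [comul0_matA0, h, Matrix.one_apply]
    · have h := fun k => counit0_supermatrix0 (p := p) (q := q) (Sum.inr k) (Sum.inr j)
      simp only [supermatrix0, Matrix.fromBlocks_apply₂₂] at h
      simp [comul0_matD0, h, Matrix.one_apply]
  exact DFunLike.congr_fun this r

variable (s) in
/-- The evaluation of the even coordinates at the unit. -/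
def evalUnit : FunGL p q →ₗ[ℂ] Grass p q :=
  (TensorProduct.lid ℂ _).toLinearMap ∘ₗ (counit0 p q).toLinearMap.rTensor (Grass p q) ∘ₗ
    (toA p q).symm.toLinearMap ∘ₗ (bigPhi p q s).toLinearMap

/-- In the new coordinates `leftHom` is `comul0` on the even part and puts the Grassmann part to the
right. Applying the counit to the even part of the right factor returns z. -/
lemma evalUnit_leftHom (z : FunGL p q) : (evalUnit s).lTensor (FunGL0 p q) (leftHom p q z) =
    (toA p q).symm (bigPhi p q s z) := by
  obtain ⟨y, rfl⟩ : ∃ y, bigPsi p q s y = z := ⟨_, bigPsi_bigPhi z⟩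
  rw [bigPhi_bigPsi]
  induction y using FunGL_induction with
  | add x y hx hy => simp only [map_add, hx, hy]
  | tmul r w =>
    rw [bigPsi_toA, map_mul, leftHom_subst, leftHom_psi, AlgEquiv.symm_apply_apply]
    nth_rewrite 2 [← comul0_counit r]
    induction comul0 p q r using TensorProduct.induction_on with
    | zero => simp
    | add a b ha hb => simp only [map_add, add_mul, ha, hb, TensorProduct.add_tmul]
    | tmul a b =>
      have : evalUnit s (subst p q s b * psi p q s w) = counit0 p q b • w := by
        rw [← bigPsi_toA]
        simp [evalUnit, bigPhi_bigPsi]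
      simp [this, TensorProduct.smul_tmul]

lemma lTensor_comul_left (x : V ⊗[ℂ] FunGL p q) :
    ((proj0 p q).toLinearMap.rTensor (FunGL p q) ∘ₗ comul p q).lTensor V x =
      (leftHom p q).toLinearMap.lTensor V x := by
  congr 2
  ext z
  exact (leftHom_apply z).symm

/-- An induced element is determined by its value at the unit of the even group: applying `evalUnit`
to the last factor of the defining equation gives x = `omega` (`evalUnit` x). Conversely the image
of `omega` satisfies the equation by coassociativity of β and the invariance of ξ and ζ. -/
theorem ind_eq_range {gV : ZMod 2 → Submodule ℂ V}
    (hβ : IsSuperComodule (comul0 p q).toLinearMap (counit0 p q).toLinearMap (gr0 p q) gV β)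
    (s : Side) :
    ind (comul p q) (proj0 p q).toLinearMap β = LinearMap.range (omega s β) := by
  have key : ∀ x : V ⊗[ℂ] FunGL p q, ((evalUnit s).lTensor (FunGL0 p q)).lTensor V
      (TensorProduct.assoc ℂ V (FunGL0 p q) (FunGL p q) (β.rTensor (FunGL p q) x)) =
        TensorProduct.assoc ℂ V _ _ (β.rTensor _ ((evalUnit s).lTensor V x)) := fun x => by
    induction x using TensorProduct.induction_on with
    | zero => simp
    | add a b ha hb => simp only [map_add, ha, hb]
    | tmul v y =>
      rw [LinearMap.rTensor_tmul, LinearMap.lTensor_tmul, LinearMap.rTensor_tmul]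
      induction β v using TensorProduct.induction_on with
      | zero => simp
      | add a b ha hb => simp only [map_add, TensorProduct.add_tmul, ha, hb]
      | tmul v r => simp
  apply le_antisymm
  · intro x hx
    have hx' : TensorProduct.assoc ℂ V (FunGL0 p q) (FunGL p q) (β.rTensor (FunGL p q) x) =
        (leftHom p q).toLinearMap.lTensor V x := by
      rw [← lTensor_comul_left]; exact hx
    refine ⟨(evalUnit s).lTensor V x, ?_⟩
    rw [omega_eq, ← key, hx']
    simp only [← LinearMap.comp_apply, ← LinearMap.lTensor_comp]
    have e : (bigPsi p q s).toLinearMap ∘ₗ (toA p q).toLinearMap ∘ₗ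
        (evalUnit s).lTensor (FunGL0 p q) ∘ₗ (leftHom p q).toLinearMap = LinearMap.id := by
      ext z
      have h := evalUnit_leftHom (s := s) z
      simp only [LinearMap.comp_apply, AlgHom.toLinearMap_apply, AlgEquiv.toLinearMap_apply,
        LinearMap.id_apply]
      rw [h, AlgEquiv.apply_symm_apply, bigPsi_bigPhi]
    simp only [e, LinearMap.lTensor_id, LinearMap.id_apply]
  · rintro _ ⟨t, rfl⟩
    change TensorProduct.assoc ℂ V (FunGL0 p q) (FunGL p q) (β.rTensor (FunGL p q) (omega s β t)) =
      _
    rw [lTensor_comul_left]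
    induction t using TensorProduct.induction_on with
    | zero => simp
    | add a b ha hb => simp only [map_add, ha, hb]
    | tmul v x =>
      rw [omega_tmul]
      have h1 : ∀ t : V ⊗[ℂ] FunGL0 p q, TensorProduct.assoc ℂ V (FunGL0 p q) (FunGL p q)
          (β.rTensor (FunGL p q) ((LinearMap.mulRight ℂ (psi p q s x) ∘ₗ
            (subst p q s).toLinearMap).lTensor V t)) =
          ((LinearMap.mulRight ℂ (psi p q s x) ∘ₗ
            (subst p q s).toLinearMap).lTensor (FunGL0 p q)).lTensor V
              (TensorProduct.assoc ℂ V _ _ (β.rTensor _ t)) := fun t => by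
        induction t using TensorProduct.induction_on with
        | zero => simp
        | add a b ha hb => simp only [map_add, ha, hb]
        | tmul v r =>
          rw [LinearMap.rTensor_tmul, LinearMap.lTensor_tmul, LinearMap.rTensor_tmul]
          induction β v using TensorProduct.induction_on with
          | zero => simp
          | add a b ha hb => simp only [map_add, TensorProduct.add_tmul, ha, hb]
          | tmul v r => simp
      rw [h1, hβ.coassoc, ← LinearMap.lTensor_comp_apply, ← LinearMap.lTensor_comp_apply]
      congr 2
      ext r
      simp only [LinearMap.comp_apply, AlgHom.toLinearMap_apply, LinearMap.mulRight_apply, map_mul,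
        leftHom_subst, leftHom_psi]
      induction comul0 p q r using TensorProduct.induction_on with
      | zero => simp
      | add a b ha hb => simp only [map_add, ha, hb, add_mul]
      | tmul a b => simp

/-! ### The variables in the Grassmann algebra -/

variable (p q s) in
/-- The indices of the base variables. -/
def baseIdx : Set (OddGen p q) := Set.range (sideGen s)

variable (p q s) in
/-- The indices of the composite variables. -/
def compIdx : Set (OddGen p q) := Set.range (sideGen s.opp)

lemma isCompl_baseIdx : IsCompl (baseIdx p q s) (compIdx p q s) := by
  cases s
  · refine isCompl_iff.2 ⟨Set.disjoint_left.2 ?_, codisjoint_iff.2 (Set.eq_univ_iff_forall.2 ?_)⟩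
    · rintro _ ⟨k, rfl⟩ ⟨l, h⟩
      exact Sum.inr_ne_inl h
    · rintro (k | k)
      · exact Or.inl ⟨k, rfl⟩
      · exact Or.inr ⟨(k.2, k.1), rfl⟩
  · refine isCompl_iff.2 ⟨Set.disjoint_left.2 ?_, codisjoint_iff.2 (Set.eq_univ_iff_forall.2 ?_)⟩
    · rintro _ ⟨k, rfl⟩ ⟨l, h⟩
      exact Sum.inl_ne_inr h
    · rintro (k | k)
      · exact Or.inr ⟨k, rfl⟩
      · exact Or.inl ⟨(k.2, k.1), rfl⟩

lemma baseIdx_eq : baseIdx p q s = {k | ∃ i j, k = gB s i j} := by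
  ext k
  constructor
  · rintro ⟨l, rfl⟩
    obtain ⟨i, j, rfl⟩ := pairB_surjective s l
    exact ⟨i, j, (gB_eq i j).symm⟩
  · rintro ⟨i, j, rfl⟩
    exact ⟨_, (gB_eq i j).symm⟩

lemma compIdx_eq : compIdx p q s = {k | ∃ i j, k = gC s i j} := by
  ext k
  constructor
  · rintro ⟨l, rfl⟩
    obtain ⟨i, j, rfl⟩ := pairB_surjective s l
    exact ⟨j, i, (gC_eq i j).symm⟩
  · rintro ⟨i, j, rfl⟩
    exact ⟨_, (gC_eq j i).symm⟩

/-- This and the next lemmas move all polynomial spaces of the theorem to the Grassmann algebra,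
where they have monomial bases. -/
lemma baseVars_eq_image : baseVars p q s = psi p q s '' (theta '' baseIdx p q s) := by
  rw [baseVars_eq, baseIdx_eq]
  ext x
  constructor
  · rintro ⟨i, j, rfl⟩
    exact ⟨_, ⟨_, ⟨i, j, rfl⟩, rfl⟩, psi_gB i j⟩
  · rintro ⟨_, ⟨_, ⟨i, j, rfl⟩, rfl⟩, rfl⟩
    exact ⟨i, j, psi_gB i j⟩

lemma compVars_eq_image : compVars p q s = psi p q s '' (theta '' compIdx p q s) := by
  rw [compVars_eq, compIdx_eq]
  ext x
  constructor
  · rintro ⟨i, j, rfl⟩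
    exact ⟨_, ⟨_, ⟨i, j, rfl⟩, rfl⟩, psi_gC i j⟩
  · rintro ⟨_, ⟨_, ⟨i, j, rfl⟩, rfl⟩, rfl⟩
    exact ⟨i, j, psi_gC i j⟩

lemma adjoin_baseVars : Subalgebra.toSubmodule (Algebra.adjoin ℂ (baseVars p q s)) =
    (Subalgebra.toSubmodule (Algebra.adjoin ℂ (theta '' baseIdx p q s))).map
      (psi p q s).toLinearMap := by
  rw [baseVars_eq_image, ← AlgHom.map_adjoin]
  rfl

lemma adjoin_compVars : Subalgebra.toSubmodule (Algebra.adjoin ℂ (compVars p q s)) =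
    (Subalgebra.toSubmodule (Algebra.adjoin ℂ (theta '' compIdx p q s))).map
      (psi p q s).toLinearMap := by
  rw [compVars_eq_image, ← AlgHom.map_adjoin]
  rfl

lemma span_baseVars : Submodule.span ℂ (baseVars p q s) =
    (Submodule.span ℂ (theta '' baseIdx p q s)).map (psi p q s).toLinearMap := by
  rw [baseVars_eq_image, Submodule.map_span]
  rfl

lemma span_compVars : Submodule.span ℂ (compVars p q s) =
    (Submodule.span ℂ (theta '' compIdx p q s)).map (psi p q s).toLinearMap := by
  rw [compVars_eq_image, Submodule.map_span]
  rfl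

end omega

/-! ### The subspaces of the induced comodule in coordinates -/

section coords
variable {p q : ℕ} {V : Type*} [AddCommGroup V] [Module ℂ V] {s : Side}
  {β : V →ₗ[ℂ] V ⊗[ℂ] FunGL0 p q}
  {e : Module.Basis (Finset (OddGen p q)) ℂ (Grass p q)}

open Classical in
variable (p q s) in
/-- The sets of generators with at most `j` composite variables. -/
def filSets (j : ℕ) : Set (Finset (OddGen p q)) := {S | (S.filter (· ∈ compIdx p q s)).card ≤ j}

lemma filPoly_eq (he : IsMonomialBasis e) (j : ℕ) :
    Subalgebra.toSubmodule (Algebra.adjoin ℂ (baseVars p q s)) *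
      (1 ⊔ Submodule.span ℂ (compVars p q s)) ^ j =
        (spanOf e (filSets p q s j)).map (psi p q s).toLinearMap := by
  rw [filSets, ← he.adjoin_mul_pow isCompl_baseIdx, Submodule.map_mul, Submodule.map_pow,
    Submodule.map_sup, Submodule.map_one, adjoin_baseVars, span_compVars]

lemma kacFil_eq (he : IsMonomialBasis e) (j : ℕ) : kacFil s β j =
    (LinearMap.range ((spanOf e (filSets p q s j)).subtype.lTensor V)).map (omega s β) := by
  rw [kacFil, filPoly_eq he, elems_map]

lemma compMonomials_eq (he : IsMonomialBasis e) (j : ℕ) : compMonomials p q s j =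
    (spanOf e {S | ↑S ⊆ compIdx p q s ∧ S.card = j}).map (psi p q s).toLinearMap := by
  rw [compMonomials, span_compVars, ← Submodule.map_pow, he.span_theta_pow]

lemma elems_comp_eq (he : IsMonomialBasis e) :
    elems s β (Subalgebra.toSubmodule (Algebra.adjoin ℂ (compVars p q s))) =
      (LinearMap.range ((spanOf e {S | ↑S ⊆ compIdx p q s}).subtype.lTensor V)).map
        (omega s β) := by
  rw [adjoin_compVars, elems_map, he.adjoin_theta]

lemma elems_one_eq (he : IsMonomialBasis e) : elems s β 1 =
    (LinearMap.range ((spanOf e {∅}).subtype.lTensor V)).map (omega s β) := by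
  rw [he.spanOf_one, ← elems_map, Submodule.map_one]

lemma elems_top_eq (he : IsMonomialBasis e) :
    elems s β (Submodule.span ℂ (baseVars p q s) ^ (p * q)) =
      (LinearMap.range ((spanOf e {S | ↑S ⊆ baseIdx p q s ∧ S.card = p * q}).subtype.lTensor V)).map
        (omega s β) := by
  rw [span_baseVars, ← Submodule.map_pow, elems_map, he.span_theta_pow]

lemma kacFil_zero : kacFil s β 0 =
    elems s β (Subalgebra.toSubmodule (Algebra.adjoin ℂ (baseVars p q s))) := by
  rw [kacFil, pow_zero, mul_one]

lemma kacFil_mono (j : ℕ) : kacFil s β j ≤ kacFil s β (j + 1) := by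
  obtain ⟨e, he⟩ := exists_isMonomialBasis (OddGen p q)
  rw [kacFil_eq he, kacFil_eq he]
  refine Submodule.map_mono fun t ht => ?_
  rw [mem_range_spanOf] at ht ⊢
  exact fun S hS => ht S fun h => hS (le_trans h (Nat.le_succ j))

theorem kacFil_top {gV : ZMod 2 → Submodule ℂ V}
    (hβ : IsSuperComodule (comul0 p q).toLinearMap (counit0 p q).toLinearMap (gr0 p q) gV β) :
    kacFil s β (p * q) = ind (comul p q) (proj0 p q).toLinearMap β := by
  classical
  obtain ⟨e, he⟩ := exists_isMonomialBasis (OddGen p q)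
  rw [kacFil_eq he, ind_eq_range hβ s, LinearMap.range_eq_map (omega s β)]
  refine congrArg (Submodule.map (omega s β)) (eq_top_iff.2 fun t _ =>
    (mem_range_spanOf e _ t).2 fun S hS => (hS ?_).elim)
  -- There are only pq composite generators, so the degree bound pq is no restriction.
  have h : S.filter (· ∈ compIdx p q s) ⊆ Finset.univ.image (sideGen s.opp) := fun k hk => by
    obtain ⟨l, rfl⟩ := (Finset.mem_filter.1 hk).2
    exact Finset.mem_image_of_mem _ (Finset.mem_univ _)
  have := (Finset.card_le_card h).trans Finset.card_image_le
  rw [Finset.card_univ, Fintype.card_prod, Fintype.card_fin, Fintype.card_fin] at this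
  rw [filSets, Set.mem_ofPred_eq]
  convert this

theorem rank_ind {gV : ZMod 2 → Submodule ℂ V}
    (hβ : IsSuperComodule (comul0 p q).toLinearMap (counit0 p q).toLinearMap (gr0 p q) gV β) :
    Module.rank ℂ (ind (comul p q) (proj0 p q).toLinearMap β) =
      2 ^ (2 * p * q) * Module.rank ℂ V := by
  obtain ⟨e, -⟩ := exists_isMonomialBasis (OddGen p q)
  have h : Module.rank ℂ (Grass p q) = 2 ^ (2 * p * q) := by
    rw [rank_eq_card_basis e, Fintype.card_finset, Fintype.card_sum, Fintype.card_prod,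
      Fintype.card_prod, Fintype.card_fin, Fintype.card_fin]
    push_cast
    congr 1
    ring
  rw [ind_eq_range hβ .plus, ← (LinearEquiv.ofInjective _ (omega_injective hβ)).rank_eq,
    rank_tensorProduct, h, mul_comm]
  -- As the cast of a natural number, the dimension of the Grassmann algebra is unaffected by the
  -- universe lift in the rank of a tensor product.
  have h2 : (2 : Cardinal.{0}) ^ (2 * p * q) = ((2 ^ (2 * p * q) : ℕ) : Cardinal) := by
    push_cast; rfl
  rw [h2, Cardinal.lift_natCast, Cardinal.lift_uzero]
  push_cast
  rfl

end coords

/-! ### The comultiplication in the new coordinates -/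

section comultiplication
variable {p q : ℕ} {s : Side}

lemma mem_gr_of_superOdd {x : FunGL p q} (hx : x ∈ superOdd (parity p q)) : x ∈ gr p q 1 :=
  ((isInv_gr p q).mem 1 x).2 (by rw [hx.2, sg_one, neg_smul, one_smul])

lemma inL_superOdd {x : FunGL p q} (hx : x ∈ superOdd (parity p q)) :
    inL p q x ∈ superOdd (parity2 p q) :=
  superOdd_left hx (mem_gr_of_superOdd hx) one_mem_gr_zero (one_mem _)

lemma inR_superOdd {x : FunGL p q} (hx : x ∈ superOdd (parity p q)) :
    inR p q x ∈ superOdd (parity2 p q) :=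
  superOdd_right hx (mem_gr_of_superOdd hx) one_mem_gr_zero (one_mem _)

lemma inR_evenHom_mem_center (r : FunGL0 p q) :
    inR p q (evenHom p q r) ∈ Subalgebra.center ℂ (AA p q) :=
  even_right_mem_center (evenHom_mem_gr r) (evenHom_mem_center r)

variable (p q) in
/-- The total parity as a homomorphism. -/
def parity2Hom : AA p q →ₐ[ℂ] AA p q :=
  mapAA (parityHom p q) (parityHom p q) isEvenHom_parityHom isEvenHom_parityHom

lemma parity2Hom_apply (t : AA p q) : parity2Hom p q t = parity2 p q t := (parity2_eq t).symm

lemma parity2_inR (x : FunGL p q) : parity2 p q (inR p q x) = inR p q (parity p q x) := by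
  change parity2 p q ((1 : FunGL p q) ᵍ⊗ₜ[ℂ] x) = _
  rw [parity2_tmul, parity_one]
  rfl

variable (p q s) in
/-- The subalgebra generated by the base variables of the left factor and by the right factor. -/
def baseAlg : Subalgebra ℂ (AA p q) :=
  Algebra.adjoin ℂ (inL p q '' baseVars p q s ∪ Set.range (inR p q))

variable (p q s) in
/-- The even central elements of `baseAlg`. -/
def coefAlg : Subalgebra ℂ (Subalgebra.center ℂ (AA p q)) :=
  (baseAlg p q s ⊓ AlgHom.equalizer (parity2Hom p q) (AlgHom.id ℂ (AA p q))).comap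
    (Subalgebra.center ℂ (AA p q)).val

variable (p q s) in
/-- The inclusion of `coefAlg`. -/
def coefVal : coefAlg p q s →ₐ[ℂ] AA p q :=
  (Subalgebra.center ℂ (AA p q)).val.comp (coefAlg p q s).val

lemma coefVal_mem_center (z : coefAlg p q s) :
    coefVal p q s z ∈ Subalgebra.center ℂ (AA p q) := z.1.2

lemma coefVal_mem (z : coefAlg p q s) : coefVal p q s z ∈ baseAlg p q s := z.2.1

lemma parity2_coefVal (z : coefAlg p q s) :
    parity2 p q (coefVal p q s z) = coefVal p q s z := by
  rw [← parity2Hom_apply]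
  exact z.2.2

lemma inR_mem_baseAlg (x : FunGL p q) : inR p q x ∈ baseAlg p q s :=
  Algebra.subset_adjoin (Or.inr ⟨x, rfl⟩)

lemma inL_sXi_mem_baseAlg (i j) : inL p q (sXi p q s i j) ∈ baseAlg p q s :=
  Algebra.subset_adjoin (Or.inl ⟨_, by rw [baseVars_eq]; exact ⟨i, j, rfl⟩, rfl⟩)

variable (p q s) in
/-- The even part of the right factor. -/
def coefR : FunGL0 p q →ₐ[ℂ] coefAlg p q s :=
  (central2 p q).codRestrict (coefAlg p q s) fun r => by
    refine ⟨inR_mem_baseAlg (evenHom p q r), ?_⟩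
    change parity2Hom p q (inR p q (evenHom p q r)) = inR p q (evenHom p q r)
    rw [parity2Hom_apply, parity2_inR, parity_evenHom]

/-- The product of two odd elements. -/
def coefMul {x y : AA p q} (hx : x ∈ superOdd (parity2 p q)) (hx' : x ∈ baseAlg p q s)
    (hy : y ∈ superOdd (parity2 p q)) (hy' : y ∈ baseAlg p q s) : coefAlg p q s :=
  ⟨⟨x * y, superOdd_mul_mem_center parity2_parity2 hx hy⟩, mul_mem hx' hy', by
    change parity2Hom p q (x * y) = x * y
    rw [parity2Hom_apply, parity2_mul, hx.2, hy.2, neg_mul_neg]⟩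

lemma coefMul_nilpotent {x y : AA p q} (hx : x ∈ superOdd (parity2 p q))
    (hx' : x ∈ baseAlg p q s) (hy : y ∈ superOdd (parity2 p q)) (hy' : y ∈ baseAlg p q s) :
    IsNilpotent (coefMul hx hx' hy hy') :=
  (IsNilpotent.map_iff (f := (coefAlg p q s).val) Subtype.val_injective).1
    (superOdd_mul_nilpotent parity2_parity2 hx hy)

lemma sC_mem (i j) : sC p q s i j ∈ superOdd (parity p q) := oddEl_mem _

lemma sB_mem (i j) : sB p q s i j ∈ superOdd (parity p q) := oddEl_mem _

variable (p q s) in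
/-- The matrix `A₂ + ξ₁ C₂`, over `coefAlg`. -/
def alphaZ : Matrix (Fin (rowSize p q s)) (Fin (rowSize p q s)) (coefAlg p q s) :=
  (sA0 p q s).map (coefR p q s) + Matrix.of fun i j => ∑ k,
    coefMul (inL_superOdd (sXi_mem i k)) (inL_sXi_mem_baseAlg i k) (inR_superOdd (sC_mem k j))
      (inR_mem_baseAlg _)

/-- A₂ is invertible and ξ₁C₂ has nilpotent entries. Taking the inverse inside `coefAlg` is
essential: it shows that α⁻¹ contains no ζ₁ and remains even and central. -/
lemma isUnit_det_alphaZ : IsUnit (alphaZ p q s).det :=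
  isUnit_det_add (isUnit_det_map _ isUnit_det_sA0) fun i j => by
    rw [Matrix.of_apply]
    exact isNilpotent_sum fun k _ => coefMul_nilpotent _ _ _ _

variable (p q s) in
/-- The matrix `A₂ + ξ₁ C₂`. -/
def alpha : Matrix (Fin (rowSize p q s)) (Fin (rowSize p q s)) (AA p q) :=
  (alphaZ p q s).map (coefVal p q s)

lemma alpha_eq : alpha p q s = (sA p q s).map (inR p q) +
    (sXi p q s).map (inL p q) * (sC p q s).map (inR p q) := by
  ext i j
  rw [alpha, Matrix.map_apply, alphaZ, Matrix.add_apply, map_add, Matrix.add_apply,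
    Matrix.mul_apply, Matrix.of_apply, map_sum]
  rfl

lemma comul_blocks (s : Side) :
    (sA p q s).map (comulHom p q) = (sA p q s).map (inL p q) * (sA p q s).map (inR p q) +
      (sB p q s).map (inL p q) * (sC p q s).map (inR p q) ∧
    (sB p q s).map (comulHom p q) = (sA p q s).map (inL p q) * (sB p q s).map (inR p q) +
      (sB p q s).map (inL p q) * (sD p q s).map (inR p q) ∧
    (sC p q s).map (comulHom p q) = (sC p q s).map (inL p q) * (sA p q s).map (inR p q) +
      (sD p q s).map (inL p q) * (sC p q s).map (inR p q) ∧
    (sD p q s).map (comulHom p q) = (sC p q s).map (inL p q) * (sB p q s).map (inR p q) +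
      (sD p q s).map (inL p q) * (sD p q s).map (inR p q) :=
  block_mul comulHom_supermatrix' s

lemma comul_sA : (sA p q s).map (comulHom p q) = (sA p q s).map (inL p q) * alpha p q s := by
  rw [(comul_blocks s).1, alpha_eq, Matrix.mul_add, ← Matrix.mul_assoc, map_sXi]

/-- Apply Δ to Aξ = B. With Δ(A) = A₁α and B₁ = A₁ξ₁, the factor A₁ cancels. -/
lemma alpha_mul_comul_sXi : alpha p q s * (sXi p q s).map (comulHom p q) =
    (sB p q s).map (inR p q) + (sXi p q s).map (inL p q) * (sD p q s).map (inR p q) := by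
  have h := map_sXi (s := s) (comulHom p q)
  rw [comul_sA, (comul_blocks s).2.1, ← map_sXi (inL p q)] at h
  simp only [Matrix.mul_assoc, ← Matrix.mul_add] at h
  exact sA_cancel _ h

lemma comul_sXi : (sXi p q s).map (comulHom p q) = (alphaZ p q s)⁻¹.map (coefVal p q s) *
    ((sB p q s).map (inR p q) + (sXi p q s).map (inL p q) * (sD p q s).map (inR p q)) :=
  eq_inv_mul _ isUnit_det_alphaZ alpha_mul_comul_sXi

/-- Δ(ξ) involves only ξ from the first factor. This is why the bottom of the filtration is stable,
and it makes δ a matrix over `coefAlg` as well. -/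
lemma comul_sXi_mem (i j) : comulHom p q (sXi p q s i j) ∈ baseAlg p q s := by
  have h := congrFun₂ (comul_sXi (s := s)) i j
  rw [Matrix.map_apply] at h
  rw [h, Matrix.mul_apply]
  refine sum_mem fun k _ => mul_mem (coefVal_mem _) ?_
  rw [Matrix.add_apply, Matrix.mul_apply]
  exact add_mem (inR_mem_baseAlg _) (sum_mem fun l _ =>
    mul_mem (inL_sXi_mem_baseAlg _ _) (inR_mem_baseAlg _))

lemma comul_sXi_superOdd (i j) : comulHom p q (sXi p q s i j) ∈ superOdd (parity2 p q) := by
  have h := congrFun₂ (comul_sXi (s := s)) i j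
  rw [Matrix.map_apply] at h
  rw [h, Matrix.mul_apply]
  refine sum_mem fun k _ => superOdd_center_mul parity2_mul (coefVal_mem_center _)
    (parity2_coefVal _) ?_
  rw [Matrix.add_apply, Matrix.mul_apply]
  refine add_mem (inR_superOdd (sB_mem _ _)) (sum_mem fun l _ =>
    superOdd_mul_center parity2_mul (inR_evenHom_mem_center _) ?_ (inL_superOdd (sXi_mem _ _)))
  exact (parity2_inR _).trans (congrArg _ (parity_evenHom _))

variable (p q s) in
/-- The matrix `D₂ - C₂ Δ(ξ)`, over `coefAlg`. -/
def deltaZ : Matrix (Fin (colSize p q s)) (Fin (colSize p q s)) (coefAlg p q s) :=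
  (sD0 p q s).map (coefR p q s) + Matrix.of fun i j => -(∑ k,
    coefMul (inR_superOdd (sC_mem i k)) (inR_mem_baseAlg _) (comul_sXi_superOdd k j)
      (comul_sXi_mem k j) : coefAlg p q s)

lemma isNilpotent_neg_sum {ι Z : Type*} [Fintype ι] [CommRing Z] (f : ι → Z)
    (h : ∀ k, IsNilpotent (f k)) : IsNilpotent (-∑ k, f k) :=
  (isNilpotent_sum fun k _ => h k).neg

lemma isUnit_det_deltaZ : IsUnit (deltaZ p q s).det :=
  isUnit_det_add (isUnit_det_map _ isUnit_det_sD0) fun i j => by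
    rw [Matrix.of_apply]
    exact isNilpotent_neg_sum _ fun k => coefMul_nilpotent _ _ _ _

variable (p q s) in
/-- The matrix `D₂ - C₂ Δ(ξ)`. -/
def delta : Matrix (Fin (colSize p q s)) (Fin (colSize p q s)) (AA p q) :=
  (deltaZ p q s).map (coefVal p q s)

lemma delta_eq : delta p q s = (sD p q s).map (inR p q) -
    (sC p q s).map (inR p q) * (sXi p q s).map (comulHom p q) := by
  ext i j
  rw [delta, Matrix.map_apply, deltaZ, Matrix.add_apply, map_add, Matrix.sub_apply,
    Matrix.mul_apply, Matrix.of_apply, map_neg, map_sum, sub_eq_add_neg]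
  rfl

/-- D = T + Cξ = T + Tζξ eliminates D from the first factor in favour of the new coordinates. -/
lemma inL_sD : (sD p q s).map (inL p q) = (sT p q s).map (inL p q) +
    (sT p q s).map (inL p q) * (sZeta p q s).map (inL p q) * (sXi p q s).map (inL p q) := by
  rw [map_sZeta, map_sT, sub_add_cancel]

/-- In Δ(D) - Δ(C)Δ(ξ), write D₁ = T₁ + C₁ξ₁. The terms with C₁ add up to C₁(B₂ + ξ₁D₂ - αΔ(ξ)) = 0,
and T₁(D₂ - C₂Δ(ξ)) is left. -/
lemma comul_sT : (sT p q s).map (comulHom p q) = (sT p q s).map (inL p q) * delta p q s := by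
  have h := alpha_mul_comul_sXi (p := p) (q := q) (s := s)
  rw [alpha_eq, Matrix.add_mul] at h
  rw [map_sT, (comul_blocks s).2.2.1, (comul_blocks s).2.2.2, delta_eq, inL_sD,
    ← map_sZeta (inL p q)]
  -- The relation for αΔ(ξ), multiplied from the left by C₁ = T₁ζ₁.
  have h' := congrArg (fun M => (sT p q s).map (inL p q) * (sZeta p q s).map (inL p q) * M) h
  simp only [Matrix.mul_add, Matrix.add_mul, Matrix.mul_sub, Matrix.mul_assoc] at h' ⊢
  rw [← sub_eq_zero] at h' ⊢
  rw [← neg_eq_zero, ← h']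
  abel

/-- Apply Δ to Tζ = C. Since Δ(C) = C₁A₂ + D₁C₂ = T₁(ζ₁A₂ + C₂ + ζ₁ξ₁C₂), the factor T₁ cancels. The
two terms of the result have degrees one and zero in ζ₁. -/
lemma delta_mul_comul_sZeta : delta p q s * (sZeta p q s).map (comulHom p q) =
    (sZeta p q s).map (inL p q) * alpha p q s + (sC p q s).map (inR p q) := by
  have h := map_sZeta (s := s) (comulHom p q)
  rw [comul_sT, (comul_blocks s).2.2.1, inL_sD, ← map_sZeta (inL p q), Matrix.mul_assoc] at h
  apply sT_cancel (inL p q)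
  rw [h, alpha_eq]
  simp only [Matrix.mul_add, Matrix.add_mul, Matrix.mul_assoc]
  abel

lemma comul_sZeta : (sZeta p q s).map (comulHom p q) = (deltaZ p q s)⁻¹.map (coefVal p q s) *
    ((sZeta p q s).map (inL p q) * alpha p q s + (sC p q s).map (inR p q)) :=
  eq_inv_mul _ isUnit_det_deltaZ delta_mul_comul_sZeta

variable (p q s) in
/-- The substitution of `(α, δ)` in the coefficients. -/
def kappa : FunGL0 p q →ₐ[ℂ] AA p q :=
  (coefVal p q s).comp (evalSide s (alphaZ p q s) (deltaZ p q s) isUnit_det_alphaZ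
    isUnit_det_deltaZ)

lemma kappa_mem_center (r : FunGL0 p q) : kappa p q s r ∈ Subalgebra.center ℂ (AA p q) :=
  coefVal_mem_center _

lemma kappa_mem (r : FunGL0 p q) : kappa p q s r ∈ baseAlg p q s := coefVal_mem _

lemma kappa_commute (r : FunGL0 p q) (t : AA p q) : Commute t (kappa p q s r) :=
  Subalgebra.mem_center_iff.1 (kappa_mem_center r) t

lemma kappa_sA0 : (sA0 p q s).map (kappa p q s) = alpha p q s := by
  ext i j
  rw [Matrix.map_apply, kappa, AlgHom.comp_apply, evalSide_sA0]
  rfl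

lemma kappa_sD0 : (sD0 p q s).map (kappa p q s) = delta p q s := by
  ext i j
  rw [Matrix.map_apply, kappa, AlgHom.comp_apply, evalSide_sD0]
  rfl

variable (p q s) in
/-- The product of a homomorphism to the left factor with `κ`. -/
def liftKappa {R : Type*} [Ring R] [Algebra ℂ R] (f : R →ₐ[ℂ] FunGL p q) :
    R ⊗[ℂ] FunGL0 p q →ₐ[ℂ] AA p q :=
  Algebra.TensorProduct.lift ((inL p q).comp f) (kappa p q s) fun _ _ => kappa_commute _ _

lemma liftKappa_tmul {R : Type*} [Ring R] [Algebra ℂ R] (f : R →ₐ[ℂ] FunGL p q) (x : R)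
    (r : FunGL0 p q) : liftKappa p q s f (x ⊗ₜ r) = inL p q (f x) * kappa p q s r :=
  Algebra.TensorProduct.lift_tmul _ _ _ _ _

lemma comul0_sA0 (i j) : comul0 p q (sA0 p q s i j) = ∑ k, sA0 p q s i k ⊗ₜ sA0 p q s k j := by
  cases s
  · exact comul0_matA0 i j
  · exact comul0_matD0 i j

lemma comul0_sD0 (i j) : comul0 p q (sD0 p q s i j) = ∑ k, sD0 p q s i k ⊗ₜ sD0 p q s k j := by
  cases s
  · exact comul0_matD0 i j
  · exact comul0_matA0 i j

/-- The coefficients obey Δ𝒟(A,T) = 𝒟(A₁,T₁)𝒟(α,δ), by Δ(A) = A₁α and Δ(T) = T₁δ. -/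
lemma comulHom_subst (r : FunGL0 p q) : comulHom p q (subst p q s r) =
    liftKappa p q s (subst p q s) (comul0 p q r) := by
  have : (comulHom p q).comp (subst p q s) =
      (liftKappa p q s (subst p q s)).comp (comul0 p q) := by
    refine FunGL0_side_hom_ext s (fun i j => ?_) fun i j => ?_
    · rw [AlgHom.comp_apply, AlgHom.comp_apply, subst_sA0, comul0_sA0, map_sum]
      refine (congrFun₂ comul_sA i j).trans ?_
      rw [Matrix.mul_apply, ← kappa_sA0]
      refine Finset.sum_congr rfl fun k _ => ?_
      rw [liftKappa_tmul, subst_sA0]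
      rfl
    · rw [AlgHom.comp_apply, AlgHom.comp_apply, subst_sD0, comul0_sD0, map_sum]
      refine (congrFun₂ comul_sT i j).trans ?_
      rw [Matrix.mul_apply, ← kappa_sD0]
      refine Finset.sum_congr rfl fun k _ => ?_
      rw [liftKappa_tmul, subst_sD0]
      rfl
  exact DFunLike.congr_fun this r

/-! ### The leading part of the comultiplication -/

variable (p q s) in
/-- The right coaction of the even part, with coefficients substituted by `κ`. -/
def leading : FunGL p q →ₐ[ℂ] AA p q :=
  (liftKappa p q s (AlgHom.id ℂ _)).comp (rightHom p q)

lemma leading_blocks (s : Side) :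
    (sA p q s).map (leading p q s) = (sA p q s).map (inL p q) * alpha p q s ∧
    (sB p q s).map (leading p q s) = (sB p q s).map (inL p q) * delta p q s ∧
    (sC p q s).map (leading p q s) = (sC p q s).map (inL p q) * alpha p q s ∧
    (sD p q s).map (leading p q s) = (sD p q s).map (inL p q) * delta p q s := by
  have h := block_mul (f := leading p q s) (g := inL p q)
    (h := (kappa p q s).comp (proj0 p q)) (fun i j => by
      rw [leading, AlgHom.comp_apply, rightHom_supermatrix, map_sum]
      refine Finset.sum_congr rfl fun k _ => ?_
      rw [liftKappa_tmul, AlgHom.comp_apply, proj0_supermatrix]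
      rfl) s
  obtain ⟨h1, h2, h3, h4⟩ := proj0_block (p := p) (q := q) s
  have z : ∀ {m n : ℕ}, (0 : Matrix (Fin m) (Fin n) (FunGL0 p q)).map (kappa p q s) = 0 :=
    Matrix.map_zero _ (map_zero _)
  simpa only [map_comp, h1, h2, h3, h4, z, Matrix.mul_zero, add_zero, zero_add, kappa_sA0,
    kappa_sD0] using h

lemma alpha_mul_leading_sXi : alpha p q s * (sXi p q s).map (leading p q s) =
    (sXi p q s).map (inL p q) * delta p q s := by
  have h := map_sXi (s := s) (leading p q s)
  rw [(leading_blocks s).1, (leading_blocks s).2.1, ← map_sXi (inL p q), Matrix.mul_assoc,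
    Matrix.mul_assoc] at h
  exact sA_cancel _ h

lemma leading_sT : (sT p q s).map (leading p q s) = (sT p q s).map (inL p q) * delta p q s := by
  rw [map_sT, (leading_blocks s).2.2.1, (leading_blocks s).2.2.2, Matrix.mul_assoc,
    alpha_mul_leading_sXi, map_sT, Matrix.sub_mul, Matrix.mul_assoc]

lemma delta_mul_leading_sZeta : delta p q s * (sZeta p q s).map (leading p q s) =
    (sZeta p q s).map (inL p q) * alpha p q s := by
  have h := map_sZeta (s := s) (leading p q s)
  rw [leading_sT, (leading_blocks s).2.2.1, ← map_sZeta (inL p q), Matrix.mul_assoc,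
    Matrix.mul_assoc] at h
  exact sT_cancel _ h

/-- The leading part satisfies δζ' = ζ₁α, the full coproduct has the extra term C₂. So the
difference has degree zero in ζ₁, one less than ζ itself. -/
lemma comul_sub_leading_sZeta :
    (sZeta p q s).map (comulHom p q) - (sZeta p q s).map (leading p q s) =
      (deltaZ p q s)⁻¹.map (coefVal p q s) * (sC p q s).map (inR p q) := by
  apply eq_inv_mul _ isUnit_det_deltaZ
  rw [Matrix.mul_sub, ← delta, delta_mul_comul_sZeta, delta_mul_leading_sZeta, add_sub_cancel_left]

lemma comul_sub_leading_sZeta_mem (i j) :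
    comulHom p q (sZeta p q s i j) - leading p q s (sZeta p q s i j) ∈ baseAlg p q s := by
  have h := congrFun₂ (comul_sub_leading_sZeta (s := s)) i j
  rw [Matrix.sub_apply, Matrix.map_apply, Matrix.map_apply] at h
  rw [h, Matrix.mul_apply]
  exact sum_mem fun k _ => mul_mem (coefVal_mem _) (inR_mem_baseAlg _)

end comultiplication

/-! ### Spaces of functions of the left factor with arbitrary coefficients on the right -/

section leftSpan
variable {p q : ℕ} {s : Side}

/-- The subspace `P ⊗ A(p,q)` of the super tensor square. -/
def leftSpan (P : Submodule ℂ (FunGL p q)) : Submodule ℂ (AA p q) :=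
  P.map (inL p q).toLinearMap * LinearMap.range (inR p q).toLinearMap

lemma leftSpan_mono {P Q : Submodule ℂ (FunGL p q)} (h : P ≤ Q) : leftSpan P ≤ leftSpan Q :=
  mul_le_mul' (Submodule.map_mono h) le_rfl

lemma inL_mem_leftSpan {P : Submodule ℂ (FunGL p q)} {x : FunGL p q} (hx : x ∈ P) :
    inL p q x ∈ leftSpan P := by
  rw [← mul_one (inL p q x)]
  exact Submodule.mul_mem_mul ⟨x, hx, rfl⟩ ⟨1, map_one (inR p q)⟩

lemma inR_mem_leftSpan {P : Submodule ℂ (FunGL p q)} (hP : 1 ∈ P) (x : FunGL p q) :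
    inR p q x ∈ leftSpan P := by
  rw [← one_mul (inR p q x)]
  exact Submodule.mul_mem_mul ⟨1, hP, map_one (inL p q)⟩ ⟨x, rfl⟩

lemma inR_mul_inL_of_mem {j : ZMod 2} {y : FunGL p q} (hy : y ∈ gr p q j) (x : FunGL p q) :
    inR p q y * inL p q x = inL p q (if j = 0 then x else parity p q x) * inR p q y := by
  have key : ∀ i, ∀ x ∈ gr p q i,
      inR p q y * inL p q x = inL p q (if j = 0 then x else parity p q x) * inR p q y := by
    intro i x hx
    have h := inR_mul_inL hx hy
    rw [units_smul_eq] at h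
    rw [parity_of_mem hx]
    obtain rfl | rfl := zmod_two j
    · simpa using h.symm
    · obtain rfl | rfl := zmod_two i
      · simpa using h.symm
      · rw [if_pos ⟨rfl, rfl⟩, neg_one_smul] at h
        rw [if_neg one_ne_zero, sg_one, neg_one_smul, map_neg, neg_mul, h, neg_neg]
  have h0 := key 0 _ ((isInv_gr p q).eigenProj_mem 0 x)
  have h1 := key 1 _ ((isInv_gr p q).eigenProj_mem 1 x)
  rw [← eigenProj_add (parity p q) x, map_add, mul_add, h0, h1, ← add_mul, ← map_add]
  split_ifs <;> simp only [map_add]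

lemma range_inR_mul_map (Q : Submodule ℂ (FunGL p q)) (hQ : ∀ x ∈ Q, parity p q x ∈ Q) :
    LinearMap.range (inR p q).toLinearMap * Q.map (inL p q).toLinearMap ≤ leftSpan Q := by
  rw [Submodule.mul_le]
  rintro _ ⟨y, rfl⟩ _ ⟨x, hx, rfl⟩
  change inR p q y * inL p q x ∈ leftSpan Q
  rw [← eigenProj_add (parity p q) y, map_add, add_mul,
    inR_mul_inL_of_mem ((isInv_gr p q).eigenProj_mem 0 y),
    inR_mul_inL_of_mem ((isInv_gr p q).eigenProj_mem 1 y)]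
  refine add_mem (Submodule.mul_mem_mul ⟨_, ?_, rfl⟩ ⟨_, rfl⟩)
    (Submodule.mul_mem_mul ⟨_, ?_, rfl⟩ ⟨_, rfl⟩)
  · exact hx
  · exact hQ x hx

/-- Reordering the factors moves elements of the second tensor factor past Q, which applies the
parity to Q when they are odd. Hence Q must be stable under parity. -/
lemma leftSpan_mul (P Q : Submodule ℂ (FunGL p q)) (hQ : ∀ x ∈ Q, parity p q x ∈ Q) :
    leftSpan P * leftSpan Q ≤ leftSpan (P * Q) := by
  have hR : LinearMap.range (inR p q).toLinearMap * LinearMap.range (inR p q).toLinearMap ≤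
      LinearMap.range (inR p q).toLinearMap := by
    rw [Submodule.mul_le]
    rintro _ ⟨x, rfl⟩ _ ⟨y, rfl⟩
    exact ⟨x * y, map_mul (inR p q) x y⟩
  calc leftSpan P * leftSpan Q
      = P.map (inL p q).toLinearMap * (LinearMap.range (inR p q).toLinearMap *
          Q.map (inL p q).toLinearMap) * LinearMap.range (inR p q).toLinearMap := by
        simp only [leftSpan, mul_assoc]
    _ ≤ P.map (inL p q).toLinearMap * (Q.map (inL p q).toLinearMap *
          LinearMap.range (inR p q).toLinearMap) * LinearMap.range (inR p q).toLinearMap :=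
        mul_le_mul' (mul_le_mul' le_rfl (range_inR_mul_map Q hQ)) le_rfl
    _ = P.map (inL p q).toLinearMap * Q.map (inL p q).toLinearMap *
          (LinearMap.range (inR p q).toLinearMap * LinearMap.range (inR p q).toLinearMap) := by
        simp only [mul_assoc]
    _ ≤ P.map (inL p q).toLinearMap * Q.map (inL p q).toLinearMap *
          LinearMap.range (inR p q).toLinearMap := mul_le_mul' le_rfl hR
    _ = leftSpan (P * Q) := by rw [leftSpan, Submodule.map_mul]

end leftSpan

/-! ### The filtration of the functions -/

section filPoly
variable {p q : ℕ} {s : Side}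

section
variable {I : Type*} [Fintype I] [DecidableEq I]
  {e : Module.Basis (Finset I) ℂ (ExteriorAlgebra ℂ (I → ℂ))}

lemma IsMonomialBasis.involute_eq (he : IsMonomialBasis e) (S : Finset I) :
    ∃ c : ℂ, CliffordAlgebra.involute (Q := (0 : QuadraticForm ℂ (I → ℂ))) (e S) = c • e S := by
  induction S using Finset.induction_on with
  | empty => exact ⟨1, by rw [he.empty, one_smul]; exact map_one _⟩
  | insert k S hk ih =>
    obtain ⟨c, -, h⟩ := he.insert_eq hk
    obtain ⟨d, hd⟩ := ih
    have ht : CliffordAlgebra.involute (Q := (0 : QuadraticForm ℂ (I → ℂ))) (theta k) = -theta k :=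
      CliffordAlgebra.involute_ι _
    refine ⟨-d, ?_⟩
    rw [h, map_smul, smul_comm]
    congr 1
    refine (map_mul _ _ _).trans ?_
    rw [hd, ht]
    simp

lemma IsMonomialBasis.involute_mem (he : IsMonomialBasis e) (F : Set (Finset I))
    (x : ExteriorAlgebra ℂ (I → ℂ)) (hx : x ∈ spanOf e F) :
    CliffordAlgebra.involute (Q := (0 : QuadraticForm ℂ (I → ℂ))) x ∈ spanOf e F := by
  have : spanOf e F ≤ (spanOf e F).comap
      (CliffordAlgebra.involute (Q := (0 : QuadraticForm ℂ (I → ℂ)))).toLinearMap := by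
    refine Submodule.span_le.2 ?_
    rintro _ ⟨S, hS, rfl⟩
    obtain ⟨c, hc⟩ := he.involute_eq S
    change CliffordAlgebra.involute (Q := (0 : QuadraticForm ℂ (I → ℂ))) (e S) ∈ spanOf e F
    rw [hc]
    exact Submodule.smul_mem _ _ (Submodule.subset_span ⟨S, hS, rfl⟩)
  exact this hx

lemma IsMonomialBasis.spanOf_mul_le (he : IsMonomialBasis e) {F F' F'' : Set (Finset I)}
    (h : ∀ S ∈ F, ∀ T ∈ F', Disjoint S T → S ∪ T ∈ F'') :
    spanOf e F * spanOf e F' ≤ spanOf e F'' := by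
  rw [spanOf, spanOf, Submodule.span_mul_span, Submodule.span_le]
  rintro _ ⟨_, ⟨S, hS, rfl⟩, _, ⟨T, hT, rfl⟩, rfl⟩
  by_cases hd : Disjoint S T
  · obtain ⟨c, -, hc⟩ := he.mul_disjoint S T hd
    change e S * e T ∈ _
    rw [hc]
    exact Submodule.smul_mem _ _ (Submodule.subset_span ⟨_, h S hS T hT hd, rfl⟩)
  · change e S * e T ∈ _
    rw [he.mul_not_disjoint S T hd]
    exact zero_mem _

end

variable (p q s) in
/-- The polynomials in the base and the composite variables, of degree at most `j` in the latter. -/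
def filPoly (j : ℕ) : Submodule ℂ (FunGL p q) :=
  Subalgebra.toSubmodule (Algebra.adjoin ℂ (baseVars p q s)) *
    (1 ⊔ Submodule.span ℂ (compVars p q s)) ^ j

lemma filPoly_zero : filPoly p q s 0 =
    Subalgebra.toSubmodule (Algebra.adjoin ℂ (baseVars p q s)) := by
  rw [filPoly, pow_zero, mul_one]

lemma filPoly_mul_le (i j : ℕ) : filPoly p q s i * filPoly p q s j ≤ filPoly p q s (i + j) := by
  classical
  obtain ⟨e, he⟩ := exists_isMonomialBasis (OddGen p q)
  rw [filPoly, filPoly, filPoly, filPoly_eq he, filPoly_eq he, filPoly_eq he, ← Submodule.map_mul]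
  refine Submodule.map_mono (he.spanOf_mul_le fun S hS T hT _ => ?_)
  change ((S ∪ T).filter _).card ≤ i + j
  rw [Finset.filter_union]
  exact (Finset.card_union_le _ _).trans (add_le_add hS hT)

lemma parity_mem_map_psi {e : Module.Basis (Finset (OddGen p q)) ℂ (Grass p q)}
    (he : IsMonomialBasis e) (F : Set (Finset (OddGen p q))) (x : FunGL p q)
    (hx : x ∈ (spanOf e F).map (psi p q s).toLinearMap) :
    parity p q x ∈ (spanOf e F).map (psi p q s).toLinearMap := by
  obtain ⟨y, hy, rfl⟩ := hx
  exact ⟨_, he.involute_mem F y hy, (parity_psi y).symm⟩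

lemma parity_filPoly (j : ℕ) (x : FunGL p q) (hx : x ∈ filPoly p q s j) :
    parity p q x ∈ filPoly p q s j := by
  obtain ⟨e, he⟩ := exists_isMonomialBasis (OddGen p q)
  rw [filPoly, filPoly_eq he] at hx ⊢
  exact parity_mem_map_psi he _ x hx

lemma one_mem_filPoly_zero : (1 : FunGL p q) ∈ filPoly p q s 0 := by
  rw [filPoly_zero]
  exact one_mem (Algebra.adjoin ℂ (baseVars p q s))

lemma filPoly_mono : Monotone (filPoly p q s) := fun i j h => by
  exact mul_le_mul' le_rfl (pow_le_pow_right' le_sup_left h)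

lemma leftSpan_filPoly_mul (i j : ℕ) : leftSpan (filPoly p q s i) * leftSpan (filPoly p q s j) ≤
    leftSpan (filPoly p q s (i + j)) :=
  (leftSpan_mul _ _ (parity_filPoly j)).trans (leftSpan_mono (filPoly_mul_le i j))

lemma leftSpan_filPoly_pow (j : ℕ) :
    leftSpan (filPoly p q s 1) ^ j ≤ leftSpan (filPoly p q s j) := by
  induction j with
  | zero =>
    rw [pow_zero, Submodule.one_le]
    have := inL_mem_leftSpan (one_mem_filPoly_zero (p := p) (q := q) (s := s))
    rwa [map_one] at this
  | succ j ih =>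
    rw [pow_succ]
    exact (mul_le_mul' ih le_rfl).trans (leftSpan_filPoly_mul j 1)

/-- Hence factors taken from `baseAlg`, such as the entries of α, δ and their inverses, have degree
zero and do not affect the filtration. -/
lemma baseAlg_le : Subalgebra.toSubmodule (baseAlg p q s) ≤ leftSpan (filPoly p q s 0) := by
  intro t ht
  have ht' : t ∈ Algebra.adjoin ℂ (inL p q '' baseVars p q s ∪ Set.range (inR p q)) := ht
  have h1 : (1 : AA p q) ∈ leftSpan (filPoly p q s 0) := by
    have := inL_mem_leftSpan (one_mem_filPoly_zero (p := p) (q := q) (s := s))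
    rwa [map_one] at this
  induction ht' using Algebra.adjoin_induction with
  | mem x hx =>
    obtain ⟨y, hy, rfl⟩ | ⟨y, rfl⟩ := hx
    · refine inL_mem_leftSpan ?_
      rw [filPoly_zero]
      exact Algebra.subset_adjoin hy
    · exact inR_mem_leftSpan one_mem_filPoly_zero y
  | algebraMap c =>
    rw [Algebra.algebraMap_eq_smul_one]
    exact Submodule.smul_mem _ _ h1
  | add x y hx hy ihx ihy => exact add_mem (ihx hx) (ihy hy)
  | mul x y hx hy ihx ihy =>
    exact leftSpan_filPoly_mul 0 0 (Submodule.mul_mem_mul (ihx hx) (ihy hy))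

lemma adjoin_baseVars_le_comap : Algebra.adjoin ℂ (baseVars p q s) ≤
    (baseAlg p q s).comap (comulHom p q) := by
  rw [Algebra.adjoin_le_iff, baseVars_eq]
  rintro _ ⟨i, j, rfl⟩
  exact comul_sXi_mem i j

lemma sZeta_mem_filPoly (i j) : sZeta p q s i j ∈ filPoly p q s 1 := by
  rw [filPoly, pow_one, ← one_mul (sZeta p q s i j)]
  refine Submodule.mul_mem_mul (one_mem (Algebra.adjoin ℂ (baseVars p q s)))
    (Submodule.mem_sup_right (Submodule.subset_span ?_))
  rw [compVars_eq]
  exact ⟨i, j, rfl⟩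

lemma comul_sZeta_mem (i j) : comulHom p q (sZeta p q s i j) ∈ leftSpan (filPoly p q s 1) := by
  have h := congrFun₂ (comul_sZeta (s := s)) i j
  rw [Matrix.map_apply] at h
  rw [h, Matrix.mul_apply]
  refine sum_mem fun k _ => leftSpan_filPoly_mul 0 1 (Submodule.mul_mem_mul
    (baseAlg_le (coefVal_mem _)) ?_)
  rw [Matrix.add_apply, Matrix.mul_apply]
  refine add_mem (sum_mem fun l _ => leftSpan_filPoly_mul 1 0 (Submodule.mul_mem_mul
    (inL_mem_leftSpan (sZeta_mem_filPoly _ _)) (baseAlg_le (coefVal_mem _)))) ?_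
  exact leftSpan_mono (filPoly_mono zero_le_one) (baseAlg_le (inR_mem_baseAlg _))

/-- Multiplicativity reduces this to generators: Δ(ξ) has degree zero and Δ(ζ) degree at most one in
ζ₁. -/
lemma comul_filPoly (j : ℕ) :
    (filPoly p q s j).map (comulHom p q).toLinearMap ≤ leftSpan (filPoly p q s j) := by
  have h0 : (Subalgebra.toSubmodule (Algebra.adjoin ℂ (baseVars p q s))).map
      (comulHom p q).toLinearMap ≤ leftSpan (filPoly p q s 0) := by
    rintro _ ⟨x, hx, rfl⟩
    exact baseAlg_le (adjoin_baseVars_le_comap hx)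
  have h1 : (1 ⊔ Submodule.span ℂ (compVars p q s)).map (comulHom p q).toLinearMap ≤
      leftSpan (filPoly p q s 1) := by
    rw [Submodule.map_sup, Submodule.map_one]
    refine sup_le ?_ ?_
    · rw [Submodule.one_le]
      exact leftSpan_mono (filPoly_mono zero_le_one) (baseAlg_le (one_mem (baseAlg p q s)))
    · rw [Submodule.map_span_le, compVars_eq]
      rintro _ ⟨i, j, rfl⟩
      exact comul_sZeta_mem i j
  rw [filPoly, Submodule.map_mul, Submodule.map_pow]
  refine (mul_le_mul' h0 ((pow_le_pow_left' h1 j).trans (leftSpan_filPoly_pow j))).trans ?_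
  have := leftSpan_filPoly_mul (p := p) (q := q) (s := s) 0 j
  rwa [zero_add] at this

end filPoly

/-! ### The coaction on the induced comodule -/

section coaction
variable {p q : ℕ} {V : Type*} [AddCommGroup V] [Module ℂ V] {s : Side}
  {β : V →ₗ[ℂ] V ⊗[ℂ] FunGL0 p q}

variable (p q V) in
/-- The identification of `V ⊗ (A ⊗ A)` with `(V ⊗ A) ⊗ A`. -/
def assocAA : V ⊗[ℂ] AA p q →ₗ[ℂ] (V ⊗[ℂ] FunGL p q) ⊗[ℂ] FunGL p q :=
  (TensorProduct.assoc ℂ V _ _).symm.toLinearMap ∘ₗ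
    (GradedTensorProduct.of ℂ (gr p q) (gr p q)).symm.toLinearMap.lTensor V

lemma assocAA_tmul (v : V) (x y : FunGL p q) :
    assocAA p q V (v ⊗ₜ (inL p q x * inR p q y)) = (v ⊗ₜ x) ⊗ₜ y := by
  rw [inL_mul_inR]
  rfl

lemma cofree_eq (t : V ⊗[ℂ] FunGL p q) : cofree V (comul p q) t =
    assocAA p q V ((comulHom p q).toLinearMap.lTensor V t) := by
  rw [assocAA, LinearMap.comp_apply, ← LinearMap.lTensor_comp_apply]
  rfl

variable (s β) in
/-- The parameterisation in the left factor. -/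
def param2 : V ⊗[ℂ] AA p q →ₗ[ℂ] (V ⊗[ℂ] FunGL p q) ⊗[ℂ] FunGL p q :=
  (param s β).rTensor (FunGL p q) ∘ₗ assocAA p q V

lemma param2_tmul (v : V) (x y : FunGL p q) :
    param2 s β (v ⊗ₜ (inL p q x * inR p q y)) = param s β (v ⊗ₜ x) ⊗ₜ y := by
  rw [param2, LinearMap.comp_apply, assocAA_tmul, LinearMap.rTensor_tmul]

lemma AA_inL_inR_induction {P : AA p q → Prop} (t : AA p q)
    (tmul : ∀ x y, P (inL p q x * inR p q y)) (add : ∀ x y, P x → P y → P (x + y)) : P t := by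
  refine AA_induction (t := t) (add := add) (hom := fun i j x _ y _ => ?_)
  rw [← inL_mul_inR]
  exact tmul x y

lemma param2_eq (v : V) (t : AA p q) : param2 s β (v ⊗ₜ t) = assocAA p q V
    ((LinearMap.mulRight ℂ t ∘ₗ ((inL p q).comp (subst p q s)).toLinearMap).lTensor V (β v)) := by
  induction t using AA_inL_inR_induction with
  | add x y hx hy =>
    have : (LinearMap.mulRight ℂ (x + y) : AA p q →ₗ[ℂ] AA p q) =
        LinearMap.mulRight ℂ x + LinearMap.mulRight ℂ y := by
      ext; simp [mul_add]
    rw [TensorProduct.tmul_add, map_add, hx, hy, this, LinearMap.add_comp, LinearMap.lTensor_add,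
      LinearMap.add_apply, map_add]
  | tmul x y =>
    rw [param2_tmul, param_tmul]
    induction β v using TensorProduct.induction_on with
    | zero => simp
    | add a b ha hb => rw [map_add, TensorProduct.add_tmul, ha, hb, map_add, map_add]
    | tmul v r =>
      simp only [LinearMap.lTensor_tmul, LinearMap.comp_apply, AlgHom.toLinearMap_apply,
        LinearMap.mulRight_apply, AlgHom.comp_apply]
      rw [← mul_assoc, ← map_mul, assocAA_tmul]

/-- The coaction in parameters. By `comulHom_subst` and coassociativity of β, the factor 𝒟(A₁,T₁) is
absorbed in the parameterisation, and F is replaced by 𝒟(α,δ)Δ(F). All assertions on the coaction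
are proved with this formula. -/
theorem cofree_param {gV : ZMod 2 → Submodule ℂ V}
    (hβ : IsSuperComodule (comul0 p q).toLinearMap (counit0 p q).toLinearMap (gr0 p q) gV β)
    (v : V) (F : FunGL p q) : cofree V (comul p q) (param s β (v ⊗ₜ F)) = param2 s β
      ((LinearMap.mulRight ℂ (comulHom p q F) ∘ₗ (kappa p q s).toLinearMap).lTensor V (β v)) := by
  rw [param_tmul, cofree_eq]
  have h1 : ∀ t : V ⊗[ℂ] FunGL0 p q, param2 s β
      ((LinearMap.mulRight ℂ (comulHom p q F) ∘ₗ (kappa p q s).toLinearMap).lTensor V t) =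
      assocAA p q V ((LinearMap.mulRight ℂ (comulHom p q F) ∘ₗ
        (liftKappa p q s (subst p q s)).toLinearMap).lTensor V
          (TensorProduct.assoc ℂ V _ _ (β.rTensor _ t))) := fun t => by
    induction t using TensorProduct.induction_on with
    | zero => simp
    | add a b ha hb => simp only [map_add, ha, hb]
    | tmul v r =>
      rw [LinearMap.lTensor_tmul, param2_eq, LinearMap.rTensor_tmul]
      congr 1
      induction β v using TensorProduct.induction_on with
      | zero => simp
      | add a b ha hb => simp only [map_add, TensorProduct.add_tmul, ha, hb]
      | tmul w r' => simp [liftKappa_tmul, mul_assoc]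
  rw [h1, hβ.coassoc, ← LinearMap.lTensor_comp_apply, ← LinearMap.lTensor_comp_apply]
  congr 3
  ext r
  simp [comulHom_subst]

lemma param2_mem {P : Submodule ℂ (FunGL p q)} {t : AA p q} (ht : t ∈ leftSpan P) (v : V) :
    param2 s β (v ⊗ₜ t) ∈ LinearMap.range ((elems s β P).subtype.rTensor (FunGL p q)) := by
  rw [leftSpan] at ht
  induction ht using Submodule.mul_induction_on' with
  | mem_mul_mem x hx y hy =>
    obtain ⟨x, hx, rfl⟩ := hx
    obtain ⟨y, rfl⟩ := hy
    refine ⟨(⟨param s β (v ⊗ₜ x), ⟨_, ⟨v ⊗ₜ ⟨x, hx⟩, rfl⟩, rfl⟩⟩ : elems s β P) ⊗ₜ y, ?_⟩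
    exact (param2_tmul v x y).symm
  | add x _ y _ ihx ihy =>
    rw [TensorProduct.tmul_add, map_add]
    exact add_mem ihx ihy

lemma elems_induction {P : Submodule ℂ (FunGL p q)} {M : V ⊗[ℂ] FunGL p q → Prop}
    (zero : M 0) (tmul : ∀ v, ∀ F ∈ P, M (param s β (v ⊗ₜ F)))
    (add : ∀ x y, M x → M y → M (x + y)) (u : V ⊗[ℂ] FunGL p q) (hu : u ∈ elems s β P) : M u := by
  obtain ⟨_, ⟨t, rfl⟩, rfl⟩ := hu
  induction t using TensorProduct.induction_on with
  | zero => simpa using zero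
  | add a b ha hb => rw [map_add, map_add]; exact add _ _ ha hb
  | tmul v F => exact tmul v F F.2

theorem elems_stable {gV : ZMod 2 → Submodule ℂ V}
    (hβ : IsSuperComodule (comul0 p q).toLinearMap (counit0 p q).toLinearMap (gr0 p q) gV β)
    {P : Submodule ℂ (FunGL p q)}
    (hP : ∀ r, ∀ F ∈ P, kappa p q s r * comulHom p q F ∈ leftSpan P)
    (u : V ⊗[ℂ] FunGL p q) (hu : u ∈ elems s β P) : cofree V (comul p q) u ∈
      LinearMap.range ((elems s β P).subtype.rTensor (FunGL p q)) := by
  refine elems_induction (M := fun u => cofree V (comul p q) u ∈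
    LinearMap.range ((elems s β P).subtype.rTensor (FunGL p q))) ?_ (fun v F hF => ?_)
    (fun x y hx hy => ?_) u hu
  · rw [map_zero]; exact zero_mem _
  · rw [cofree_param hβ]
    induction β v using TensorProduct.induction_on with
    | zero => simp
    | add a b ha hb => rw [map_add, map_add]; exact add_mem ha hb
    | tmul v r => exact param2_mem (hP r F hF) v
  · rw [map_add]; exact add_mem hx hy

lemma omega_parity {gV : ZMod 2 → Submodule ℂ V}
    (hβ : IsSuperComodule (comul0 p q).toLinearMap (counit0 p q).toLinearMap (gr0 p q) gV β)
    {σ : V →ₗ[ℂ] V} (hσ : IsInv gV σ) (t : V ⊗[ℂ] Grass p q) :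
    TensorProduct.map σ (parity p q) (omega s β t) = omega s β (TensorProduct.map σ
      (CliffordAlgebra.involute (Q := (0 : QuadraticForm ℂ (OddGen p q → ℂ)))).toLinearMap t) := by
  induction t using TensorProduct.induction_on with
  | zero => simp
  | add a b ha hb => simp only [map_add, ha, hb]
  | tmul v x =>
    rw [TensorProduct.map_tmul, omega_tmul, omega_tmul, ← hβ.parity_comm hσ (isInv_gr0 p q)]
    induction β v using TensorProduct.induction_on with
    | zero => simp
    | add a b ha hb => simp only [map_add, ha, hb]
    | tmul v r =>
      simp only [LinearMap.lTensor_tmul, LinearMap.comp_apply, AlgHom.toLinearMap_apply,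
        LinearMap.mulRight_apply, TensorProduct.map_tmul, parity_mul, parity_subst, parity_psi,
        LinearMap.id_apply]

lemma map_omega_parity {gV : ZMod 2 → Submodule ℂ V}
    (hβ : IsSuperComodule (comul0 p q).toLinearMap (counit0 p q).toLinearMap (gr0 p q) gV β)
    {σ : V →ₗ[ℂ] V} (hσ : IsInv gV σ)
    {e : Module.Basis (Finset (OddGen p q)) ℂ (Grass p q)} (he : IsMonomialBasis e)
    (F : Set (Finset (OddGen p q))) (u : V ⊗[ℂ] FunGL p q)
    (hu : u ∈ (LinearMap.range ((spanOf e F).subtype.lTensor V)).map (omega s β)) :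
    TensorProduct.map σ (parity p q) u ∈
      (LinearMap.range ((spanOf e F).subtype.lTensor V)).map (omega s β) := by
  obtain ⟨_, ⟨t, rfl⟩, rfl⟩ := hu
  refine ⟨_, ?_, (omega_parity hβ hσ _).symm⟩
  induction t using TensorProduct.induction_on with
  | zero => simp
  | add a b ha hb => rw [map_add, map_add]; exact add_mem ha hb
  | tmul v x => exact ⟨σ v ⊗ₜ ⟨_, he.involute_mem F x x.2⟩, rfl⟩

theorem isSubcomodule_kacFil {gV : ZMod 2 → Submodule ℂ V}
    (hβ : IsSuperComodule (comul0 p q).toLinearMap (counit0 p q).toLinearMap (gr0 p q) gV β)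
    (s : Side) (j : ℕ) :
    IsSubcomodule (tensorGr gV (gr p q)) (cofree V (comul p q)) (kacFil s β j) := by
  obtain ⟨σ, hσ⟩ := exists_isInv hβ.isInternal
  obtain ⟨e, he⟩ := exists_isMonomialBasis (OddGen p q)
  refine isSubcomodule_of_inv (hσ.tensor (isInv_gr p q)) (fun u hu => ?_)
    (elems_stable hβ fun r F hF => ?_)
  · rw [kacFil_eq he] at hu ⊢
    exact map_omega_parity hβ hσ he _ u hu
  · have := leftSpan_filPoly_mul (p := p) (q := q) (s := s) 0 j
    rw [zero_add] at this
    exact this (Submodule.mul_mem_mul (baseAlg_le (kappa_mem r)) (comul_filPoly j ⟨F, hF, rfl⟩))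

/-- The induced space is the top of the filtration, so no separate argument is needed. -/
theorem isSubcomodule_ind {gV : ZMod 2 → Submodule ℂ V}
    (hβ : IsSuperComodule (comul0 p q).toLinearMap (counit0 p q).toLinearMap (gr0 p q) gV β) :
    IsSubcomodule (tensorGr gV (gr p q)) (cofree V (comul p q))
      (ind (comul p q) (proj0 p q).toLinearMap β) :=
  kacFil_top (s := .plus) hβ ▸ isSubcomodule_kacFil hβ .plus (p * q)

theorem isSuperComodule_ind {gV : ZMod 2 → Submodule ℂ V}
    (hβ : IsSuperComodule (comul0 p q).toLinearMap (counit0 p q).toLinearMap (gr0 p q) gV β)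
    (h : IsSubcomodule (tensorGr gV (gr p q)) (cofree V (comul p q))
      (ind (comul p q) (proj0 p q).toLinearMap β)) :
    IsSuperComodule (comul p q) (counit p q) (gr p q)
      (restrictGr (tensorGr gV (gr p q)) (ind (comul p q) (proj0 p q).toLinearMap β))
      h.coaction := by
  obtain ⟨σ, hσ⟩ := exists_isInv hβ.isInternal
  exact (isSuperComodule_cofree hσ).restrict (isInv_gr p q) h

end coaction

/-! ### Primitive elements -/

section primitive
variable {p q : ℕ} {s : Side}

lemma parProj_evenHom (r : FunGL0 p q) : parProj p q s (evenHom p q r) = parEven p q r := by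
  change toPar p q (Algebra.TensorProduct.map _ _ (r ⊗ₜ 1)) = toPar p q (r ⊗ₜ 1)
  simp

lemma parProj_oddEl (l : OddGen p q) : parProj p q s (oddEl l) = toPar p q
    (1 ⊗ₜ ExteriorAlgebra.ι ℂ (fun k => (Pi.single l 1 : OddGen p q → ℂ) (sideGen s k))) := by
  change toPar p q (Algebra.TensorProduct.map _ _ (1 ⊗ₜ ExteriorAlgebra.ι ℂ (Pi.single l 1))) = _
  rw [Algebra.TensorProduct.map_tmul, map_one, ExteriorAlgebra.map_apply_ι]
  rfl

lemma gC_notMem (i j) (k : Fin p × Fin q) : sideGen s k ≠ gC s i j := fun h =>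
  Set.disjoint_left.1 (isCompl_baseIdx (s := s)).disjoint ⟨k, rfl⟩
    (by rw [compIdx_eq]; exact ⟨i, j, h⟩)

lemma parProj_sC (i j) : parProj p q s (sC p q s i j) = 0 := by
  refine (parProj_oddEl _).trans ?_
  have : (fun k => (Pi.single (gC s i j) 1 : OddGen p q → ℂ) (sideGen s k)) = 0 := by
    funext k
    exact Pi.single_eq_of_ne (gC_notMem i j k) _
  rw [this, map_zero, TensorProduct.tmul_zero, map_zero]

variable (p q) in
/-- The retraction of the parabolic quotient onto its even part. -/
def parRet : Par p q →ₐ[ℂ] FunGL0 p q :=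
  ((Algebra.TensorProduct.rid ℂ ℂ (FunGL0 p q)).toAlgHom.comp
    (Algebra.TensorProduct.map (AlgHom.id ℂ (FunGL0 p q)) ExteriorAlgebra.algebraMapInv)).comp
      (toPar p q).symm.toAlgHom

lemma parRet_parEven (r : FunGL0 p q) : parRet p q (parEven p q r) = r := by
  change (Algebra.TensorProduct.rid ℂ ℂ (FunGL0 p q)) (Algebra.TensorProduct.map _ _ (r ⊗ₜ 1)) = r
  simp

lemma parRet_parProj (x : FunGL p q) : parRet p q (parProj p q s x) = proj0 p q x := by
  have : (parRet p q).comp (parProj p q s) = proj0 p q := by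
    refine FunGL_hom_ext (fun r => ?_) fun k => ?_
    · rw [AlgHom.comp_apply, parProj_evenHom, parRet_parEven, proj0_even]
    · rw [AlgHom.comp_apply, parProj_oddEl, proj0_odd]
      change (Algebra.TensorProduct.rid ℂ ℂ (FunGL0 p q))
        (Algebra.TensorProduct.map _ _ (1 ⊗ₜ ExteriorAlgebra.ι ℂ _)) = 0
      simp [ExteriorAlgebra.algebraMapInv]
  exact DFunLike.congr_fun this x

section
variable {W : Type*} [AddCommGroup W] [Module ℂ W] {γ : W →ₗ[ℂ] W ⊗[ℂ] FunGL p q}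

/-- The even part is a retract of the parabolic quotient, so an element independent of the odd
generators equals its own even part. Membership in a range becomes an equation. -/
lemma mem_primitive_iff {w : W} : w ∈ primitive s γ ↔ (parProj p q s).toLinearMap.lTensor W (γ w) =
    ((parEven p q).toLinearMap ∘ₗ (proj0 p q).toLinearMap).lTensor W (γ w) := by
  have e : (parEven p q).toLinearMap ∘ₗ (proj0 p q).toLinearMap =
      ((parEven p q).toLinearMap ∘ₗ (parRet p q).toLinearMap) ∘ₗ (parProj p q s).toLinearMap := by
    ext x
    simp [parRet_parProj]
  constructor
  · rintro ⟨t, ht⟩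
    rw [LinearMap.comp_apply] at ht
    rw [e, LinearMap.lTensor_comp_apply _ _ _ (γ w), ← ht, ← LinearMap.lTensor_comp_apply]
    congr 2
    ext r
    simp [parRet_parEven]
  · intro h
    refine ⟨(proj0 p q).toLinearMap.lTensor W (γ w), ?_⟩
    rw [← LinearMap.lTensor_comp_apply, ← h, LinearMap.comp_apply]

lemma map_primitive_coaction {gW : ZMod 2 → Submodule ℂ W} {U : Submodule ℂ W}
    (h : IsSubcomodule gW γ U) :
    (primitive s h.coaction).map U.subtype = U ⊓ primitive s γ := by
  have nat : ∀ (f : FunGL p q →ₗ[ℂ] Par p q) (t), f.lTensor W (U.subtype.rTensor _ t) =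
      U.subtype.rTensor _ (f.lTensor U t) := fun f t => by
    rw [← LinearMap.comp_apply, LinearMap.lTensor_comp_rTensor, ← LinearMap.rTensor_comp_lTensor]
    rfl
  have key : ∀ u : U, u ∈ primitive s h.coaction ↔ (u : W) ∈ primitive s γ := fun u => by
    rw [mem_primitive_iff, mem_primitive_iff, ← h.coaction_spec, nat, nat,
      (subtype_rTensor_injective U).eq_iff]
  ext w
  constructor
  · rintro ⟨u, hu, rfl⟩
    exact ⟨u.2, (key u).1 hu⟩
  · rintro ⟨hw, hp⟩
    exact ⟨⟨w, hw⟩, (key ⟨w, hw⟩).2 hp, rfl⟩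

/-- The tangent functional in a direction of one side sees only the corresponding parabolic
quotient. Therefore it vanishes on primitive coefficients. -/
lemma oddFunctional_eq (k : Fin p × Fin q) (x : FunGL p q) : oddFunctional s k x =
    (LinearMap.mul' ℂ ℂ ∘ₗ TensorProduct.map (counit0 p q).toLinearMap
      (LinearMap.proj k ∘ₗ ExteriorAlgebra.ιInv) ∘ₗ (toPar p q).symm.toLinearMap)
        (parProj p q s x) := by
  induction x using FunGL_induction with
  | add x y hx hy => simp only [map_add, hx, hy]
  | tmul r w =>
    have h := LinearMap.congr_fun (ExteriorAlgebra.ιInv_comp_map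
      (LinearMap.funLeft ℂ ℂ (sideGen (p := p) (q := q) s))) w
    simp only [LinearMap.comp_apply, AlgHom.toLinearMap_apply] at h
    simp [oddFunctional, parProj, h, LinearMap.funLeft_apply]

lemma oddFunctional_evenHom (k : Fin p × Fin q) (r : FunGL0 p q) :
    oddFunctional s k (evenHom p q r) = 0 := by
  change LinearMap.mul' ℂ ℂ (TensorProduct.map _ _ (r ⊗ₜ 1)) = 0
  have : ExteriorAlgebra.ιInv (1 : Grass p q) = 0 := by
    -- Naturality with respect to the zero map shows that the linear part of 1 is zero.
    have h := LinearMap.congr_fun (ExteriorAlgebra.ιInv_comp_map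
      (0 : (OddGen p q → ℂ) →ₗ[ℂ] (OddGen p q → ℂ))) 1
    simp only [LinearMap.comp_apply, AlgHom.toLinearMap_apply, map_one] at h
    exact h
  simp [this]

lemma oddOp_of_primitive {w : W} (hw : w ∈ primitive s γ) (k : Fin p × Fin q) :
    oddOp s γ k w = 0 := by
  rw [mem_primitive_iff] at hw
  have e : oddFunctional s k = (LinearMap.mul' ℂ ℂ ∘ₗ TensorProduct.map (counit0 p q).toLinearMap
      (LinearMap.proj k ∘ₗ ExteriorAlgebra.ιInv) ∘ₗ (toPar p q).symm.toLinearMap) ∘ₗ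
        (parProj p q s).toLinearMap := LinearMap.ext (oddFunctional_eq k)
  rw [oddOp, LinearMap.comp_apply, LinearMap.comp_apply, e, LinearMap.lTensor_comp_apply, hw,
    ← LinearMap.lTensor_comp_apply]
  have z : (LinearMap.mul' ℂ ℂ ∘ₗ TensorProduct.map (counit0 p q).toLinearMap
      (LinearMap.proj k ∘ₗ ExteriorAlgebra.ιInv) ∘ₗ (toPar p q).symm.toLinearMap) ∘ₗ
        (parEven p q).toLinearMap ∘ₗ (proj0 p q).toLinearMap = 0 := by
    ext x
    have h := oddFunctional_eq (s := s) k (evenHom p q (proj0 p q x))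
    rw [oddFunctional_evenHom, parProj_evenHom] at h
    exact h.symm
  rw [z, LinearMap.lTensor_zero, LinearMap.zero_apply, map_zero]

end

/-! ### Killing one block of odd generators -/

variable (p q s) in
/-- The homomorphism that kills the block `C` for `plus`, `B` for `minus`. -/
def killC : FunGL p q →ₐ[ℂ] FunGL p q :=
  liftFun (evenHom p q) (liftOdd (oddFun s (sB p q s) 0) fun k l =>
    superOdd_anticomm (σ := parity p q) (oddFun_mem sB_mem (fun _ _ => zero_mem _) k)
      (oddFun_mem sB_mem (fun _ _ => zero_mem _) l))
    fun r _ => (Subalgebra.mem_center_iff.1 (evenHom_mem_center r) _).symm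

lemma killC_evenHom (r : FunGL0 p q) : killC p q s (evenHom p q r) = evenHom p q r :=
  liftFun_even _ _ (fun r _ => (Subalgebra.mem_center_iff.1 (evenHom_mem_center r) _).symm) _

lemma killC_oddEl (k : OddGen p q) : killC p q s (oddEl k) = oddFun s (sB p q s) 0 k :=
  (liftFun_odd _ _ (fun r _ => (Subalgebra.mem_center_iff.1 (evenHom_mem_center r) _).symm)
    (theta k)).trans (liftOdd_theta _ _ _)

lemma killC_sB (i j) : killC p q s (sB p q s i j) = sB p q s i j :=
  (killC_oddEl _).trans (oddFun_gB _ _ _ _)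

lemma killC_sC (i j) : killC p q s (sC p q s i j) = 0 :=
  (killC_oddEl _).trans (oddFun_gC _ _ _ _)

lemma isEvenHom_killC : IsEvenHom (killC p q s) := by
  have : (parityHom p q).comp (killC p q s) = (killC p q s).comp (parityHom p q) := by
    refine FunGL_hom_ext (fun r => ?_) fun k => ?_ <;>
      rw [AlgHom.comp_apply, AlgHom.comp_apply, parityHom_apply, parityHom_apply]
    · rw [parity_evenHom, killC_evenHom, parity_evenHom]
    · rw [parity_oddEl, map_neg, killC_oddEl]
      exact (oddFun_mem (σ := parity p q) sB_mem (fun _ _ => zero_mem _) k).2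
  exact DFunLike.congr_fun this

lemma isEvenHom_even : IsEvenHom ((evenHom p q).comp (proj0 p q)) := by
  have : (parityHom p q).comp ((evenHom p q).comp (proj0 p q)) =
      ((evenHom p q).comp (proj0 p q)).comp (parityHom p q) := by
    refine FunGL_hom_ext (fun r => ?_) fun k => ?_ <;>
      simp only [AlgHom.comp_apply, parityHom_apply]
    · rw [proj0_even, parity_evenHom, proj0_even]
    · rw [parity_oddEl, map_neg, proj0_odd]
      simp
  exact DFunLike.congr_fun this

/-- Thus the projection may be preceded by an even endomorphism of A(p,q), and the conditions can be
checked inside the super tensor square. -/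
lemma parProj_killC (x : FunGL p q) : parProj p q s (killC p q s x) = parProj p q s x := by
  have : (parProj p q s).comp (killC p q s) = parProj p q s := by
    refine FunGL_hom_ext (fun r => ?_) fun k => ?_
    · rw [AlgHom.comp_apply, killC_evenHom]
    · rw [AlgHom.comp_apply]
      obtain ⟨i, j, rfl⟩ | ⟨i, j, rfl⟩ := oddGen_cases s k
      · exact congrArg _ (killC_sB i j)
      · exact (congrArg _ (killC_sC i j)).trans ((map_zero _).trans (parProj_sC i j).symm)
  exact DFunLike.congr_fun this x

variable (p q s) in
/-- Killing the block `C` in the right factor. -/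
def killC2 : AA p q →ₐ[ℂ] AA p q := mapAA (AlgHom.id ℂ _) (killC p q s) isEvenHom_id isEvenHom_killC

variable (p q) in
/-- Killing all odd generators in the right factor. -/
def killOdd2 : AA p q →ₐ[ℂ] AA p q :=
  mapAA (AlgHom.id ℂ _) ((evenHom p q).comp (proj0 p q)) isEvenHom_id isEvenHom_even

lemma mapAA_inL (f g : FunGL p q →ₐ[ℂ] FunGL p q) (hf : IsEvenHom f) (hg : IsEvenHom g) (x) :
    mapAA f g hf hg (inL p q x) = inL p q (f x) := liftAA_inL _ _ _ _

lemma mapAA_inR (f g : FunGL p q →ₐ[ℂ] FunGL p q) (hf : IsEvenHom f) (hg : IsEvenHom g) (x) :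
    mapAA f g hf hg (inR p q x) = inR p q (g x) := liftAA_inR _ _ _ _

lemma killC2_inR_sC : ((sC p q s).map (inR p q)).map (killC2 p q s) = 0 := by
  ext i j
  change killC2 p q s (inR p q (sC p q s i j)) = 0
  rw [killC2, mapAA_inR, killC_sC, map_zero]

lemma killOdd2_inR_sC : ((sC p q s).map (inR p q)).map (killOdd2 p q) = 0 := by
  ext i j
  change killOdd2 p q (inR p q (sC p q s i j)) = 0
  rw [killOdd2, mapAA_inR, AlgHom.comp_apply, show proj0 p q (sC p q s i j) = 0 from proj0_odd _,
    map_zero, map_zero]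

lemma kill_inR_evenHom (r : FunGL0 p q) : killC2 p q s (inR p q (evenHom p q r)) =
    killOdd2 p q (inR p q (evenHom p q r)) := by
  rw [killC2, killOdd2, mapAA_inR, mapAA_inR, killC_evenHom, AlgHom.comp_apply, proj0_even]

lemma kill_inL (x : FunGL p q) : killC2 p q s (inL p q x) = killOdd2 p q (inL p q x) := by
  rw [killC2, killOdd2, mapAA_inL, mapAA_inL]

/-- For C₂ = 0 one has α = A₂ and δ = D₂, in which no B₂ is left to be killed. -/
lemma kill_kappa (r : FunGL0 p q) :
    killC2 p q s (kappa p q s r) = killOdd2 p q (kappa p q s r) := by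
  have hA : (alpha p q s).map (killC2 p q s) = (alpha p q s).map (killOdd2 p q) := by
    rw [alpha_eq, Matrix.map_add _ (map_add _), Matrix.map_add _ (map_add _), Matrix.map_mul,
      Matrix.map_mul, killC2_inR_sC, killOdd2_inR_sC, Matrix.mul_zero, Matrix.mul_zero]
    congr 1
    ext i j
    exact kill_inR_evenHom _
  have hD : (delta p q s).map (killC2 p q s) = (delta p q s).map (killOdd2 p q) := by
    rw [delta_eq, Matrix.map_sub _ (map_sub _), Matrix.map_sub _ (map_sub _), Matrix.map_mul,
      Matrix.map_mul, killC2_inR_sC, killOdd2_inR_sC, Matrix.zero_mul, Matrix.zero_mul]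
    congr 1
    ext i j
    exact kill_inR_evenHom _
  have : (killC2 p q s).comp (kappa p q s) = (killOdd2 p q).comp (kappa p q s) := by
    rw [← kappa_sA0] at hA
    rw [← kappa_sD0] at hD
    exact FunGL0_side_hom_ext s (fun i j => congrFun₂ hA i j) fun i j => congrFun₂ hD i j
  exact DFunLike.congr_fun this r

/-- For C₂ = 0 the relation δΔ(ζ) = ζ₁α + C₂ reads D₂Δ(ζ) = ζ₁A₂, whether or not B₂ is killed too;
D₂ cancels. -/
lemma kill_comul_sZeta : ((sZeta p q s).map (comulHom p q)).map (killC2 p q s) =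
    ((sZeta p q s).map (comulHom p q)).map (killOdd2 p q) := by
  have h := delta_mul_comul_sZeta (p := p) (q := q) (s := s)
  have h1 := congrArg (fun M => M.map (killC2 p q s)) h
  have h2 := congrArg (fun M => M.map (killOdd2 p q)) h
  simp only [Matrix.map_mul, Matrix.map_add _ (map_add (killC2 p q s)),
    Matrix.map_add _ (map_add (killOdd2 p q)), killC2_inR_sC, killOdd2_inR_sC, add_zero] at h1 h2
  have hk : ∀ {m n : ℕ} (M : Matrix (Fin m) (Fin n) (FunGL0 p q)),
      (M.map (kappa p q s)).map (killC2 p q s) = (M.map (kappa p q s)).map (killOdd2 p q) :=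
    fun M => by ext i j; exact kill_kappa _
  have hl : ((sZeta p q s).map (inL p q)).map (killC2 p q s) =
      ((sZeta p q s).map (inL p q)).map (killOdd2 p q) := by ext i j; exact kill_inL _
  rw [← kappa_sA0, ← kappa_sD0] at h2
  rw [hl, ← kappa_sA0, ← kappa_sD0, hk, hk, ← h2] at h1
  exact map_mul_cancel ((killOdd2 p q).comp (kappa p q s)) isUnit_det_sD0 h1

lemma kill_comul_adjoin (F : FunGL p q) (hF : F ∈ Algebra.adjoin ℂ (compVars p q s)) :
    killC2 p q s (comulHom p q F) = killOdd2 p q (comulHom p q F) := by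
  have : Algebra.adjoin ℂ (compVars p q s) ≤ AlgHom.equalizer ((killC2 p q s).comp (comulHom p q))
      ((killOdd2 p q).comp (comulHom p q)) := by
    rw [Algebra.adjoin_le_iff, compVars_eq]
    rintro _ ⟨i, j, rfl⟩
    exact congrFun₂ kill_comul_sZeta i j
  exact this hF

end primitive

/-! ### Polynomials in the composite variables give primitive elements -/

section
variable {p q : ℕ} {V : Type*} [AddCommGroup V] [Module ℂ V] {s : Side}
  {β : V →ₗ[ℂ] V ⊗[ℂ] FunGL0 p q}

lemma lTensor_param2 (g : FunGL p q →ₐ[ℂ] FunGL p q) (hg : IsEvenHom g) (t : V ⊗[ℂ] AA p q) :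
    g.toLinearMap.lTensor _ (param2 s β t) = param2 s β
      ((mapAA (AlgHom.id ℂ _) g isEvenHom_id hg).toLinearMap.lTensor V t) := by
  induction t using TensorProduct.induction_on with
  | zero => simp
  | add a b ha hb => simp only [map_add, ha, hb]
  | tmul v t =>
    induction t using AA_inL_inR_induction with
    | add x y hx hy => rw [TensorProduct.tmul_add, map_add, map_add, map_add, map_add, hx, hy]
    | tmul x y =>
      rw [param2_tmul, LinearMap.lTensor_tmul, LinearMap.lTensor_tmul, AlgHom.toLinearMap_apply,
        AlgHom.toLinearMap_apply, map_mul, mapAA_inL, mapAA_inR, param2_tmul]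
      rfl

theorem elems_comp_le_primitive {gV : ZMod 2 → Submodule ℂ V}
    (hβ : IsSuperComodule (comul0 p q).toLinearMap (counit0 p q).toLinearMap (gr0 p q) gV β) :
    elems s β (Subalgebra.toSubmodule (Algebra.adjoin ℂ (compVars p q s))) ≤
      primitive s (cofree V (comul p q)) := by
  intro u hu
  refine elems_induction (M := fun u => u ∈ primitive s (cofree V (comul p q))) (zero_mem _)
    (fun v F hF => ?_) (fun x y hx hy => add_mem hx hy) u hu
  rw [mem_primitive_iff, cofree_param hβ]
  set t := (LinearMap.mulRight ℂ (comulHom p q F) ∘ₗ (kappa p q s).toLinearMap).lTensor V (β v)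
    with ht
  have e1 : (parProj p q s).toLinearMap =
      (parProj p q s).toLinearMap ∘ₗ (killC p q s).toLinearMap := by
    ext x; exact (parProj_killC x).symm
  have e2 : (parEven p q).toLinearMap ∘ₗ (proj0 p q).toLinearMap = (parProj p q s).toLinearMap ∘ₗ
      ((evenHom p q).comp (proj0 p q)).toLinearMap := by
    ext x; exact (parProj_evenHom _).symm
  have hL : ∀ x : (V ⊗[ℂ] FunGL p q) ⊗[ℂ] FunGL p q, (parProj p q s).toLinearMap.lTensor _ x =
      (parProj p q s).toLinearMap.lTensor _ ((killC p q s).toLinearMap.lTensor _ x) := fun x => by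
    rw [← LinearMap.lTensor_comp_apply, ← e1]
  have e3 : (killC2 p q s).toLinearMap.lTensor V t = (killOdd2 p q).toLinearMap.lTensor V t := by
    rw [ht, ← LinearMap.lTensor_comp_apply, ← LinearMap.lTensor_comp_apply]
    congr 2
    ext r
    simp only [LinearMap.comp_apply, AlgHom.toLinearMap_apply, LinearMap.mulRight_apply, map_mul,
      kill_kappa, kill_comul_adjoin F hF]
  rw [e2, hL, LinearMap.lTensor_comp_apply, lTensor_param2 _ isEvenHom_killC,
    lTensor_param2 _ isEvenHom_even]
  exact congrArg (fun z => (parProj p q s).toLinearMap.lTensor _ (param2 s β z)) e3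

end

/-! ### The odd root vectors -/

section derivation
variable {p q : ℕ} {s : Side}

/-- The action of an odd root vector on functions. -/
def oddDer (s : Side) (k : Fin p × Fin q) : FunGL p q →ₗ[ℂ] FunGL p q :=
  (TensorProduct.rid ℂ _).toLinearMap ∘ₗ (oddFunctional s k).lTensor _ ∘ₗ comul p q

/-- The contraction of the right factor of the super tensor square. -/
def contractAA (f : FunGL p q →ₗ[ℂ] ℂ) : AA p q →ₗ[ℂ] FunGL p q :=
  (TensorProduct.rid ℂ _).toLinearMap ∘ₗ f.lTensor _ ∘ₗ
    (GradedTensorProduct.of ℂ (gr p q) (gr p q)).symm.toLinearMap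

lemma contractAA_tmul (f : FunGL p q →ₗ[ℂ] ℂ) (x y : FunGL p q) :
    contractAA f (inL p q x * inR p q y) = f y • x := by
  rw [inL_mul_inR]
  rfl

lemma oddDer_apply (k : Fin p × Fin q) (x : FunGL p q) :
    oddDer s k x = contractAA (oddFunctional s k) (comulHom p q x) := rfl

lemma contractAA_counit (x : FunGL p q) :
    contractAA (counitHom p q).toLinearMap (comulHom p q x) = x := comul_counit x

lemma oddFunctional_toA (k : Fin p × Fin q) (r : FunGL0 p q) (w : Grass p q) :
    oddFunctional s k (toA p q (r ⊗ₜ w)) =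
      counit0 p q r * ExteriorAlgebra.ιInv w (sideGen s k) := by
  simp [oddFunctional]

lemma ιInv_mul {M : Type*} [AddCommGroup M] [Module ℂ M] (w w' : ExteriorAlgebra ℂ M) :
    ExteriorAlgebra.ιInv (w * w') = ExteriorAlgebra.algebraMapInv w • ExteriorAlgebra.ιInv w' +
      ExteriorAlgebra.algebraMapInv w' • ExteriorAlgebra.ιInv w := by
  -- The right action for the trivial square-zero extension, whose product is the asserted rule for
  -- the linear part.
  let _ : Module ℂᵐᵒᵖ M := Module.compHom _ ((RingHom.id ℂ).fromOpposite mul_comm)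
  have : IsCentralScalar ℂ M := ⟨fun r m => rfl⟩
  have fst : ∀ w : ExteriorAlgebra ℂ M,
      (ExteriorAlgebra.toTrivSqZeroExt w).fst = ExteriorAlgebra.algebraMapInv w := by
    have : (TrivSqZeroExt.fstHom ℂ ℂ M).comp ExteriorAlgebra.toTrivSqZeroExt =
        ExteriorAlgebra.algebraMapInv := by
      ext m
      simp [ExteriorAlgebra.algebraMapInv]
    exact DFunLike.congr_fun this
  change (ExteriorAlgebra.toTrivSqZeroExt (w * w')).snd =
    _ • (ExteriorAlgebra.toTrivSqZeroExt w').snd + _ • (ExteriorAlgebra.toTrivSqZeroExt w).snd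
  rw [map_mul, TrivSqZeroExt.snd_mul, fst, fst, op_smul_eq_smul]

lemma counitHom_toA (r : FunGL0 p q) (w : Grass p q) :
    counitHom p q (toA p q (r ⊗ₜ w)) = counit0 p q r * ExteriorAlgebra.algebraMapInv w := by
  simp [counitHom, proj0, mul_comm]

lemma oddFunctional_mul (k : Fin p × Fin q) (x y : FunGL p q) : oddFunctional s k (x * y) =
    counitHom p q x * oddFunctional s k y + oddFunctional s k x * counitHom p q y := by
  induction x using FunGL_induction with
  | add x x' hx hx' => rw [add_mul, map_add, hx, hx', map_add, map_add]; ring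
  | tmul r w =>
    induction y using FunGL_induction with
    | add y y' hy hy' => rw [mul_add, map_add, hy, hy', map_add, map_add]; ring
    | tmul r' w' =>
      rw [← map_mul, Algebra.TensorProduct.tmul_mul_tmul]
      simp only [oddFunctional_toA, counitHom_toA, ιInv_mul, map_mul, Pi.add_apply, Pi.smul_apply,
        smul_eq_mul]
      ring

lemma oddFunctional_oddEl (k : Fin p × Fin q) (l : OddGen p q) :
    oddFunctional s k (oddEl l) = (Pi.single l 1 : OddGen p q → ℂ) (sideGen s k) := by
  rw [oddEl, oddFunctional_toA, map_one, one_mul, ExteriorAlgebra.ι_leftInverse]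

lemma counitHom_of_mem_one {x : FunGL p q} (hx : x ∈ gr p q 1) : counitHom p q x = 0 := by
  rw [counitHom, AlgHom.comp_apply, proj0_of_mem_one hx, map_zero]

lemma ιInv_involute {I : Type*} [Fintype I] [DecidableEq I] (w : ExteriorAlgebra ℂ (I → ℂ)) :
    ExteriorAlgebra.ιInv (CliffordAlgebra.involute (Q := (0 : QuadraticForm ℂ (I → ℂ))) w) =
      -ExteriorAlgebra.ιInv w := by
  have : (CliffordAlgebra.involute (Q := (0 : QuadraticForm ℂ (I → ℂ)))) =
      ExteriorAlgebra.map (-LinearMap.id) := by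
    refine exterior_hom_ext fun k => (CliffordAlgebra.involute_ι _).trans ?_
    rw [theta, ExteriorAlgebra.map_apply_ι, LinearMap.neg_apply, map_neg]
    rfl
  rw [this]
  exact LinearMap.congr_fun (ExteriorAlgebra.ιInv_comp_map (-LinearMap.id)) w

lemma oddFunctional_of_mem_zero {x : FunGL p q} (hx : x ∈ gr p q 0) (k : Fin p × Fin q) :
    oddFunctional s k x = 0 := by
  have key : ∀ x : FunGL p q, oddFunctional s k (parity p q x) = -oddFunctional s k x := by
    intro x
    induction x using FunGL_induction with
    | add x y hx hy => simp only [map_add, hx, hy]; ring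
    | tmul r w =>
      rw [parity_toA, oddFunctional_toA, oddFunctional_toA, ιInv_involute, Pi.neg_apply, mul_neg]
  have h := key x
  rw [parity_of_mem_zero hx] at h
  exact self_eq_neg.1 h

/-- If the functional meets the second factor of t, that factor is odd and has been moved past the
first factor of u; this causes the parity. If the counit meets it, it is even and there is no sign.
-/
lemma contractAA_mul (k : Fin p × Fin q) (t u : AA p q) :
    contractAA (oddFunctional s k) (t * u) =
      contractAA (counitHom p q).toLinearMap t * contractAA (oddFunctional s k) u +
        contractAA (oddFunctional s k) t *
          parity p q (contractAA (counitHom p q).toLinearMap u) := by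
  have hc : ∀ (f : FunGL p q →ₗ[ℂ] ℂ) (x y : FunGL p q),
      contractAA f (x ᵍ⊗ₜ[ℂ] y) = f y • x := fun f x y => rfl
  induction t using AA_induction with
  | add t t' ht ht' => simp only [add_mul, map_add, ht, ht']; abel
  | hom i j x hx y hy =>
    induction u using AA_induction with
    | add u u' hu hu' => simp only [mul_add, map_add, hu, hu']; abel
    | hom i' j' x' hx' y' hy' =>
      rw [AA_mul _ hy hx', units_smul_eq, map_smul, hc, hc, hc, hc, hc, oddFunctional_mul,
        AlgHom.toLinearMap_apply, AlgHom.toLinearMap_apply, map_smul, parity_of_mem hx']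
      obtain rfl | rfl := zmod_two j
      · rw [oddFunctional_of_mem_zero hy]
        simp [smul_smul, mul_comm]
      · rw [counitHom_of_mem_one hy]
        obtain rfl | rfl := zmod_two i'
        · simp [smul_smul, mul_comm]
        · simp [smul_smul, mul_comm]

lemma oddDer_mul (k : Fin p × Fin q) (x y : FunGL p q) : oddDer s k (x * y) =
    x * oddDer s k y + oddDer s k x * parity p q y := by
  rw [oddDer_apply, map_mul, contractAA_mul, contractAA_counit, contractAA_counit]
  rfl

lemma oddDer_one (k : Fin p × Fin q) : oddDer s k 1 = 0 := by
  have h := oddDer_mul (s := s) k 1 1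
  rw [one_mul, parity_one, mul_one, one_mul] at h
  exact left_eq_add.1 h

lemma map_oddDer_mul (k : Fin p × Fin q) {l m n : ℕ} (X : Matrix (Fin l) (Fin m) (FunGL p q))
    (Y : Matrix (Fin m) (Fin n) (FunGL p q)) : (X * Y).map (oddDer s k) =
      X * Y.map (oddDer s k) + X.map (oddDer s k) * Y.map (parity p q) := by
  ext i j
  simp only [Matrix.map_apply, Matrix.mul_apply, Matrix.add_apply, map_sum, oddDer_mul,
    Finset.sum_add_distrib]

variable (s) in
/-- The constant matrix with a single entry, the derivative of the block `B`. -/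
def derB (k : Fin p × Fin q) : Matrix (Fin (rowSize p q s)) (Fin (colSize p q s)) (FunGL p q) :=
  Matrix.of fun i j =>
    algebraMap ℂ _ ((Pi.single (gB s i j) 1 : OddGen p q → ℂ) (sideGen s k))

lemma contractAA_inL_mul_inR (k : Fin p × Fin q) {l m n : ℕ}
    (X : Matrix (Fin l) (Fin m) (FunGL p q)) (Y : Matrix (Fin m) (Fin n) (FunGL p q)) :
    (X.map (inL p q) * Y.map (inR p q)).map (contractAA (oddFunctional s k)) =
      X * (Y.map fun y => algebraMap ℂ _ (oddFunctional s k y) : Matrix _ _ (FunGL p q)) := by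
  ext i j
  simp only [Matrix.map_apply, Matrix.mul_apply, map_sum, contractAA_tmul]
  exact Finset.sum_congr rfl fun _ _ => by rw [Algebra.smul_def, Algebra.commutes]

lemma oddFunctional_blocks (s : Side) (k : Fin p × Fin q) :
    ((sA p q s).map fun y => algebraMap ℂ (FunGL p q) (oddFunctional s k y)) = 0 ∧
    ((sB p q s).map fun y => algebraMap ℂ (FunGL p q) (oddFunctional s k y)) = derB s k ∧
    ((sC p q s).map fun y => algebraMap ℂ (FunGL p q) (oddFunctional s k y)) = 0 ∧
    ((sD p q s).map fun y => algebraMap ℂ (FunGL p q) (oddFunctional s k y)) = 0 := by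
  refine ⟨?_, ?_, ?_, ?_⟩ <;> ext i j
  · change algebraMap ℂ (FunGL p q) (oddFunctional s k (evenHom p q _)) = 0
    rw [oddFunctional_evenHom, map_zero]
  · change algebraMap ℂ (FunGL p q) (oddFunctional s k (oddEl _)) = _
    rw [oddFunctional_oddEl]
    rfl
  · change algebraMap ℂ (FunGL p q) (oddFunctional s k (oddEl _)) = 0
    rw [oddFunctional_oddEl, Pi.single_eq_of_ne (gC_notMem i j k), map_zero]
  · change algebraMap ℂ (FunGL p q) (oddFunctional s k (evenHom p q _)) = 0
    rw [oddFunctional_evenHom, map_zero]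

lemma oddDer_blocks (s : Side) (k : Fin p × Fin q) :
    (sA p q s).map (oddDer s k) = 0 ∧ (sB p q s).map (oddDer s k) = sA p q s * derB s k ∧
    (sC p q s).map (oddDer s k) = 0 ∧ (sD p q s).map (oddDer s k) = sC p q s * derB s k := by
  obtain ⟨a, b, c, d⟩ := oddFunctional_blocks (p := p) (q := q) s k
  have e : ∀ {m n : ℕ} (X : Matrix (Fin m) (Fin n) (FunGL p q)), X.map (oddDer s k) =
      (X.map (comulHom p q)).map (contractAA (oddFunctional s k)) := fun X => rfl
  obtain ⟨h1, h2, h3, h4⟩ := comul_blocks (p := p) (q := q) s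
  simp only [e, h1, h2, h3, h4, Matrix.map_add _ (map_add (contractAA (oddFunctional s k))),
    contractAA_inL_mul_inR, a, b, c, d, Matrix.mul_zero, add_zero, and_self]

/-- Differentiate Aξ = B. With E the matrix `derB`, the derivatives of A and B are 0 and AE, so A
cancels. The next lemmas give ∂T = CE - CE = 0 and T∂ζ = ∂C = 0: in the new coordinates the odd
operators are partial derivatives in ξ alone. -/
lemma oddDer_sXi (k : Fin p × Fin q) : (sXi p q s).map (oddDer s k) = derB s k := by
  obtain ⟨h1, h2, -, -⟩ := oddDer_blocks (p := p) (q := q) s k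
  have h := map_oddDer_mul (s := s) k (sA p q s) (sXi p q s)
  rw [sA_mul_sXi, h1, h2, Matrix.zero_mul, add_zero] at h
  exact (sA_cancel (AlgHom.id ℂ _) h).symm

lemma oddDer_sT (k : Fin p × Fin q) : (sT p q s).map (oddDer s k) = 0 := by
  obtain ⟨-, -, h3, h4⟩ := oddDer_blocks (p := p) (q := q) s k
  rw [sT, Matrix.map_sub _ (map_sub (oddDer s k)), map_oddDer_mul, h3, h4, oddDer_sXi,
    Matrix.zero_mul, add_zero, sub_self]

lemma oddDer_sZeta (k : Fin p × Fin q) : (sZeta p q s).map (oddDer s k) = 0 := by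
  have h := map_oddDer_mul (s := s) k (sT p q s) (sZeta p q s)
  rw [sT_mul_sZeta, oddDer_sT, (oddDer_blocks s k).2.2.1, Matrix.zero_mul, add_zero] at h
  exact sT_cancel (AlgHom.id ℂ _) (h.symm.trans (Matrix.mul_zero _).symm)

lemma oddDer_subst (k : Fin p × Fin q) (r : FunGL0 p q) : oddDer s k (subst p q s r) = 0 := by
  refine FunGL0_side_induction s (P := fun r => oddDer s k (subst p q s r) = 0)
    (fun c => ?_) (fun i j => ?_) (fun i j => ?_) (fun x y hx hy => ?_) (fun x y hx hy => ?_) (fun x y hxy hx => ?_) r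
  · rw [AlgHom.commutes, Algebra.algebraMap_eq_smul_one, map_smul, oddDer_one, smul_zero]
  · rw [subst_sA0]
    exact congrFun₂ (oddDer_blocks s k).1 i j
  · rw [subst_sD0]
    exact congrFun₂ (oddDer_sT k) i j
  · rw [map_add, map_add, hx, hy, add_zero]
  · rw [map_mul, oddDer_mul, hx, hy, mul_zero, zero_mul, add_zero]
  -- Differentiating xy = 1 with ∂x = 0 gives x∂y = 0, and x is invertible.
  · have h := oddDer_mul (s := s) k (subst p q s x) (subst p q s y)
    rw [← map_mul, hxy, map_one, oddDer_one, hx, zero_mul, add_zero] at h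
    have h' := congrArg (subst p q s y * ·) h
    simp only [← mul_assoc, ← map_mul, mul_comm y x, hxy, map_one, one_mul, mul_zero] at h'
    exact h'.symm

lemma oddDer_psi (k : Fin p × Fin q) (x : Grass p q) :
    oddDer s k (psi p q s x) = psi p q s (contr (sideGen s k) x) := by
  have hθ : ∀ l, oddDer s k (psi p q s (theta l)) =
      algebraMap ℂ _ ((Pi.single l 1 : OddGen p q → ℂ) (sideGen s k)) := fun l => by
    obtain ⟨i, j, rfl⟩ | ⟨i, j, rfl⟩ := oddGen_cases s l
    · rw [psi_gB]
      exact congrFun₂ (oddDer_sXi k) i j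
    · rw [psi_gC, Pi.single_eq_of_ne (gC_notMem i j k), map_zero]
      exact congrFun₂ (oddDer_sZeta k) i j
  induction x using exterior_induction with
  | one => rw [map_one, oddDer_one, contr_one, map_zero]
  | add x y hx hy => simp only [map_add, hx, hy]
  | smul c x hx => simp only [map_smul, hx]
  | mul_theta x l hx =>
    rw [map_mul, oddDer_mul, hθ, hx, (psi_theta_mem l).2, contr_mul_theta, map_sub, map_smul,
      map_mul, mul_neg, sub_eq_add_neg, ← Algebra.commutes, Algebra.smul_def]

end derivation

/-! ### The odd operators in coordinates and the determination of the primitive elements -/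

section
variable {p q : ℕ} {V : Type*} [AddCommGroup V] [Module ℂ V] {s : Side}
  {β : V →ₗ[ℂ] V ⊗[ℂ] FunGL0 p q}

lemma oddOp_cofree (k : Fin p × Fin q) (t : V ⊗[ℂ] FunGL p q) :
    oddOp s (cofree V (comul p q)) k t = (oddDer s k).lTensor V t := by
  induction t using TensorProduct.induction_on with
  | zero => simp
  | add a b ha hb => rw [map_add, map_add, ha, hb]
  | tmul v x =>
    simp only [oddOp, cofree, oddDer, LinearMap.comp_apply, LinearMap.lTensor_tmul]
    induction comul p q x using TensorProduct.induction_on with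
    | zero => simp
    | add a b ha hb => simp only [map_add, TensorProduct.tmul_add, ha, hb]
    | tmul a b => simp

theorem oddOp_omega (k : Fin p × Fin q) (t : V ⊗[ℂ] Grass p q) :
    oddOp s (cofree V (comul p q)) k (omega s β t) =
      omega s β ((contr (sideGen s k)).lTensor V t) := by
  rw [oddOp_cofree]
  induction t using TensorProduct.induction_on with
  | zero => simp
  | add a b ha hb => simp only [map_add, ha, hb]
  | tmul v x =>
    rw [LinearMap.lTensor_tmul, omega_tmul, omega_tmul, ← LinearMap.lTensor_comp_apply]
    congr 2
    ext r
    simp only [LinearMap.comp_apply, AlgHom.toLinearMap_apply, LinearMap.mulRight_apply, oddDer_mul,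
      oddDer_subst, zero_mul, add_zero, oddDer_psi]

/-- A primitive element is annihilated by all odd operators, that is, by the contractions with all
base variables, so no monomial containing one can occur. The converse is `elems_comp_le_primitive`.
-/
theorem primitive_ind {gV : ZMod 2 → Submodule ℂ V}
    (hβ : IsSuperComodule (comul0 p q).toLinearMap (counit0 p q).toLinearMap (gr0 p q) gV β)
    (s : Side) :
    ind (comul p q) (proj0 p q).toLinearMap β ⊓ primitive s (cofree V (comul p q)) =
      elems s β (Subalgebra.toSubmodule (Algebra.adjoin ℂ (compVars p q s))) := by
  obtain ⟨e, he⟩ := exists_isMonomialBasis (OddGen p q)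
  apply le_antisymm
  · rintro x ⟨hx, hp⟩
    rw [ind_eq_range hβ s] at hx
    obtain ⟨t, rfl⟩ := hx
    rw [elems_comp_eq he]
    refine ⟨t, (mem_range_spanOf e _ t).2 fun S hS => ?_, rfl⟩
    obtain ⟨l, hl, hl'⟩ := Set.not_subset.1 hS
    obtain ⟨k, rfl⟩ : l ∈ baseIdx p q s := by
      have h : l ∈ baseIdx p q s ⊔ compIdx p q s := by
        rw [isCompl_baseIdx.sup_eq_top]
        trivial
      exact h.resolve_right hl'
    refine tcoord_eq_zero_of_contr he (k := sideGen s k) (omega_injective (s := s) hβ ?_) hl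
    rw [← oddOp_omega, oddOp_of_primitive hp, map_zero]
  · refine le_inf ?_ (elems_comp_le_primitive hβ)
    rw [elems_comp_eq he, ind_eq_range hβ s]
    exact LinearMap.map_le_range

/-- Since `omega` is injective, the intersection may be taken in the Grassmann algebra: a monomial
that has only base variables and only composite variables is 1. -/
theorem primitive_kacFil_zero {gV : ZMod 2 → Submodule ℂ V}
    (hβ : IsSuperComodule (comul0 p q).toLinearMap (counit0 p q).toLinearMap (gr0 p q) gV β)
    (s : Side) :
    kacFil s β 0 ⊓ primitive s (cofree V (comul p q)) = elems s β 1 := by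
  obtain ⟨e, he⟩ := exists_isMonomialBasis (OddGen p q)
  have hle : kacFil s β 0 ≤ ind (comul p q) (proj0 p q).toLinearMap β := by
    rw [kacFil_eq he, ind_eq_range hβ s]
    exact LinearMap.map_le_range
  rw [← inf_eq_left.2 hle, inf_assoc, primitive_ind hβ, kacFil_zero, adjoin_baseVars, elems_map,
    he.adjoin_theta, elems_comp_eq he, ← Submodule.map_inf _ (omega_injective hβ), elems_one_eq he]
  congr 1
  ext t
  rw [Submodule.mem_inf, mem_range_spanOf, mem_range_spanOf, mem_range_spanOf]
  constructor
  · rintro ⟨h1, h2⟩ S hS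
    by_cases hb : ↑S ⊆ baseIdx p q s
    · refine h2 S fun hc => hS ?_
      have := (isCompl_baseIdx (s := s)).disjoint hb hc
      simpa using this
    · exact h1 S hb
  · intro h
    exact ⟨fun S hS => h S fun h' => hS (by rw [Set.mem_singleton_iff.1 h']; simp),
      fun S hS => h S fun h' => hS (by rw [Set.mem_singleton_iff.1 h']; simp)⟩

end

/-! ### The comultiplication of the top monomial in the base variables -/

section top
variable {p q : ℕ} {s : Side}

lemma sB_opp (i j) : ∃ i' j', sC p q s i j = sB p q s.opp i' j' := by
  cases s
  · exact ⟨i, j, rfl⟩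
  · exact ⟨i, j, rfl⟩

lemma sC_opp (i j) : ∃ i' j', sB p q s i j = sC p q s.opp i' j' := by
  cases s
  · exact ⟨i, j, rfl⟩
  · exact ⟨i, j, rfl⟩

lemma killB2_inR_evenHom (r : FunGL0 p q) :
    killC2 p q s (inR p q (evenHom p q r)) = inR p q (evenHom p q r) := by
  rw [killC2, mapAA_inR, killC_evenHom]

lemma killB2_inL (x : FunGL p q) : killC2 p q s (inL p q x) = inL p q x := by
  rw [killC2, mapAA_inL]
  rfl

lemma killB2_sC : ((sC p q s).map (inR p q)).map (killC2 p q s.opp) = (sC p q s).map (inR p q) := by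
  ext i j
  obtain ⟨i', j', h⟩ := sB_opp (p := p) (q := q) (s := s) i j
  change killC2 p q s.opp (inR p q (sC p q s i j)) = inR p q (sC p q s i j)
  rw [h, killC2, mapAA_inR, killC_sB]

lemma killB2_sB : ((sB p q s).map (inR p q)).map (killC2 p q s.opp) = 0 := by
  ext i j
  obtain ⟨i', j', h⟩ := sC_opp (p := p) (q := q) (s := s) i j
  change killC2 p q s.opp (inR p q (sB p q s i j)) = 0
  rw [h, killC2, mapAA_inR, killC_sC, map_zero]

/-- On the opposite side the killed block is B, and α contains no B₂. -/
lemma killB2_alpha : (alpha p q s).map (killC2 p q s.opp) = alpha p q s := by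
  rw [alpha_eq, Matrix.map_add _ (map_add _), Matrix.map_mul, killB2_sC]
  congr 1
  · ext i j
    exact killB2_inR_evenHom _
  · congr 1
    ext i j
    exact killB2_inL _

variable (p q s) in
/-- The comultiplication of `ξ` with the block `B` of the right factor killed. -/
def killXi : Matrix (Fin (rowSize p q s)) (Fin (colSize p q s)) (AA p q) :=
  ((sXi p q s).map (comulHom p q)).map (killC2 p q s.opp)

/-- With B₂ = 0 only ξ₁D₂ remains, so the coproduct becomes linear homogeneous in ξ₁ up to α⁻¹. -/
lemma alpha_mul_killXi : alpha p q s * killXi p q s =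
    (sXi p q s).map (inL p q) * (sD p q s).map (inR p q) := by
  have h := congrArg (fun M => M.map (killC2 p q s.opp))
    (alpha_mul_comul_sXi (p := p) (q := q) (s := s))
  simp only [Matrix.map_mul, Matrix.map_add _ (map_add (killC2 p q s.opp)), killB2_alpha,
    killB2_sB, zero_add] at h
  rw [killXi, h]
  congr 1
  · ext i j
    exact killB2_inL _
  · ext i j
    exact killB2_inR_evenHom _

variable (p q s) in
/-- The substitution of `(α, D₂)` in the coefficients. -/
def kappaAlpha : FunGL0 p q →ₐ[ℂ] AA p q :=
  (coefVal p q s).comp (evalSide s (alphaZ p q s) ((sD0 p q s).map (coefR p q s))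
    isUnit_det_alphaZ (isUnit_det_map _ isUnit_det_sD0))

lemma kappaAlpha_mem_center (r : FunGL0 p q) :
    kappaAlpha p q s r ∈ Subalgebra.center ℂ (AA p q) := coefVal_mem_center _

lemma kappaAlpha_sA0 : (sA0 p q s).map (kappaAlpha p q s) = alpha p q s := by
  ext i j
  rw [Matrix.map_apply, kappaAlpha, AlgHom.comp_apply, evalSide_sA0]
  rfl

lemma kappaAlpha_sD0 (i j) :
    kappaAlpha p q s (sD0 p q s i j) = inR p q (evenHom p q (sD0 p q s i j)) := by
  rw [kappaAlpha, AlgHom.comp_apply, evalSide_sD0]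
  rfl

lemma killXi_eq : killXi p q s = (sA0 p q s)⁻¹.map (kappaAlpha p q s) *
    ((sXi p q s).map (inL p q) * (sD p q s).map (inR p q)) := by
  apply eq_inv_mul _ isUnit_det_sA0
  rw [kappaAlpha_sA0, alpha_mul_killXi]

/-- Two homomorphisms that agree on the generators after multiplication by `T` agree after
multiplication by `T`. -/
lemma mul_hom_eq {T : AA p q} {K : FunGL0 p q →ₐ[ℂ] AA p q}
    (hA : ∀ i j, T * K (sA0 p q s i j) = T * inR p q (evenHom p q (sA0 p q s i j)))
    (hD : ∀ i j, T * K (sD0 p q s i j) = T * inR p q (evenHom p q (sD0 p q s i j)))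
    (r : FunGL0 p q) : T * K r = T * inR p q (evenHom p q r) := by
  have hc : ∀ (x : FunGL0 p q) (t : AA p q),
      t * inR p q (evenHom p q x) = inR p q (evenHom p q x) * t := fun x t =>
    Subalgebra.mem_center_iff.1 (inR_evenHom_mem_center x) t
  refine FunGL0_side_induction s (P := fun r => T * K r = T * inR p q (evenHom p q r))
    (fun c => ?_) hA hD (fun x y hx hy => ?_) (fun x y hx hy => ?_) (fun x y hxy hx => ?_) r
  · simp only [AlgHom.commutes]
  · simp only [map_add, mul_add, hx, hy]
  · rw [map_mul, ← mul_assoc, hx, mul_assoc, ← hc, ← mul_assoc, hy, map_mul, map_mul, mul_assoc,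
      ← hc, ← mul_assoc]
  -- T itself need not be cancellable. Instead the inverse in the second factor, which is central,
  -- is inserted and moved to the front.
  · have h1 : inR p q (evenHom p q x) * inR p q (evenHom p q y) = 1 := by
      rw [← map_mul, ← map_mul, hxy, map_one, map_one]
    have h2 : K x * K y = 1 := by rw [← map_mul, hxy, map_one]
    calc T * K y = T * (inR p q (evenHom p q x) * inR p q (evenHom p q y)) * K y := by
          rw [h1, mul_one]
      _ = inR p q (evenHom p q y) * (T * inR p q (evenHom p q x) * K y) := by
          rw [← mul_assoc, hc y, mul_assoc]
      _ = inR p q (evenHom p q y) * (T * (K x * K y)) := by rw [← hx, mul_assoc]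
      _ = T * inR p q (evenHom p q y) := by rw [h2, mul_one, hc]

variable (p q s) in
/-- The set of all generators of one block. -/
def topSet : Finset (OddGen p q) := by
  classical exact Finset.univ.image (sideGen s)

lemma mem_topSet {k : OddGen p q} : k ∈ topSet p q s ↔ k ∈ baseIdx p q s := by
  classical
  simp [topSet, baseIdx]

lemma sideGen_injective : Function.Injective (sideGen (p := p) (q := q) s) := by
  cases s
  · exact Sum.inl_injective
  · rintro ⟨a, b⟩ ⟨c, d⟩ h
    have := Sum.inr_injective h
    simp only [Prod.mk.injEq] at this ⊢
    exact this.symm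

lemma card_topSet : (topSet p q s).card = p * q := by
  classical
  rw [topSet, Finset.card_image_of_injective _ sideGen_injective, Finset.card_univ,
    Fintype.card_prod, Fintype.card_fin, Fintype.card_fin]

lemma topSets_eq : {S : Finset (OddGen p q) | ↑S ⊆ baseIdx p q s ∧ S.card = p * q} =
    {topSet p q s} := by
  ext S
  constructor
  · rintro ⟨h1, h2⟩
    exact Finset.eq_of_subset_of_card_le (fun k hk => mem_topSet.2 (h1 hk))
      (by rw [card_topSet, h2])
  · rintro rfl
    exact ⟨fun k hk => mem_topSet.1 hk, card_topSet⟩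

variable {e : Module.Basis (Finset (OddGen p q)) ℂ (Grass p q)}

/-- The top monomial already contains every base variable. So on it ξ₁ is zero, and α acts as A₂. -/
lemma top_mul_sXi (he : IsMonomialBasis e) (i j) :
    inL p q (psi p q s (e (topSet p q s))) * inL p q (sXi p q s i j) = 0 := by
  rw [← map_mul, ← psi_gB, ← map_mul, ← he.singleton, he.mul_not_disjoint, map_zero, map_zero]
  rw [Finset.disjoint_singleton_right, not_not, mem_topSet, baseIdx_eq]
  exact ⟨i, j, rfl⟩

lemma top_mul_alpha (he : IsMonomialBasis e) (i j) :
    inL p q (psi p q s (e (topSet p q s))) * alpha p q s i j =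
      inL p q (psi p q s (e (topSet p q s))) * inR p q (sA p q s i j) := by
  rw [alpha_eq, Matrix.add_apply, Matrix.mul_apply, mul_add, Finset.mul_sum]
  refine (congrArg _ (Finset.sum_eq_zero fun k _ => ?_)).trans (add_zero _)
  rw [← mul_assoc, Matrix.map_apply, top_mul_sXi he, zero_mul]

lemma top_mul_killXi (he : IsMonomialBasis e) (i j) :
    inL p q (psi p q s (e (topSet p q s))) * killXi p q s i j = 0 := by
  -- Multiplying αΔ(ξ) = ξ₁D₂ by the top monomial gives zero on the right and replaces α by A₂ on
  -- the left; then A₂ cancels.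
  have h : (sA0 p q s).map ((inR p q).comp (evenHom p q)) *
      (Matrix.of fun i j => inL p q (psi p q s (e (topSet p q s))) * killXi p q s i j) =
      (sA0 p q s).map ((inR p q).comp (evenHom p q)) *
        (0 : Matrix (Fin (rowSize p q s)) (Fin (colSize p q s)) (AA p q)) := by
    ext i j
    have h1 := congrArg (inL p q (psi p q s (e (topSet p q s))) * ·)
      (congrFun₂ (alpha_mul_killXi (p := p) (q := q) (s := s)) i j)
    simp only [Matrix.mul_apply, Finset.mul_sum, ← mul_assoc, top_mul_alpha he,
      Matrix.map_apply, top_mul_sXi he, zero_mul, Finset.sum_const_zero] at h1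
    rw [Matrix.mul_zero, Matrix.mul_apply]
    refine Eq.trans (Finset.sum_congr rfl fun k _ => ?_) h1
    rw [Matrix.of_apply, ← mul_assoc]
    congr 1
    exact (Subalgebra.mem_center_iff.1 (inR_evenHom_mem_center _) _).symm
  exact congrFun₂ (map_mul_cancel _ isUnit_det_sA0 h) i j

lemma top_mul_killDelta (he : IsMonomialBasis e) (i j) :
    inL p q (psi p q s (e (topSet p q s))) * killC2 p q s.opp (delta p q s i j) =
      inL p q (psi p q s (e (topSet p q s))) * inR p q (sD p q s i j) := by
  -- The top monomial has to be moved past the odd entries of C₂ to meet Δ(ξ). As an eigenvector of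
  -- the parity it only acquires a scalar.
  obtain ⟨c, hc⟩ := he.involute_eq (topSet p q s)
  have hp : parity2 p q (inL p q (psi p q s (e (topSet p q s)))) =
      c • inL p q (psi p q s (e (topSet p q s))) := by
    have : parity2 p q (inL p q (psi p q s (e (topSet p q s)))) =
        inL p q (parity p q (psi p q s (e (topSet p q s)))) := by
      change parity2 p q (psi p q s (e (topSet p q s)) ᵍ⊗ₜ[ℂ] (1 : FunGL p q)) = _
      rw [parity2_tmul, parity_one]
      rfl
    rw [this, parity_psi, hc, map_smul, map_smul]
  have hd : killC2 p q s.opp (delta p q s i j) = inR p q (sD p q s i j) -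
      ∑ k, inR p q (sC p q s i k) * killXi p q s k j := by
    have h := congrArg (fun M => M.map (killC2 p q s.opp)) (delta_eq (p := p) (q := q) (s := s))
    simp only [Matrix.map_mul, Matrix.map_sub _ (map_sub (killC2 p q s.opp)), killB2_sC] at h
    have h' := congrFun₂ h i j
    rw [Matrix.map_apply, Matrix.sub_apply, Matrix.mul_apply] at h'
    rw [h']
    congr 1
    exact killB2_inR_evenHom _
  rw [hd, mul_sub, Finset.mul_sum]
  refine (congrArg _ (Finset.sum_eq_zero fun k _ => ?_)).trans (sub_zero _)
  have ho := (inR_superOdd (sC_mem (p := p) (q := q) (s := s) i k)).1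
    (parity2 p q (inL p q (psi p q s (e (topSet p q s)))))
  rw [parity2_parity2] at ho
  rw [← mul_assoc, ← ho, hp, mul_assoc, smul_mul_assoc, top_mul_killXi he, smul_zero, mul_zero]

lemma top_mul_killKappa (he : IsMonomialBasis e) (r : FunGL0 p q) :
    inL p q (psi p q s (e (topSet p q s))) * killC2 p q s.opp (kappa p q s r) =
      inL p q (psi p q s (e (topSet p q s))) * inR p q (evenHom p q r) := by
  refine mul_hom_eq (s := s) (K := (killC2 p q s.opp).comp (kappa p q s)) (fun i j => ?_)
    (fun i j => ?_) r
  · have h1 : kappa p q s (sA0 p q s i j) = alpha p q s i j := congrFun₂ kappa_sA0 i j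
    have h2 : killC2 p q s.opp (alpha p q s i j) = alpha p q s i j := congrFun₂ killB2_alpha i j
    rw [AlgHom.comp_apply, h1, h2, top_mul_alpha he]
    rfl
  · have h1 : kappa p q s (sD0 p q s i j) = delta p q s i j := congrFun₂ kappa_sD0 i j
    rw [AlgHom.comp_apply, h1, top_mul_killDelta he]
    rfl

lemma top_mul_kappaAlpha (he : IsMonomialBasis e) (r : FunGL0 p q) :
    inL p q (psi p q s (e (topSet p q s))) * kappaAlpha p q s r =
      inL p q (psi p q s (e (topSet p q s))) * inR p q (evenHom p q r) := by
  refine mul_hom_eq (s := s) (fun i j => ?_) (fun i j => ?_) r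
  · have h1 : kappaAlpha p q s (sA0 p q s i j) = alpha p q s i j := congrFun₂ kappaAlpha_sA0 i j
    rw [h1, top_mul_alpha he]
    rfl
  · rw [kappaAlpha_sD0]

/-- The central elements that act on `T` as even elements of the right factor. -/
def evenOn (T : AA p q) : Submodule ℂ (AA p q) where
  carrier := {z | z ∈ Subalgebra.center ℂ (AA p q) ∧
    ∃ c, T * z = T * inR p q (evenHom p q c)}
  add_mem' := by
    rintro _ _ ⟨h1, c, hc⟩ ⟨h2, d, hd⟩
    exact ⟨add_mem h1 h2, c + d, by rw [map_add, map_add, mul_add, mul_add, hc, hd]⟩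
  zero_mem' := ⟨zero_mem _, 0, by rw [map_zero, map_zero]⟩
  smul_mem' := by
    rintro a _ ⟨h1, c, hc⟩
    exact ⟨Subalgebra.smul_mem _ h1 a, a • c, by
      rw [map_smul, map_smul, mul_smul_comm, mul_smul_comm, hc]⟩

lemma evenOn_mul (T : AA p q) : evenOn T * evenOn T ≤ evenOn T := by
  rw [Submodule.mul_le]
  rintro z ⟨h1, c, hc⟩ w ⟨h2, d, hd⟩
  refine ⟨mul_mem h1 h2, c * d, ?_⟩
  rw [← mul_assoc, hc, mul_assoc, Subalgebra.mem_center_iff.1 h2, ← mul_assoc, hd, mul_assoc,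
    map_mul, map_mul, Subalgebra.mem_center_iff.1 (inR_evenHom_mem_center c)]

lemma evenOn_one (T : AA p q) : 1 ≤ evenOn T := by
  rw [Submodule.one_le]
  exact ⟨one_mem _, 1, by rw [map_one, map_one]⟩

lemma evenOn_pow (T : AA p q) (n : ℕ) : evenOn T ^ n ≤ evenOn T := by
  induction n with
  | zero => rw [pow_zero]; exact evenOn_one T
  | succ n ih => rw [pow_succ]; exact (mul_le_mul' ih le_rfl).trans (evenOn_mul T)

/-- Centrality allows the coefficients to be collected when a product of pq factors is expanded. -/
lemma evenOn_commute (T : AA p q) (M : Submodule ℂ (AA p q)) : Commute (evenOn T) M := by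
  refine le_antisymm (Submodule.mul_le.2 fun z hz m hm => ?_)
    (Submodule.mul_le.2 fun m hm z hz => ?_)
  · rw [← Subalgebra.mem_center_iff.1 hz.1]
    exact Submodule.mul_mem_mul hm hz
  · rw [Subalgebra.mem_center_iff.1 hz.1]
    exact Submodule.mul_mem_mul hz hm

lemma killXi_mem (he : IsMonomialBasis e) (i j) :
    killXi p q s i j ∈ evenOn (inL p q (psi p q s (e (topSet p q s)))) *
      (Submodule.span ℂ (baseVars p q s)).map (inL p q).toLinearMap := by
  rw [killXi_eq, Matrix.mul_apply]
  refine sum_mem fun k _ => ?_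
  rw [Matrix.mul_apply, Finset.mul_sum]
  refine sum_mem fun l _ => ?_
  change kappaAlpha p q s ((sA0 p q s)⁻¹ i k) *
    (inL p q (sXi p q s k l) * inR p q (evenHom p q (sD0 p q s l j))) ∈ _
  rw [Subalgebra.mem_center_iff.1 (inR_evenHom_mem_center (sD0 p q s l j))
    (inL p q (sXi p q s k l)), ← mul_assoc]
  refine Submodule.mul_mem_mul (evenOn_mul _ (Submodule.mul_mem_mul ?_ ?_)) ⟨_, ?_, rfl⟩
  · exact ⟨kappaAlpha_mem_center _, _, top_mul_kappaAlpha he _⟩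
  · exact ⟨inR_evenHom_mem_center _, _, rfl⟩
  · exact Submodule.subset_span (by rw [baseVars_eq]; exact ⟨k, l, rfl⟩)

/-- Each factor of the top monomial goes to a combination of entries of ξ₁ with coefficients in
`evenOn`. The product of pq of them is a coefficient times the top monomial, and on that the
coefficient acts as an even element of the second factor. -/
lemma killC2_comul_top (he : IsMonomialBasis e) :
    ∃ c, killC2 p q s.opp (comulHom p q (psi p q s (e (topSet p q s)))) =
      inL p q (psi p q s (e (topSet p q s))) * inR p q (evenHom p q c) := by
  set T := inL p q (psi p q s (e (topSet p q s))) with hT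
  have h1 : psi p q s (e (topSet p q s)) ∈ Submodule.span ℂ (baseVars p q s) ^ (p * q) := by
    rw [span_baseVars, ← Submodule.map_pow, he.span_theta_pow, topSets_eq]
    exact ⟨_, Submodule.subset_span ⟨_, rfl, rfl⟩, rfl⟩
  have h2 : (Submodule.span ℂ (baseVars p q s)).map
      ((killC2 p q s.opp).comp (comulHom p q)).toLinearMap ≤ evenOn T *
        (Submodule.span ℂ (baseVars p q s)).map (inL p q).toLinearMap := by
    rw [Submodule.map_span_le, baseVars_eq]
    rintro _ ⟨i, j, rfl⟩
    have := killXi_mem (s := s) he i j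
    rw [baseVars_eq] at this
    exact this
  have h3 : (Submodule.span ℂ (baseVars p q s) ^ (p * q)).map
      ((killC2 p q s.opp).comp (comulHom p q)).toLinearMap ≤
        evenOn T * Submodule.span ℂ {T} := by
    -- There are exactly pq anticommuting base variables, so their monomials of order pq span a
    -- line.
    have h4 : (Submodule.span ℂ (baseVars p q s)).map (inL p q).toLinearMap ^ (p * q) =
        Submodule.span ℂ {T} := by
      rw [← Submodule.map_pow, span_baseVars, ← Submodule.map_pow, he.span_theta_pow, topSets_eq,
        spanOf, Set.image_singleton, Submodule.map_span, Submodule.map_span, Set.image_singleton,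
        Set.image_singleton]
      rfl
    rw [Submodule.map_pow]
    refine (pow_le_pow_left' h2 _).trans ?_
    rw [(evenOn_commute T _).mul_pow, h4]
    exact mul_le_mul' (evenOn_pow T _) le_rfl
  obtain ⟨z, hz, h⟩ := Submodule.mem_mul_span_singleton.1 (h3 ⟨_, h1, rfl⟩)
  obtain ⟨hz1, c, hc⟩ := hz
  refine ⟨c, ?_⟩
  rw [← hc, Subalgebra.mem_center_iff.1 hz1]
  exact h.symm

theorem killC2_kappa_comul_top (he : IsMonomialBasis e) (r : FunGL0 p q) :
    ∃ c, killC2 p q s.opp (kappa p q s r * comulHom p q (psi p q s (e (topSet p q s)))) =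
      inL p q (psi p q s (e (topSet p q s))) * inR p q (evenHom p q c) := by
  obtain ⟨c, hc⟩ := killC2_comul_top (s := s) he
  refine ⟨r * c, ?_⟩
  rw [← kappa_commute, map_mul, hc, mul_assoc,
    ← Subalgebra.mem_center_iff.1 (inR_evenHom_mem_center c), ← mul_assoc, top_mul_killKappa he,
    mul_assoc, map_mul, map_mul]

end top

/-! ### The bottom of the filtration is a Kac module -/

section kac
variable {p q : ℕ} {V : Type*} [AddCommGroup V] [Module ℂ V] {s : Side}
  {β : V →ₗ[ℂ] V ⊗[ℂ] FunGL0 p q} {gV : ZMod 2 → Submodule ℂ V}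
  {e : Module.Basis (Finset (OddGen p q)) ℂ (Grass p q)}

lemma kacFil_zero_eq (he : IsMonomialBasis e) : kacFil s β 0 =
    (LinearMap.range ((spanOf e {S | ↑S ⊆ baseIdx p q s}).subtype.lTensor V)).map
      (omega s β) := by
  rw [kacFil_zero, adjoin_baseVars, elems_map, he.adjoin_theta]

lemma mem_kacFil_zero (he : IsMonomialBasis e) {u : V ⊗[ℂ] FunGL p q} : u ∈ kacFil s β 0 ↔
    ∃ t, (∀ S : Finset (OddGen p q), ¬↑S ⊆ baseIdx p q s → tcoord e S t = 0) ∧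
      omega s β t = u := by
  rw [kacFil_zero_eq he, Submodule.mem_map]
  refine exists_congr fun t => and_congr_left fun _ => ?_
  rw [mem_range_spanOf]
  rfl

/-- The monomials of order pq in the base variables are multiples of one, so U is a copy of V. -/
lemma mem_elems_top (he : IsMonomialBasis e) {u : V ⊗[ℂ] FunGL p q} :
    u ∈ elems s β (Submodule.span ℂ (baseVars p q s) ^ (p * q)) ↔
      ∃ v, omega s β (v ⊗ₜ e (topSet p q s)) = u := by
  rw [elems_top_eq he, topSets_eq, Submodule.mem_map]
  constructor
  · rintro ⟨t, ht, rfl⟩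
    rw [mem_range_spanOf] at ht
    refine ⟨tcoord e (topSet p q s) t, congrArg _ ?_⟩
    rw [← Finset.sum_eq_single_of_mem (f := fun S => tcoord e S t ⊗ₜ[ℂ] e S) _
      (Finset.mem_univ (topSet p q s)) fun S _ hS => ?_, sum_tcoord]
    rw [ht S hS, TensorProduct.zero_tmul]
  · rintro ⟨v, rfl⟩
    exact ⟨_, ⟨v ⊗ₜ ⟨_, IsMonomialBasis.mem_spanOf rfl⟩, rfl⟩, rfl⟩

lemma elems_top_le :
    elems s β (Submodule.span ℂ (baseVars p q s) ^ (p * q)) ≤ kacFil s β 0 := by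
  obtain ⟨e, he⟩ := exists_isMonomialBasis (OddGen p q)
  intro u hu
  obtain ⟨v, rfl⟩ := (mem_elems_top he).1 hu
  refine (mem_kacFil_zero he).2 ⟨_, fun S hS => ?_, rfl⟩
  rw [tcoord_tmul, Module.Basis.coord_apply, Module.Basis.repr_self,
    Finsupp.single_eq_of_ne, zero_smul]
  rintro rfl
  exact hS fun k hk => mem_topSet.1 hk

lemma parProj_cofree_top
    (hβ : IsSuperComodule (comul0 p q).toLinearMap (counit0 p q).toLinearMap (gr0 p q) gV β)
    (u : V ⊗[ℂ] FunGL p q) (hu : u ∈ elems s β (Submodule.span ℂ (baseVars p q s) ^ (p * q))) :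
    (parProj p q s.opp).toLinearMap.lTensor _ (cofree V (comul p q) u) ∈ LinearMap.range
      (TensorProduct.map (elems s β (Submodule.span ℂ (baseVars p q s) ^ (p * q))).subtype
        (parEven p q).toLinearMap) := by
  obtain ⟨e, he⟩ := exists_isMonomialBasis (OddGen p q)
  obtain ⟨v, rfl⟩ := (mem_elems_top he).1 hu
  have h : (parProj p q s.opp).toLinearMap =
      (parProj p q s.opp).toLinearMap ∘ₗ (killC p q s.opp).toLinearMap :=
    LinearMap.ext fun x => (parProj_killC x).symm
  have h1 : omega s β (v ⊗ₜ e (topSet p q s)) =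
      param s β (v ⊗ₜ psi p q s (e (topSet p q s))) := rfl
  rw [h1, cofree_param hβ, h, LinearMap.lTensor_comp, LinearMap.comp_apply,
    lTensor_param2 _ isEvenHom_killC, ← LinearMap.comp_apply (LinearMap.lTensor V _),
    ← LinearMap.lTensor_comp]
  generalize β v = y
  induction y using TensorProduct.induction_on with
  | zero => simp only [map_zero, zero_mem]
  | add x y hx hy => simp only [map_add]; exact add_mem hx hy
  | tmul v r =>
    obtain ⟨c, hc⟩ := killC2_kappa_comul_top (s := s) he r
    have h2 : ((mapAA (AlgHom.id ℂ _) (killC p q s.opp) isEvenHom_id isEvenHom_killC).toLinearMap ∘ₗ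
        LinearMap.mulRight ℂ (comulHom p q (psi p q s (e (topSet p q s)))) ∘ₗ
          (kappa p q s).toLinearMap) r = inL p q (psi p q s (e (topSet p q s))) *
            inR p q (evenHom p q c) := hc
    rw [LinearMap.lTensor_tmul, h2, param2_tmul, LinearMap.lTensor_tmul, AlgHom.toLinearMap_apply,
      parProj_evenHom]
    exact ⟨⟨_, (mem_elems_top he).2 ⟨v, rfl⟩⟩ ⊗ₜ c, rfl⟩

lemma coe_oddOp {W : Type*} [AddCommGroup W] [Module ℂ W] {γ : W →ₗ[ℂ] W ⊗[ℂ] FunGL p q}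
    {gW : ZMod 2 → Submodule ℂ W} {U : Submodule ℂ W} (h : IsSubcomodule gW γ U)
    (k : Fin p × Fin q) (u : U) : (oddOp s h.coaction k u : W) = oddOp s γ k u := by
  change U.subtype (TensorProduct.rid ℂ U ((oddFunctional s k).lTensor U (h.coaction u))) =
    TensorProduct.rid ℂ W ((oddFunctional s k).lTensor W (γ u))
  rw [← h.coaction_spec u]
  generalize h.coaction u = t
  induction t using TensorProduct.induction_on with
  | zero => simp only [map_zero]
  | add x y hx hy => simp only [map_add, hx, hy]
  | tmul w x =>
    simp only [LinearMap.lTensor_tmul, LinearMap.rTensor_tmul, TensorProduct.rid_tmul, map_smul]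

lemma coe_list_oddOp {W : Type*} [AddCommGroup W] [Module ℂ W] {γ : W →ₗ[ℂ] W ⊗[ℂ] FunGL p q}
    {gW : ZMod 2 → Submodule ℂ W} {U : Submodule ℂ W} (h : IsSubcomodule gW γ U)
    (l : List (Fin p × Fin q)) (u : U) :
    ((l.map fun k => oddOp s h.coaction k).prod u : W) = (l.map fun k => oddOp s γ k).prod u := by
  induction l with
  | nil => rfl
  | cons k l ih =>
    rw [List.map_cons, List.map_cons, List.prod_cons, List.prod_cons, Module.End.mul_apply,
      Module.End.mul_apply, coe_oddOp, ih]

lemma list_oddOp_omega (l : List (Fin p × Fin q)) (v : V) (x : Grass p q) :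
    (l.map fun k => oddOp s (cofree V (comul p q)) k).prod (omega s β (v ⊗ₜ x)) =
      omega s β (v ⊗ₜ ((l.map (sideGen s)).map contr).prod x) := by
  induction l with
  | nil => rfl
  | cons k l ih =>
    simp only [List.map_cons, List.prod_cons, Module.End.mul_apply]
    rw [ih, oddOp_omega, LinearMap.lTensor_tmul]

open Classical in
variable (p q s) in
/-- The complement of a set of generators of one block, the generators being enumerated. -/
def compl (S : Finset (Fin (p * q))) : Finset (OddGen p q) :=
  topSet p q s \ S.image fun m => sideGen s (finProdFinEquiv.symm m)

lemma compl_injective : Function.Injective (compl p q s) := by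
  classical
  intro S T h
  have hi : Function.Injective fun m : Fin (p * q) => sideGen s (finProdFinEquiv.symm m) :=
    sideGen_injective.comp finProdFinEquiv.symm.injective
  have hs : ∀ S : Finset (Fin (p * q)),
      (S.image fun m => sideGen s (finProdFinEquiv.symm m)) ⊆ topSet p q s := fun S k hk => by
    obtain ⟨m, _, rfl⟩ := Finset.mem_image.1 hk
    exact mem_topSet.2 ⟨_, rfl⟩
  apply Finset.image_injective hi
  rw [← Finset.sdiff_sdiff_eq_self (hs S), ← Finset.sdiff_sdiff_eq_self (hs T)]
  exact congrArg _ h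

/-- With `compl_injective`, complementation matches the words of odd operators bijectively with the
monomials in the base variables. -/
lemma exists_compl_iff {T : Finset (OddGen p q)} :
    (∃ S, compl p q s S = T) ↔ ↑T ⊆ baseIdx p q s := by
  classical
  constructor
  · rintro ⟨S, rfl⟩ k hk
    exact mem_topSet.1 (Finset.mem_sdiff.1 hk).1
  · intro hT
    refine ⟨Finset.univ.filter fun m => sideGen s (finProdFinEquiv.symm m) ∉ T, ?_⟩
    ext k
    rw [compl, Finset.mem_sdiff, mem_topSet]
    constructor
    · rintro ⟨⟨m, rfl⟩, h⟩
      by_contra hk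
      exact h (Finset.mem_image.2 ⟨finProdFinEquiv m, Finset.mem_filter.2 ⟨Finset.mem_univ _, by
        rwa [Equiv.symm_apply_apply]⟩, by rw [Equiv.symm_apply_apply]⟩)
    · intro hk
      refine ⟨hT hk, fun h => ?_⟩
      obtain ⟨m, hm, rfl⟩ := Finset.mem_image.1 h
      exact (Finset.mem_filter.1 hm).2 hk

/-- The word acts by contractions with distinct base generators, each of which removes its generator
from the top monomial. The scalar does not depend on v. -/
lemma oddWord_omega (he : IsMonomialBasis e) (S : Finset (Fin (p * q))) :
    ∃ c : ℂ, c ≠ 0 ∧ ∀ v : V, oddWord s (cofree V (comul p q)) S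
      (omega s β (v ⊗ₜ e (topSet p q s))) = omega s β ((c • v) ⊗ₜ e (compl p q s S)) := by
  classical
  set l := ((S.sort (· ≤ ·)).map finProdFinEquiv.symm).map (sideGen (p := p) (q := q) s) with hl
  have hn : l.Nodup := ((S.sort_nodup (· ≤ ·)).map finProdFinEquiv.symm.injective).map
    sideGen_injective
  obtain ⟨c, h0, hc⟩ := he.contr_word (topSet p q s) l hn (fun k hk => by
    obtain ⟨m, _, rfl⟩ := List.mem_map.1 hk
    exact mem_topSet.2 ⟨_, rfl⟩)
  have ht : l.toFinset = S.image fun m => sideGen s (finProdFinEquiv.symm m) := by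
    ext k
    simp [hl]
  refine ⟨c, h0, fun v => ?_⟩
  have h1 := list_oddOp_omega (s := s) (β := β) ((S.sort (· ≤ ·)).map finProdFinEquiv.symm) v
    (e (topSet p q s))
  rw [hc, ht, List.map_map, TensorProduct.tmul_smul, TensorProduct.smul_tmul'] at h1
  exact h1

/-- In coordinates the map f ↦ ∑ ∂_S f(S) is diagonal: the coefficient at the complement of S is a
nonzero multiple of the vector of f(S). So it is bijective onto the elements with base variables
only. Stability of U is the computation with the top monomial. -/
theorem isKacComodule_kacFil_zero
    (hβ : IsSuperComodule (comul0 p q).toLinearMap (counit0 p q).toLinearMap (gr0 p q) gV β)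
    (s : Side)
    (hW : IsSubcomodule (tensorGr gV (gr p q)) (cofree V (comul p q)) (kacFil s β 0)) :
    IsKacComodule s (restrictGr (tensorGr gV (gr p q)) (kacFil s β 0)) hW.coaction
      ((elems s β (Submodule.span ℂ (baseVars p q s) ^ (p * q))).submoduleOf
        (kacFil s β 0)) := by
  obtain ⟨e, he⟩ := exists_isMonomialBasis (OddGen p q)
  refine ⟨?_, fun u hu => ?_, ?_⟩
  · obtain ⟨σ, hσ⟩ := exists_isInv hβ.isInternal
    have hT := hσ.tensor (isInv_gr p q)
    have hs := hT.stable hW.homogeneous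
    refine (hT.restrict hs).homogeneous fun u hu => ?_
    have h := map_omega_parity (s := s) hβ hσ he {S | ↑S ⊆ baseIdx p q s ∧ S.card = p * q} u
    rw [← elems_top_eq he] at h
    exact h hu
  · obtain ⟨z, hz⟩ := parProj_cofree_top hβ (u : V ⊗[ℂ] FunGL p q) hu
    -- U occurs both as a subspace of V ⊗ A(p,q) and as one of the bottom of the filtration; this
    -- map passes from the first to the second.
    let j : elems s β (Submodule.span ℂ (baseVars p q s) ^ (p * q)) →ₗ[ℂ]
        (elems s β (Submodule.span ℂ (baseVars p q s) ^ (p * q))).submoduleOf (kacFil s β 0) :=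
      LinearMap.codRestrict _ (Submodule.inclusion elems_top_le) fun x => x.2
    refine ⟨j.rTensor _ z, ?_⟩
    apply Module.Flat.rTensor_preserves_injective_linearMap (M := Par p q)
      (kacFil s β 0).subtype (kacFil s β 0).injective_subtype
    have h1 : (kacFil s β 0).subtype.rTensor (Par p q)
        ((parProj p q s.opp).toLinearMap.lTensor _ (hW.coaction u)) =
        (parProj p q s.opp).toLinearMap.lTensor _ (cofree V (comul p q) u) := by
      rw [← hW.coaction_spec u]
      exact (LinearMap.congr_fun (LinearMap.rTensor_comp_lTensor _ _ _) _).trans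
        (LinearMap.congr_fun (LinearMap.lTensor_comp_rTensor _ _ _) _).symm
    rw [h1, ← hz]
    generalize z = z
    induction z using TensorProduct.induction_on with
    | zero => simp only [map_zero]
    | add x y hx hy => simp only [map_add, hx, hy]
    | tmul w x => rfl
  · have hi := omega_injective (s := s) hβ
    choose c h0 hc using fun S => oddWord_omega (s := s) (V := V) (β := β) he S
    -- Distinct words lead to distinct monomials, so each coefficient isolates one summand.
    have hco : ∀ (f : Finset (Fin (p * q)) → V) (S),
        tcoord e (compl p q s S) (∑ S, (c S • f S) ⊗ₜ[ℂ] e (compl p q s S)) = c S • f S := by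
      intro f S
      rw [map_sum, Finset.sum_eq_single S (fun T _ hT => ?_) fun h => absurd (Finset.mem_univ _) h,
        tcoord_tmul, Module.Basis.coord_apply, Module.Basis.repr_self, Finsupp.single_eq_same,
        one_smul]
      rw [tcoord_tmul, Module.Basis.coord_apply, Module.Basis.repr_self,
        Finsupp.single_eq_of_ne (fun h => hT (compl_injective h.symm)), zero_smul]
    have hF : ∀ (f : Finset (Fin (p * q)) →
        (elems s β (Submodule.span ℂ (baseVars p q s) ^ (p * q))).submoduleOf (kacFil s β 0))
        (g : Finset (Fin (p * q)) → V),
        (∀ S, omega s β (g S ⊗ₜ e (topSet p q s)) = ((f S : kacFil s β 0) : V ⊗[ℂ] FunGL p q)) →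
        ((∑ S, oddWord s hW.coaction S (f S) : kacFil s β 0) : V ⊗[ℂ] FunGL p q) =
          omega s β (∑ S, (c S • g S) ⊗ₜ e (compl p q s S)) := by
      intro f g hfg
      rw [AddSubmonoidClass.coe_finsetSum, map_sum]
      refine Finset.sum_congr rfl fun S _ => ?_
      rw [← hc, hfg]
      have := coe_list_oddOp (s := s) hW ((S.sort (· ≤ ·)).map finProdFinEquiv.symm) (f S)
      rw [List.map_map, List.map_map] at this
      exact this
    constructor
    · intro f f' hff
      choose g hg using fun S => (mem_elems_top he).1 (f S).2
      choose g' hg' using fun S => (mem_elems_top he).1 (f' S).2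
      have h := congrArg Subtype.val hff
      rw [hF f g hg, hF f' g' hg'] at h
      funext S
      have h2 := congrArg (tcoord e (compl p q s S)) (hi h)
      rw [hco, hco] at h2
      apply Subtype.ext
      apply Subtype.ext
      exact (hg S).symm.trans ((congrArg (fun v => omega s β (v ⊗ₜ e (topSet p q s)))
        (smul_right_injective V (h0 S) h2)).trans (hg' S))
    · rintro ⟨w, hw⟩
      obtain ⟨t, ht, rfl⟩ := (mem_kacFil_zero he).1 hw
      -- The inverse of the diagonal map: every coefficient is divided by its scalar.
      let g := fun S => (c S)⁻¹ • tcoord e (compl p q s S) t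
      have hg : ∀ S, omega s β (g S ⊗ₜ e (topSet p q s)) ∈
          elems s β (Submodule.span ℂ (baseVars p q s) ^ (p * q)) := fun S =>
        (mem_elems_top he).2 ⟨_, rfl⟩
      refine ⟨fun S => ⟨⟨_, elems_top_le (hg S)⟩, hg S⟩, Subtype.ext ?_⟩
      refine (hF _ g fun S => rfl).trans (congrArg _ ?_)
      refine tcoord_ext (e := e) fun T => ?_
      by_cases hT : ↑T ⊆ baseIdx p q s
      · obtain ⟨S, rfl⟩ := exists_compl_iff.2 hT
        rw [hco, smul_inv_smul₀ (h0 S)]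
      · rw [ht T hT, map_sum]
        refine Finset.sum_eq_zero fun S _ => ?_
        rw [tcoord_tmul, Module.Basis.coord_apply, Module.Basis.repr_self,
          Finsupp.single_eq_of_ne, zero_smul]
        rintro h
        exact hT (exists_compl_iff.1 ⟨S, h.symm⟩)

end kac

/-! ### The right coaction of the even part on the composite monomials -/

section right
variable {p q : ℕ} {s : Side}

variable (p q) in
/-- The left factor of `A(p,q) ⊗ A₀(p,q)`. -/
abbrev uL : FunGL p q →ₐ[ℂ] FunGL p q ⊗[ℂ] FunGL0 p q := Algebra.TensorProduct.includeLeft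

variable (p q) in
/-- The right factor of `A(p,q) ⊗ A₀(p,q)`. -/
abbrev uR : FunGL0 p q →ₐ[ℂ] FunGL p q ⊗[ℂ] FunGL0 p q := Algebra.TensorProduct.includeRight

lemma uL_mul_uR (x : FunGL p q) (r : FunGL0 p q) : uL p q x * uR p q r = x ⊗ₜ r := by
  simp

lemma uR_mul_uL (x : FunGL p q) (r : FunGL0 p q) : uR p q r * uL p q x = x ⊗ₜ r := by
  simp

lemma rightHom_blocks (s : Side) :
    (sA p q s).map (rightHom p q) = (sA p q s).map (uL p q) * (sA0 p q s).map (uR p q) ∧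
    (sB p q s).map (rightHom p q) = (sB p q s).map (uL p q) * (sD0 p q s).map (uR p q) ∧
    (sC p q s).map (rightHom p q) = (sC p q s).map (uL p q) * (sA0 p q s).map (uR p q) ∧
    (sD p q s).map (rightHom p q) = (sD p q s).map (uL p q) * (sD0 p q s).map (uR p q) := by
  have h := block_mul (f := rightHom p q) (g := uL p q)
    (h := (uR p q).comp (proj0 p q)) (fun i j => by
      rw [rightHom_supermatrix]
      refine Finset.sum_congr rfl fun k _ => ?_
      rw [AlgHom.comp_apply, proj0_supermatrix, uL_mul_uR]) s
  obtain ⟨h1, h2, h3, h4⟩ := proj0_block (p := p) (q := q) s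
  have z : ∀ {m n : ℕ}, (0 : Matrix (Fin m) (Fin n) (FunGL0 p q)).map (uR p q) = 0 :=
    Matrix.map_zero _ (map_zero _)
  simpa only [map_comp, h1, h2, h3, h4, z, Matrix.mul_zero, add_zero, zero_add] using h

lemma rightHom_sXi : (sA0 p q s).map (uR p q) * (sXi p q s).map (rightHom p q) =
    (sXi p q s).map (uL p q) * (sD0 p q s).map (uR p q) := by
  have h := map_sXi (s := s) (rightHom p q)
  rw [(rightHom_blocks s).1, (rightHom_blocks s).2.1, ← map_sXi (uL p q), Matrix.mul_assoc,
    Matrix.mul_assoc] at h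
  exact sA_cancel _ h

lemma rightHom_sT : (sT p q s).map (rightHom p q) =
    (sT p q s).map (uL p q) * (sD0 p q s).map (uR p q) := by
  rw [map_sT, (rightHom_blocks s).2.2.1, (rightHom_blocks s).2.2.2, Matrix.mul_assoc,
    rightHom_sXi, map_sT, Matrix.sub_mul, Matrix.mul_assoc]

/-- The right coaction multiplies T by D₀ and C by A₀, so by Tζ = C it sends ζ to D₀⁻¹ζA₀. This is
linear in ζ, so the monomials of a fixed order form a subcomodule. -/
lemma rightHom_sZeta : (sD0 p q s).map (uR p q) * (sZeta p q s).map (rightHom p q) =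
    (sZeta p q s).map (uL p q) * (sA0 p q s).map (uR p q) := by
  have h := map_sZeta (s := s) (rightHom p q)
  rw [rightHom_sT, (rightHom_blocks s).2.2.1, ← map_sZeta (uL p q), Matrix.mul_assoc,
    Matrix.mul_assoc] at h
  exact sT_cancel _ h

lemma range_uR_mul_self :
    LinearMap.range (uR p q).toLinearMap * LinearMap.range (uR p q).toLinearMap ≤
      LinearMap.range (uR p q).toLinearMap := by
  rw [Submodule.mul_le]
  rintro _ ⟨x, rfl⟩ _ ⟨y, rfl⟩
  exact ⟨x * y, map_mul (uR p q) x y⟩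

lemma commute_map_uL (P : Submodule ℂ (FunGL p q)) :
    Commute (P.map (uL p q).toLinearMap) (LinearMap.range (uR p q).toLinearMap) := by
  refine le_antisymm (Submodule.mul_le.2 ?_) (Submodule.mul_le.2 ?_)
  · rintro _ ⟨x, hx, rfl⟩ _ ⟨y, rfl⟩
    refine (congrArg (· ∈ _) ((uR_mul_uL x y).trans (uL_mul_uR x y).symm)).mp ?_
    exact Submodule.mul_mem_mul ⟨_, rfl⟩ ⟨x, hx, rfl⟩
  · rintro _ ⟨y, rfl⟩ _ ⟨x, hx, rfl⟩
    refine (congrArg (· ∈ _) ((uL_mul_uR x y).trans (uR_mul_uL x y).symm)).mp ?_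
    exact Submodule.mul_mem_mul ⟨x, hx, rfl⟩ ⟨_, rfl⟩

lemma rightHom_sZeta_mem (i j) : rightHom p q (sZeta p q s i j) ∈
    (Submodule.span ℂ (compVars p q s)).map (uL p q).toLinearMap *
      LinearMap.range (uR p q).toLinearMap := by
  have h : (sZeta p q s).map (rightHom p q) = (sD0 p q s)⁻¹.map (uR p q) *
      ((sZeta p q s).map (uL p q) * (sA0 p q s).map (uR p q)) :=
    eq_inv_mul _ isUnit_det_sD0 rightHom_sZeta
  have h' := congrFun₂ h i j
  rw [Matrix.map_apply] at h'
  rw [h', Matrix.mul_apply]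
  refine sum_mem fun k _ => ?_
  rw [Matrix.mul_apply, Finset.mul_sum]
  refine sum_mem fun l _ => ?_
  change uR p q ((sD0 p q s)⁻¹ i k) * (uL p q (sZeta p q s k l) * uR p q (sA0 p q s l j)) ∈ _
  have e : uR p q ((sD0 p q s)⁻¹ i k) * (uL p q (sZeta p q s k l) * uR p q (sA0 p q s l j)) =
      uL p q (sZeta p q s k l) * uR p q ((sD0 p q s)⁻¹ i k * sA0 p q s l j) := by
    rw [← mul_assoc, uR_mul_uL, ← uL_mul_uR, map_mul, mul_assoc]
  rw [e]
  exact Submodule.mul_mem_mul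
    ⟨_, Submodule.subset_span (by rw [compVars_eq]; exact ⟨k, l, rfl⟩), rfl⟩ ⟨_, rfl⟩

lemma rightHom_compMonomials (j : ℕ) : (compMonomials p q s j).map (rightHom p q).toLinearMap ≤
    (compMonomials p q s j).map (uL p q).toLinearMap * LinearMap.range (uR p q).toLinearMap := by
  have h1 : (Submodule.span ℂ (compVars p q s)).map (rightHom p q).toLinearMap ≤
      (Submodule.span ℂ (compVars p q s)).map (uL p q).toLinearMap *
        LinearMap.range (uR p q).toLinearMap := by
    rw [Submodule.map_span_le]
    intro x hx
    have hx' := hx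
    rw [compVars_eq] at hx'
    obtain ⟨i, k, rfl⟩ := hx'
    exact rightHom_sZeta_mem i k
  have h2 : ∀ j : ℕ, LinearMap.range (uR p q).toLinearMap ^ j ≤
      LinearMap.range (uR p q).toLinearMap := by
    intro j
    induction j with
    | zero =>
      rw [pow_zero, Submodule.one_le]
      exact ⟨1, map_one (uR p q)⟩
    | succ j ih => rw [pow_succ]; exact (mul_le_mul' ih le_rfl).trans range_uR_mul_self
  rw [compMonomials, Submodule.map_pow, Submodule.map_pow]
  refine (pow_le_pow_left' h1 j).trans ?_
  rw [(commute_map_uL _).mul_pow]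
  exact mul_le_mul' le_rfl (h2 j)

lemma parity_compMonomials (j : ℕ) (x : FunGL p q) (hx : x ∈ compMonomials p q s j) :
    parity p q x ∈ compMonomials p q s j := by
  obtain ⟨e, he⟩ := exists_isMonomialBasis (OddGen p q)
  rw [compMonomials_eq he] at hx ⊢
  exact parity_mem_map_psi he _ x hx

theorem isSubcomodule_compMonomials (s : Side) (j : ℕ) :
    IsSubcomodule (gr p q) (rightCoaction0 p q) (compMonomials p q s j) := by
  refine isSubcomodule_of_inv (isInv_gr p q) (parity_compMonomials j) fun u hu => ?_
  rw [← rightHom_apply]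
  have h : (compMonomials p q s j).map (uL p q).toLinearMap *
      LinearMap.range (uR p q).toLinearMap ≤
        LinearMap.range ((compMonomials p q s j).subtype.rTensor (FunGL0 p q)) := by
    rw [Submodule.mul_le]
    rintro _ ⟨x, hx, rfl⟩ _ ⟨y, rfl⟩
    exact ⟨⟨x, hx⟩ ⊗ₜ y, (uL_mul_uR x y).symm⟩
  exact h (rightHom_compMonomials j ⟨u, hu, rfl⟩)

theorem isSuperComodule_compMonomials {j : ℕ}
    (h : IsSubcomodule (gr p q) (rightCoaction0 p q) (compMonomials p q s j)) :
    IsSuperComodule (comul0 p q).toLinearMap (counit0 p q).toLinearMap (gr0 p q)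
      (restrictGr (gr p q) (compMonomials p q s j)) h.coaction :=
  (isSuperComodule_rightCoaction0 p q).restrict (isInv_gr0 p q) h

end right

/-! ### Tensor products of comodules over the even part -/

section tensor
variable {p q : ℕ} {V : Type*} [AddCommGroup V] [Module ℂ V] {V' : Type*} [AddCommGroup V']
  [Module ℂ V']

/-- The product of the coefficients: `(v ⊗ a) ⊗ (w ⊗ b) ↦ (v ⊗ w) ⊗ ab`. -/
def mulCoef (V V' D : Type*) [AddCommGroup V] [Module ℂ V] [AddCommGroup V'] [Module ℂ V']
    [CommRing D] [Algebra ℂ D] :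
    (V ⊗[ℂ] D) ⊗[ℂ] (V' ⊗[ℂ] D) →ₗ[ℂ] (V ⊗[ℂ] V') ⊗[ℂ] D :=
  (LinearMap.mul' ℂ D).lTensor (V ⊗[ℂ] V') ∘ₗ
    (TensorProduct.tensorTensorTensorComm ℂ V D V' D).toLinearMap

lemma mulCoef_tmul {D : Type*} [CommRing D] [Algebra ℂ D] (v : V) (w : V') (a b : D) :
    mulCoef V V' D ((v ⊗ₜ a) ⊗ₜ (w ⊗ₜ b)) = (v ⊗ₜ w) ⊗ₜ (a * b) := rfl

lemma tensorCoaction_tmul {D : Type*} [CommRing D] [Algebra ℂ D] (β : V →ₗ[ℂ] V ⊗[ℂ] D)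
    (β' : V' →ₗ[ℂ] V' ⊗[ℂ] D) (v : V) (w : V') :
    tensorCoaction β β' (v ⊗ₜ w) = mulCoef V V' D (β v ⊗ₜ β' w) := rfl

/-- An induction principle for pairs of tensors. -/
lemma tensor_pair_induction {A B C D : Type*} [AddCommGroup A] [Module ℂ A] [AddCommGroup B]
    [Module ℂ B] [AddCommGroup C] [Module ℂ C] [AddCommGroup D] [Module ℂ D] {M : Type*}
    [AddCommGroup M] [Module ℂ M] {f g : (A ⊗[ℂ] B) ⊗[ℂ] (C ⊗[ℂ] D) →ₗ[ℂ] M}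
    (h : ∀ a b c d, f ((a ⊗ₜ b) ⊗ₜ (c ⊗ₜ d)) = g ((a ⊗ₜ b) ⊗ₜ (c ⊗ₜ d))) : f = g := by
  ext a b c d
  exact h a b c d

lemma _root_.AlgHom.lTensor_mulCoef {D E : Type*} [CommRing D] [Algebra ℂ D] [CommRing E]
    [Algebra ℂ E] (f : D →ₐ[ℂ] E) (y : V ⊗[ℂ] D) (z : V' ⊗[ℂ] D) :
    f.toLinearMap.lTensor (V ⊗[ℂ] V') (mulCoef V V' D (y ⊗ₜ z)) =
      mulCoef V V' E (f.toLinearMap.lTensor V y ⊗ₜ f.toLinearMap.lTensor V' z) := by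
  have key : f.toLinearMap.lTensor (V ⊗[ℂ] V') ∘ₗ mulCoef V V' D = mulCoef V V' E ∘ₗ
      TensorProduct.map (f.toLinearMap.lTensor V) (f.toLinearMap.lTensor V') := by
    refine tensor_pair_induction fun a b c d => ?_
    simp only [LinearMap.comp_apply, mulCoef_tmul, TensorProduct.map_tmul, LinearMap.lTensor_tmul,
      AlgHom.toLinearMap_apply, map_mul]
  exact LinearMap.congr_fun key (y ⊗ₜ z)

lemma assoc_mulCoef_tmul {D : Type*} [CommRing D] [Algebra ℂ D] (y : V ⊗[ℂ] D) (z : V' ⊗[ℂ] D)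
    (b d : D) : TensorProduct.assoc ℂ (V ⊗[ℂ] V') D D (mulCoef V V' D (y ⊗ₜ z) ⊗ₜ (b * d)) =
      mulCoef V V' (D ⊗[ℂ] D) (TensorProduct.assoc ℂ V D D (y ⊗ₜ b) ⊗ₜ
        TensorProduct.assoc ℂ V' D D (z ⊗ₜ d)) := by
  have key : (TensorProduct.assoc ℂ (V ⊗[ℂ] V') D D).toLinearMap ∘ₗ
      (TensorProduct.mk ℂ _ D).flip (b * d) ∘ₗ mulCoef V V' D =
      mulCoef V V' (D ⊗[ℂ] D) ∘ₗ TensorProduct.map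
        ((TensorProduct.assoc ℂ V D D).toLinearMap ∘ₗ (TensorProduct.mk ℂ _ D).flip b)
        ((TensorProduct.assoc ℂ V' D D).toLinearMap ∘ₗ (TensorProduct.mk ℂ _ D).flip d) := by
    refine tensor_pair_induction fun _ _ _ _ => ?_
    simp only [LinearMap.comp_apply, mulCoef_tmul, TensorProduct.map_tmul, LinearMap.flip_apply,
      TensorProduct.mk_apply, LinearEquiv.coe_coe, TensorProduct.assoc_tmul,
      Algebra.TensorProduct.tmul_mul_tmul]
  exact LinearMap.congr_fun key (y ⊗ₜ z)

lemma assoc_mulCoef {D : Type*} [CommRing D] [Algebra ℂ D] (β : V →ₗ[ℂ] V ⊗[ℂ] D)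
    (β' : V' →ₗ[ℂ] V' ⊗[ℂ] D) (y : V ⊗[ℂ] D) (z : V' ⊗[ℂ] D) :
    TensorProduct.assoc ℂ (V ⊗[ℂ] V') D D
      ((tensorCoaction β β').rTensor D (mulCoef V V' D (y ⊗ₜ z))) =
      mulCoef V V' (D ⊗[ℂ] D) (TensorProduct.assoc ℂ V D D (β.rTensor D y) ⊗ₜ
        TensorProduct.assoc ℂ V' D D (β'.rTensor D z)) := by
  have key : (TensorProduct.assoc ℂ (V ⊗[ℂ] V') D D).toLinearMap ∘ₗ
      (tensorCoaction β β').rTensor D ∘ₗ mulCoef V V' D =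
      mulCoef V V' (D ⊗[ℂ] D) ∘ₗ TensorProduct.map
        ((TensorProduct.assoc ℂ V D D).toLinearMap ∘ₗ β.rTensor D)
        ((TensorProduct.assoc ℂ V' D D).toLinearMap ∘ₗ β'.rTensor D) := by
    refine tensor_pair_induction fun a b c d => ?_
    simp only [LinearMap.comp_apply, mulCoef_tmul, TensorProduct.map_tmul,
      LinearMap.rTensor_tmul, LinearEquiv.coe_coe, tensorCoaction_tmul, assoc_mulCoef_tmul]
  exact LinearMap.congr_fun key (y ⊗ₜ z)

/-- Coassociativity and the counit law follow from those of the factors because `comul0` and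
`counit0` are multiplicative; the coefficients commute, so there are no signs. -/
theorem isSuperComodule_tensorCoaction {gV : ZMod 2 → Submodule ℂ V}
    {gV' : ZMod 2 → Submodule ℂ V'} {β : V →ₗ[ℂ] V ⊗[ℂ] FunGL0 p q}
    {β' : V' →ₗ[ℂ] V' ⊗[ℂ] FunGL0 p q}
    (hβ : IsSuperComodule (comul0 p q).toLinearMap (counit0 p q).toLinearMap (gr0 p q) gV β)
    (hβ' : IsSuperComodule (comul0 p q).toLinearMap (counit0 p q).toLinearMap (gr0 p q) gV' β') :
    IsSuperComodule (comul0 p q).toLinearMap (counit0 p q).toLinearMap (gr0 p q)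
      (tensorGr gV gV') (tensorCoaction β β') := by
  obtain ⟨σ, hσ⟩ := exists_isInv hβ.isInternal
  obtain ⟨τ, hτ⟩ := exists_isInv hβ'.isInternal
  have hT := hσ.tensor hτ
  refine ⟨hT.isInternal, fun i t ht => ?_, fun t => ?_, fun t => ?_⟩
  · refine hT.map_mem (hT.tensor (isInv_gr0 p q)) _ (fun t => ?_) ht
    induction t using TensorProduct.induction_on with
    | zero => simp only [map_zero]
    | add x y hx hy => simp only [map_add, hx, hy]
    | tmul v w =>
      have key : TensorProduct.map (TensorProduct.map σ τ) LinearMap.id ∘ₗ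
          mulCoef V V' (FunGL0 p q) = mulCoef V V' (FunGL0 p q) ∘ₗ
            TensorProduct.map (TensorProduct.map σ LinearMap.id)
              (TensorProduct.map τ LinearMap.id) :=
        tensor_pair_induction fun a b c d => rfl
      rw [tensorCoaction_tmul, TensorProduct.map_tmul, tensorCoaction_tmul,
        ← hβ.parity_comm hσ (isInv_gr0 p q), ← hβ'.parity_comm hτ (isInv_gr0 p q)]
      exact LinearMap.congr_fun key (β v ⊗ₜ β' w)
  · induction t using TensorProduct.induction_on with
    | zero => simp only [map_zero]
    | add x y hx hy => simp only [map_add, hx, hy]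
    | tmul v w =>
      rw [tensorCoaction_tmul]
      rw [assoc_mulCoef, hβ.coassoc, hβ'.coassoc, AlgHom.lTensor_mulCoef]
  · induction t using TensorProduct.induction_on with
    | zero => simp only [map_zero]
    | add x y hx hy => simp only [map_add, hx, hy]
    | tmul v w =>
      have key : (TensorProduct.rid ℂ (V ⊗[ℂ] V')).toLinearMap ∘ₗ
          (counit0 p q).toLinearMap.lTensor (V ⊗[ℂ] V') ∘ₗ mulCoef V V' (FunGL0 p q) =
          TensorProduct.map
            ((TensorProduct.rid ℂ V).toLinearMap ∘ₗ (counit0 p q).toLinearMap.lTensor V)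
            ((TensorProduct.rid ℂ V').toLinearMap ∘ₗ (counit0 p q).toLinearMap.lTensor V') := by
        refine tensor_pair_induction fun a b c d => ?_
        simp [mulCoef_tmul, TensorProduct.smul_tmul', mul_smul, smul_comm (counit0 p q d)]
      rw [tensorCoaction_tmul]
      refine (LinearMap.congr_fun key (β v ⊗ₜ β' w)).trans ?_
      exact congrArg₂ (· ⊗ₜ[ℂ] ·) (hβ.counit v) (hβ'.counit w)

end tensor

/-! ### The leading part of the comultiplication of the composite monomials -/

section leadingPart
variable {p q : ℕ} {s : Side}

lemma compMonomials_le_filPoly (j : ℕ) : compMonomials p q s j ≤ filPoly p q s j := by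
  rw [compMonomials, filPoly, ← one_mul (Submodule.span ℂ (compVars p q s) ^ j)]
  refine mul_le_mul' ?_ (pow_le_pow_left' le_sup_right j)
  rw [Submodule.one_le]
  exact one_mem (Algebra.adjoin ℂ (baseVars p q s))

/-- Each ζ differs from its leading part by a term of degree zero. Both maps are homomorphisms, so
replacing one factor at a time shows that the difference on a monomial loses one degree. -/
theorem comul_sub_leading_mem (j : ℕ) (x : FunGL p q) (hx : x ∈ compMonomials p q s (j + 1)) :
    comulHom p q x - leading p q s x ∈ leftSpan (filPoly p q s j) := by
  have h1 : ∀ y ∈ Submodule.span ℂ (compVars p q s),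
      comulHom p q y - leading p q s y ∈ leftSpan (filPoly p q s 0) := by
    intro y hy
    induction hy using Submodule.span_induction with
    | mem y hy =>
      rw [compVars_eq] at hy
      obtain ⟨i, k, rfl⟩ := hy
      exact baseAlg_le (comul_sub_leading_sZeta_mem i k)
    | zero => simp only [map_zero, sub_zero, zero_mem]
    | add a b _ _ ha hb =>
      rw [map_add, map_add, add_sub_add_comm]
      exact add_mem ha hb
    | smul c a _ ha =>
      rw [map_smul, map_smul, ← smul_sub]
      exact Submodule.smul_mem _ c ha
  induction j generalizing x with
  | zero =>
    rw [compMonomials, zero_add, pow_one] at hx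
    exact h1 x hx
  | succ j ih =>
    rw [compMonomials, pow_succ] at hx
    induction hx using Submodule.mul_induction_on' with
    | add a _ b _ ha hb =>
      rw [map_add, map_add, add_sub_add_comm]
      exact add_mem ha hb
    | mem_mul_mem a ha b hb =>
      have hb' : b ∈ filPoly p q s 1 := compMonomials_le_filPoly 1 (by
        rw [compMonomials, pow_one]; exact hb)
      -- The degrees of the two terms are at most j + 1 and (j + 1) + 0.
      have e : comulHom p q (a * b) - leading p q s (a * b) =
          (comulHom p q a - leading p q s a) * comulHom p q b +
            leading p q s a * (comulHom p q b - leading p q s b) := by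
        rw [map_mul, map_mul, sub_mul, mul_sub]
        abel
      have hl : leading p q s a ∈ leftSpan (filPoly p q s (j + 1)) := by
        rw [← sub_sub_cancel (comulHom p q a) (leading p q s a)]
        exact sub_mem (comul_filPoly (j + 1) ⟨a, compMonomials_le_filPoly _ ha, rfl⟩)
          (leftSpan_mono (filPoly_mono (Nat.le_succ j)) (ih a ha))
      rw [e]
      refine add_mem (leftSpan_filPoly_mul j 1 (Submodule.mul_mem_mul (ih a ha)
        (comul_filPoly 1 ⟨b, hb', rfl⟩))) ?_
      exact leftSpan_filPoly_mul (j + 1) 0 (Submodule.mul_mem_mul hl (h1 b hb))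

end leadingPart

/-! ### The quotients of the filtration -/

section general
variable {C : Type*} [AddCommGroup C] [Module ℂ C] {Q : Type*} [AddCommGroup Q] [Module ℂ Q]
  {V : Type*} [AddCommGroup V] [Module ℂ V] {V' : Type*} [AddCommGroup V'] [Module ℂ V']

/-- Two comodules parameterised bijectively by the same space in a compatible way are isomorphic. -/
theorem comoduleIso_of_bijective {gV : ZMod 2 → Submodule ℂ V} {γ : V →ₗ[ℂ] V ⊗[ℂ] C}
    {gV' : ZMod 2 → Submodule ℂ V'} {γ' : V' →ₗ[ℂ] V' ⊗[ℂ] C} {σ : V →ₗ[ℂ] V} {σ' : V' →ₗ[ℂ] V'}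
    (hσ : IsInv gV σ) (hσ' : IsInv gV' σ') {b : Q →ₗ[ℂ] V} {a : Q →ₗ[ℂ] V'}
    (hb : Function.Bijective b) (ha : Function.Bijective a)
    (hs : ∀ t, ∃ t', b t' = σ (b t) ∧ a t' = σ' (a t))
    (hc : ∀ t, ∃ y, b.rTensor C y = γ (b t) ∧ a.rTensor C y = γ' (a t)) :
    ComoduleIso gV γ gV' γ' := by
  let e : V ≃ₗ[ℂ] V' := (LinearEquiv.ofBijective b hb).symm.trans (LinearEquiv.ofBijective a ha)
  have he : ∀ t, e (b t) = a t := fun t => by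
    change LinearEquiv.ofBijective a ha ((LinearEquiv.ofBijective b hb).symm
      (LinearEquiv.ofBijective b hb t)) = a t
    rw [LinearEquiv.symm_apply_apply]
    rfl
  refine ⟨e, fun i => hσ.map_eq hσ' e (fun v => ?_) i, fun v => ?_⟩
  · obtain ⟨t, rfl⟩ := hb.2 v
    obtain ⟨t', h1, h2⟩ := hs t
    rw [he, ← h1, he, h2]
  · obtain ⟨t, rfl⟩ := hb.2 v
    obtain ⟨y, h1, h2⟩ := hc t
    have : e.toLinearMap ∘ₗ b = a := LinearMap.ext he
    rw [he, ← h1, ← h2, ← this, LinearMap.rTensor_comp, LinearMap.comp_apply]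

lemma mkQ_rTensor_eq_zero {U U' : Submodule ℂ V} (hle : U' ≤ U) (x : U ⊗[ℂ] C)
    (hx : U.subtype.rTensor C x ∈ LinearMap.range (U'.subtype.rTensor C)) :
    (U'.submoduleOf U).mkQ.rTensor C x = 0 := by
  obtain ⟨t, ht⟩ := hx
  have h : x = (Submodule.inclusion hle).rTensor C t := by
    apply subtype_rTensor_injective U
    rw [← ht, ← LinearMap.comp_apply, ← LinearMap.rTensor_comp, Submodule.subtype_comp_inclusion]
  have z : (U'.submoduleOf U).mkQ ∘ₗ Submodule.inclusion hle = 0 := by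
    ext x
    exact (Submodule.Quotient.mk_eq_zero _).2 x.2
  rw [h, ← LinearMap.comp_apply, ← LinearMap.rTensor_comp, z, LinearMap.rTensor_zero,
    LinearMap.zero_apply]

end general

section quotient
variable {p q : ℕ} {V : Type*} [AddCommGroup V] [Module ℂ V] {s : Side}
  {β : V →ₗ[ℂ] V ⊗[ℂ] FunGL0 p q} {gV : ZMod 2 → Submodule ℂ V}
  {e : Module.Basis (Finset (OddGen p q)) ℂ (Grass p q)} {j : ℕ}

lemma evalUnit_psi (w : Grass p q) : evalUnit s (psi p q s w) = w := by
  have h : psi p q s w = bigPsi p q s (toA p q (1 ⊗ₜ w)) := by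
    rw [bigPsi_toA, map_one, one_mul]
  rw [h, evalUnit, LinearMap.comp_apply, LinearMap.comp_apply, LinearMap.comp_apply,
    AlgHom.toLinearMap_apply, bigPhi_bigPsi]
  change TensorProduct.lid ℂ _ ((counit0 p q).toLinearMap.rTensor _ (1 ⊗ₜ w)) = w
  rw [LinearMap.rTensor_tmul, AlgHom.toLinearMap_apply, map_one, TensorProduct.lid_tmul, one_smul]

lemma psi_evalUnit (z : compMonomials p q s j) :
    psi p q s (evalUnit s (z : FunGL p q)) = z := by
  obtain ⟨e, he⟩ := exists_isMonomialBasis (OddGen p q)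
  obtain ⟨w, -, hw⟩ := (compMonomials_eq (s := s) he j).le z.2
  rw [← hw]
  exact congrArg _ (evalUnit_psi w)

lemma evalUnit_mem (he : IsMonomialBasis e) (z : compMonomials p q s j) :
    evalUnit s (z : FunGL p q) ∈ spanOf e {S | ↑S ⊆ compIdx p q s ∧ S.card = j} := by
  obtain ⟨w, hw', hw⟩ := (compMonomials_eq (s := s) he j).le z.2
  rw [← hw]
  refine (congrArg (· ∈ _) (evalUnit_psi w)).mpr hw'

lemma evalUnit_parity (z : compMonomials p q s j) : evalUnit s (parity p q z) =
    CliffordAlgebra.involute (Q := (0 : QuadraticForm ℂ (OddGen p q → ℂ)))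
      (evalUnit s (z : FunGL p q)) := by
  rw [← psi_evalUnit z, parity_psi, evalUnit_psi, evalUnit_psi]

variable (p q s e) in
/-- The polynomials in the base variables. -/
abbrev baseGrass : Submodule ℂ (Grass p q) := spanOf e {S | ↑S ⊆ baseIdx p q s}

variable (e V s j) in
/-- The multiplication of composite monomials with polynomials in the base variables. -/
def mulGrass : (V ⊗[ℂ] compMonomials p q s j) ⊗[ℂ] baseGrass p q s e →ₗ[ℂ] V ⊗[ℂ] Grass p q :=
  (LinearMap.mul' ℂ (Grass p q)).lTensor V ∘ₗ
    (TensorProduct.assoc ℂ V (Grass p q) (Grass p q)).toLinearMap ∘ₗ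
      TensorProduct.map ((evalUnit s ∘ₗ (compMonomials p q s j).subtype).lTensor V)
        (baseGrass p q s e).subtype

lemma mulGrass_tmul (v : V) (z : compMonomials p q s j) (g : baseGrass p q s e) :
    mulGrass V s e j ((v ⊗ₜ z) ⊗ₜ g) = v ⊗ₜ (evalUnit s (z : FunGL p q) * g) := rfl

/-- Base and composite variables have disjoint index sets, so a product of monomials in the two
kinds determines its factors; `exists_split` recovers them linearly. -/
lemma mulGrass_injective (he : IsMonomialBasis e) : Function.Injective (mulGrass V s e j) := by
  obtain ⟨n, hn⟩ := he.exists_split (isCompl_baseIdx (p := p) (q := q) (s := s)).disjoint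
  have h : n.lTensor V ∘ₗ mulGrass V s e j =
      (TensorProduct.assoc ℂ V (Grass p q) (Grass p q)).toLinearMap ∘ₗ
      TensorProduct.map ((evalUnit s ∘ₗ (compMonomials p q s j).subtype).lTensor V)
        (baseGrass p q s e).subtype := by
    ext v z g
    exact congrArg (v ⊗ₜ[ℂ] ·) (hn _
      (IsMonomialBasis.spanOf_mono (fun S hS => hS.1) (evalUnit_mem he z)) _ g.2)
  have hi : Function.Injective (evalUnit s ∘ₗ (compMonomials p q s j).subtype) := fun z z' hz =>
    Subtype.ext (by rw [← psi_evalUnit z, ← psi_evalUnit z']; exact congrArg _ hz)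
  have h2 : Function.Injective (n.lTensor V ∘ₗ mulGrass V s e j) := by
    rw [h, ← LinearMap.rTensor_comp_lTensor]
    exact (TensorProduct.assoc ℂ V (Grass p q) (Grass p q)).injective.comp
      ((Module.Flat.rTensor_preserves_injective_linearMap _
        (Module.Flat.lTensor_preserves_injective_linearMap _ hi)).comp
          (Module.Flat.lTensor_preserves_injective_linearMap _
            (Submodule.injective_subtype _)))
  exact Function.Injective.of_comp h2

lemma tcoord_tmul_eq_zero {F : Set (Finset (OddGen p q))} {x : Grass p q} (hx : x ∈ spanOf e F)
    (v : V) {S : Finset (OddGen p q)} (hS : S ∉ F) : tcoord e S (v ⊗ₜ x) = 0 :=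
  (mem_range_spanOf e F _).1 ⟨v ⊗ₜ ⟨x, hx⟩, rfl⟩ S hS

-- The products are homogeneous of degree j in the composite variables, because the second factor
-- contains none of them.
open Classical in
lemma tcoord_mulGrass (he : IsMonomialBasis e)
    (t : (V ⊗[ℂ] compMonomials p q s j) ⊗[ℂ] baseGrass p q s e) {S : Finset (OddGen p q)}
    (hS : (S.filter (· ∈ compIdx p q s)).card ≠ j) : tcoord e S (mulGrass V s e j t) = 0 := by
  have h : tcoord e S ∘ₗ mulGrass V s e j = 0 := by
    ext v z g
    refine tcoord_tmul_eq_zero (F := {S | (S.filter (· ∈ compIdx p q s)).card = j}) ?_ v hS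
    refine he.spanOf_mul_le (fun T hT T' hT' _ => ?_)
      (Submodule.mul_mem_mul (evalUnit_mem he z) g.2)
    rw [Set.mem_ofPred_eq, Finset.filter_union, Finset.filter_true_of_mem fun k hk => hT.1 hk,
      Finset.filter_false_of_mem fun k hk hk' =>
        (isCompl_baseIdx (p := p) (q := q) (s := s)).disjoint.le_bot ⟨hT' hk, hk'⟩,
      Finset.union_empty, hT.2]
  exact LinearMap.congr_fun h t

lemma mem_kacFil (he : IsMonomialBasis e) {u : V ⊗[ℂ] FunGL p q} : u ∈ kacFil s β j ↔
    ∃ t, (∀ S ∉ filSets p q s j, tcoord e S t = 0) ∧ omega s β t = u := by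
  rw [kacFil_eq he, Submodule.mem_map]
  refine exists_congr fun t => and_congr_left fun _ => ?_
  rw [mem_range_spanOf]

lemma omega_mulGrass_mem (he : IsMonomialBasis e)
    (t : (V ⊗[ℂ] compMonomials p q s j) ⊗[ℂ] baseGrass p q s e) :
    omega s β (mulGrass V s e j t) ∈ kacFil s β j :=
  (mem_kacFil he).2 ⟨_, fun _ hS => tcoord_mulGrass he t fun h => hS h.le, rfl⟩

/-- The product has only monomials of degree j + 1, an element of W_j only those of degree at most
j. By injectivity of `omega` both must vanish. -/
lemma mulGrass_inj_mod
    (hβ : IsSuperComodule (comul0 p q).toLinearMap (counit0 p q).toLinearMap (gr0 p q) gV β)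
    (he : IsMonomialBasis e)
    (t : (V ⊗[ℂ] compMonomials p q s (j + 1)) ⊗[ℂ] baseGrass p q s e)
    (ht : omega s β (mulGrass V s e (j + 1) t) ∈ kacFil s β j) : t = 0 := by
  classical
  apply mulGrass_injective he
  rw [map_zero]
  obtain ⟨u, hu, h⟩ := (mem_kacFil he).1 ht
  obtain rfl := omega_injective hβ h
  refine tcoord_ext (e := e) fun S => ?_
  rw [map_zero]
  by_cases hS : S ∈ filSets p q s j
  · refine tcoord_mulGrass he t fun h => ?_
    have h' : (S.filter (· ∈ compIdx p q s)).card ≤ j := hS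
    omega
  · exact hu S hS

lemma exists_mulGrass (he : IsMonomialBasis e) (u : V ⊗[ℂ] FunGL p q)
    (hu : u ∈ kacFil s β (j + 1)) :
    ∃ t, u - omega s β (mulGrass V s e (j + 1) t) ∈ kacFil s β j := by
  classical
  rw [kacFil_eq he] at hu
  obtain ⟨_, ⟨x, rfl⟩, rfl⟩ := hu
  induction x using TensorProduct.induction_on with
  | zero => exact ⟨0, by simp only [map_zero, sub_zero, zero_mem]⟩
  | add x y hx hy =>
    obtain ⟨t, ht⟩ := hx
    obtain ⟨t', ht'⟩ := hy
    refine ⟨t + t', ?_⟩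
    simp only [map_add, add_sub_add_comm]
    exact add_mem ht ht'
  | tmul v w =>
    obtain ⟨w, hw⟩ := w
    change ∃ t, omega s β (v ⊗ₜ w) - _ ∈ _
    induction hw using Submodule.span_induction with
    | zero => exact ⟨0, by simp only [TensorProduct.tmul_zero, map_zero, sub_zero, zero_mem]⟩
    | add x y _ _ hx hy =>
      obtain ⟨t, ht⟩ := hx
      obtain ⟨t', ht'⟩ := hy
      refine ⟨t + t', ?_⟩
      simp only [TensorProduct.tmul_add, map_add, add_sub_add_comm]
      exact add_mem ht ht'
    | smul c x _ hx =>
      obtain ⟨t, ht⟩ := hx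
      refine ⟨c • t, ?_⟩
      rw [TensorProduct.tmul_smul, map_smul, map_smul, map_smul, ← smul_sub]
      exact Submodule.smul_mem _ c ht
    | mem x hx =>
      obtain ⟨S, hS, rfl⟩ := hx
      by_cases h : S ∈ filSets p q s j
      · refine ⟨0, ?_⟩
        rw [map_zero, map_zero, sub_zero]
        exact (mem_kacFil he).2 ⟨_, fun T hT => tcoord_tmul_eq_zero
          (IsMonomialBasis.mem_spanOf h) v hT, rfl⟩
      -- The monomials not already in W_j have exact degree j + 1. Each factors into its composite
      -- and its base part, and c⁻¹ corrects the scalar of this factorization.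
      · have hc : (S.filter (· ∈ compIdx p q s)).card = j + 1 := by
          have h1 : (S.filter (· ∈ compIdx p q s)).card ≤ j + 1 := hS
          have h2 : ¬(S.filter (· ∈ compIdx p q s)).card ≤ j := h
          omega
        have hd : Disjoint (S.filter (· ∈ compIdx p q s)) (S.filter (¬ · ∈ compIdx p q s)) :=
          Finset.disjoint_filter_filter_not _ _ _
        obtain ⟨c, hc0, hm⟩ := he.mul_disjoint _ _ hd
        rw [Finset.filter_union_filter_not_eq] at hm
        have hz : psi p q s (e (S.filter (· ∈ compIdx p q s))) ∈ compMonomials p q s (j + 1) := by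
          rw [compMonomials_eq he]
          exact ⟨_, IsMonomialBasis.mem_spanOf
            ⟨fun k hk => (Finset.mem_filter.1 hk).2, hc⟩, rfl⟩
        have hg : e (S.filter (¬ · ∈ compIdx p q s)) ∈ baseGrass p q s e := by
          refine IsMonomialBasis.mem_spanOf fun k hk => ?_
          have := (Finset.mem_filter.1 hk).2
          rw [← (isCompl_baseIdx (p := p) (q := q) (s := s)).compl_eq] at this
          exact not_not.1 this
        refine ⟨((c⁻¹ • v) ⊗ₜ ⟨_, hz⟩) ⊗ₜ ⟨_, hg⟩, ?_⟩
        rw [mulGrass_tmul]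
        change omega s β _ - omega s β ((c⁻¹ • v) ⊗ₜ (evalUnit s (psi p q s _) * _)) ∈ _
        rw [evalUnit_psi, hm, TensorProduct.smul_tmul_smul, inv_mul_cancel₀ hc0, one_smul, sub_self]
        exact zero_mem _

/-! ### Compatibility with the coactions -/

variable (s e) in
/-- The inclusion of base polynomials on the left of the tensor square. -/
def baseTensor : baseGrass p q s e ⊗[ℂ] FunGL p q →ₗ[ℂ] AA p q :=
  LinearMap.mul' ℂ (AA p q) ∘ₗ TensorProduct.map
    (((inL p q).comp (psi p q s)).toLinearMap ∘ₗ (baseGrass p q s e).subtype)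
      (inR p q).toLinearMap

lemma baseTensor_tmul (g : baseGrass p q s e) (y : FunGL p q) :
    baseTensor s e (g ⊗ₜ y) = inL p q (psi p q s g) * inR p q y := rfl

lemma filPoly_zero_eq (he : IsMonomialBasis e) : filPoly p q s 0 =
    (baseGrass p q s e).map (psi p q s).toLinearMap := by
  rw [filPoly_zero, adjoin_baseVars, he.adjoin_theta]

lemma leftSpan_le_range_baseTensor (he : IsMonomialBasis e) :
    leftSpan (filPoly p q s 0) ≤ LinearMap.range (baseTensor s e) := by
  rw [filPoly_zero_eq he, leftSpan, Submodule.mul_le]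
  rintro _ ⟨_, ⟨g, hg, rfl⟩, rfl⟩ _ ⟨y, rfl⟩
  exact ⟨⟨g, hg⟩ ⊗ₜ y, rfl⟩

variable (s V j) in
/-- The product of composite monomials, coefficients and `F`. -/
def leadingMul (F : AA p q) :
    (V ⊗[ℂ] compMonomials p q s j) ⊗[ℂ] FunGL0 p q →ₗ[ℂ] V ⊗[ℂ] AA p q :=
  (LinearMap.mulRight ℂ F ∘ₗ (liftKappa p q s (AlgHom.id ℂ _)).toLinearMap ∘ₗ
    (compMonomials p q s j).subtype.rTensor (FunGL0 p q)).lTensor V ∘ₗ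
      (TensorProduct.assoc ℂ V _ _).toLinearMap

lemma leadingMul_tmul (F : AA p q) (v : V) (z : compMonomials p q s j) (r : FunGL0 p q) :
    leadingMul V s j F ((v ⊗ₜ z) ⊗ₜ r) = v ⊗ₜ (inL p q z * kappa p q s r * F) := by
  exact congrArg (fun x => v ⊗ₜ[ℂ] (x * F))
    (liftKappa_tmul (p := p) (q := q) (s := s) (AlgHom.id ℂ _) z.1 r)

/-- By multiplicativity and centrality of `kappa`, the coefficients of V and of V_j combine:
applying `kappa` to the tensor product coaction gives the coefficients of V times the leading part
of the monomial. -/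
lemma leadingMul_mulCoef (F : AA p q) (y : V ⊗[ℂ] FunGL0 p q)
    (w : compMonomials p q s j ⊗[ℂ] FunGL0 p q) :
    leadingMul V s j F (mulCoef V _ (FunGL0 p q) (y ⊗ₜ w)) =
      (LinearMap.mulRight ℂ (liftKappa p q s (AlgHom.id ℂ _)
        ((compMonomials p q s j).subtype.rTensor (FunGL0 p q) w) * F) ∘ₗ
          (kappa p q s).toLinearMap).lTensor V y := by
  induction y using TensorProduct.induction_on with
  | zero => simp only [TensorProduct.zero_tmul, map_zero]
  | add x y hx hy => simp only [TensorProduct.add_tmul, map_add, hx, hy]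
  | tmul v r =>
    rw [LinearMap.lTensor_tmul]
    change _ = v ⊗ₜ (kappa p q s r * _)
    induction w using TensorProduct.induction_on with
    | zero => simp only [TensorProduct.tmul_zero, map_zero, zero_mul, mul_zero]
    | add x y hx hy =>
      simp only [TensorProduct.tmul_add, map_add, add_mul, mul_add, hx, hy]
    | tmul z r' =>
      rw [mulCoef_tmul, leadingMul_tmul, LinearMap.rTensor_tmul, liftKappa_tmul, map_mul,
        ← mul_assoc (inL p q _), (kappa_commute r _).eq]
      simp only [mul_assoc]
      rfl

/-- The factor 𝒟(α,δ)Δ(g) has degree zero, so it is a polynomial in ξ₁ with coefficients in the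
second factor. Writing it in this way gives one tensor y that describes the coaction in both
comodules. -/
lemma exists_common_coaction
    {β' : (V ⊗[ℂ] compMonomials p q s j) →ₗ[ℂ] (V ⊗[ℂ] compMonomials p q s j) ⊗[ℂ] FunGL0 p q}
    (he : IsMonomialBasis e) (g : baseGrass p q s e)
    (t : (V ⊗[ℂ] compMonomials p q s j) ⊗[ℂ] FunGL0 p q) :
    ∃ y, (omega s β' ∘ₗ (baseGrass p q s e).subtype.lTensor _).rTensor (FunGL p q) y =
        param2 s β' ((LinearMap.mulRight ℂ (comulHom p q (psi p q s g)) ∘ₗ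
          (kappa p q s).toLinearMap).lTensor _ t) ∧
      (omega s β ∘ₗ mulGrass V s e j).rTensor (FunGL p q) y =
        param2 s β (leadingMul V s j (comulHom p q (psi p q s g)) t) := by
  induction t using TensorProduct.induction_on with
  | zero => exact ⟨0, by simp only [map_zero], by simp only [map_zero]⟩
  | add a b ha hb =>
    obtain ⟨y, h1, h2⟩ := ha
    obtain ⟨y', h1', h2'⟩ := hb
    exact ⟨y + y', by simp only [map_add, h1, h1'], by simp only [map_add, h2, h2']⟩
  | tmul w r =>
    have hm : kappa p q s r * comulHom p q (psi p q s g) ∈ leftSpan (filPoly p q s 0) := by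
      have hg : psi p q s (g : Grass p q) ∈ filPoly p q s 0 := by
        rw [filPoly_zero_eq he]
        exact ⟨_, g.2, rfl⟩
      exact leftSpan_filPoly_mul 0 0 (Submodule.mul_mem_mul (baseAlg_le (kappa_mem r))
        (comul_filPoly 0 ⟨_, hg, rfl⟩))
    obtain ⟨y, hy⟩ := leftSpan_le_range_baseTensor he hm
    refine ⟨(TensorProduct.assoc ℂ _ _ _).symm (w ⊗ₜ y), ?_, ?_⟩
    · rw [LinearMap.lTensor_tmul]
      change _ = param2 s β' (w ⊗ₜ (kappa p q s r * comulHom p q (psi p q s g)))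
      rw [← hy]
      clear hy
      induction y using TensorProduct.induction_on with
      | zero => simp only [TensorProduct.tmul_zero, map_zero]
      | add a b ha hb => simp only [TensorProduct.tmul_add, map_add, ha, hb]
      | tmul g y => rw [baseTensor_tmul, param2_tmul]; rfl
    · induction w using TensorProduct.induction_on with
      | zero => simp only [TensorProduct.zero_tmul, map_zero]
      | add a b ha hb => simp only [TensorProduct.add_tmul, map_add, ha, hb]
      | tmul v z =>
        rw [leadingMul_tmul, mul_assoc, ← hy]
        clear hy
        induction y using TensorProduct.induction_on with
        | zero => simp only [TensorProduct.tmul_zero, map_zero, mul_zero]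
        | add a b ha hb => simp only [TensorProduct.tmul_add, map_add, mul_add, ha, hb]
        | tmul g y =>
          rw [baseTensor_tmul, ← mul_assoc, ← map_mul, param2_tmul, ← psi_evalUnit z, ← map_mul]
          rfl

lemma omega_mulGrass_tmul (v : V) (z : compMonomials p q s j) (g : baseGrass p q s e) :
    omega s β (mulGrass V s e j ((v ⊗ₜ z) ⊗ₜ g)) = param s β (v ⊗ₜ (z * psi p q s g)) := by
  rw [mulGrass_tmul, omega, LinearMap.comp_apply, LinearMap.lTensor_tmul,
    AlgHom.toLinearMap_apply, map_mul, psi_evalUnit]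

lemma liftKappa_coaction (hZ : IsSubcomodule (gr p q) (rightCoaction0 p q) (compMonomials p q s j))
    (z : compMonomials p q s j) : liftKappa p q s (AlgHom.id ℂ _)
      ((compMonomials p q s j).subtype.rTensor (FunGL0 p q) (hZ.coaction z)) =
        leading p q s z := by
  rw [hZ.coaction_spec, ← rightHom_apply, leading, AlgHom.comp_apply]

lemma param2_sub_mem {P : Submodule ℂ (FunGL p q)} {F G : AA p q}
    (h : ∀ r, kappa p q s r * (F - G) ∈ leftSpan P) (y : V ⊗[ℂ] FunGL0 p q) :
    param2 s β ((LinearMap.mulRight ℂ F ∘ₗ (kappa p q s).toLinearMap).lTensor V y) -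
      param2 s β ((LinearMap.mulRight ℂ G ∘ₗ (kappa p q s).toLinearMap).lTensor V y) ∈
        LinearMap.range ((elems s β P).subtype.rTensor (FunGL p q)) := by
  induction y using TensorProduct.induction_on with
  | zero => simp only [map_zero, sub_zero, zero_mem]
  | add x y hx hy =>
    simp only [map_add, add_sub_add_comm]
    exact add_mem hx hy
  | tmul v r =>
    rw [LinearMap.lTensor_tmul, LinearMap.lTensor_tmul, ← map_sub, ← TensorProduct.tmul_sub]
    refine param2_mem ?_ v
    have := h r
    rwa [mul_sub] at this

/-- In the coaction, Δ(z) may be replaced by its leading part modulo W_j. The error has degree at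
most j, and multiplication by Δ(g) and by `kappa` does not raise it. -/
lemma cofree_mulGrass
    (hβ : IsSuperComodule (comul0 p q).toLinearMap (counit0 p q).toLinearMap (gr0 p q) gV β)
    (hZ : IsSubcomodule (gr p q) (rightCoaction0 p q) (compMonomials p q s (j + 1)))
    (he : IsMonomialBasis e) (v : V) (z : compMonomials p q s (j + 1)) (g : baseGrass p q s e) :
    cofree V (comul p q) (omega s β (mulGrass V s e (j + 1) ((v ⊗ₜ z) ⊗ₜ g))) -
      param2 s β (leadingMul V s (j + 1) (comulHom p q (psi p q s g))
        (tensorCoaction β hZ.coaction (v ⊗ₜ z))) ∈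
      LinearMap.range ((kacFil s β j).subtype.rTensor (FunGL p q)) := by
  have hg : psi p q s (g : Grass p q) ∈ filPoly p q s 0 := by
    rw [filPoly_zero_eq he]
    exact ⟨_, g.2, rfl⟩
  rw [omega_mulGrass_tmul, cofree_param hβ, tensorCoaction_tmul, leadingMul_mulCoef,
    liftKappa_coaction, map_mul]
  refine param2_sub_mem (fun r => ?_) (β v)
  rw [← sub_mul]
  have h1 := comul_sub_leading_mem (p := p) (q := q) (s := s) j z.1 z.2
  have h2 := comul_filPoly (p := p) (q := q) (s := s) 0 (Submodule.mem_map_of_mem hg)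
  have h3 := leftSpan_filPoly_mul j 0 (Submodule.mul_mem_mul h1 h2)
  have h4 := leftSpan_filPoly_mul 0 j (Submodule.mul_mem_mul (baseAlg_le (kappa_mem r)) h3)
  rw [zero_add] at h4
  exact h4

/-- Both comodules are parameterised bijectively by V ⊗ V_{j+1} tensored with the polynomials in ξ:
the quotient by multiplying the monomials in ζ into the function, W₀(V ⊗ V_{j+1}) by treating them
as vectors. The two coactions agree because the leading part of Δ on V_{j+1} is its right coaction
with (α,δ) substituted. -/
theorem comoduleIso_kacFil
    (hβ : IsSuperComodule (comul0 p q).toLinearMap (counit0 p q).toLinearMap (gr0 p q) gV β)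
    (hle : kacFil s β j ≤ kacFil s β (j + 1))
    (hW : IsSubcomodule (tensorGr gV (gr p q)) (cofree V (comul p q)) (kacFil s β j))
    (hW' : IsSubcomodule (tensorGr gV (gr p q)) (cofree V (comul p q)) (kacFil s β (j + 1)))
    (hZ : IsSubcomodule (gr p q) (rightCoaction0 p q) (compMonomials p q s (j + 1)))
    (hWZ : IsSubcomodule
      (tensorGr (tensorGr gV (restrictGr (gr p q) (compMonomials p q s (j + 1)))) (gr p q))
      (cofree (V ⊗[ℂ] compMonomials p q s (j + 1)) (comul p q))
      (kacFil s (tensorCoaction β hZ.coaction) 0)) :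
    ComoduleIso (V' := kacFil s (tensorCoaction β hZ.coaction) 0)
      (quotGr (tensorGr gV (gr p q)) (kacFil s β (j + 1)) (kacFil s β j))
      (hW'.quotCoaction hW hle)
      (restrictGr (tensorGr (tensorGr gV (restrictGr (gr p q)
        (compMonomials p q s (j + 1)))) (gr p q)) (kacFil s (tensorCoaction β hZ.coaction) 0))
      hWZ.coaction := by
  obtain ⟨e, he⟩ := exists_isMonomialBasis (OddGen p q)
  obtain ⟨σ, hσ⟩ := exists_isInv hβ.isInternal
  have hβ' := isSuperComodule_tensorCoaction hβ (isSuperComodule_compMonomials hZ)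
  have hσ' := hσ.tensor ((isInv_gr p q).restrict (parity_compMonomials (s := s) (j + 1)))
  have hT := hσ.tensor (isInv_gr p q)
  have hT' := hσ'.tensor (isInv_gr p q)
  have hU := hT.stable hW'.homogeneous
  have hU' := hT.stable hW.homogeneous
  let b' : (V ⊗[ℂ] compMonomials p q s (j + 1)) ⊗[ℂ] baseGrass p q s e →ₗ[ℂ]
      kacFil s β (j + 1) :=
    (omega s β ∘ₗ mulGrass V s e (j + 1)).codRestrict _ (omega_mulGrass_mem he)
  let a : (V ⊗[ℂ] compMonomials p q s (j + 1)) ⊗[ℂ] baseGrass p q s e →ₗ[ℂ]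
      kacFil s (tensorCoaction β hZ.coaction) 0 :=
    (omega s (tensorCoaction β hZ.coaction) ∘ₗ (baseGrass p q s e).subtype.lTensor _).codRestrict _
      fun t => by rw [kacFil_zero_eq he]; exact ⟨_, ⟨t, rfl⟩, rfl⟩
  let N := (kacFil s β j).submoduleOf (kacFil s β (j + 1))
  let b := N.mkQ ∘ₗ b'
  let τ : (kacFil s β (j + 1) ⧸ N) →ₗ[ℂ] (kacFil s β (j + 1) ⧸ N) :=
    N.mapQ N ((TensorProduct.map σ (parity p q)).restrict hU) fun u hu => hU' u hu
  refine comoduleIso_of_bijective (b := b) (a := a) (hT.quot (ρ := τ) hU fun u => rfl)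
    (hT'.restrict (hT'.stable hWZ.homogeneous)) ⟨?_, ?_⟩ ⟨?_, ?_⟩ ?_ ?_
  · rw [injective_iff_map_eq_zero]
    intro t ht
    exact mulGrass_inj_mod hβ he t ((Submodule.Quotient.mk_eq_zero N).1 ht)
  · intro y
    obtain ⟨u, rfl⟩ := N.mkQ_surjective y
    obtain ⟨t, ht⟩ := exists_mulGrass he (u : V ⊗[ℂ] FunGL p q) u.2
    exact ⟨t, ((Submodule.Quotient.eq N).2 ht).symm⟩
  · intro t t' h
    exact Module.Flat.lTensor_preserves_injective_linearMap _ (Submodule.injective_subtype _)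
      (omega_injective hβ' (congrArg Subtype.val h))
  · rintro ⟨u, hu⟩
    have hu' := hu
    rw [kacFil_zero_eq he] at hu'
    obtain ⟨_, ⟨t, rfl⟩, h⟩ := hu'
    exact ⟨t, Subtype.ext h⟩
  · intro t
    induction t using TensorProduct.induction_on with
    | zero => exact ⟨0, by simp only [map_zero], by simp only [map_zero]⟩
    | add x y hx hy =>
      obtain ⟨t, h1, h2⟩ := hx
      obtain ⟨t', h1', h2'⟩ := hy
      exact ⟨t + t', by simp only [map_add, h1, h1'], by simp only [map_add, h2, h2']⟩
    | tmul w g =>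
      refine ⟨TensorProduct.map σ ((parity p q).restrict (parity_compMonomials (s := s) (j + 1))) w
        ⊗ₜ ⟨_, he.involute_mem _ _ g.2⟩, ?_, Subtype.ext ?_⟩
      · refine congrArg N.mkQ (Subtype.ext ?_)
        change omega s β _ = TensorProduct.map σ (parity p q) (omega s β _)
        rw [omega_parity hβ hσ]
        congr 1
        induction w using TensorProduct.induction_on with
        | zero => simp only [TensorProduct.zero_tmul, map_zero]
        | add x y hx hy => simp only [TensorProduct.add_tmul, map_add, hx, hy]
        | tmul v z =>
          rw [mulGrass_tmul, TensorProduct.map_tmul, mulGrass_tmul, TensorProduct.map_tmul,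
            AlgHom.toLinearMap_apply, map_mul, ← evalUnit_parity]
          rfl
      · exact (omega_parity hβ' hσ' (w ⊗ₜ (g : Grass p q))).symm
  · intro t
    induction t using TensorProduct.induction_on with
    | zero => exact ⟨0, by simp only [map_zero], by simp only [map_zero]⟩
    | add x y hx hy =>
      obtain ⟨t, h1, h2⟩ := hx
      obtain ⟨t', h1', h2'⟩ := hy
      exact ⟨t + t', by simp only [map_add, h1, h1'], by simp only [map_add, h2, h2']⟩
    | tmul w g =>
      induction w using TensorProduct.induction_on with
      | zero => exact ⟨0, by simp only [TensorProduct.zero_tmul, map_zero],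
          by simp only [TensorProduct.zero_tmul, map_zero]⟩
      | add x y hx hy =>
        obtain ⟨t, h1, h2⟩ := hx
        obtain ⟨t', h1', h2'⟩ := hy
        exact ⟨t + t', by simp only [TensorProduct.add_tmul, map_add, h1, h1'],
          by simp only [TensorProduct.add_tmul, map_add, h2, h2']⟩
      | tmul v z =>
        obtain ⟨y, h1, h2⟩ := exists_common_coaction (β := β)
          (β' := tensorCoaction β hZ.coaction) he g (tensorCoaction β hZ.coaction (v ⊗ₜ z))
        refine ⟨y, ?_, ?_⟩
        -- The difference of the two sides is the lower order error, which lies in W_j ⊗ A(p,q) and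
        -- vanishes in the quotient.
        · change _ = N.mkQ.rTensor _ (hW'.coaction (b' _))
          rw [LinearMap.rTensor_comp, LinearMap.comp_apply, ← sub_eq_zero, ← map_sub]
          refine mkQ_rTensor_eq_zero hle _ ?_
          have h := cofree_mulGrass hβ hZ he v z g
          rw [← neg_mem_iff, neg_sub, ← h2] at h
          rw [map_sub, hW'.coaction_spec, ← LinearMap.comp_apply, ← LinearMap.rTensor_comp]
          exact h
        · apply subtype_rTensor_injective
          rw [hWZ.coaction_spec, ← LinearMap.comp_apply, ← LinearMap.rTensor_comp]
          exact h1.trans (cofree_param hβ' (v ⊗ₜ z) (psi p q s g)).symm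

end quotient

end GLSuper
end

/-! ### Assembly of the main theorem -/

theorem mainTheorem6 (p q : ℕ) {V : Type*} [AddCommGroup V] [Module ℂ V]
    (gV : ZMod 2 → Submodule ℂ V) (β : V →ₗ[ℂ] V ⊗[ℂ] FunGL0 p q)
    (hβ : IsSuperComodule (comul0 p q).toLinearMap (counit0 p q).toLinearMap (gr0 p q) gV β) :
    ∃ hind : IsSubcomodule (tensorGr gV (gr p q)) (cofree V (comul p q))
        (ind (comul p q) (proj0 p q).toLinearMap β),
      IsSuperComodule (comul p q) (counit p q) (gr p q)
        (restrictGr (tensorGr gV (gr p q)) (ind (comul p q) (proj0 p q).toLinearMap β))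
        hind.coaction ∧
      Module.rank ℂ (ind (comul p q) (proj0 p q).toLinearMap β) =
        2 ^ (2 * p * q) * Module.rank ℂ V ∧
      ∀ s : Side,
        (primitive s hind.coaction).map (Submodule.subtype _) =
          elems s β (Subalgebra.toSubmodule (Algebra.adjoin ℂ (compVars p q s))) ∧
        kacFil s β (p * q) = ind (comul p q) (proj0 p q).toLinearMap β ∧
        ∃ (hle : ∀ j, kacFil s β j ≤ kacFil s β (j + 1))
          (hW : ∀ j, IsSubcomodule (tensorGr gV (gr p q)) (cofree V (comul p q)) (kacFil s β j))
          (hZ : ∀ j, IsSubcomodule (gr p q) (rightCoaction0 p q) (compMonomials p q s j))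
          (hWZ : ∀ j, IsSubcomodule
            (tensorGr (tensorGr gV (restrictGr (gr p q) (compMonomials p q s j))) (gr p q))
            (cofree (V ⊗[ℂ] compMonomials p q s j) (comul p q))
            (kacFil s (tensorCoaction β (hZ j).coaction) 0)),
          (∀ j, IsSuperComodule (comul0 p q).toLinearMap (counit0 p q).toLinearMap (gr0 p q)
            (restrictGr (gr p q) (compMonomials p q s j)) (hZ j).coaction) ∧
          (∀ j, j < p * q →
            ComoduleIso
              (quotGr (tensorGr gV (gr p q)) (kacFil s β (j + 1)) (kacFil s β j))
              ((hW (j + 1)).quotCoaction (hW j) (hle j))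
              (restrictGr (tensorGr (tensorGr gV (restrictGr (gr p q)
                (compMonomials p q s (j + 1)))) (gr p q))
                (kacFil s (tensorCoaction β (hZ (j + 1)).coaction) 0))
              (hWZ (j + 1)).coaction) ∧
          kacFil s β 0 =
            elems s β (Subalgebra.toSubmodule (Algebra.adjoin ℂ (baseVars p q s))) ∧
          (primitive s (hW 0).coaction).map (Submodule.subtype _) = elems s β 1 ∧
          IsKacComodule s (restrictGr (tensorGr gV (gr p q)) (kacFil s β 0)) (hW 0).coaction
            ((elems s β (Submodule.span ℂ (baseVars p q s) ^ (p * q))).submoduleOf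
              (kacFil s β 0)) := by
  have hind := isSubcomodule_ind hβ
  refine ⟨hind, isSuperComodule_ind hβ hind, rank_ind hβ, fun s => ?_⟩
  have hW := isSubcomodule_kacFil hβ s
  have hZ := isSubcomodule_compMonomials (p := p) (q := q) s
  have hcZ := fun j => isSuperComodule_compMonomials (hZ j)
  have hWZ := fun j =>
    isSubcomodule_kacFil (isSuperComodule_tensorCoaction hβ (hcZ j)) s 0
  refine ⟨?_, kacFil_top hβ, kacFil_mono, hW, hZ, hWZ, hcZ, fun j _ => ?_, kacFil_zero, ?_,
    isKacComodule_kacFil_zero hβ s (hW 0)⟩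
  · rw [map_primitive_coaction, primitive_ind hβ]
  · exact comoduleIso_kacFil hβ _ _ _ _ _
  · rw [map_primitive_coaction, primitive_kacFil_zero hβ]
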